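/- **Setting.** Let $\Omega\subset\mathbb R^3$ be a (bounded, open, nonempty) convex polyhedron and let $\mu_1,\mu_4,\mu_5,\mu_6,\lambda\in\mathbb R$ with $\mu_4>0$, $\mu_1+\lambda^2\ge 0$, $\mu_5+\mu_6-\lambda^2\ge 0$. Let $\rho>0$. For $0<h\le 1$ let $\mathcal T_h$ be a conforming subdivision of $\overline\Omega$ into finitely many tetrahedra, each of which has diameter at most $h\,\mathrm{diam}\,\Omega$, contains a ball of diameter $\rho h\,\mathrm{diam}\,\Omega$ (quasi-uniformity), and has a vertex not on $\partial\Omega$. Let $\mathcal N_h$ be the set of vertices (nodes) and $\phi_z$, $z\in\mathcal N_h$, the continuous piecewise affine nodal basis. Let $Z_h$ be the continuous piecewise affine functions on $\overline\Omega$, $Y_h=\{v\in Z_h: v|_{\partial\Omega}=0\}$, $M_h=\{q\in Z_h:\int_\Omega q=0\}$, $X_h$ the continuous piecewise quadratic functions vanishing on $\partial\Omega$, $V_h=\{v\in X_h^3:(\nabla\cdot v,q)=0\ \forall q\in M_h\}$, $U_h=V_h\times Y_h^3$. Here $(\cdot,\cdot)$ is the $L^2(\Omega)$ inner product, $(\nabla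 f)_{il}=\partial_l f_i$, $A_{sym}$ and $A_{skw}$ are the symmetric and skew-symmetric parts of a matrix, and matrices carry the Frobenius inner product. Let $\mathcal I_h f=\sum_z f(z)\phi_z$ and $$(y_1,y_2)_h=\int_\Omega\mathcal I_h(y_1\cdot y_2)\,dx=\sum_{z\in\mathcal N_h}y_1(z)\cdot y_2(z)\int_\Omega\phi_z\,dx,\qquad \|y\|_h^2=(y,y)_h ;$$ when a factor contains $\nabla v$ with $v\in V_h$, which jumps across faces, the product is evaluated tetrahedron by tetrahedron, with nodal values taken from within each tetrahedron $K$: $\sum_K\sum_{z\in K}(\cdot)|_K(z)\int_K\phi_z\,dx$. For a piecewise affine $f$, $\Delta_hf\in Y_h^3$ is defined by $(-\Delta_hf,b)_h=(\nabla f,\nabla b)$ for all $b\in Y_h^3$; for an $L^2$ field $A$, $\mathcal R_hA$ is the continuous piecewise affine field with $(\mathcal R_hA,b)_h=(A,b)$ for all continuous piecewise affine $b$; $\mathcal Q_h$ is the $L^2$-projection onto $V_h$. Let $v_0\in L^2_\sigma(\Omega)$ (the $L^2$-closure of the smooth compactly supported solenoidal fields on $\Omega$) and $d_0\in H^2(\Omega;\mathbb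 R^3)$ (continuous representative) with $|d_0|=1$ in $\Omega$. Put $\mathcal E(v_0,d_0)=\frac12\|v_0\|_{L^2}^2+\frac12\|\nabla d_0\|_{L^2}^2$. Let $k>0$, $J\in\mathbb N$, $\partial_tf^j=(f^j-f^{j-1})/k$, $f^{j-1/2}=\frac12(f^j+f^{j-1})$. **Scheme.** $v^0=\mathcal Q_hv_0$, $d^0=\mathcal I_hd_0$, and for $1\le j\le J$ one has $d^j=d^j_\circ+\mathcal I_hd_0$, $(v^j,d^j_\circ)\in U_h$, and for all $(a,c)\in U_h$, with $m=d^{j-1/2}$ and $w=\Delta_hd^{j-1/2}$, $$(\partial_tv^j,a)+((v^{j-1}\cdot\nabla)v^j,a)+\tfrac12((\nabla\cdot v^{j-1})v^j,a)-([\mathcal R_h\nabla d^{j-1}]^T[m\times(m\times w)],a)_h+(T_L^j,\nabla a)=0,$$ $$(\partial_td^j,c)_h+(m\times[\mathcal R_h\nabla d^{j-1}v^j],m\times c)_h-((\nabla v^j)_{skw}m,c)_h+\lambda(m\times[(\nabla v^j)_{sym}m],m\times c)_h-(m\times w,m\times c)_h=0,$$ where $$\begin{aligned}(T_L^j,\nabla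 a)={}&(\mu_1+\lambda^2)(d^j\cdot(\nabla v^j)_{sym}d^j,\,d^j\cdot(\nabla a)_{sym}d^j)+\mu_4((\nabla v^j)_{sym},(\nabla a)_{sym})\\&+(\mu_5+\mu_6-\lambda^2)((\nabla v^j)_{sym}d^j,(\nabla a)_{sym}d^j)\\&+\lambda(m\times[(\nabla a)_{sym}m],m\times w)_h+((\nabla a)_{skw}w,m)_h.\end{aligned}$$ **Proposition.** Every solution $(v^j,d^j)_{0\le j\le J}$ of the scheme has the following properties. 1. For all $1\le n\le J$, $$\begin{aligned}&\tfrac12\|v^n\|_{L^2}^2+\tfrac12\|\nabla d^n\|_{L^2}^2+\tfrac{k^2}2\sum_{j=1}^n\|\partial_tv^j\|_{L^2}^2+k\sum_{j=1}^n(\mu_1+\lambda^2)\|d^j\cdot(\nabla v^j)_{sym}d^j\|_{L^2}^2+k\sum_{j=1}^n\mu_4\|(\nabla v^j)_{sym}\|_{L^2}^2\\&+k\sum_{j=1}^n(\mu_5+\mu_6-\lambda^2)\|(\nabla v^j)_{sym}d^j\|_{L^2}^2+k\sum_{j=1}^n\|\mathcal I_h(d^{j-1/2}\times\Delta_hd^{j-1/2})\|_h^2=\tfrac12\|v^0\|_{L^2}^2+\tfrac12\|\nabla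 d^0\|_{L^2}^2 .\end{aligned}$$ 2. $|d^j(z)|=1$ for all $z\in\mathcal N_h$ and $0\le j\le J$. 3. For every $B$ there is a constant $C>0$, depending only on $\Omega$, the coefficients $\mu_i,\lambda$, the quasi-uniformity constant $\rho$, and $B$ (in particular, not on $h$, the mesh, $k$, $J$ or the solution), such that whenever $\|v_0\|_{L^2}^2+\|d_0\|_{H^2}^2\le B$, for all $1\le n\le J$, $$k\sum_{l=1}^n\Big[\|\partial_td^l\|_{L^{3/2}(\Omega)}^2+\|\partial_tv^l\|_{(H^2(\Omega)\cap H^1_{0,\sigma}(\Omega))^*}^2+\|\nabla v^l\|_{L^2(\Omega)}^2\Big]\le C\,(\mathcal E(v_0,d_0)+1),$$ where $H^1_{0,\sigma}(\Omega)$ is the $H^1$-closure of the smooth compactly supported solenoidal fields, $H^2\cap H^1_{0,\sigma}$ carries the $H^2$ norm, and $\partial_tv^l$ acts by the $L^2(\Omega)$ inner product. -/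

import Mathlib

open MeasureTheory
open scoped ENNReal ContDiff

namespace EricksenLeslie

/-- Three-dimensional Euclidean space. -/
abbrev E3 : Type := EuclideanSpace ℝ (Fin 3)

/-- Real `3 × 3` matrices, as linear maps; the gradient `∇f` of `f : E3 → E3` at `x` is
`fderiv ℝ f x`, so that `(∇f) w = (w · ∇) f`. -/
abbrev Mat3 : Type := E3 →L[ℝ] E3

/-! ### Vector algebra -/

/-- The standard basis of `E3`. -/
noncomputable def e (i : Fin 3) : E3 := EuclideanSpace.single i (1 : ℝ)

/-- The cross product of two vectors. -/
noncomputable def cross (x y : E3) : E3 :=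
  WithLp.toLp 2 (crossProduct (WithLp.ofLp x) (WithLp.ofLp y))

/-- Symmetric part of a matrix. -/
noncomputable def symPart (A : Mat3) : Mat3 := (1 / 2 : ℝ) • (A + ContinuousLinearMap.adjoint A)

/-- Skew-symmetric part of a matrix. -/
noncomputable def skwPart (A : Mat3) : Mat3 := (1 / 2 : ℝ) • (A - ContinuousLinearMap.adjoint A)

/-- Frobenius inner product of two matrices. -/
noncomputable def frob (A B : Mat3) : ℝ := ∑ i, inner ℝ (A (e i)) (B (e i))

/-- Divergence of a vector field. -/
noncomputable def divg (v : E3 → E3) (x : E3) : ℝ := ∑ i, (fderiv ℝ v x (e i)) i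

/-! ### Sobolev spaces on a domain -/

/-- `G` is the weak gradient of `f` on the open set `Ω`: `G x w` is the weak derivative of `f`
at `x` in the direction `w`. -/
def IsWeakGrad {F : Type*} [NormedAddCommGroup F] [NormedSpace ℝ F]
    (Ω : Set E3) (f : E3 → F) (G : E3 → E3 →L[ℝ] F) : Prop :=
  ∀ ψ : E3 → ℝ, ContDiff ℝ ∞ ψ → HasCompactSupport ψ → tsupport ψ ⊆ Ω → ∀ w : E3,
    ∫ x in Ω, (fderiv ℝ ψ x w) • f x = -∫ x in Ω, ψ x • G x w

/-- `f ∈ H²(Ω; ℝ³)` with weak gradient `G` and weak Hessian `H`. -/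
structure IsH2 (Ω : Set E3) (f : E3 → E3) (G : E3 → Mat3) (H : E3 → E3 →L[ℝ] Mat3) : Prop where
  memLp : MemLp f 2 (volume.restrict Ω)
  memLp_grad : MemLp G 2 (volume.restrict Ω)
  memLp_hess : MemLp H 2 (volume.restrict Ω)
  weakGrad : IsWeakGrad Ω f G
  weakHess : IsWeakGrad Ω G H

/-- The square of the `H²(Ω)` norm of a function with weak gradient `G` and weak Hessian `H`. -/
noncomputable def h2NormSq (Ω : Set E3) (f : E3 → E3) (G : E3 → Mat3)
    (H : E3 → E3 →L[ℝ] Mat3) : ℝ :=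
  ∫ x in Ω, (‖f x‖ ^ 2 + ∑ i, ‖G x (e i)‖ ^ 2 + ∑ i, ∑ l, ‖H x (e i) (e l)‖ ^ 2)

/-- Smooth solenoidal vector fields with compact support in `Ω`. -/
structure IsSolenoidalTest (Ω : Set E3) (ψ : E3 → E3) : Prop where
  contDiff : ContDiff ℝ ∞ ψ
  compact : HasCompactSupport ψ
  support : tsupport ψ ⊆ Ω
  div_eq_zero : ∀ x, divg ψ x = 0

/-- `f ∈ L²_σ(Ω)`, the closure in `L²(Ω)` of the smooth solenoidal fields with compact support. -/
def MemL2Sigma (Ω : Set E3) (f : E3 → E3) : Prop :=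
  MemLp f 2 (volume.restrict Ω) ∧
  ∀ ε : ℝ, 0 < ε → ∃ ψ, IsSolenoidalTest Ω ψ ∧
    eLpNorm (fun x => f x - ψ x) 2 (volume.restrict Ω) < ENNReal.ofReal ε

/-- `f ∈ H¹_{0,σ}(Ω)` with gradient `G`: the closure in `H¹(Ω)` of the smooth solenoidal fields
with compact support. -/
def MemH10Sigma (Ω : Set E3) (f : E3 → E3) (G : E3 → Mat3) : Prop :=
  MemLp f 2 (volume.restrict Ω) ∧ MemLp G 2 (volume.restrict Ω) ∧
  ∀ ε : ℝ, 0 < ε → ∃ ψ, IsSolenoidalTest Ω ψ ∧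
    eLpNorm (fun x => f x - ψ x) 2 (volume.restrict Ω) < ENNReal.ofReal ε ∧
    eLpNorm (fun x => G x - fderiv ℝ ψ x) 2 (volume.restrict Ω) < ENNReal.ofReal ε

/-- The norm of `φ ↦ ∫_Ω f · φ` in the dual of `H²(Ω) ∩ H¹_{0,σ}(Ω)`, where the latter space
carries the `H²(Ω)` norm. -/
noncomputable def dualNorm (Ω : Set E3) (f : E3 → E3) : ℝ≥0∞ :=
  ⨆ (φ : E3 → E3) (G : E3 → Mat3) (H : E3 → E3 →L[ℝ] Mat3)
    (_ : IsH2 Ω φ G H ∧ MemH10Sigma Ω φ G ∧ h2NormSq Ω φ G H ≤ 1),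
    ‖∫ x in Ω, inner ℝ (f x) (φ x)‖ₑ

/-- The total energy `½ ‖v‖² + ½ ‖∇d‖²` in terms of `v` and the weak gradient `G` of `d`. -/
noncomputable def totalEnergy (Ω : Set E3) (v : E3 → E3) (G : E3 → Mat3) : ℝ :=
  1 / 2 * (∫ x in Ω, ‖v x‖ ^ 2) + 1 / 2 * ∫ x in Ω, frob (G x) (G x)

/-! ### Meshes -/

/-- `Ω` is a (bounded, open, nonempty) convex polyhedron. -/
def IsConvexPolyhedron (Ω : Set E3) : Prop :=
  Ω.Nonempty ∧ ∃ S : Finset E3, Ω = interior (convexHull ℝ (S : Set E3))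

/-- A (conforming) subdivision of `Ω` into tetrahedra: a finite simplicial complex all of whose
faces are faces of tetrahedra and which covers exactly the closure of `Ω`. -/
structure TetMesh (Ω : Set E3) extends Geometry.SimplicialComplex ℝ E3 where
  finite_faces : faces.Finite
  pure : ∀ s ∈ faces, ∃ t ∈ faces, s ⊆ t ∧ t.card = 4
  space_eq : toSimplicialComplex.space = closure Ω

namespace TetMesh

variable {Ω : Set E3}

open Classical in
/-- The tetrahedra of the mesh, each one given by its four vertices. -/
noncomputable def cells (M : TetMesh Ω) : Finset (Finset E3) :=
  M.finite_faces.toFinset.filter (fun s => s.card = 4)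

open Classical in
/-- The nodes of the mesh, that is, the vertices of its tetrahedra. -/
noncomputable def nodes (M : TetMesh Ω) : Finset E3 := M.cells.biUnion id

/-- The family is quasi-uniform with constant `ρ`, at mesh size `h`: all tetrahedra have diameter
at most `h · diam Ω` and contain a ball of diameter `ρ · h · diam Ω`. (A tetrahedron is
star-shaped with respect to every ball that it contains.) -/
def QuasiUniform (M : TetMesh Ω) (ρ h : ℝ) : Prop :=
  0 < h ∧ h ≤ 1 ∧ ∀ s ∈ M.cells,
    Metric.diam (convexHull ℝ (s : Set E3)) ≤ h * Metric.diam Ω ∧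
    ∃ c : E3, Metric.closedBall c (ρ * h * Metric.diam Ω / 2) ⊆ convexHull ℝ (s : Set E3)

/-- Every tetrahedron has a node which is not on the boundary of `Ω`. -/
def HasInteriorNodes (M : TetMesh Ω) : Prop :=
  ∀ s ∈ M.cells, ∃ z ∈ s, z ∉ frontier Ω

/-- `w` is the system of barycentric coordinates of `x` in a tetrahedron of the mesh. -/
def IsBary (M : TetMesh Ω) (x : E3) (w : E3 → ℝ) : Prop :=
  ∃ s ∈ M.cells, (∀ y ∈ s, 0 ≤ w y) ∧ (∀ y, y ∉ s → w y = 0) ∧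
    ∑ y ∈ s, w y = 1 ∧ ∑ y ∈ s, w y • y = x

open Classical in
/-- The nodal (hat) basis function `φ_z`: on each tetrahedron it is the barycentric coordinate
that belongs to `z` (the barycentric coordinates of a point of the closure of `Ω` exist and do not
depend on the tetrahedron chosen); it is `0` outside of the closure of `Ω`. -/
noncomputable def hat (M : TetMesh Ω) (z x : E3) : ℝ :=
  if hx : ∃ w, M.IsBary x w then hx.choose z else 0

/-- Nodal interpolation `I_h f = ∑_z f(z) φ_z`. -/
noncomputable def interp (M : TetMesh Ω) (f : E3 → E3) (x : E3) : E3 :=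
  ∑ z ∈ M.nodes, M.hat z x • f z

/-- The mass-lumped inner product `(y₁, y₂)_h = ∫_Ω I_h (y₁ · y₂)`, for functions which have
values at the nodes. -/
noncomputable def lumped (M : TetMesh Ω) (y₁ y₂ : E3 → E3) : ℝ :=
  ∑ z ∈ M.nodes, inner ℝ (y₁ z) (y₂ z) * ∫ x in Ω, M.hat z x

/-- The same quadrature rule `∑_K ∫_K I_K F`, for an integrand that is only piecewise continuous:
`F s z` is the value at the vertex `z` of the continuous extension of `F` from the interior of the
tetrahedron `s`. When `F s z` does not depend on `s`, this is `∑_z F z ∫_Ω φ_z`. -/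
noncomputable def lumpedCells (M : TetMesh Ω) (F : Finset E3 → E3 → ℝ) : ℝ :=
  ∑ s ∈ M.cells, ∑ z ∈ s, F s z * ∫ x in convexHull ℝ (s : Set E3), M.hat z x

/-! ### Finite element spaces -/

/-- Continuous functions on the closure of `Ω` which are polynomials of degree at most `m` on each
tetrahedron. (Values outside of the closure of `Ω` are irrelevant.) -/
def IsPiecewisePoly (M : TetMesh Ω) (m : ℕ) (f : E3 → ℝ) : Prop :=
  ContinuousOn f (closure Ω) ∧
  ∀ s ∈ M.cells, ∃ p : MvPolynomial (Fin 3) ℝ, p.totalDegree ≤ m ∧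
    ∀ x ∈ convexHull ℝ (s : Set E3), f x = MvPolynomial.eval (fun i => x i) p

/-- The space `[Z_h]³` of continuous piecewise affine vector fields. -/
def MemZ (M : TetMesh Ω) (y : E3 → E3) : Prop :=
  ∀ i, M.IsPiecewisePoly 1 (fun x => y x i)

/-- The space `[Y_h]³` of continuous piecewise affine vector fields with zero boundary values. -/
def MemY (M : TetMesh Ω) (y : E3 → E3) : Prop :=
  M.MemZ y ∧ ∀ x ∈ frontier Ω, y x = 0

/-- The pressure space `M_h`. -/
def MemPressure (M : TetMesh Ω) (q : E3 → ℝ) : Prop :=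
  M.IsPiecewisePoly 1 q ∧ ∫ x in Ω, q x = 0

/-- The space `V_h` of approximately divergence-free fields in `[X_h]³`, where `X_h` consists of
the continuous piecewise quadratic functions with zero boundary values. The derivative of a finite
element function on `Ω` exists in the interior of every tetrahedron, hence almost everywhere. -/
def MemV (M : TetMesh Ω) (v : E3 → E3) : Prop :=
  (∀ i, M.IsPiecewisePoly 2 (fun x => v x i)) ∧ (∀ x ∈ frontier Ω, v x = 0) ∧
  ∀ q : E3 → ℝ, M.MemPressure q → ∫ x in Ω, divg v x * q x = 0

/-- The gradient of a finite element function at the vertex `z` of the tetrahedron `s`, as seen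
from within `s`. -/
noncomputable def cellGrad (v : E3 → E3) (s : Finset E3) (z : E3) : Mat3 :=
  fderivWithin ℝ v (convexHull ℝ (s : Set E3)) z

/-! ### Discrete operators -/

/-- `v = Q_h v₀`, the `L²(Ω)`-orthogonal projection of `v₀` onto `V_h`. -/
def IsVelocityProj (M : TetMesh Ω) (v₀ v : E3 → E3) : Prop :=
  M.MemV v ∧ ∀ a, M.MemV a → ∫ x in Ω, inner ℝ (v x) (a x) = ∫ x in Ω, inner ℝ (v₀ x) (a x)

/-- `w = Δ_h f`, the mass-lumped discrete Laplacian of the finite element function `f`: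
`w ∈ [Y_h]³` and `(-w, b)_h = (∇f, ∇b)` for all `b ∈ [Y_h]³`. -/
def IsDiscreteLaplacian (M : TetMesh Ω) (f w : E3 → E3) : Prop :=
  M.MemY w ∧ ∀ b, M.MemY b →
    M.lumped (fun x => -w x) b = ∫ x in Ω, frob (fderiv ℝ f x) (fderiv ℝ b x)

/-- `R = R_h A`, the mass-lumped `L²` projection of the matrix field `A` onto the continuous
piecewise affine matrix fields, columnwise: `(R w, b)_h = (A w, b)` for all `b ∈ [Z_h]³`. -/
def IsLumpedProj (M : TetMesh Ω) (A R : E3 → Mat3) : Prop :=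
  ∀ w : E3, M.MemZ (fun x => R x w) ∧ ∀ b, M.MemZ b →
    M.lumped (fun x => R x w) b = ∫ x in Ω, inner ℝ (A x w) (b x)

end TetMesh

/-! ### The discrete scheme -/

/-- The coefficients of the Leslie stress tensor. -/
structure LeslieCoeffs where
  μ₁ : ℝ
  μ₄ : ℝ
  μ₅ : ℝ
  μ₆ : ℝ
  lam : ℝ

/-- The discrete time derivative `(f^j - f^{j-1}) / k`, for `j ≥ 1`. -/
noncomputable def dt (k : ℝ) (f : ℕ → E3 → E3) (j : ℕ) (x : E3) : E3 :=
  k⁻¹ • (f j x - f (j - 1) x)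

/-- The midpoint value `f^{j-1/2} = (f^j + f^{j-1}) / 2`, for `j ≥ 1`. -/
noncomputable def mid (f : ℕ → E3 → E3) (j : ℕ) (x : E3) : E3 :=
  (1 / 2 : ℝ) • (f j x + f (j - 1) x)

variable {Ω : Set E3}

/-- The dissipative part `(T_D, ∇a)` of the discrete Leslie stress, with `v = v^j`, `d = d^j`. -/
noncomputable def dissStress (P : LeslieCoeffs) (Ω : Set E3) (v d a : E3 → E3) : ℝ :=
  (P.μ₁ + P.lam ^ 2) *
      (∫ x in Ω, inner ℝ (d x) (symPart (fderiv ℝ v x) (d x)) *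
        inner ℝ (d x) (symPart (fderiv ℝ a x) (d x)))
    + P.μ₄ * (∫ x in Ω, frob (symPart (fderiv ℝ v x)) (symPart (fderiv ℝ a x)))
    + (P.μ₅ + P.μ₆ - P.lam ^ 2) *
      (∫ x in Ω, inner ℝ (symPart (fderiv ℝ v x) (d x)) (symPart (fderiv ℝ a x) (d x)))

/-- The discrete Leslie stress `(T_L, ∇a)`, with `v = v^j`, `d = d^j`, `m = d^{j-1/2}` and
`w = Δ_h d^{j-1/2}`. -/
noncomputable def leslieStress (P : LeslieCoeffs) (M : TetMesh Ω) (v d m w a : E3 → E3) : ℝ :=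
  dissStress P Ω v d a
    + P.lam * M.lumpedCells (fun s z =>
        inner ℝ (cross (m z) (symPart (TetMesh.cellGrad a s z) (m z))) (cross (m z) (w z)))
    + M.lumpedCells (fun s z => inner ℝ (skwPart (TetMesh.cellGrad a s z) (w z)) (m z))

/-- The discrete momentum equation at time step `j`, tested with `a`. -/
def MomentumEq (P : LeslieCoeffs) (M : TetMesh Ω) (k : ℝ) (v d w : ℕ → E3 → E3)
    (R : ℕ → E3 → Mat3) (j : ℕ) (a : E3 → E3) : Prop :=
  (∫ x in Ω, inner ℝ (dt k v j x) (a x))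
    + (∫ x in Ω, inner ℝ (fderiv ℝ (v j) x (v (j - 1) x)) (a x))
    + 1 / 2 * (∫ x in Ω, inner ℝ (divg (v (j - 1)) x • v j x) (a x))
    - M.lumped (fun z => ContinuousLinearMap.adjoint (R j z)
        (cross (mid d j z) (cross (mid d j z) (w j z)))) a
    + leslieStress P M (v j) (d j) (mid d j) (w j) a = 0

/-- The discrete director equation at time step `j`, tested with `c`. -/
def DirectorEq (P : LeslieCoeffs) (M : TetMesh Ω) (k : ℝ) (v d w : ℕ → E3 → E3)
    (R : ℕ → E3 → Mat3) (j : ℕ) (c : E3 → E3) : Prop :=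
  M.lumped (dt k d j) c
    + M.lumped (fun z => cross (mid d j z) (R j z (v j z))) (fun z => cross (mid d j z) (c z))
    - M.lumpedCells (fun s z =>
        inner ℝ (skwPart (TetMesh.cellGrad (v j) s z) (mid d j z)) (c z))
    + P.lam * M.lumpedCells (fun s z =>
        inner ℝ (cross (mid d j z) (symPart (TetMesh.cellGrad (v j) s z) (mid d j z)))
          (cross (mid d j z) (c z)))
    - M.lumped (fun z => cross (mid d j z) (w j z)) (fun z => cross (mid d j z) (c z)) = 0

/-- `(v^j, d^j)` for `0 ≤ j ≤ J` is a solution of the scheme with time step `k` and initial data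
`(v₀, d₀)`; here `w j = Δ_h d^{j-1/2}` and `R j = R_h ∇d^{j-1}` for `1 ≤ j ≤ J`. -/
structure IsSchemeSolution (P : LeslieCoeffs) (M : TetMesh Ω) (k : ℝ) (J : ℕ)
    (v₀ d₀ : E3 → E3) (v d w : ℕ → E3 → E3) (R : ℕ → E3 → Mat3) : Prop where
  v_zero : M.IsVelocityProj v₀ (v 0)
  d_zero : ∀ x ∈ closure Ω, d 0 x = M.interp d₀ x
  v_mem : ∀ j, 1 ≤ j → j ≤ J → M.MemV (v j)
  d_mem : ∀ j, 1 ≤ j → j ≤ J → M.MemY (fun x => d j x - M.interp d₀ x)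
  laplacian : ∀ j, 1 ≤ j → j ≤ J → M.IsDiscreteLaplacian (mid d j) (w j)
  proj_grad : ∀ j, 1 ≤ j → j ≤ J → M.IsLumpedProj (fderiv ℝ (d (j - 1))) (R j)
  momentum : ∀ j, 1 ≤ j → j ≤ J → ∀ a, M.MemV a → MomentumEq P M k v d w R j a
  director : ∀ j, 1 ≤ j → j ≤ J → ∀ c, M.MemY c → DirectorEq P M k v d w R j c

end EricksenLeslie

open EricksenLeslie

open MeasureTheory
open scoped ENNReal ContDiff

namespace EricksenLeslie

/-! ### Integration lemmas -/

/-! The energy law is obtained by testing the momentum equation with `v j`, the director equation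
with `-w j`, and the definition of the discrete Laplacian with the discrete time derivative of the
director. Convection drops out because the previous velocity vanishes on the boundary and the extra
divergence term makes the form skew. Since all coupling terms are evaluated by the same nodal
quadrature, they cancel vertex by vertex: elastic force against director transport, skew part
against skew part, one `lam` term against the other. Only the squared norm of the cross product of
`mid d j` and `w j` survives (`energy_step`), and the midpoint rule makes the elastic energy
telescope.

The length constraint follows by testing the director equation with the midpoint value at one
interior node. Every term except the time derivative vanishes, and what is left is the difference of
two squared lengths (`norm_d_succ`). Boundary nodes keep their initial values.

For the uniform bounds, Korn's inequality turns the energy law into a bound for the time sums of the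
squared velocity gradient and the squared cross product, in terms of the initial discrete energy.
That energy is controlled by the data because nodal interpolation is stable from `H²` to `H¹`. Each
time derivative is then bounded by a fixed multiple of these two dissipated quantities
(`exists_step_bound`). For the director this is a nodal duality argument between `L³` and `L^{3/2}`,
with the velocity in `L⁶` by Sobolev's inequality (`eLpNorm_dt_le`).

For the velocity (`exists_dualNorm_le`) one needs, for a test field `φ` in `H²` and in the closure
of the solenoidal fields, a discrete field that pairs with the discrete time derivative exactly as
`φ` does and is bounded in `L^∞` and in `W^{1,4}` (`exists_test_function`). It is built in three
steps: the nodal interpolant of `φ`; a correction by edge bubbles at interior vertices, which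
restores the discrete divergence constraint and has `L²` size of order the mesh size squared
(`exists_memV_approx`); and a multiple of the time derivative itself, chosen to make the pairing
exact, which is no larger in `L²` than the remaining error. That quadratic order beats the negative
powers lost in the inverse estimates, so no stability of the projection onto the discrete space
beyond `L²` is needed. The field `w j` itself is never bounded: a skew matrix sees it only through
the cross product.

The `H²` facts used (density of smooth functions, pointwise values, interpolation errors, the
embedding of the gradient into `L⁴`, zero boundary values) are derived from homotheties of convex
sets, mollification and averaged Taylor expansions. Finite element functions with zero boundary
values are extended by zero to Lipschitz functions on the whole space, where integration by parts
and the Sobolev inequality are available. -/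

theorem finrank_E3 : Module.finrank ℝ E3 = 3 := by simp [E3]

theorem lintegral_comp_add_smul (Φ : E3 → ℝ≥0∞) (a : E3) {s : ℝ} (hs : s ≠ 0) :
    ∫⁻ x, Φ (a + s • x) = ENNReal.ofReal ((|s| ^ 3)⁻¹) * ∫⁻ x, Φ x := by
  have h1 : ∫⁻ x, Φ (a + s • x) = ∫⁻ y, Φ (a + y) ∂(Measure.map (fun x : E3 => s • x) volume) := by
    have := lintegral_map_equiv (μ := (volume : Measure E3)) (fun y => Φ (a + y))
      (Homeomorph.smulOfNeZero s hs).toMeasurableEquiv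
    exact this.symm
  rw [h1, Measure.map_addHaar_smul volume hs, lintegral_smul_measure,
    lintegral_add_left_eq_self, finrank_E3, abs_inv, abs_pow, smul_eq_mul]

/-- The homothety only has to map `K` into `K'`, so the change of variables loses an inequality and
nothing else. With `K' = K` convex and the centre in `K`, this is the source of almost every
integral estimate below. -/
theorem setLIntegral_comp_add_smul_le (Φ : E3 → ℝ≥0∞) (a : E3) {s : ℝ} (hs : s ≠ 0)
    {K K' : Set E3} (hK : MeasurableSet K) (hK' : MeasurableSet K')
    (hsub : ∀ x ∈ K, a + s • x ∈ K') :
    ∫⁻ x in K, Φ (a + s • x) ≤ ENNReal.ofReal ((|s| ^ 3)⁻¹) * ∫⁻ x in K', Φ x := by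
  rw [← lintegral_indicator hK', ← lintegral_comp_add_smul _ a hs, ← lintegral_indicator hK]
  refine lintegral_mono fun x => ?_
  by_cases hx : x ∈ K
  · simp [hx, hsub x hx]
  · simp [hx]

theorem sq_lintegral_mul_le {α : Type*} [MeasurableSpace α] (μ : Measure α) {f g : α → ℝ≥0∞}
    (hf : AEMeasurable f μ) (hg : AEMeasurable g μ) :
    (∫⁻ x, f x * g x ∂μ) ^ 2 ≤ (∫⁻ x, f x ^ 2 ∂μ) * ∫⁻ x, g x ^ 2 ∂μ := by
  have h := ENNReal.lintegral_mul_le_Lp_mul_Lq μ Real.HolderConjugate.two_two hf hg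
  simp only [Pi.mul_apply, ENNReal.rpow_two] at h
  calc _ ≤ ((∫⁻ x, f x ^ 2 ∂μ) ^ (1 / 2 : ℝ) * (∫⁻ x, g x ^ 2 ∂μ) ^ (1 / 2 : ℝ)) ^ 2 := by
        gcongr
    _ = _ := by
        rw [mul_pow, ← ENNReal.rpow_natCast, ← ENNReal.rpow_mul, ← ENNReal.rpow_natCast,
          ← ENNReal.rpow_mul]
        norm_num

theorem sq_lintegral_le {α : Type*} [MeasurableSpace α] (μ : Measure α) {f : α → ℝ≥0∞}
    (hf : AEMeasurable f μ) : (∫⁻ x, f x ∂μ) ^ 2 ≤ μ Set.univ * ∫⁻ x, f x ^ 2 ∂μ := by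
  simpa using sq_lintegral_mul_le μ (f := fun _ => 1) aemeasurable_const hf

theorem sq_eLpNorm_two {α F : Type*} [MeasurableSpace α] [NormedAddCommGroup F] (μ : Measure α)
    (f : α → F) : eLpNorm f 2 μ ^ 2 = ∫⁻ x, ‖f x‖ₑ ^ 2 ∂μ := by
  have := eLpNorm_nnreal_pow_eq_lintegral (μ := μ) (f := f) (p := 2) (by norm_num)
  simpa using this

theorem eLpNorm_two_le_iff {α F : Type*} [MeasurableSpace α] [NormedAddCommGroup F]
    {G : Type*} [NormedAddCommGroup G] {β : Type*} [MeasurableSpace β] (μ : Measure α)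
    (ν : Measure β) (f : α → F) (g : β → G) (c : ℝ≥0∞) :
    eLpNorm f 2 μ ≤ c * eLpNorm g 2 ν ↔
      ∫⁻ x, ‖f x‖ₑ ^ 2 ∂μ ≤ c ^ 2 * ∫⁻ x, ‖g x‖ₑ ^ 2 ∂ν := by
  rw [← sq_eLpNorm_two, ← sq_eLpNorm_two, ← mul_pow]
  exact (ENNReal.pow_le_pow_left_iff (two_ne_zero)).symm

/-! ### Mollification -/

section Mollify

variable {F : Type*} [NormedAddCommGroup F] [NormedSpace ℝ F]

/-- Mollification of `g` by a smooth bump. -/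
noncomputable def moll (ρ : ContDiffBump (0 : E3)) (g : E3 → F) : E3 → F :=
  convolution (ρ.normed volume) g (ContinuousLinearMap.lsmul ℝ ℝ) volume

theorem moll_apply (ρ : ContDiffBump (0 : E3)) (g : E3 → F) (x : E3) :
    moll ρ g x = ∫ y, ρ.normed volume y • g (x - y) := rfl

theorem lintegral_bump (ρ : ContDiffBump (0 : E3)) :
    ∫⁻ y, ‖ρ.normed volume y‖ₑ = 1 := by
  have h := ρ.integral_normed (μ := volume)
  rw [integral_eq_lintegral_of_nonneg_ae (Filter.Eventually.of_forall fun x => ρ.nonneg_normed x)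
    ρ.continuous_normed.aestronglyMeasurable] at h
  have h2 : ∫⁻ y, ‖ρ.normed volume y‖ₑ = ∫⁻ y, ENNReal.ofReal (ρ.normed volume y) := by
    congr with y
    rw [Real.enorm_eq_ofReal (ρ.nonneg_normed y)]
  rw [h2]
  have := ENNReal.toReal_eq_one_iff _ |>.1 h
  exact this

/-- Jensen's inequality for the probability measure whose density is the normalized bump. -/
theorem enorm_moll_sq_le (ρ : ContDiffBump (0 : E3)) {g : E3 → F}
    (hg : AEStronglyMeasurable g volume) (x : E3) :
    ‖moll ρ g x‖ₑ ^ 2 ≤ ∫⁻ y, ‖ρ.normed volume y‖ₑ * ‖g (x - y)‖ₑ ^ 2 := by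
  have hm : Measurable fun y => ‖ρ.normed volume y‖ₑ := ρ.continuous_normed.enorm.measurable
  have hgm : AEMeasurable (fun y => ‖g (x - y)‖ₑ) volume :=
    (hg.comp_quasiMeasurePreserving
      (Measure.measurePreserving_sub_left volume x).quasiMeasurePreserving).enorm
  have h1 : ‖moll ρ g x‖ₑ ≤ ∫⁻ y, ‖ρ.normed volume y‖ₑ * ‖g (x - y)‖ₑ := by
    rw [moll_apply]
    refine (enorm_integral_le_lintegral_enorm _).trans (le_of_eq ?_)
    simp_rw [enorm_smul]
  have h2 := sq_lintegral_le (volume.withDensity fun y => ‖ρ.normed volume y‖ₑ)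
    (f := fun y => ‖g (x - y)‖ₑ) (hgm.mono_ac (withDensity_absolutelyContinuous _ _))
  rw [lintegral_withDensity_eq_lintegral_mul₀ hm.aemeasurable hgm,
    lintegral_withDensity_eq_lintegral_mul₀ hm.aemeasurable (hgm.pow_const 2),
    withDensity_apply _ MeasurableSet.univ, Measure.restrict_univ, lintegral_bump, one_mul] at h2
  exact (pow_le_pow_left' h1 2).trans h2

/-- Integrate the pointwise Jensen bound, exchange the integrals, and use translation invariance. -/
theorem lintegral_moll_sq_le (ρ : ContDiffBump (0 : E3)) {g : E3 → F}
    (hg : AEStronglyMeasurable g volume) :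
    ∫⁻ x, ‖moll ρ g x‖ₑ ^ 2 ≤ ∫⁻ x, ‖g x‖ₑ ^ 2 := by
  calc ∫⁻ x, ‖moll ρ g x‖ₑ ^ 2
      ≤ ∫⁻ x, ∫⁻ y, ‖ρ.normed volume y‖ₑ * ‖g (x - y)‖ₑ ^ 2 :=
        lintegral_mono fun x => enorm_moll_sq_le ρ hg x
    _ = ∫⁻ y, ∫⁻ x, ‖ρ.normed volume y‖ₑ * ‖g (x - y)‖ₑ ^ 2 := by
        refine lintegral_lintegral_swap ?_
        have h1 : AEMeasurable (fun p : E3 × E3 => ‖ρ.normed volume p.2‖ₑ)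
            (volume.prod volume) :=
          (ρ.continuous_normed.enorm.measurable.comp measurable_snd).aemeasurable
        refine h1.mul (AEMeasurable.pow_const ?_ 2)
        exact (hg.comp_quasiMeasurePreserving
            (quasiMeasurePreserving_sub_of_right_invariant volume volume)).enorm
    _ = ∫⁻ y, ‖ρ.normed volume y‖ₑ * ∫⁻ x, ‖g x‖ₑ ^ 2 := by
        refine lintegral_congr fun y => ?_
        rw [lintegral_const_mul' _ _ (by simp)]
        congr 1
        exact lintegral_sub_right_eq_self (fun x => ‖g x‖ₑ ^ 2) y
    _ = _ := by
        rw [lintegral_mul_const _ ρ.continuous_normed.enorm.measurable, lintegral_bump, one_mul]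

theorem contDiff_moll (ρ : ContDiffBump (0 : E3)) {g : E3 → F}
    (hg : LocallyIntegrable g volume) : ContDiff ℝ ∞ (moll ρ g) :=
  ρ.hasCompactSupport_normed.contDiff_convolution_left _ (ρ.contDiff_normed (n := ⊤)) hg

theorem moll_sub (ρ : ContDiffBump (0 : E3)) {g g' : E3 → F}
    (hg : LocallyIntegrable g volume) (hg' : LocallyIntegrable g' volume) (x : E3) :
    moll ρ (g - g') x = moll ρ g x - moll ρ g' x := by
  have h1 : ∀ {f : E3 → F}, LocallyIntegrable f volume →
      Integrable (fun y => ρ.normed volume y • f (x - y)) volume := by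
    intro f hf
    exact (ρ.hasCompactSupport_normed.convolutionExists_left
      (ContinuousLinearMap.lsmul ℝ ℝ) ρ.continuous_normed hf) x
  rw [moll_apply, moll_apply, moll_apply, ← integral_sub (h1 hg) (h1 hg')]
  simp [smul_sub]

/-- On points whose `rOut`-neighbourhood lies in `Ω`, mollification commutes with the weak
gradient. -/
theorem hasFDerivAt_moll [CompleteSpace F] {Ω : Set E3} (hΩ : MeasurableSet Ω) {f : E3 → F}
    {G : E3 → E3 →L[ℝ] F}
    (hf : LocallyIntegrable (Ω.indicator f) volume) (hG : LocallyIntegrable (Ω.indicator G) volume)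
    (hw : IsWeakGrad Ω f G) (ρ : ContDiffBump (0 : E3)) {x : E3}
    (hx : Metric.closedBall x ρ.rOut ⊆ Ω) :
    HasFDerivAt (moll ρ (Ω.indicator f)) (moll ρ (Ω.indicator G) x) x := by
  have hd := (ρ.hasCompactSupport_normed (μ := volume)).hasFDerivAt_convolution_left
    (ContinuousLinearMap.lsmul ℝ ℝ) (μ := (volume : Measure E3)) (g := Ω.indicator f)
    (ρ.contDiff_normed (n := 1)) hf x
  refine hd.congr_fderiv (ContinuousLinearMap.ext fun w => Eq.symm ?_)
  -- the test function
  set ψ : E3 → ℝ := fun y => ρ.normed volume (x - y) with hψ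
  have hψs : ContDiff ℝ ∞ ψ := (ρ.contDiff_normed (n := ⊤)).comp (contDiff_const.sub contDiff_id)
  have hsupp : tsupport ψ ⊆ Metric.closedBall x ρ.rOut := by
    refine closure_minimal ?_ Metric.isClosed_closedBall
    intro y hy
    have : x - y ∈ Function.support (ρ.normed volume) := hy
    rw [ρ.support_normed_eq (μ := volume), Metric.mem_ball, dist_zero_right] at this
    rw [Metric.mem_closedBall, dist_comm, dist_eq_norm]
    exact this.le
  have hcs : HasCompactSupport ψ :=
    HasCompactSupport.of_support_subset_isCompact (isCompact_closedBall x ρ.rOut)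
      ((subset_tsupport ψ).trans hsupp)
  have key := hw ψ hψs hcs (hsupp.trans hx) w
  have hψd : ∀ y, fderiv ℝ ψ y w = - fderiv ℝ (ρ.normed volume) (x - y) w := by
    intro y
    have h1 : HasFDerivAt ψ ((fderiv ℝ (ρ.normed volume) (x - y)).comp
        (-(ContinuousLinearMap.id ℝ E3))) y := by
      have h2 := ((ρ.contDiff_normed (μ := volume) (n := 1)).differentiable
        (by norm_num) (x - y)).hasFDerivAt
      exact h2.comp y ((hasFDerivAt_id y).const_sub x)
    rw [h1.fderiv]; simp
  have hcg : ConvolutionExistsAt (fderiv ℝ (ρ.normed volume)) (Ω.indicator f) x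
      ((ContinuousLinearMap.lsmul ℝ ℝ (E := F)).precompL E3) volume :=
    ((ρ.hasCompactSupport_normed (μ := volume)).fderiv (𝕜 := ℝ)).convolutionExists_left _
      ((ρ.contDiff_normed (n := 1)).continuous_fderiv (by norm_num)) hf x
  have hGi : Integrable (fun y => ρ.normed volume y • Ω.indicator G (x - y)) volume :=
    (ρ.hasCompactSupport_normed.convolutionExists_left
      (ContinuousLinearMap.lsmul ℝ ℝ) ρ.continuous_normed hG) x
  -- The reflection `y ↦ x - y` turns both convolutions into integrals against the test function `ψ`
  -- and its derivative, the form in which the weak gradient is defined.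
  have hR : (convolution (fderiv ℝ (ρ.normed volume)) (Ω.indicator f)
      ((ContinuousLinearMap.lsmul ℝ ℝ (E := F)).precompL E3) volume x) w
      = ∫ y, (fderiv ℝ (ρ.normed volume) (x - y) w) • Ω.indicator f y := by
    rw [convolution_def, ContinuousLinearMap.integral_apply hcg]
    rw [← integral_sub_left_eq_self _ volume x]
    simp [ContinuousLinearMap.precompL_apply]
  have hL : (moll ρ (Ω.indicator G) x) w = ∫ y, ψ y • Ω.indicator G y w := by
    rw [moll_apply, ContinuousLinearMap.integral_apply hGi]
    rw [← integral_sub_left_eq_self _ volume x]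
    simp [hψ]
  rw [hL, hR]
  have e1 : ∫ y, ψ y • Ω.indicator G y w = ∫ y in Ω, ψ y • G y w := by
    rw [← integral_indicator hΩ]
    congr with y
    by_cases hy : y ∈ Ω <;> simp [hy]
  have e2 : ∫ y, (fderiv ℝ (ρ.normed volume) (x - y) w) • Ω.indicator f y
      = ∫ y in Ω, -((fderiv ℝ ψ y w) • f y) := by
    rw [← integral_indicator hΩ]
    congr with y
    by_cases hy : y ∈ Ω <;> simp [hy, hψd]
  rw [e1, e2, integral_neg, key, neg_neg]

end Mollify

end EricksenLeslie

namespace EricksenLeslie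
open Filter Topology

/-! ### Density of smooth functions in `H²` of a bounded convex domain -/

section Approx

variable {F : Type*} [NormedAddCommGroup F] [NormedSpace ℝ F]

/-- The homothety of ratio `1 - δ` and centre `c`. -/
noncomputable def contract (c : E3) (δ : ℝ) (x : E3) : E3 := δ • c + (1 - δ) • x

theorem hasFDerivAt_contract (c : E3) (δ : ℝ) (x : E3) :
    HasFDerivAt (contract c δ) ((1 - δ) • ContinuousLinearMap.id ℝ E3) x :=
  ((hasFDerivAt_id x).const_smul (1 - δ)).const_add _

/-- The Jacobian of the contraction contributes at most `(1/2)⁻³ = 8`, and `8 ≤ 3 ^ 2`. -/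
theorem eLpNorm_moll_contract_le (ρ : ContDiffBump (0 : E3)) {g : E3 → F}
    (hg : AEStronglyMeasurable g volume) (c : E3) {δ : ℝ} (hδ : δ ≤ 1 / 2) :
    eLpNorm (fun x => moll ρ g (contract c δ x)) 2 volume ≤ 3 * eLpNorm g 2 volume := by
  rw [eLpNorm_two_le_iff]
  have h1 : (0 : ℝ) < 1 - δ := by linarith
  unfold contract
  rw [lintegral_comp_add_smul (fun x => ‖moll ρ g x‖ₑ ^ 2) (δ • c) h1.ne']
  refine mul_le_mul' ?_ (lintegral_moll_sq_le ρ hg)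
  rw [abs_of_pos h1]
  have : ((3 : ℝ≥0∞)) ^ 2 = ENNReal.ofReal 9 := by norm_num
  rw [this]
  refine ENNReal.ofReal_le_ofReal ?_
  have h2 : (1 / 2 : ℝ) ^ 3 ≤ (1 - δ) ^ 3 := by gcongr; linarith
  calc ((1 - δ) ^ 3)⁻¹ ≤ ((1 / 2 : ℝ) ^ 3)⁻¹ := by gcongr
    _ ≤ 9 := by norm_num

/-- Density argument: replace `g` by a continuous compactly supported `k`. The operators are bounded
on `L²` uniformly in `n`, so the replacement costs a multiple of `ε`. For `k` the convergence is
uniform on `Ω` by uniform continuity, since points are displaced by at most the bump radius plus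
`|δ|` times a bound for `Ω`. -/
theorem tendsto_moll_contract [CompleteSpace F] {Ω : Set E3} (hΩm : MeasurableSet Ω)
    (hΩb : Bornology.IsBounded Ω)
    {g : E3 → F} (hg : MemLp g 2 volume) (c : E3) {ρ : ℕ → ContDiffBump (0 : E3)} {δ : ℕ → ℝ}
    (hδ : Tendsto δ atTop (𝓝 0)) (hδ2 : ∀ n, δ n ≤ 1 / 2)
    (hρ : Tendsto (fun n => (ρ n).rOut) atTop (𝓝 0)) :
    Tendsto (fun n => eLpNorm (fun x => moll (ρ n) g (contract c (δ n) x) - g x) 2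
      (volume.restrict Ω)) atTop (𝓝 0) := by
  have hvol : volume Ω ≠ ⊤ := hΩb.measure_lt_top.ne
  -- The total factor of `ε` in the final estimate: `3 + 1` for `g - k` with and without the
  -- operator, and the root of the volume for the uniform bound on `k`.
  set A : ℝ≥0∞ := 4 + volume Ω ^ (1 / 2 : ℝ) with hA
  have hAt : A ≠ ⊤ := by
    simp only [hA, ne_eq, ENNReal.add_eq_top, not_or]
    exact ⟨by simp, ENNReal.rpow_ne_top_of_nonneg (by norm_num) hvol⟩
  have hA0 : A ≠ 0 := by simp [hA]
  rw [ENNReal.tendsto_nhds_zero]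
  intro η hη
  wlog hηt : η ≠ ⊤ generalizing η
  · push Not at hηt; simp [hηt]
  -- continuous approximation
  set ε : ℝ≥0∞ := η / A with hε
  have hε0 : ε ≠ 0 := (ENNReal.div_pos hη.ne' hAt).ne'
  have hεt : ε ≠ ⊤ := ENNReal.div_ne_top hηt hA0
  obtain ⟨k, hkc, hk, hkcont, hkm⟩ := hg.exists_hasCompactSupport_eLpNorm_sub_le
    (by norm_num) hε0
  have huc : UniformContinuous k := hkcont.uniformContinuous_of_tendsto_cocompact (hkc.is_zero_at_infty)
  have hε' : 0 < ε.toReal := ENNReal.toReal_pos hε0 hεt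
  obtain ⟨s, hs, hsk⟩ := Metric.uniformContinuous_iff.1 huc ε.toReal hε'
  obtain ⟨D, hD0, hD⟩ : ∃ D : ℝ, 0 < D ∧ ∀ x ∈ Ω, ‖x - c‖ ≤ D := by
    obtain ⟨D, hD⟩ := hΩb.subset_closedBall c
    exact ⟨max D 1, by positivity, fun x hx => le_max_of_le_left
      (by simpa [dist_eq_norm] using hD hx)⟩
  have hlim : Tendsto (fun n => (ρ n).rOut + |δ n| * D) atTop (𝓝 0) := by
    simpa using hρ.add (hδ.abs.mul_const D)
  filter_upwards [hlim.eventually (gt_mem_nhds hs)] with n hn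
  have hlk : LocallyIntegrable k volume := hkm.locallyIntegrable (by norm_num)
  have hlg : LocallyIntegrable g volume := hg.locallyIntegrable (by norm_num)
  have hct : Continuous (contract c (δ n)) := by unfold contract; fun_prop
  have hpt : ∀ x ∈ Ω, ‖moll (ρ n) k (contract c (δ n) x) - k x‖ ≤ ε.toReal := by
    intro x hx
    rw [← dist_eq_norm]
    have h2 : moll (ρ n) k (contract c (δ n) x)
        = moll (ρ n) (fun y => k (y + (contract c (δ n) x - x))) x := by
      rw [moll_apply, moll_apply]
      congr with y
      congr 2
      abel
    have h3 : ∀ y ∈ Metric.ball x (ρ n).rOut,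
        dist (k (y + (contract c (δ n) x - x))) (k x) ≤ ε.toReal := by
      intro y hy
      refine (hsk ?_).le
      rw [dist_eq_norm]
      have h4 : y + (contract c (δ n) x - x) - x = (y - x) + (-(δ n)) • (x - c) := by
        unfold contract; module
      rw [h4]
      calc _ ≤ ‖y - x‖ + ‖(-(δ n)) • (x - c)‖ := norm_add_le _ _
        _ ≤ (ρ n).rOut + |δ n| * D := by
          rw [norm_smul, norm_neg, Real.norm_eq_abs]
          have := hD x hx
          have h5 : ‖y - x‖ ≤ (ρ n).rOut := by simpa [dist_eq_norm] using (Metric.mem_ball.1 hy).le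
          gcongr
        _ < s := hn
    rw [h2]
    -- reduce to an integral estimate
    have h6 : moll (ρ n) (fun y => k (y + (contract c (δ n) x - x))) x - k x
        = ∫ y, (ρ n).normed volume y • (k (x - y + (contract c (δ n) x - x)) - k x) := by
      rw [moll_apply]
      have hi1 : Integrable (fun y => (ρ n).normed volume y •
          k (x - y + (contract c (δ n) x - x))) volume := by
        refine Continuous.integrable_of_hasCompactSupport ?_ ?_
        · exact (ρ n).continuous_normed.smul (hkcont.comp (by fun_prop))
        · exact (ρ n).hasCompactSupport_normed.smul_right
      have hi2 : Integrable (fun y => (ρ n).normed volume y • k x) volume :=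
        (ρ n).integrable_normed.smul_const _
      simp_rw [smul_sub]
      rw [integral_sub hi1 hi2, integral_smul_const, (ρ n).integral_normed, one_smul]
    rw [dist_eq_norm, h6]
    calc _ ≤ ∫ y, (ρ n).normed volume y * ε.toReal := by
          refine norm_integral_le_of_norm_le ((ρ n).integrable_normed.mul_const _) ?_
          refine Eventually.of_forall fun y => ?_
          rw [norm_smul, Real.norm_eq_abs, abs_of_nonneg ((ρ n).nonneg_normed y)]
          by_cases hy : y ∈ Metric.ball (0 : E3) (ρ n).rOut
          · refine mul_le_mul_of_nonneg_left ?_ ((ρ n).nonneg_normed y)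
            have := h3 (x - y) (by simpa [dist_eq_norm] using hy)
            rwa [dist_eq_norm] at this
          · have : (ρ n).normed volume y = 0 := by
              by_contra h0
              exact hy ((ρ n).support_normed_eq (μ := volume) ▸ (show y ∈ Function.support _ from h0))
            simp [this]
      _ = ε.toReal := by rw [integral_mul_const, (ρ n).integral_normed, one_mul]
  have hmS : ∀ {q : E3 → F}, LocallyIntegrable q volume →
      AEStronglyMeasurable (fun x => moll (ρ n) q (contract c (δ n) x)) (volume.restrict Ω) :=
    fun hq => ((contDiff_moll (ρ n) hq).continuous.comp hct).aestronglyMeasurable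
  have hgk : LocallyIntegrable (g - k) volume := hlg.sub hlk
  have hdec : (fun x => moll (ρ n) g (contract c (δ n) x) - g x)
      = (fun x => moll (ρ n) (g - k) (contract c (δ n) x))
        + ((fun x => moll (ρ n) k (contract c (δ n) x) - k x) - (g - k)) := by
    funext x
    simp only [Pi.add_apply, Pi.sub_apply, moll_sub _ hlg hlk]
    abel
  have hgkm : AEStronglyMeasurable (g - k) (volume.restrict Ω) :=
    (hg.1.sub hkm.1).restrict
  have hkS : AEStronglyMeasurable (fun x => moll (ρ n) k (contract c (δ n) x) - k x)
      (volume.restrict Ω) := (hmS hlk).sub hkm.1.restrict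
  rw [hdec]
  calc _ ≤ eLpNorm (fun x => moll (ρ n) (g - k) (contract c (δ n) x)) 2 (volume.restrict Ω)
        + (eLpNorm (fun x => moll (ρ n) k (contract c (δ n) x) - k x) 2 (volume.restrict Ω)
          + eLpNorm (g - k) 2 (volume.restrict Ω)) := by
        refine (eLpNorm_add_le (hmS hgk) (hkS.sub hgkm) (by norm_num)).trans ?_
        gcongr
        exact eLpNorm_sub_le hkS hgkm (by norm_num)
    _ ≤ 3 * ε + (volume Ω ^ (1 / 2 : ℝ) * ε + ε) := by
        gcongr
        · calc _ ≤ eLpNorm (fun x => moll (ρ n) (g - k) (contract c (δ n) x)) 2 volume :=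
                eLpNorm_mono_measure _ Measure.restrict_le_self
            _ ≤ 3 * eLpNorm (g - k) 2 volume :=
                eLpNorm_moll_contract_le _ (hg.1.sub hkm.1) _ (hδ2 n)
            _ ≤ 3 * ε := by gcongr
        · have := eLpNorm_le_of_ae_bound (μ := volume.restrict Ω) (p := 2)
            (f := fun x => moll (ρ n) k (contract c (δ n) x) - k x) (C := ε.toReal)
            ((ae_restrict_iff' hΩm).2 (Eventually.of_forall hpt))
          rw [Measure.restrict_apply_univ, ENNReal.ofReal_toReal hεt] at this
          simpa [Function.comp_def] using this
        · exact (eLpNorm_mono_measure _ Measure.restrict_le_self).trans hk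
    _ = A * ε := by rw [hA]; ring
    _ ≤ η := by rw [hε]; exact ENNReal.mul_div_le

/-- Smooth functions are dense in `H²` of a bounded convex open set. -/
theorem IsH2.exists_smooth_approx {Ω : Set E3} (hΩo : IsOpen Ω) (hΩc : Convex ℝ Ω)
    (hΩb : Bornology.IsBounded Ω) (hΩn : Ω.Nonempty) {f : E3 → E3} {G : E3 → Mat3}
    {H : E3 → E3 →L[ℝ] Mat3} (hf : IsH2 Ω f G H) :
    ∃ u : ℕ → E3 → E3, (∀ n, ContDiff ℝ ∞ (u n)) ∧
      Tendsto (fun n => eLpNorm (fun x => u n x - f x) 2 (volume.restrict Ω)) atTop (𝓝 0) ∧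
      Tendsto (fun n => eLpNorm (fun x => fderiv ℝ (u n) x - G x) 2 (volume.restrict Ω))
        atTop (𝓝 0) ∧
      Tendsto (fun n => eLpNorm (fun x => fderiv ℝ (fderiv ℝ (u n)) x - H x) 2
        (volume.restrict Ω)) atTop (𝓝 0) := by
  obtain ⟨c, hc⟩ := hΩn
  obtain ⟨r, hr, hball⟩ := Metric.isOpen_iff.1 hΩo c hc
  have hΩm := hΩo.measurableSet
  set δ : ℕ → ℝ := fun n => 1 / ((n : ℝ) + 2) with hδdef
  have hδpos : ∀ n, 0 < δ n := fun n => by positivity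
  have hδ2 : ∀ n, δ n ≤ 1 / 2 := fun n => by
    simp only [hδdef]
    have : (0 : ℝ) ≤ n := n.cast_nonneg
    gcongr; linarith
  have hδ : Tendsto δ atTop (𝓝 0) := by
    have := tendsto_one_div_add_atTop_nhds_zero_nat (𝕜 := ℝ)
    have h2 := (tendsto_add_atTop_iff_nat 1).2 this
    refine h2.congr fun n => ?_
    simp only [hδdef]; push_cast; ring_nf
  -- Contracting by `δ n` towards the centre of a ball of radius `r` inside `Ω` leaves a margin of
  -- `δ n * r` to the complement. The mollification radius is half of it.
  set ρ : ℕ → ContDiffBump (0 : E3) := fun n =>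
    ⟨δ n * r / 4, δ n * r / 2, by have := hδpos n; positivity, by
      have := mul_pos (hδpos n) hr; linarith⟩ with hρdef
  have hρ : Tendsto (fun n => (ρ n).rOut) atTop (𝓝 0) := by
    simpa using (hδ.mul_const r).div_const 2
  have hsub : ∀ n, ∀ x ∈ Ω, Metric.closedBall (contract c (δ n) x) (ρ n).rOut ⊆ Ω := by
    intro n x hx y hy
    have hd := hδpos n
    -- A point near the contracted `x` is a convex combination of `x` and a point of the ball around
    -- `c`, hence in `Ω` by convexity.
    have h1 : y = (1 - δ n) • x + δ n • (c + (δ n)⁻¹ • (y - contract c (δ n) x)) := by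
      rw [smul_add, smul_smul, mul_inv_cancel₀ hd.ne', one_smul]; unfold contract; module
    rw [h1]
    refine hΩc hx (hball ?_) (by linarith [hδ2 n]) hd.le (by ring)
    rw [Metric.mem_ball, dist_eq_norm, add_sub_cancel_left, norm_smul, norm_inv, Real.norm_eq_abs,
      abs_of_pos hd]
    have h2 : ‖y - contract c (δ n) x‖ ≤ δ n * r / 2 := by
      simpa [dist_eq_norm] using hy
    calc (δ n)⁻¹ * ‖y - contract c (δ n) x‖ ≤ (δ n)⁻¹ * (δ n * r / 2) := by gcongr
      _ = r / 2 := by field_simp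
      _ < r := by linarith
  have ind : ∀ {X : Type} [NormedAddCommGroup X] {q : E3 → X}, MemLp q 2 (volume.restrict Ω) →
      MemLp (Ω.indicator q) 2 volume := fun hq => (memLp_indicator_iff_restrict hΩm).2 hq
  have hfL := ind hf.memLp
  have hGL := ind hf.memLp_grad
  have hHL := ind (X := E3 →L[ℝ] Mat3) hf.memLp_hess
  have lf := hfL.locallyIntegrable (by norm_num)
  have lG := hGL.locallyIntegrable (by norm_num)
  have lH := hHL.locallyIntegrable (by norm_num)
  set u : ℕ → E3 → E3 := fun n x => moll (ρ n) (Ω.indicator f) (contract c (δ n) x) with hu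
  have hD1 : ∀ n, ∀ x ∈ Ω, HasFDerivAt (u n)
      ((1 - δ n) • moll (ρ n) (Ω.indicator G) (contract c (δ n) x)) x := by
    intro n x hx
    have h1 := hasFDerivAt_moll hΩm lf lG hf.weakGrad (ρ n) (hsub n x hx)
    refine (h1.comp x (hasFDerivAt_contract c (δ n) x)).congr_fderiv ?_
    simp
  have hD2 : ∀ n, ∀ x ∈ Ω, fderiv ℝ (fderiv ℝ (u n)) x
      = (1 - δ n) ^ 2 • moll (ρ n) (Ω.indicator H) (contract c (δ n) x) := by
    intro n x hx
    have h1 := hasFDerivAt_moll hΩm lG lH hf.weakHess (ρ n) (hsub n x hx)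
    have h2 := (h1.comp x (hasFDerivAt_contract c (δ n) x)).const_smul (1 - δ n)
    have h3 : fderiv ℝ (u n) =ᶠ[𝓝 x]
        fun y => (1 - δ n) • moll (ρ n) (Ω.indicator G) (contract c (δ n) y) := by
      filter_upwards [hΩo.mem_nhds hx] with y hy using (hD1 n y hy).fderiv
    rw [h3.fderiv_eq]
    refine h2.fderiv.trans ?_
    rw [pow_two, mul_smul]
    simp
  -- One argument serves the function, its gradient and its Hessian. By the chain rule these are
  -- contracted mollifications times the powers 0, 1, 2 of `1 - δ n`, and the scalar factors tend to
  -- one.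
  have scal : ∀ {X : Type} [NormedAddCommGroup X] [NormedSpace ℝ X] [CompleteSpace X]
      {q : E3 → X} (_ : MemLp q 2 (volume.restrict Ω)) (a : ℕ → ℝ) (_ : Tendsto a atTop (𝓝 1))
      (w : ℕ → E3 → X) (_ : ∀ n, ∀ x ∈ Ω, w n x =
        a n • moll (ρ n) (Ω.indicator q) (contract c (δ n) x)),
      Tendsto (fun n => eLpNorm (fun x => w n x - q x) 2 (volume.restrict Ω)) atTop (𝓝 0) := by
    intro X _ _ _ q hq a ha w hw
    have h1 := tendsto_moll_contract hΩm hΩb (ind hq) c hδ hδ2 hρ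
    have hqt : eLpNorm q 2 (volume.restrict Ω) ≠ ⊤ := hq.2.ne
    have hbound : ∀ n, eLpNorm (fun x => w n x - q x) 2 (volume.restrict Ω) ≤
        ‖a n‖ₑ * eLpNorm (fun x => moll (ρ n) (Ω.indicator q) (contract c (δ n) x)
          - Ω.indicator q x) 2 (volume.restrict Ω)
        + ‖a n - 1‖ₑ * eLpNorm q 2 (volume.restrict Ω) := by
      intro n
      have lq := (ind hq).locallyIntegrable (by norm_num)
      have hct : Continuous (contract c (δ n)) := by unfold contract; fun_prop
      have m1 : AEStronglyMeasurable (fun x => moll (ρ n) (Ω.indicator q) (contract c (δ n) x)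
          - Ω.indicator q x) (volume.restrict Ω) :=
        ((contDiff_moll (ρ n) lq).continuous.comp hct).aestronglyMeasurable.sub (ind hq).1.restrict
      rw [← eLpNorm_const_smul, ← eLpNorm_const_smul]
      refine le_trans (le_of_eq (eLpNorm_congr_ae ?_))
        (eLpNorm_add_le (m1.const_smul (a n)) (hq.1.const_smul (a n - 1)) (by norm_num))
      refine (ae_restrict_iff' hΩm).2 (Eventually.of_forall fun x hx => ?_)
      simp only [hw n x hx, Pi.add_apply, Pi.smul_apply, Set.indicator_of_mem hx]
      module
    refine tendsto_of_tendsto_of_tendsto_of_le_of_le tendsto_const_nhds ?_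
      (fun n => by simp) hbound
    have ha' : Tendsto (fun n => ‖a n‖ₑ) atTop (𝓝 ‖(1 : ℝ)‖ₑ) :=
      (continuous_enorm.tendsto _).comp ha
    have hb' : Tendsto (fun n => ‖a n - 1‖ₑ) atTop (𝓝 0) := by
      have := (continuous_enorm.tendsto ((1 : ℝ) - 1)).comp (ha.sub_const 1)
      simpa [Function.comp_def] using this
    have t1 := ENNReal.Tendsto.mul ha' (Or.inr (by simp)) h1 (Or.inr (by simp))
    have t2 := ENNReal.Tendsto.mul_const hb' (Or.inr hqt)
    simpa using t1.add t2
  have h1δ : Tendsto (fun n => 1 - δ n) atTop (𝓝 1) := by simpa using hδ.const_sub 1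
  refine ⟨u, fun n => ?_, ?_, ?_, ?_⟩
  · refine (contDiff_moll (ρ n) lf).comp ?_
    unfold contract
    fun_prop
  · exact scal hf.memLp (fun _ => 1) tendsto_const_nhds u (fun n x _ => by simp [hu])
  · exact scal hf.memLp_grad _ h1δ _ (fun n x hx => (hD1 n x hx).fderiv)
  · exact scal (X := E3 →L[ℝ] Mat3) hf.memLp_hess (fun n => (1 - δ n) ^ 2) (by simpa using h1δ.pow 2) _ hD2

end Approx

end EricksenLeslie

namespace EricksenLeslie
open Filter Topology

/-! ### Averaged Taylor estimates and the embedding of `H¹` into `L⁴` on convex sets -/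

section Averages

variable {F : Type*} [NormedAddCommGroup F] [NormedSpace ℝ F] [CompleteSpace F]

theorem lintegral_Ioo_rpow {a : ℝ} (ha : -1 < a) :
    ∫⁻ s in Set.Ioo (0 : ℝ) 1, ENNReal.ofReal (s ^ a) = ENNReal.ofReal (1 / (a + 1)) := by
  have h1 : IntegrableOn (fun s : ℝ => s ^ a) (Set.Ioo 0 1) := by
    have := intervalIntegral.intervalIntegrable_rpow' (a := 0) (b := 1) ha
    rw [intervalIntegrable_iff_integrableOn_Ioo_of_le zero_le_one] at this
    exact this
  rw [← ofReal_integral_eq_lintegral_ofReal h1]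
  · congr 1
    rw [← integral_Ioc_eq_integral_Ioo, ← intervalIntegral.integral_of_le zero_le_one,
      integral_rpow (Or.inl ha)]
    simp [Real.zero_rpow (by linarith : a + 1 ≠ 0)]
  · refine (ae_restrict_iff' measurableSet_Ioo).2 (Eventually.of_forall fun s hs => ?_)
    exact Real.rpow_nonneg hs.1.le _

theorem enorm_sub_le_lintegral_deriv {g g' : ℝ → F} (hg : ∀ s, HasDerivAt g (g' s) s)
    (hg' : Continuous g') : ‖g 1 - g 0‖ₑ ≤ ∫⁻ s in Set.Ioo (0 : ℝ) 1, ‖g' s‖ₑ := by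
  rw [← intervalIntegral.integral_eq_sub_of_hasDerivAt (fun s _ => hg s)
    (hg'.intervalIntegrable 0 1), intervalIntegral.integral_of_le zero_le_one,
    integral_Ioc_eq_integral_Ioo]
  exact enorm_integral_le_lintegral_enorm _

theorem continuous_enorm_comp {X : Type*} [NormedAddCommGroup X] {g : E3 → X}
    (hg : Continuous g) : Continuous fun x => ‖g x‖ₑ := hg.enorm

theorem hasDerivAt_comp_line {X : Type*} [NormedAddCommGroup X] [NormedSpace ℝ X] {f : E3 → X}
    (hf : Differentiable ℝ f) (z y : E3) (s : ℝ) :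
    HasDerivAt (fun s : ℝ => f (z + s • y)) (fderiv ℝ f (z + s • y) y) s := by
  have h1 : HasDerivAt (fun s : ℝ => z + s • y) y s := by
    simpa using ((hasDerivAt_id s).smul_const y).const_add z
  exact ((hf _).hasFDerivAt).comp_hasDerivAt s h1

/-- Along the segment from `z` to `x`, the function minus `s` times its directional derivative takes
the value `f z` at `s = 0` and the other Taylor terms at `s = 1`, and its derivative contains only
second derivatives, with weight `s`. That weight, small near `z`, makes the average over `x` finite
in dimension three. -/
theorem enorm_taylor_le {f : E3 → F} (hf : ContDiff ℝ 2 f) (x z : E3) :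
    ‖f z - (f x + fderiv ℝ f x (z - x))‖ₑ ≤ ∫⁻ s in Set.Ioo (0 : ℝ) 1,
      ENNReal.ofReal s * ‖fderiv ℝ (fderiv ℝ f) (z + s • (x - z))‖ₑ * ‖x - z‖ₑ ^ 2 := by
  have hf1 : Differentiable ℝ f := hf.differentiable (by norm_num)
  have hdf : ContDiff ℝ 1 (fderiv ℝ f) := hf.fderiv_right (by norm_num)
  have hf2 : Differentiable ℝ (fderiv ℝ f) := hdf.differentiable (by norm_num)
  have hc2 : Continuous (fderiv ℝ (fderiv ℝ f)) := hdf.continuous_fderiv (by norm_num)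
  set g : ℝ → F := fun s => f (z + s • (x - z)) - s • fderiv ℝ f (z + s • (x - z)) (x - z) with hg
  set g' : ℝ → F := fun s => -(s • fderiv ℝ (fderiv ℝ f) (z + s • (x - z)) (x - z) (x - z)) with hg'
  have hd : ∀ s, HasDerivAt g (g' s) s := by
    intro s
    have h1 := hasDerivAt_comp_line hf1 z (x - z) s
    have h2 := (hasDerivAt_comp_line hf2 z (x - z) s).clm_apply (hasDerivAt_const s (x - z))
    have h3 := (hasDerivAt_id s).smul h2
    refine (h1.sub h3).congr_deriv ?_
    simp [hg']
  have hc : Continuous g' := by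
    simp only [hg']; fun_prop
  have := enorm_sub_le_lintegral_deriv hd hc
  have e1 : g 1 - g 0 = -(f z - (f x + fderiv ℝ f x (z - x))) := by
    simp only [hg, one_smul, zero_smul, add_zero, sub_zero, add_sub_cancel]
    rw [← neg_sub x z, map_neg]; abel
  rw [e1, enorm_neg] at this
  refine this.trans (setLIntegral_mono' measurableSet_Ioo fun s hs => ?_)
  simp only [hg', enorm_neg, enorm_smul]
  rw [Real.enorm_eq_ofReal hs.1.le, mul_assoc, pow_two, ← mul_assoc ‖_‖ₑ]
  gcongr
  refine (ContinuousLinearMap.le_opENorm _ _).trans ?_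
  gcongr
  exact ContinuousLinearMap.le_opENorm _ _

theorem enorm_line_le {f : E3 → F} (hf : ContDiff ℝ 1 f) (x y : E3) :
    ‖f x - f y‖ₑ ≤ ∫⁻ s in Set.Ioo (0 : ℝ) 1, ‖fderiv ℝ f (x + s • (y - x))‖ₑ * ‖y - x‖ₑ := by
  have hf1 : Differentiable ℝ f := hf.differentiable (by norm_num)
  have hc : Continuous (fderiv ℝ f) := hf.continuous_fderiv (by norm_num)
  have := enorm_sub_le_lintegral_deriv (hasDerivAt_comp_line hf1 x (y - x)) (by fun_prop)
  simp only [one_smul, zero_smul, add_zero, add_sub_cancel] at this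
  rw [← enorm_neg, neg_sub]
  refine this.trans (lintegral_mono fun s => ?_)
  exact ContinuousLinearMap.le_opENorm _ _

/-- Averaged second order Taylor estimate on a convex set. -/
theorem taylor_average {f : E3 → F} (hf : ContDiff ℝ 2 f) {K : Set E3} (hK : Convex ℝ K)
    (hKm : MeasurableSet K) {h : ℝ} (hh : ∀ x ∈ K, ∀ y ∈ K, ‖x - y‖ ≤ h) {z : E3} (hz : z ∈ K) :
    ∫⁻ x in K, ‖f z - (f x + fderiv ℝ f x (z - x))‖ₑ ≤
      ENNReal.ofReal (2 * h ^ 2) *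
        (volume K * ∫⁻ x in K, ‖fderiv ℝ (fderiv ℝ f) x‖ₑ ^ 2) ^ (1 / 2 : ℝ) := by
  have hdf : ContDiff ℝ 1 (fderiv ℝ f) := hf.fderiv_right (by norm_num)
  have hc2 : Continuous (fderiv ℝ (fderiv ℝ f)) := hdf.continuous_fderiv (by norm_num)
  set Φ : E3 → ℝ≥0∞ := fun x => ‖fderiv ℝ (fderiv ℝ f) x‖ₑ with hΦ
  have hΦc : Continuous Φ := by
    exact continuous_enorm_comp (X := E3 →L[ℝ] E3 →L[ℝ] F) hc2
  rw [show ∫⁻ x in K, ‖fderiv ℝ (fderiv ℝ f) x‖ₑ ^ 2 = ∫⁻ x in K, Φ x ^ 2 from rfl]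
  have hΦe : ∀ x, ‖fderiv ℝ (fderiv ℝ f) x‖ₑ = Φ x := fun _ => rfl
  clear_value Φ
  set A : ℝ≥0∞ := (volume K * ∫⁻ x in K, Φ x ^ 2) ^ (1 / 2 : ℝ) with hA
  -- For fixed `s`, Cauchy–Schwarz and the homothety with centre `z` cost `s ^ (-3/2)`. Together
  -- with the Taylor weight `s` this leaves `s ^ (-1/2)`, whose integral is 2.
  have inner : ∀ s ∈ Set.Ioo (0 : ℝ) 1,
      ∫⁻ x in K, Φ (z + s • (x - z)) ≤ ENNReal.ofReal (s ^ (-(3 / 2) : ℝ)) * A := by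
    intro s hs
    have h1 := sq_lintegral_le (volume.restrict K) (f := fun x => Φ (z + s • (x - z)))
      (by fun_prop)
    have h2 : ∫⁻ x in K, Φ (z + s • (x - z)) ^ 2
        ≤ ENNReal.ofReal ((|s| ^ 3)⁻¹) * ∫⁻ x in K, Φ x ^ 2 := by
      have := setLIntegral_comp_add_smul_le (fun x => Φ x ^ 2) (z - s • z) hs.1.ne' hKm hKm
        (fun x hx => ?_)
      · refine le_trans (le_of_eq (lintegral_congr fun x => ?_)) this
        congr 2; module
      · have := hK hz hx (by linarith [hs.2] : (0 : ℝ) ≤ 1 - s) hs.1.le (by ring)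
        convert this using 1; module
    rw [Measure.restrict_apply_univ] at h1
    have h3 : (∫⁻ x in K, Φ (z + s • (x - z))) ^ 2
        ≤ ENNReal.ofReal ((|s| ^ 3)⁻¹) * (volume K * ∫⁻ x in K, Φ x ^ 2) := by
      refine h1.trans ?_
      calc _ ≤ volume K * (ENNReal.ofReal ((|s| ^ 3)⁻¹) * ∫⁻ x in K, Φ x ^ 2) := by gcongr
        _ = _ := by ring
    have h4 := ENNReal.rpow_le_rpow h3 (by norm_num : (0 : ℝ) ≤ 1 / 2)
    rw [← ENNReal.rpow_natCast, ← ENNReal.rpow_mul, ENNReal.mul_rpow_of_nonneg _ _ (by norm_num),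
      ENNReal.ofReal_rpow_of_nonneg (by positivity) (by norm_num)] at h4
    have h5 : ((|s| ^ 3)⁻¹ : ℝ) ^ (1 / 2 : ℝ) = s ^ (-(3 / 2) : ℝ) := by
      rw [abs_of_pos hs.1, ← Real.rpow_natCast, ← Real.rpow_neg hs.1.le, ← Real.rpow_mul hs.1.le]
      norm_num
    rw [h5] at h4
    simpa [hA] using h4
  have hxz : ∀ x ∈ K, ‖x - z‖ₑ ^ 2 ≤ ENNReal.ofReal (h ^ 2) := by
    intro x hx
    have h0 : 0 ≤ h := (norm_nonneg _).trans (hh x hx z hz)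
    rw [ENNReal.ofReal_pow h0, ← ofReal_norm]
    gcongr
    exact hh x hx z hz
  calc _ ≤ ∫⁻ x in K, ∫⁻ s in Set.Ioo (0 : ℝ) 1,
        ENNReal.ofReal (h ^ 2) * (ENNReal.ofReal s * Φ (z + s • (x - z))) := by
        refine setLIntegral_mono' hKm fun x hx => (enorm_taylor_le hf x z).trans ?_
        refine lintegral_mono fun s => ?_
        rw [mul_comm (ENNReal.ofReal (h ^ 2)), hΦe]
        gcongr
        exact hxz x hx
    _ = ∫⁻ s in Set.Ioo (0 : ℝ) 1, ∫⁻ x in K,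
        ENNReal.ofReal (h ^ 2) * (ENNReal.ofReal s * Φ (z + s • (x - z))) := by
        refine lintegral_lintegral_swap (Measurable.aemeasurable ?_)
        exact ((ENNReal.measurable_ofReal.comp measurable_snd).mul
          (hΦc.comp (by fun_prop : Continuous fun p : E3 × ℝ =>
            z + p.2 • (p.1 - z))).measurable).const_mul _
    _ ≤ ∫⁻ s in Set.Ioo (0 : ℝ) 1,
        ENNReal.ofReal (h ^ 2) * (ENNReal.ofReal (s ^ (-(1 / 2) : ℝ)) * A) := by
        refine setLIntegral_mono' measurableSet_Ioo fun s hs => ?_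
        rw [lintegral_const_mul' _ _ ENNReal.ofReal_ne_top,
          lintegral_const_mul' _ _ ENNReal.ofReal_ne_top]
        refine mul_le_mul' le_rfl ?_
        calc _ ≤ ENNReal.ofReal s * (ENNReal.ofReal (s ^ (-(3 / 2) : ℝ)) * A) :=
              mul_le_mul' le_rfl (inner s hs)
          _ = ENNReal.ofReal (s ^ (-(1 / 2) : ℝ)) * A := by
              rw [← mul_assoc, ← ENNReal.ofReal_mul hs.1.le]
              congr 2
              nth_rewrite 1 [← Real.rpow_one s]
              rw [← Real.rpow_add hs.1]; norm_num
    _ = _ := by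
        rw [lintegral_const_mul' _ _ ENNReal.ofReal_ne_top, lintegral_mul_const,
          lintegral_Ioo_rpow (by norm_num), ← mul_assoc, ← ENNReal.ofReal_mul (by positivity)]
        · congr 2; norm_num; ring
        · exact ENNReal.measurable_ofReal.comp (by fun_prop)

/-- For fixed `t` the inner average is bounded in sup norm by the homothety in `y`, with square of
order `t ^ (-3)`. It is bounded in `L²` uniformly in `t`: by the sup bound if `t ≥ 1/2`, otherwise
by exchanging the integrals and using the homothety in `x`. Multiplying the two gives a fourth power
integral of order `t ^ (-3)`. Two weighted Cauchy–Schwarz inequalities in `t` replace Minkowski's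
inequality and leave the integrable power `t ^ (-3/4)`. The constant is `64 * 4 * 8`. -/
theorem lintegral_average_pow_four_le {Φ : E3 → ℝ≥0∞} (hΦc : Continuous Φ) {K : Set E3}
    (hK : Convex ℝ K) (hKm : MeasurableSet K) :
    ∫⁻ x in K, (∫⁻ t in Set.Ioo (0 : ℝ) 1, ∫⁻ y in K, Φ (x + t • (y - x))) ^ 4 ≤
      2048 * volume K ^ 3 * (∫⁻ x in K, Φ x ^ 2) ^ 2 := by
  obtain ⟨V, hV⟩ : ∃ V, V = volume K := ⟨_, rfl⟩
  obtain ⟨N, hN⟩ : ∃ N, N = ∫⁻ x in K, Φ x ^ 2 := ⟨_, rfl⟩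
  obtain ⟨g, hg⟩ : ∃ g : ℝ → E3 → ℝ≥0∞, ∀ t x, g t x = ∫⁻ y in K, Φ (x + t • (y - x)) :=
    ⟨fun t x => ∫⁻ y in K, Φ (x + t • (y - x)), fun _ _ => rfl⟩
  simp_rw [← hg]
  rw [← hV, ← hN]
  have hgm : Measurable fun p : ℝ × E3 => g p.1 p.2 := by
    simp only [hg]
    refine Measurable.lintegral_prod_right' (f := fun q : (ℝ × E3) × E3 =>
      Φ (q.1.2 + q.1.1 • (q.2 - q.1.2))) ?_
    exact (hΦc.comp (by fun_prop)).measurable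
  have hcombo : ∀ t ∈ Set.Ioo (0 : ℝ) 1, ∀ x ∈ K, ∀ y ∈ K, x + t • (y - x) ∈ K := by
    intro t ht x hx y hy
    have := hK hx hy (by linarith [ht.2] : (0 : ℝ) ≤ 1 - t) ht.1.le (by ring)
    convert this using 1; module
  have hsqC : ∀ t x, g t x ^ 2 ≤ V * ∫⁻ y in K, Φ (x + t • (y - x)) ^ 2 := by
    intro t x
    have := sq_lintegral_le (volume.restrict K) (f := fun y => Φ (x + t • (y - x)))
      (by fun_prop)
    rwa [Measure.restrict_apply_univ, ← hg, ← hV] at this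
  have hsup : ∀ t ∈ Set.Ioo (0 : ℝ) 1, ∀ x ∈ K,
      g t x ^ 2 ≤ V * (ENNReal.ofReal ((t ^ 3)⁻¹) * N) := by
    intro t ht x hx
    refine (hsqC t x).trans ?_
    rw [hN]
    refine mul_le_mul' le_rfl ?_
    have := setLIntegral_comp_add_smul_le (fun x => Φ x ^ 2) (x - t • x) ht.1.ne' hKm hKm
      (fun y hy => ?_)
    · rw [abs_of_pos ht.1] at this
      refine le_trans (le_of_eq (lintegral_congr fun y => ?_)) this
      congr 2; module
    · convert hcombo t ht x hx y hy using 1; module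
  have hL2 : ∀ t ∈ Set.Ioo (0 : ℝ) 1, ∫⁻ x in K, g t x ^ 2 ≤ V ^ 2 * (8 * N) := by
    intro t ht
    by_cases htt : 1 / 2 ≤ t
    · calc _ ≤ ∫⁻ x in K, V * (ENNReal.ofReal ((t ^ 3)⁻¹) * N) :=
            setLIntegral_mono' hKm fun x hx => hsup t ht x hx
        _ = V ^ 2 * (ENNReal.ofReal ((t ^ 3)⁻¹) * N) := by
            rw [setLIntegral_const, ← hV]; ring
        _ ≤ _ := by
            gcongr
            rw [← ENNReal.ofReal_ofNat 8]
            refine ENNReal.ofReal_le_ofReal ?_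
            calc (t ^ 3)⁻¹ ≤ ((1 / 2 : ℝ) ^ 3)⁻¹ := by gcongr
              _ = 8 := by norm_num
    · push Not at htt
      have h1t : (0 : ℝ) < 1 - t := by linarith
      calc _ ≤ ∫⁻ x in K, V * ∫⁻ y in K, Φ (x + t • (y - x)) ^ 2 :=
            lintegral_mono fun x => hsqC t x
        _ = V * ∫⁻ x in K, ∫⁻ y in K, Φ (x + t • (y - x)) ^ 2 := by
            rw [lintegral_const_mul]
            refine Measurable.lintegral_prod_right' (f := fun q : E3 × E3 =>
              Φ (q.1 + t • (q.2 - q.1)) ^ 2) ?_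
            exact ((hΦc.comp (by fun_prop)).measurable).pow_const 2
        _ = V * ∫⁻ y in K, ∫⁻ x in K, Φ (x + t • (y - x)) ^ 2 := by
            congr 1
            refine lintegral_lintegral_swap (Measurable.aemeasurable ?_)
            exact ((hΦc.comp (by fun_prop : Continuous fun q : E3 × E3 =>
              q.1 + t • (q.2 - q.1))).measurable).pow_const 2
        _ ≤ V * ∫⁻ y in K, 8 * N := by
            refine mul_le_mul' le_rfl (setLIntegral_mono' hKm fun y hy => ?_)
            have := setLIntegral_comp_add_smul_le (fun x => Φ x ^ 2) (t • y) h1t.ne' hKm hKm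
              (fun x hx => ?_)
            · calc ∫⁻ x in K, Φ (x + t • (y - x)) ^ 2
                  = ∫⁻ x in K, Φ (t • y + (1 - t) • x) ^ 2 := by
                    refine lintegral_congr fun x => ?_
                    congr 2; module
                _ ≤ _ := this
                _ ≤ _ := by
                    rw [hN]
                    refine mul_le_mul' ?_ le_rfl
                    rw [← ENNReal.ofReal_ofNat 8, abs_of_pos h1t]
                    refine ENNReal.ofReal_le_ofReal ?_
                    calc ((1 - t) ^ 3)⁻¹ ≤ ((1 / 2 : ℝ) ^ 3)⁻¹ := by gcongr; linarith
                      _ = 8 := by norm_num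
            · convert hcombo t ht x hx y hy using 1; module
        _ = _ := by rw [setLIntegral_const, ← hV]; ring
  have hg4 : ∀ t ∈ Set.Ioo (0 : ℝ) 1,
      ∫⁻ x in K, g t x ^ 4 ≤ ENNReal.ofReal ((t ^ 3)⁻¹) * (8 * V ^ 3 * N ^ 2) := by
    intro t ht
    calc _ ≤ ∫⁻ x in K, (V * (ENNReal.ofReal ((t ^ 3)⁻¹) * N)) * g t x ^ 2 := by
          refine setLIntegral_mono' hKm fun x hx => ?_
          calc g t x ^ 4 = g t x ^ 2 * g t x ^ 2 := by ring
            _ ≤ _ := by gcongr; exact hsup t ht x hx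
      _ = (V * (ENNReal.ofReal ((t ^ 3)⁻¹) * N)) * ∫⁻ x in K, g t x ^ 2 := by
          rw [lintegral_const_mul]
          exact (hgm.comp (by fun_prop : Measurable fun x : E3 => (t, x))).pow_const 2
      _ ≤ (V * (ENNReal.ofReal ((t ^ 3)⁻¹) * N)) * (V ^ 2 * (8 * N)) := by
          gcongr; exact hL2 t ht
      _ = _ := by ring
  obtain ⟨u, hu⟩ : ∃ u : E3 → ℝ≥0∞, ∀ x, u x = ∫⁻ t in Set.Ioo (0 : ℝ) 1, g t x :=
    ⟨fun x => ∫⁻ t in Set.Ioo (0 : ℝ) 1, g t x, fun _ => rfl⟩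
  simp_rw [← hu]
  have wmeas : ∀ a : ℝ, Measurable fun t : ℝ => ENNReal.ofReal (t ^ a) := fun a => by fun_prop
  have hgtm : ∀ x, Measurable fun t => g t x := fun x =>
    hgm.comp (by fun_prop : Measurable fun t : ℝ => (t, x))
  -- Cauchy–Schwarz with the weights `t ^ (-a/2)` and `t ^ (a/2)`. It is applied twice with `a =
  -- 3/4`, which produces the factor `4 ^ 2 * 4 = 64` and the weight `t ^ (9/4)`.
  have wcs : ∀ (a : ℝ) (q : ℝ → ℝ≥0∞), Measurable q → a < 1 → 
      (∫⁻ t in Set.Ioo (0 : ℝ) 1, q t) ^ 2 ≤ ENNReal.ofReal (1 / (-a + 1)) *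
        ∫⁻ t in Set.Ioo (0 : ℝ) 1, ENNReal.ofReal (t ^ a) * q t ^ 2 := by
    intro a q hq ha
    rw [← lintegral_Ioo_rpow (by linarith : -1 < -a)]
    have h1 := sq_lintegral_mul_le (volume.restrict (Set.Ioo (0 : ℝ) 1))
      (f := fun t => ENNReal.ofReal (t ^ (-a / 2)))
      (g := fun t => ENNReal.ofReal (t ^ (a / 2)) * q t) (wmeas _).aemeasurable
      ((wmeas _).mul hq).aemeasurable
    calc _ = (∫⁻ t in Set.Ioo (0 : ℝ) 1,
          ENNReal.ofReal (t ^ (-a / 2)) * (ENNReal.ofReal (t ^ (a / 2)) * q t)) ^ 2 := by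
          congr 1
          refine setLIntegral_congr_fun measurableSet_Ioo fun t ht => ?_
          have := ht.1
          rw [← mul_assoc, ← ENNReal.ofReal_mul (by positivity), ← Real.rpow_add ht.1]
          simp [neg_div]
      _ ≤ _ := h1
      _ = _ := by
          congr 1
          · refine setLIntegral_congr_fun measurableSet_Ioo fun t ht => ?_
            have := ht.1
            rw [← ENNReal.ofReal_pow (by positivity), ← Real.rpow_natCast, ← Real.rpow_mul ht.1.le]
            congr 2; push_cast; ring
          · refine setLIntegral_congr_fun measurableSet_Ioo fun t ht => ?_
            have := ht.1
            rw [mul_pow, ← ENNReal.ofReal_pow (by positivity), ← Real.rpow_natCast,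
              ← Real.rpow_mul ht.1.le]
            congr 3; push_cast; ring
  have hu4 : ∀ x, u x ^ 4 ≤ 64 *
      ∫⁻ t in Set.Ioo (0 : ℝ) 1, ENNReal.ofReal (t ^ (9 / 4 : ℝ)) * g t x ^ 4 := by
    intro x
    have h1 := wcs (3 / 4) (fun t => g t x) (hgtm x) (by norm_num)
    have h2 := wcs (3 / 4) (fun t => ENNReal.ofReal (t ^ (3 / 4 : ℝ)) * g t x ^ 2)
      ((wmeas _).mul ((hgtm x).pow_const 2)) (by norm_num)
    have e4 : ENNReal.ofReal (1 / (-(3 / 4) + 1)) = 4 := by norm_num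
    rw [e4, ← hu] at h1
    rw [e4] at h2
    calc u x ^ 4 = (u x ^ 2) ^ 2 := by ring
      _ ≤ (4 * ∫⁻ t in Set.Ioo (0 : ℝ) 1, ENNReal.ofReal (t ^ (3 / 4 : ℝ)) * g t x ^ 2) ^ 2 := by
          gcongr
      _ = 16 * (∫⁻ t in Set.Ioo (0 : ℝ) 1, ENNReal.ofReal (t ^ (3 / 4 : ℝ)) * g t x ^ 2) ^ 2 := by
          rw [mul_pow]; norm_num
      _ ≤ 16 * (4 * ∫⁻ t in Set.Ioo (0 : ℝ) 1, ENNReal.ofReal (t ^ (3 / 4 : ℝ)) *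
            (ENNReal.ofReal (t ^ (3 / 4 : ℝ)) * g t x ^ 2) ^ 2) := by gcongr
      _ = 64 * ∫⁻ t in Set.Ioo (0 : ℝ) 1, ENNReal.ofReal (t ^ (3 / 4 : ℝ)) *
            (ENNReal.ofReal (t ^ (3 / 4 : ℝ)) * g t x ^ 2) ^ 2 := by
          rw [← mul_assoc]; norm_num
      _ = _ := by
          congr 1
          refine setLIntegral_congr_fun measurableSet_Ioo fun t ht => ?_
          have := ht.1
          rw [mul_pow, ← ENNReal.ofReal_pow (by positivity), ← mul_assoc,
            ← ENNReal.ofReal_mul (by positivity), ← pow_mul, ← Real.rpow_natCast,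
              ← Real.rpow_mul ht.1.le, ← Real.rpow_add ht.1]
          norm_num
  calc _ ≤ ∫⁻ x in K, 64 *
        ∫⁻ t in Set.Ioo (0 : ℝ) 1, ENNReal.ofReal (t ^ (9 / 4 : ℝ)) * g t x ^ 4 :=
        lintegral_mono fun x => hu4 x
    _ = 64 * ∫⁻ x in K,
        ∫⁻ t in Set.Ioo (0 : ℝ) 1, ENNReal.ofReal (t ^ (9 / 4 : ℝ)) * g t x ^ 4 := by
        rw [lintegral_const_mul' _ _ (by norm_num)]
    _ = 64 * ∫⁻ t in Set.Ioo (0 : ℝ) 1, ∫⁻ x in K,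
        ENNReal.ofReal (t ^ (9 / 4 : ℝ)) * g t x ^ 4 := by
        congr 1
        refine lintegral_lintegral_swap (Measurable.aemeasurable ?_)
        refine Measurable.mul ((wmeas _).comp measurable_snd) ?_
        exact (hgm.comp measurable_swap).pow_const 4
    _ ≤ 64 * ∫⁻ t in Set.Ioo (0 : ℝ) 1,
        ENNReal.ofReal (t ^ (-(3 / 4) : ℝ)) * (8 * V ^ 3 * N ^ 2) := by
        gcongr 64 * ?_
        refine setLIntegral_mono' measurableSet_Ioo fun t ht => ?_
        rw [lintegral_const_mul' _ _ ENNReal.ofReal_ne_top]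
        calc _ ≤ ENNReal.ofReal (t ^ (9 / 4 : ℝ)) *
              (ENNReal.ofReal ((t ^ 3)⁻¹) * (8 * V ^ 3 * N ^ 2)) := by
              gcongr; exact hg4 t ht
          _ = _ := by
              have := ht.1
              rw [← mul_assoc, ← ENNReal.ofReal_mul (by positivity), ← Real.rpow_natCast,
                ← Real.rpow_neg ht.1.le, ← Real.rpow_add ht.1]
              norm_num
    _ = _ := by
        rw [lintegral_mul_const _ (wmeas _), lintegral_Ioo_rpow (by norm_num)]
        have e4 : ENNReal.ofReal (1 / (-(3 / 4) + 1)) = 4 := by norm_num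
        rw [e4]; ring

/-- The embedding `H¹ ⊂ L⁴` on a bounded convex set. -/
theorem lintegral_pow_four_le {f : E3 → F} (hf : ContDiff ℝ 1 f) {K : Set E3} (hK : Convex ℝ K)
    (hKm : MeasurableSet K) {h : ℝ} (hh : ∀ x ∈ K, ∀ y ∈ K, ‖x - y‖ ≤ h) :
    volume K ^ 4 * ∫⁻ x in K, ‖f x‖ₑ ^ 4 ≤ 2 ^ 17 * volume K ^ 3 *
      ((∫⁻ x in K, ‖f x‖ₑ ^ 2) ^ 2
        + ENNReal.ofReal h ^ 4 * (∫⁻ x in K, ‖fderiv ℝ f x‖ₑ ^ 2) ^ 2) := by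
  have hc : Continuous (fderiv ℝ f) := hf.continuous_fderiv (by norm_num)
  obtain ⟨V, hV⟩ : ∃ V, V = volume K := ⟨_, rfl⟩
  obtain ⟨Φ, hΦ⟩ : ∃ Φ : E3 → ℝ≥0∞, ∀ x, ‖fderiv ℝ f x‖ₑ = Φ x :=
    ⟨fun x => ‖fderiv ℝ f x‖ₑ, fun _ => rfl⟩
  have hΦc : Continuous Φ := by
    have : Φ = fun x => ‖fderiv ℝ f x‖ₑ := funext fun x => (hΦ x).symm
    rw [this]
    exact continuous_enorm_comp (X := E3 →L[ℝ] F) hc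
  obtain ⟨N, hN⟩ : ∃ N, N = ∫⁻ x in K, Φ x ^ 2 := ⟨_, rfl⟩
  have hU := lintegral_average_pow_four_le hΦc hK hKm
  obtain ⟨u, hu⟩ : ∃ u : E3 → ℝ≥0∞, ∀ x, u x = ∫⁻ t in Set.Ioo (0 : ℝ) 1,
      ∫⁻ y in K, Φ (x + t • (y - x)) :=
    ⟨fun x => ∫⁻ t in Set.Ioo (0 : ℝ) 1, ∫⁻ y in K, Φ (x + t • (y - x)), fun _ => rfl⟩
  simp_rw [← hu] at hU
  simp_rw [hΦ]
  rw [← hV, ← hN] at hU ⊢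
  -- Compare the values at `x` and at `y` along the segment between them, then average over `y`.
  have hpt : ∀ x ∈ K, V * ‖f x‖ₑ ≤ (∫⁻ y in K, ‖f y‖ₑ) + ENNReal.ofReal h * u x := by
    intro x hx
    have h1 : ∀ y ∈ K, ‖f x‖ₑ ≤ ‖f y‖ₑ + ENNReal.ofReal h *
        ∫⁻ t in Set.Ioo (0 : ℝ) 1, Φ (x + t • (y - x)) := by
      intro y hy
      calc ‖f x‖ₑ = ‖f y + (f x - f y)‖ₑ := by simp
        _ ≤ ‖f y‖ₑ + ‖f x - f y‖ₑ := enorm_add_le _ _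
        _ ≤ _ := by
          gcongr
          refine (enorm_line_le hf x y).trans ?_
          simp_rw [hΦ]
          rw [← lintegral_const_mul' _ _ ENNReal.ofReal_ne_top]
          refine lintegral_mono fun t => ?_
          rw [mul_comm]
          gcongr
          rw [← ofReal_norm]
          exact ENNReal.ofReal_le_ofReal (hh y hy x hx)
    calc V * ‖f x‖ₑ = ∫⁻ y in K, ‖f x‖ₑ := by rw [setLIntegral_const, mul_comm, hV]
      _ ≤ ∫⁻ y in K, (‖f y‖ₑ + ENNReal.ofReal h *
          ∫⁻ t in Set.Ioo (0 : ℝ) 1, Φ (x + t • (y - x))) := setLIntegral_mono' hKm h1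
      _ = (∫⁻ y in K, ‖f y‖ₑ) + ENNReal.ofReal h * ∫⁻ y in K,
          ∫⁻ t in Set.Ioo (0 : ℝ) 1, Φ (x + t • (y - x)) := by
          rw [lintegral_add_left (continuous_enorm_comp hf.continuous).measurable,
            lintegral_const_mul' _ _ ENNReal.ofReal_ne_top]
      _ = _ := by
          rw [hu]
          congr 2
          refine lintegral_lintegral_swap (Measurable.aemeasurable ?_)
          exact (hΦc.comp (by fun_prop)).measurable
  have hI : (∫⁻ y in K, ‖f y‖ₑ) ^ 4 ≤ V ^ 2 * (∫⁻ y in K, ‖f y‖ₑ ^ 2) ^ 2 := by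
    have := sq_lintegral_le (volume.restrict K) (f := fun y => ‖f y‖ₑ)
      (by have := hf.continuous; fun_prop)
    rw [Measure.restrict_apply_univ, ← hV] at this
    calc _ = ((∫⁻ y in K, ‖f y‖ₑ) ^ 2) ^ 2 := by ring
      _ ≤ (V * ∫⁻ y in K, ‖f y‖ₑ ^ 2) ^ 2 := by gcongr
      _ = _ := by ring
  have hadd4 : ∀ a b : ℝ≥0∞, (a + b) ^ 4 ≤ 8 * (a ^ 4 + b ^ 4) := by
    intro a b
    have := ENNReal.rpow_add_le_mul_rpow_add_rpow a b (p := 4) (by norm_num)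
    have e8 : (2 : ℝ≥0∞) ^ ((4 : ℝ) - 1) = 8 := by
      rw [show ((4 : ℝ) - 1) = ((3 : ℕ) : ℝ) by norm_num, ENNReal.rpow_natCast]; norm_num
    rw [e8] at this
    have h4 : ∀ c : ℝ≥0∞, c ^ (4 : ℝ) = c ^ 4 := fun c => by
      rw [show (4 : ℝ) = ((4 : ℕ) : ℝ) by norm_num, ENNReal.rpow_natCast]
    simpa only [h4] using this
  calc V ^ 4 * ∫⁻ x in K, ‖f x‖ₑ ^ 4 = ∫⁻ x in K, (V * ‖f x‖ₑ) ^ 4 := by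
        simp_rw [mul_pow]
        rw [lintegral_const_mul]
        have := hf.continuous
        exact (this.enorm.measurable).pow_const 4
    _ ≤ ∫⁻ x in K, 8 * ((∫⁻ y in K, ‖f y‖ₑ) ^ 4 + ENNReal.ofReal h ^ 4 * u x ^ 4) := by
        refine setLIntegral_mono' hKm fun x hx => ?_
        rw [← mul_pow]
        exact (pow_le_pow_left' (hpt x hx) 4).trans (hadd4 _ _)
    _ = 8 * ((∫⁻ y in K, ‖f y‖ₑ) ^ 4 * V + ENNReal.ofReal h ^ 4 * ∫⁻ x in K, u x ^ 4) := by
        rw [lintegral_const_mul' _ _ (by norm_num), lintegral_add_left measurable_const,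
          setLIntegral_const, ← hV, lintegral_const_mul' _ _ (by simp)]
    _ ≤ 8 * ((V ^ 2 * (∫⁻ y in K, ‖f y‖ₑ ^ 2) ^ 2) * V
          + ENNReal.ofReal h ^ 4 * (2048 * V ^ 3 * N ^ 2)) := by gcongr
    _ = 8 * V ^ 3 * (∫⁻ y in K, ‖f y‖ₑ ^ 2) ^ 2
          + 16384 * V ^ 3 * (ENNReal.ofReal h ^ 4 * N ^ 2) := by ring
    _ ≤ 2 ^ 17 * V ^ 3 * (∫⁻ y in K, ‖f y‖ₑ ^ 2) ^ 2
          + 2 ^ 17 * V ^ 3 * (ENNReal.ofReal h ^ 4 * N ^ 2) := by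
        gcongr <;> norm_num
    _ = _ := by ring

end Averages

end EricksenLeslie

namespace EricksenLeslie
open Filter Topology

/-! ### Pointwise values, Taylor estimates and gradient integrability for `H²` functions -/

section H2

/-- The frontier of a convex set is a null set. -/
theorem restrict_closure_eq {Ω : Set E3} (hΩc : Convex ℝ Ω) :
    volume.restrict (closure Ω) = volume.restrict Ω := by
  refine Measure.restrict_congr_set (ae_eq_set.2
    ⟨?_, by simp [Set.sdiff_eq_empty.2 subset_closure]⟩)
  refine measure_mono_null ?_ (hΩc.addHaar_frontier volume)
  intro x hx
  exact ⟨hx.1, fun h => hx.2 (interior_subset h)⟩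

theorem restrict_le_of_subset_closure {Ω K : Set E3} (hΩc : Convex ℝ Ω) (hK : K ⊆ closure Ω) :
    volume.restrict K ≤ volume.restrict Ω := by
  rw [← restrict_closure_eq hΩc]
  exact Measure.restrict_mono hK le_rfl

theorem lintegral_enorm_le_eLpNorm {F : Type*} [NormedAddCommGroup F] {K : Set E3} {w : E3 → F}
    (hw : AEStronglyMeasurable w (volume.restrict K)) :
    ∫⁻ x in K, ‖w x‖ₑ ≤ volume K ^ (1 / 2 : ℝ) * eLpNorm w 2 (volume.restrict K) := by
  have h := sq_lintegral_le (volume.restrict K) hw.enorm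
  rw [Measure.restrict_apply_univ, ← sq_eLpNorm_two] at h
  have h2 := ENNReal.rpow_le_rpow h (by norm_num : (0 : ℝ) ≤ 1 / 2)
  rw [ENNReal.mul_rpow_of_nonneg _ _ (by norm_num), ← ENNReal.rpow_natCast, ← ENNReal.rpow_mul,
    ← ENNReal.rpow_natCast, ← ENNReal.rpow_mul] at h2
  simpa using h2

theorem taylor_average' {f : E3 → E3} (hf : ContDiff ℝ 2 f) {K : Set E3} (hK : Convex ℝ K)
    (hKm : MeasurableSet K) {h : ℝ} (hh : ∀ x ∈ K, ∀ y ∈ K, ‖x - y‖ ≤ h) {z : E3} (hz : z ∈ K) :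
    ∫⁻ x in K, ‖f z - (f x + fderiv ℝ f x (z - x))‖ₑ ≤
      ENNReal.ofReal (2 * h ^ 2) * (volume K ^ (1 / 2 : ℝ) *
        eLpNorm (fderiv ℝ (fderiv ℝ f)) 2 (volume.restrict K)) := by
  refine (taylor_average hf hK hKm hh hz).trans (le_of_eq ?_)
  have e : ∫⁻ x in K, ‖fderiv ℝ (fderiv ℝ f) x‖ₑ ^ 2
      = eLpNorm (fderiv ℝ (fderiv ℝ f)) 2 (volume.restrict K) ^ 2 :=
    (sq_eLpNorm_two (F := E3 →L[ℝ] Mat3) _ _).symm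
  rw [e, ENNReal.mul_rpow_of_nonneg _ _ (by norm_num), ← ENNReal.rpow_natCast,
    ← ENNReal.rpow_mul]
  simp

/-- Write the value at `z` as the Taylor polynomial at `x` plus a remainder and average over `x` in
`K`. Applied to differences, this makes an `H²` Cauchy sequence uniformly Cauchy. -/
theorem enorm_le_of_smooth {w : E3 → E3} (hw : ContDiff ℝ 2 w) {K : Set E3} (hK : Convex ℝ K)
    (hKm : MeasurableSet K) {h : ℝ} (hh : ∀ x ∈ K, ∀ y ∈ K, ‖x - y‖ ≤ h) {z : E3} (hz : z ∈ K) :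
    volume K * ‖w z‖ₑ ≤ volume K ^ (1 / 2 : ℝ) * (eLpNorm w 2 (volume.restrict K)
      + ENNReal.ofReal h * eLpNorm (fderiv ℝ w) 2 (volume.restrict K)
      + ENNReal.ofReal (2 * h ^ 2) *
        eLpNorm (fderiv ℝ (fderiv ℝ w)) 2 (volume.restrict K)) := by
  have c0 : Continuous w := hw.continuous
  have c1 : Continuous (fderiv ℝ w) := hw.continuous_fderiv (by norm_num)
  have h1 : ∀ x ∈ K, ‖w z‖ₑ ≤ ‖w x‖ₑ + ENNReal.ofReal h * ‖fderiv ℝ w x‖ₑ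
      + ‖w z - (w x + fderiv ℝ w x (z - x))‖ₑ := by
    intro x hx
    calc ‖w z‖ₑ = ‖(w x + fderiv ℝ w x (z - x)) + (w z - (w x + fderiv ℝ w x (z - x)))‖ₑ := by
          congr 1; abel
      _ ≤ ‖w x‖ₑ + ‖fderiv ℝ w x (z - x)‖ₑ + ‖w z - (w x + fderiv ℝ w x (z - x))‖ₑ := by
          refine (enorm_add_le _ _).trans ?_
          gcongr
          exact enorm_add_le _ _
      _ ≤ _ := by
          gcongr
          refine (ContinuousLinearMap.le_opENorm _ _).trans ?_
          rw [mul_comm]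
          gcongr
          rw [← ofReal_norm]
          exact ENNReal.ofReal_le_ofReal (hh z hz x hx)
  have m0 : Measurable fun x => ‖w x‖ₑ := (continuous_enorm_comp c0).measurable
  have m1 : Measurable fun x => ENNReal.ofReal h * ‖fderiv ℝ w x‖ₑ :=
    (continuous_enorm_comp c1).measurable.const_mul _
  calc volume K * ‖w z‖ₑ = ∫⁻ x in K, ‖w z‖ₑ := by rw [setLIntegral_const, mul_comm]
    _ ≤ ∫⁻ x in K, (‖w x‖ₑ + ENNReal.ofReal h * ‖fderiv ℝ w x‖ₑ
      + ‖w z - (w x + fderiv ℝ w x (z - x))‖ₑ) := setLIntegral_mono' hKm h1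
    _ = (∫⁻ x in K, ‖w x‖ₑ) + ENNReal.ofReal h * (∫⁻ x in K, ‖fderiv ℝ w x‖ₑ)
        + ∫⁻ x in K, ‖w z - (w x + fderiv ℝ w x (z - x))‖ₑ := by
        rw [lintegral_add_left (f := fun x => ‖w x‖ₑ + ENNReal.ofReal h * ‖fderiv ℝ w x‖ₑ) (m0.add m1), lintegral_add_left m0,
          lintegral_const_mul' _ _ ENNReal.ofReal_ne_top]
    _ ≤ _ := by
        rw [mul_add, mul_add]
        refine add_le_add (add_le_add ?_ ?_) ?_
        · exact lintegral_enorm_le_eLpNorm c0.aestronglyMeasurable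
        · rw [mul_left_comm]
          gcongr
          exact lintegral_enorm_le_eLpNorm c1.aestronglyMeasurable
        · rw [mul_left_comm]
          exact taylor_average' hw hK hKm hh hz

theorem continuous_fderiv_fderiv {f : E3 → E3} (hf : ContDiff ℝ 2 f) :
    Continuous (fderiv ℝ (fderiv ℝ f)) :=
  (hf.fderiv_right (m := 1) (by norm_num)).continuous_fderiv (by norm_num)

theorem eLpNorm_sub_le_of_approx {X : Type*} [NormedAddCommGroup X] {μ : Measure E3}
    {a b g : E3 → X} (ha : AEStronglyMeasurable a μ) (hb : AEStronglyMeasurable b μ)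
    (hg : AEStronglyMeasurable g μ) :
    eLpNorm (a - b) 2 μ ≤ eLpNorm (fun x => a x - g x) 2 μ + eLpNorm (fun x => b x - g x) 2 μ := by
  have : a - b = (fun x => a x - g x) - (fun x => b x - g x) := by
    funext x; simp
  rw [this]
  exact eLpNorm_sub_le (ha.sub hg) (hb.sub hg) (by norm_num)

theorem eLpNorm_le_add_sub {X : Type*} [NormedAddCommGroup X] {μ : Measure E3} {a g : E3 → X}
    (ha : AEStronglyMeasurable a μ) (hg : AEStronglyMeasurable g μ) :
    eLpNorm a 2 μ ≤ eLpNorm g 2 μ + eLpNorm (fun x => a x - g x) 2 μ := by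
  have : a = g + fun x => a x - g x := by funext x; simp
  nth_rewrite 1 [this]
  exact eLpNorm_add_le hg (ha.sub hg) (by norm_num)

/-- A function in `H²` of a bounded convex open set has a continuous representative on the closure,
which is a pointwise limit of smooth functions converging in `H²`. -/
theorem IsH2.exists_continuous_rep {Ω : Set E3} (hΩo : IsOpen Ω) (hΩc : Convex ℝ Ω)
    (hΩb : Bornology.IsBounded Ω) (hΩn : Ω.Nonempty) {f : E3 → E3} {G : E3 → Mat3}
    {H : E3 → E3 →L[ℝ] Mat3} (hf : IsH2 Ω f G H) :
    ∃ (f' : E3 → E3) (u : ℕ → E3 → E3), (∀ n, ContDiff ℝ ∞ (u n)) ∧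
      ContinuousOn f' (closure Ω) ∧ f' =ᵐ[volume.restrict Ω] f ∧
      (∀ z ∈ closure Ω, Tendsto (fun n => u n z) atTop (𝓝 (f' z))) ∧
      Tendsto (fun n => eLpNorm (fun x => u n x - f x) 2 (volume.restrict Ω)) atTop (𝓝 0) ∧
      Tendsto (fun n => eLpNorm (fun x => fderiv ℝ (u n) x - G x) 2 (volume.restrict Ω))
        atTop (𝓝 0) ∧
      Tendsto (fun n => eLpNorm (fun x => fderiv ℝ (fderiv ℝ (u n)) x - H x) 2
        (volume.restrict Ω)) atTop (𝓝 0) := by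
  obtain ⟨u, hu, t0, t1, t2⟩ := hf.exists_smooth_approx hΩo hΩc hΩb hΩn
  have hu2 : ∀ n, ContDiff ℝ 2 (u n) := fun n => (hu n).of_le (by norm_cast)
  have hV0 : volume Ω ≠ 0 := (hΩo.measure_pos volume hΩn).ne'
  have hVt : volume Ω ≠ ⊤ := hΩb.measure_lt_top.ne
  have hVc : volume (closure Ω) = volume Ω := by
    have := congrArg (fun μ => μ Set.univ) (restrict_closure_eq hΩc)
    simpa using this
  set D : ℝ := Metric.diam (closure Ω) with hD
  have hdiam : ∀ x ∈ closure Ω, ∀ y ∈ closure Ω, ‖x - y‖ ≤ D := fun x hx y hy => by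
    rw [← dist_eq_norm]; exact Metric.dist_le_diam_of_mem hΩb.closure hx hy
  set Cst : ℝ≥0∞ := (volume Ω)⁻¹ * volume Ω ^ (1 / 2 : ℝ) with hCst
  have hCt : Cst ≠ ⊤ := ENNReal.mul_ne_top (ENNReal.inv_ne_top.2 hV0)
    (ENNReal.rpow_ne_top_of_nonneg (by norm_num) hVt)
  -- The `H²` distance from `u n` to `f`, scaled so that the difference of `u n` and `u m` is at
  -- most `a n + a m` at every point of the closure.
  set a : ℕ → ℝ≥0∞ := fun n => Cst * (eLpNorm (fun x => u n x - f x) 2 (volume.restrict Ω)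
    + ENNReal.ofReal D * eLpNorm (fun x => fderiv ℝ (u n) x - G x) 2 (volume.restrict Ω)
    + ENNReal.ofReal (2 * D ^ 2) * eLpNorm (fun x => fderiv ℝ (fderiv ℝ (u n)) x - H x) 2
        (volume.restrict Ω)) with ha
  have hat : Tendsto a atTop (𝓝 0) := by
    have s1 := ENNReal.Tendsto.const_mul (a := ENNReal.ofReal D) t1 (Or.inr ENNReal.ofReal_ne_top)
    have s2 := ENNReal.Tendsto.const_mul (a := ENNReal.ofReal (2 * D ^ 2)) t2
      (Or.inr ENNReal.ofReal_ne_top)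
    have := ENNReal.Tendsto.const_mul (a := Cst) ((t0.add s1).add s2) (Or.inr hCt)
    simpa only [mul_zero, add_zero] using this
  have hsup : ∀ n m, ∀ z ∈ closure Ω, ‖u n z - u m z‖ₑ ≤ a n + a m := by
    intro n m z hz
    have hw : ContDiff ℝ 2 (u n - u m) := (hu2 n).sub (hu2 m)
    have h1 := enorm_le_of_smooth hw hΩc.closure isClosed_closure.measurableSet hdiam hz
    rw [restrict_closure_eq hΩc, hVc] at h1
    have d1 : fderiv ℝ (u n - u m) = fderiv ℝ (u n) - fderiv ℝ (u m) := by
      funext x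
      exact fderiv_sub ((hu2 n).differentiable (by norm_num) x)
        ((hu2 m).differentiable (by norm_num) x)
    have d2 : fderiv ℝ (fderiv ℝ (u n - u m))
        = fderiv ℝ (fderiv ℝ (u n)) - fderiv ℝ (fderiv ℝ (u m)) := by
      rw [d1]; funext x
      exact fderiv_sub (((hu2 n).fderiv_right (m := 1) (by norm_num)).differentiable (by norm_num) x)
        (((hu2 m).fderiv_right (m := 1) (by norm_num)).differentiable (by norm_num) x)
    rw [d2, d1] at h1
    have b0 := eLpNorm_sub_le_of_approx (μ := volume.restrict Ω)
      (hu2 n).continuous.aestronglyMeasurable (hu2 m).continuous.aestronglyMeasurable hf.memLp.1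
    have b1 := eLpNorm_sub_le_of_approx (μ := volume.restrict Ω)
      ((hu2 n).continuous_fderiv (by norm_num)).aestronglyMeasurable
      ((hu2 m).continuous_fderiv (by norm_num)).aestronglyMeasurable hf.memLp_grad.1
    have b2 := eLpNorm_sub_le_of_approx (X := E3 →L[ℝ] Mat3) (μ := volume.restrict Ω)
      (continuous_fderiv_fderiv (hu2 n)).aestronglyMeasurable
      (continuous_fderiv_fderiv (hu2 m)).aestronglyMeasurable hf.memLp_hess.1
    calc ‖u n z - u m z‖ₑ = (volume Ω)⁻¹ * (volume Ω * ‖(u n - u m) z‖ₑ) := by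
          rw [← mul_assoc, ENNReal.inv_mul_cancel hV0 hVt, one_mul]; rfl
      _ ≤ _ := by
          refine (mul_le_mul' le_rfl h1).trans ?_
          rw [← mul_assoc, ← hCst]
          simp only [ha]
          rw [← mul_add]
          refine mul_le_mul' le_rfl ?_
          refine (add_le_add (add_le_add b0 (mul_le_mul' le_rfl b1))
            (mul_le_mul' le_rfl b2)).trans (le_of_eq ?_)
          ring
  have hcau : UniformCauchySeqOn u atTop (closure Ω) := by
    rw [Metric.uniformCauchySeqOn_iff]
    intro ε hε
    have h2 : ∀ᶠ n in atTop, a n < ENNReal.ofReal (ε / 2) :=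
      hat.eventually (gt_mem_nhds (by simpa using half_pos hε))
    obtain ⟨N, hN⟩ := eventually_atTop.1 h2
    refine ⟨N, fun n hn m hm z hz => ?_⟩
    have h3 : ‖u n z - u m z‖ₑ < ENNReal.ofReal ε := by
      refine (hsup n m z hz).trans_lt ?_
      rw [← add_halves ε, ENNReal.ofReal_add (by positivity) (by positivity)]
      exact ENNReal.add_lt_add (hN n hn) (hN m hm)
    rw [dist_eq_norm]
    rw [← ofReal_norm, ENNReal.ofReal_lt_ofReal_iff hε] at h3
    exact h3
  have hptc : ∀ z ∈ closure Ω, ∃ l, Tendsto (fun n => u n z) atTop (𝓝 l) := fun z hz =>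
    cauchySeq_tendsto_of_complete (hcau.cauchySeq hz)
  choose! f' hf' using hptc
  have hunif := hcau.tendstoUniformlyOn_of_tendsto hf'
  refine ⟨f', u, hu, hunif.continuousOn (Frequently.of_forall fun n => (hu n).continuous.continuousOn),
    ?_, hf', t0, t1, t2⟩
  -- The uniform limit and the `L²` limit agree almost everywhere, since a subsequence converges
  -- almost everywhere to the latter.
  have hm := tendstoInMeasure_of_tendsto_eLpNorm (p := 2) (by norm_num)
    (fun n => (hu n).continuous.aestronglyMeasurable) hf.memLp.1 t0
  obtain ⟨ns, hns, hae⟩ := hm.exists_seq_tendsto_ae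
  filter_upwards [hae, ae_restrict_mem hΩo.measurableSet] with x hx hxΩ
  exact tendsto_nhds_unique ((hf' x (subset_closure hxΩ)).comp hns.tendsto_atTop) hx

theorem IsH2.congr {Ω : Set E3} (hΩo : IsOpen Ω) {f f' : E3 → E3} {G : E3 → Mat3}
    {H : E3 → E3 →L[ℝ] Mat3} (hf : IsH2 Ω f G H) (h : f' =ᵐ[volume.restrict Ω] f) :
    IsH2 Ω f' G H where
  memLp := hf.memLp.ae_eq h.symm
  memLp_grad := hf.memLp_grad
  memLp_hess := hf.memLp_hess
  weakGrad := fun ψ h1 h2 h3 w => by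
    rw [← hf.weakGrad ψ h1 h2 h3 w]
    refine integral_congr_ae ?_
    filter_upwards [h] with x hx
    rw [hx]
  weakHess := hf.weakHess

/-- If `f ∈ H²` is continuous on the closure, then it is a pointwise limit of smooth functions
converging in `H²`. -/
theorem IsH2.exists_approx_of_continuousOn {Ω : Set E3} (hΩo : IsOpen Ω) (hΩc : Convex ℝ Ω)
    (hΩb : Bornology.IsBounded Ω) (hΩn : Ω.Nonempty) {f : E3 → E3} {G : E3 → Mat3}
    {H : E3 → E3 →L[ℝ] Mat3} (hf : IsH2 Ω f G H) (hfc : ContinuousOn f (closure Ω)) :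
    ∃ u : ℕ → E3 → E3, (∀ n, ContDiff ℝ ∞ (u n)) ∧
      (∀ z ∈ closure Ω, Tendsto (fun n => u n z) atTop (𝓝 (f z))) ∧
      Tendsto (fun n => eLpNorm (fun x => u n x - f x) 2 (volume.restrict Ω)) atTop (𝓝 0) ∧
      Tendsto (fun n => eLpNorm (fun x => fderiv ℝ (u n) x - G x) 2 (volume.restrict Ω))
        atTop (𝓝 0) ∧
      Tendsto (fun n => eLpNorm (fun x => fderiv ℝ (fderiv ℝ (u n)) x - H x) 2
        (volume.restrict Ω)) atTop (𝓝 0) := by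
  obtain ⟨f', u, hu, hc, hae, ht, t0, t1, t2⟩ := hf.exists_continuous_rep hΩo hΩc hΩb hΩn
  have h1 : Set.EqOn f' f Ω := Measure.eqOn_open_of_ae_eq hae hΩo (hc.mono subset_closure)
    (hfc.mono subset_closure)
  have h2 : Set.EqOn f' f (closure Ω) := h1.of_subset_closure hc hfc subset_closure subset_rfl
  exact ⟨u, hu, fun z hz => h2 hz ▸ ht z hz, t0, t1, t2⟩

/-- The averaged Taylor polynomial of `f`, times the volume. -/
noncomputable def taylorAvg (K : Set E3) (f : E3 → E3) (G : E3 → Mat3) (z : E3) : E3 :=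
  ∫ x in K, (f x + G x (z - x))

theorem integrableOn_taylor {K : Set E3} (hKm : MeasurableSet K) (hKb : Bornology.IsBounded K)
    {f : E3 → E3} {G : E3 → Mat3} (hf : IntegrableOn f K) (hG : IntegrableOn G K) (z : E3) :
    IntegrableOn (fun x => f x + G x (z - x)) K := by
  refine hf.add ?_
  obtain ⟨D, hD⟩ := hKb.subset_closedBall z
  refine Integrable.mono' (g := fun x => ‖G x‖ * D) (hG.norm.mul_const D) ?_ ?_
  · exact (ContinuousLinearMap.id ℝ Mat3).aestronglyMeasurable_comp₂ hG.1
      (Continuous.aestronglyMeasurable (by fun_prop))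
  · refine (ae_restrict_iff' hKm).2 (Eventually.of_forall fun x hx => ?_)
    refine (ContinuousLinearMap.le_opNorm _ _).trans ?_
    gcongr
    have := hD hx
    rwa [Metric.mem_closedBall, dist_comm, dist_eq_norm] at this

theorem integrableOn_of_memLp_two {X : Type*} [NormedAddCommGroup X] {Ω K : Set E3}
    (hle : volume.restrict K ≤ volume.restrict Ω)
    (hK : volume K ≠ ⊤) {g : E3 → X} (hg : MemLp g 2 (volume.restrict Ω)) : IntegrableOn g K := by
  have : IsFiniteMeasure (volume.restrict K) := ⟨by simpa using hK.lt_top⟩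
  exact (hg.mono_measure hle).integrable (by norm_num)

/-- Pass to the limit in the averaged estimate for smooth functions. The values at `z` converge
because `f` is continuous on the closure, and the averaged polynomials and Hessian norms converge
because the approximation is in `H²`. -/
theorem IsH2.taylor {Ω : Set E3} (hΩo : IsOpen Ω) (hΩc : Convex ℝ Ω)
    (hΩb : Bornology.IsBounded Ω) (hΩn : Ω.Nonempty) {f : E3 → E3} {G : E3 → Mat3}
    {H : E3 → E3 →L[ℝ] Mat3} (hf : IsH2 Ω f G H) (hfc : ContinuousOn f (closure Ω))
    {K : Set E3} (hK : Convex ℝ K) (hKm : MeasurableSet K) (hKΩ : K ⊆ closure Ω) {h : ℝ}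
    (hh : ∀ x ∈ K, ∀ y ∈ K, ‖x - y‖ ≤ h) {z : E3} (hz : z ∈ K) :
    ‖volume.real K • f z - taylorAvg K f G z‖ₑ ≤ ENNReal.ofReal (2 * h ^ 2) *
      (volume K ^ (1 / 2 : ℝ) * eLpNorm H 2 (volume.restrict K)) := by
  obtain ⟨u, hu, ht, t0, t1, t2⟩ := hf.exists_approx_of_continuousOn hΩo hΩc hΩb hΩn hfc
  have hu2 : ∀ n, ContDiff ℝ 2 (u n) := fun n => (hu n).of_le (by norm_cast)
  have hKb : Bornology.IsBounded K := hΩb.closure.subset hKΩ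
  have hle := restrict_le_of_subset_closure hΩc hKΩ
  have hVt : volume K ≠ ⊤ := hKb.measure_lt_top.ne
  have hh0 : 0 ≤ h := (norm_nonneg _).trans (hh z hz z hz)
  have if0 : IntegrableOn f K := integrableOn_of_memLp_two hle hVt hf.memLp
  have iG : IntegrableOn G K := integrableOn_of_memLp_two hle hVt hf.memLp_grad
  have iu : ∀ n, IntegrableOn (u n) K := fun n =>
    ((hu n).continuous.continuousOn.integrableOn_compact
      (Metric.isCompact_of_isClosed_isBounded isClosed_closure hKb.closure)).mono_set subset_closure
  have iDu : ∀ n, IntegrableOn (fderiv ℝ (u n)) K := fun n =>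
    (((hu2 n).continuous_fderiv (by norm_num)).continuousOn.integrableOn_compact
      (Metric.isCompact_of_isClosed_isBounded isClosed_closure hKb.closure)).mono_set subset_closure
  have s0 : Tendsto (fun n => eLpNorm (fun x => u n x - f x) 2 (volume.restrict K)) atTop (𝓝 0) :=
    tendsto_of_tendsto_of_tendsto_of_le_of_le tendsto_const_nhds t0 (fun n => by simp)
      (fun n => eLpNorm_mono_measure _ hle)
  have s1 : Tendsto (fun n => eLpNorm (fun x => fderiv ℝ (u n) x - G x) 2 (volume.restrict K))
      atTop (𝓝 0) :=
    tendsto_of_tendsto_of_tendsto_of_le_of_le tendsto_const_nhds t1 (fun n => by simp)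
      (fun n => eLpNorm_mono_measure _ hle)
  have s2 : Tendsto (fun n => eLpNorm (fun x => fderiv ℝ (fderiv ℝ (u n)) x - H x) 2
      (volume.restrict K)) atTop (𝓝 0) :=
    tendsto_of_tendsto_of_tendsto_of_le_of_le tendsto_const_nhds t2 (fun n => by simp)
      (fun n => eLpNorm_mono_measure _ hle)
  -- convergence of the averaged Taylor polynomials
  have hT : Tendsto (fun n => taylorAvg K (u n) (fderiv ℝ (u n)) z) atTop
      (𝓝 (taylorAvg K f G z)) := by
    rw [tendsto_iff_edist_tendsto_0]
    have hb : ∀ n, edist (taylorAvg K (u n) (fderiv ℝ (u n)) z) (taylorAvg K f G z) ≤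
        volume K ^ (1 / 2 : ℝ) * eLpNorm (fun x => u n x - f x) 2 (volume.restrict K)
        + ENNReal.ofReal h * (volume K ^ (1 / 2 : ℝ) *
          eLpNorm (fun x => fderiv ℝ (u n) x - G x) 2 (volume.restrict K)) := by
      intro n
      rw [edist_eq_enorm_sub, taylorAvg, taylorAvg,
        ← integral_sub (integrableOn_taylor hKm hKb (iu n) (iDu n) z)
        (integrableOn_taylor hKm hKb if0 iG z)]
      refine (enorm_integral_le_lintegral_enorm _).trans ?_
      calc _ ≤ ∫⁻ x in K, (‖u n x - f x‖ₑ + ENNReal.ofReal h * ‖fderiv ℝ (u n) x - G x‖ₑ) := by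
            refine setLIntegral_mono' hKm fun x hx => ?_
            have e : u n x + fderiv ℝ (u n) x (z - x) - (f x + G x (z - x))
                = (u n x - f x) + (fderiv ℝ (u n) x - G x) (z - x) := by
              rw [sub_apply]; abel
            rw [e]
            refine (enorm_add_le _ _).trans ?_
            gcongr
            refine (ContinuousLinearMap.le_opENorm _ _).trans ?_
            rw [mul_comm]
            gcongr
            rw [← ofReal_norm]
            exact ENNReal.ofReal_le_ofReal (hh z hz x hx)
        _ = (∫⁻ x in K, ‖u n x - f x‖ₑ) + ENNReal.ofReal h *
            ∫⁻ x in K, ‖fderiv ℝ (u n) x - G x‖ₑ := by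
            rw [lintegral_add_left' (f := fun x => ‖u n x - f x‖ₑ) ((iu n).1.sub if0.1).enorm,
              lintegral_const_mul' _ _ ENNReal.ofReal_ne_top]
        _ ≤ _ := by
            gcongr
            · exact lintegral_enorm_le_eLpNorm ((iu n).1.sub if0.1)
            · exact lintegral_enorm_le_eLpNorm ((iDu n).1.sub iG.1)
    have hVr : volume K ^ (1 / 2 : ℝ) ≠ ⊤ := ENNReal.rpow_ne_top_of_nonneg (by norm_num) hVt
    have r0 := ENNReal.Tendsto.const_mul s0 (Or.inr hVr)
    have r1 := ENNReal.Tendsto.const_mul (ENNReal.Tendsto.const_mul s1 (Or.inr hVr))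
      (Or.inr (ENNReal.ofReal_ne_top (r := h)))
    refine tendsto_of_tendsto_of_tendsto_of_le_of_le tendsto_const_nhds ?_
      (fun n => by simp) hb
    simpa using r0.add r1
  have hL : Tendsto (fun n => ‖volume.real K • u n z - taylorAvg K (u n) (fderiv ℝ (u n)) z‖ₑ)
      atTop (𝓝 ‖volume.real K • f z - taylorAvg K f G z‖ₑ) :=
    (continuous_enorm.tendsto _).comp (((ht z (hKΩ hz)).const_smul _).sub hT)
  have hR : Tendsto (fun n => ENNReal.ofReal (2 * h ^ 2) * (volume K ^ (1 / 2 : ℝ) *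
      (eLpNorm H 2 (volume.restrict K) + eLpNorm (fun x => fderiv ℝ (fderiv ℝ (u n)) x - H x) 2
        (volume.restrict K)))) atTop (𝓝 (ENNReal.ofReal (2 * h ^ 2) *
      (volume K ^ (1 / 2 : ℝ) * eLpNorm H 2 (volume.restrict K)))) := by
    have hVr : volume K ^ (1 / 2 : ℝ) ≠ ⊤ := ENNReal.rpow_ne_top_of_nonneg (by norm_num) hVt
    have r := s2.const_add (eLpNorm H 2 (volume.restrict K))
    rw [add_zero] at r
    exact ENNReal.Tendsto.const_mul (ENNReal.Tendsto.const_mul r (Or.inr hVr))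
      (Or.inr ENNReal.ofReal_ne_top)
  refine le_of_tendsto_of_tendsto' hL hR fun n => ?_
  have e1 : volume.real K • u n z - taylorAvg K (u n) (fderiv ℝ (u n)) z
      = ∫ x in K, (u n z - (u n x + fderiv ℝ (u n) x (z - x))) := by
    have : IsFiniteMeasure (volume.restrict K) := ⟨by simpa using hVt.lt_top⟩
    rw [integral_sub (integrable_const _) (integrableOn_taylor hKm hKb (iu n) (iDu n) z),
      setIntegral_const]
    rfl
  rw [e1]
  refine (enorm_integral_le_lintegral_enorm _).trans
    ((taylor_average' (hu2 n) hK hKm hh hz).trans ?_)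
  refine mul_le_mul' le_rfl (mul_le_mul' le_rfl ?_)
  have mH : AEStronglyMeasurable H (volume.restrict K) := hf.memLp_hess.1.mono_measure hle
  have mU : AEStronglyMeasurable (fderiv ℝ (fderiv ℝ (u n))) (volume.restrict K) :=
    (continuous_fderiv_fderiv (hu2 n)).aestronglyMeasurable
  exact eLpNorm_le_add_sub (X := E3 →L[ℝ] Mat3) mU mH

/-- The gradient of an `H²` function belongs to `L⁴`. -/
theorem IsH2.lintegral_grad_pow_four_le {Ω : Set E3} (hΩo : IsOpen Ω) (hΩc : Convex ℝ Ω)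
    (hΩb : Bornology.IsBounded Ω) (hΩn : Ω.Nonempty) {f : E3 → E3} {G : E3 → Mat3}
    {H : E3 → E3 →L[ℝ] Mat3} (hf : IsH2 Ω f G H) :
    volume Ω ^ 4 * ∫⁻ x in Ω, ‖G x‖ₑ ^ 4 ≤ 2 ^ 17 * volume Ω ^ 3 *
      ((∫⁻ x in Ω, ‖G x‖ₑ ^ 2) ^ 2
        + ENNReal.ofReal (Metric.diam Ω) ^ 4 * (∫⁻ x in Ω, ‖H x‖ₑ ^ 2) ^ 2) := by
  obtain ⟨u, hu, t0, t1, t2⟩ := hf.exists_smooth_approx hΩo hΩc hΩb hΩn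
  have hu2 : ∀ n, ContDiff ℝ 2 (u n) := fun n => (hu n).of_le (by norm_cast)
  have hVt : volume Ω ≠ ⊤ := hΩb.measure_lt_top.ne
  have mD : ∀ n, AEStronglyMeasurable (fderiv ℝ (u n)) (volume.restrict Ω) := fun n =>
    ((hu2 n).continuous_fderiv (by norm_num)).aestronglyMeasurable
  have mD2 : ∀ n, AEStronglyMeasurable (fderiv ℝ (fderiv ℝ (u n))) (volume.restrict Ω) := fun n =>
    (continuous_fderiv_fderiv (hu2 n)).aestronglyMeasurable
  have hm := tendstoInMeasure_of_tendsto_eLpNorm (p := 2) (by norm_num) mD hf.memLp_grad.1 t1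
  obtain ⟨ns, hns, hae⟩ := hm.exists_seq_tendsto_ae
  -- The approximation converges only in `L²`, so the fourth powers are handled by Fatou's lemma
  -- along a subsequence that converges almost everywhere.
  have hfatou : ∫⁻ x in Ω, ‖G x‖ₑ ^ 4 ≤
      liminf (fun n => ∫⁻ x in Ω, ‖fderiv ℝ (u (ns n)) x‖ₑ ^ 4) atTop := by
    refine le_trans (lintegral_mono_ae ?_) (lintegral_liminf_le' fun n =>
      ((mD (ns n)).enorm.pow_const 4))
    filter_upwards [hae] with x hx
    have h1 : Tendsto (fun n => ‖fderiv ℝ (u (ns n)) x‖ₑ ^ 4) atTop (𝓝 (‖G x‖ₑ ^ 4)) :=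
      ((ENNReal.continuous_pow 4).tendsto _).comp ((continuous_enorm.tendsto _).comp hx)
    exact h1.liminf_eq.ge
  set A : ℕ → ℝ≥0∞ := fun n => (eLpNorm G 2 (volume.restrict Ω)
    + eLpNorm (fun x => fderiv ℝ (u n) x - G x) 2 (volume.restrict Ω)) ^ 2 with hA
  set B : ℕ → ℝ≥0∞ := fun n => (eLpNorm H 2 (volume.restrict Ω)
    + eLpNorm (fun x => fderiv ℝ (fderiv ℝ (u n)) x - H x) 2 (volume.restrict Ω)) ^ 2 with hB
  have hAt : Tendsto A atTop (𝓝 (∫⁻ x in Ω, ‖G x‖ₑ ^ 2)) := by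
    rw [← sq_eLpNorm_two]
    have := ENNReal.Tendsto.pow (n := 2) (t1.const_add (eLpNorm G 2 (volume.restrict Ω)))
    simpa using this
  have hBt : Tendsto B atTop (𝓝 (∫⁻ x in Ω, ‖H x‖ₑ ^ 2)) := by
    have e : ∫⁻ x in Ω, ‖H x‖ₑ ^ 2 = eLpNorm H 2 (volume.restrict Ω) ^ 2 :=
      (sq_eLpNorm_two (F := E3 →L[ℝ] Mat3) _ _).symm
    rw [e]
    have := ENNReal.Tendsto.pow (n := 2) (t2.const_add (eLpNorm H 2 (volume.restrict Ω)))
    simpa using this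
  have hdiam : ∀ x ∈ Ω, ∀ y ∈ Ω, ‖x - y‖ ≤ Metric.diam Ω := fun x hx y hy => by
    rw [← dist_eq_norm]; exact Metric.dist_le_diam_of_mem hΩb hx hy
  have hstep : ∀ n, volume Ω ^ 4 * ∫⁻ x in Ω, ‖fderiv ℝ (u n) x‖ₑ ^ 4 ≤ 2 ^ 17 * volume Ω ^ 3 *
      (A n ^ 2 + ENNReal.ofReal (Metric.diam Ω) ^ 4 * B n ^ 2) := by
    intro n
    refine (lintegral_pow_four_le ((hu2 n).fderiv_right (m := 1) (by norm_num)) hΩc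
      hΩo.measurableSet hdiam).trans ?_
    have i1 : ∫⁻ x in Ω, ‖fderiv ℝ (u n) x‖ₑ ^ 2 ≤ A n := by
      rw [← sq_eLpNorm_two]
      exact pow_le_pow_left' (eLpNorm_le_add_sub (mD n) hf.memLp_grad.1) 2
    have i2 : ∫⁻ x in Ω, ‖fderiv ℝ (fderiv ℝ (u n)) x‖ₑ ^ 2 ≤ B n :=
      (sq_eLpNorm_two (F := E3 →L[ℝ] Mat3) _ _).symm.le.trans
        (pow_le_pow_left' (eLpNorm_le_add_sub (X := E3 →L[ℝ] Mat3) (mD2 n) hf.memLp_hess.1) 2)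
    refine mul_le_mul' le_rfl (add_le_add (pow_le_pow_left' i1 2)
      (mul_le_mul' le_rfl (pow_le_pow_left' i2 2)))
  have hRt : Tendsto (fun n => 2 ^ 17 * volume Ω ^ 3 *
      (A n ^ 2 + ENNReal.ofReal (Metric.diam Ω) ^ 4 * B n ^ 2)) atTop
      (𝓝 (2 ^ 17 * volume Ω ^ 3 *
      ((∫⁻ x in Ω, ‖G x‖ₑ ^ 2) ^ 2
        + ENNReal.ofReal (Metric.diam Ω) ^ 4 * (∫⁻ x in Ω, ‖H x‖ₑ ^ 2) ^ 2))) := by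
    have k1 : (2 : ℝ≥0∞) ^ 17 * volume Ω ^ 3 ≠ ⊤ :=
      ENNReal.mul_ne_top (by norm_num) (ENNReal.pow_ne_top hVt)
    have k2 : ENNReal.ofReal (Metric.diam Ω) ^ 4 ≠ ⊤ := by simp
    exact ENNReal.Tendsto.const_mul ((ENNReal.Tendsto.pow (n := 2) hAt).add
      (ENNReal.Tendsto.const_mul (ENNReal.Tendsto.pow (n := 2) hBt) (Or.inr k2))) (Or.inr k1)
  calc _ ≤ volume Ω ^ 4 * liminf (fun n => ∫⁻ x in Ω, ‖fderiv ℝ (u (ns n)) x‖ₑ ^ 4) atTop := by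
        gcongr
    _ ≤ liminf (fun n => volume Ω ^ 4 * ∫⁻ x in Ω, ‖fderiv ℝ (u (ns n)) x‖ₑ ^ 4) atTop := by
        rw [ENNReal.liminf_const_mul_of_ne_top]
        exact ENNReal.pow_ne_top hVt
    _ ≤ liminf (fun n => 2 ^ 17 * volume Ω ^ 3 *
      (A (ns n) ^ 2 + ENNReal.ofReal (Metric.diam Ω) ^ 4 * B (ns n) ^ 2)) atTop :=
        liminf_le_liminf (Eventually.of_forall fun n => hstep (ns n))
    _ = _ := (hRt.comp hns.tendsto_atTop).liminf_eq

end H2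

end EricksenLeslie

namespace EricksenLeslie
open Filter Topology

/-! ### Operator norms of gradients and Hessians against the Frobenius-type `H²` norm -/

section Norms

theorem sum_smul_e (x : E3) : ∑ i, x i • e i = x := by
  ext j
  simp [e, Fin.sum_univ_three, PiLp.single_apply]
  fin_cases j <;> simp

theorem norm_sq_eq_sum (x : E3) : ‖x‖ ^ 2 = ∑ i, x i ^ 2 := by
  rw [EuclideanSpace.norm_sq_eq]; simp

theorem norm_e (i : Fin 3) : ‖e i‖ = 1 := by simp [e]

theorem opNorm_sq_le_sum {X : Type*} [NormedAddCommGroup X] [NormedSpace ℝ X] (A : E3 →L[ℝ] X) :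
    ‖A‖ ^ 2 ≤ ∑ i, ‖A (e i)‖ ^ 2 := by
  have h0 : (0 : ℝ) ≤ ∑ i, ‖A (e i)‖ ^ 2 := by positivity
  have h : ‖A‖ ≤ √(∑ i, ‖A (e i)‖ ^ 2) := by
    refine A.opNorm_le_bound (Real.sqrt_nonneg _) fun x => ?_
    calc ‖A x‖ = ‖∑ i, x i • A (e i)‖ := by
          conv_lhs => rw [← sum_smul_e x]
          simp
      _ ≤ ∑ i, |x i| * ‖A (e i)‖ := by
          refine (norm_sum_le _ _).trans (le_of_eq ?_)
          simp [norm_smul]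
      _ ≤ √(∑ i, |x i| ^ 2) * √(∑ i, ‖A (e i)‖ ^ 2) :=
          Real.sum_mul_le_sqrt_mul_sqrt _ _ _
      _ = √(∑ i, ‖A (e i)‖ ^ 2) * ‖x‖ := by
          rw [mul_comm]
          congr 1
          rw [← Real.sqrt_sq (norm_nonneg x), norm_sq_eq_sum]
          simp
  calc ‖A‖ ^ 2 ≤ (√(∑ i, ‖A (e i)‖ ^ 2)) ^ 2 := by gcongr
    _ = _ := Real.sq_sqrt h0

theorem frob_self (A : Mat3) : frob A A = ∑ i, ‖A (e i)‖ ^ 2 := by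
  simp [frob, real_inner_self_eq_norm_sq]

theorem opNorm_sq_le_frob (A : Mat3) : ‖A‖ ^ 2 ≤ frob A A := by
  rw [frob_self]; exact opNorm_sq_le_sum A

theorem norm_apply_e_le {X : Type*} [NormedAddCommGroup X] [NormedSpace ℝ X] (A : E3 →L[ℝ] X)
    (i : Fin 3) : ‖A (e i)‖ ≤ ‖A‖ := by
  simpa [norm_e] using A.le_opNorm (e i)

theorem frob_self_le (A : Mat3) : frob A A ≤ 3 * ‖A‖ ^ 2 := by
  rw [frob_self]
  calc ∑ i, ‖A (e i)‖ ^ 2 ≤ ∑ _i : Fin 3, ‖A‖ ^ 2 := by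
        gcongr with i; exact norm_apply_e_le A i
    _ = _ := by simp

theorem frob_self_nonneg (A : Mat3) : 0 ≤ frob A A := by rw [frob_self]; positivity

variable {Ω : Set E3} {f : E3 → E3} {G : E3 → Mat3} {H : E3 → E3 →L[ℝ] Mat3}

theorem memLp_apply_e {X : Type*} [NormedAddCommGroup X] [NormedSpace ℝ X] {μ : Measure E3}
    {p : ℝ≥0∞} {A : E3 → E3 →L[ℝ] X} (hA : MemLp A p μ) (i : Fin 3) :
    MemLp (fun x => A x (e i)) p μ := by
  refine MemLp.of_le hA ?_ (Eventually.of_forall fun x => norm_apply_e_le (A x) i)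
  exact ((ContinuousLinearMap.apply ℝ X (e i)).continuous).comp_aestronglyMeasurable hA.1

theorem IsH2.integrable_sq (hf : IsH2 Ω f G H) : IntegrableOn (fun x => ‖f x‖ ^ 2) Ω :=
  hf.memLp.integrable_norm_pow (p := 2) (by norm_num)

theorem IsH2.integrable_grad_sq (hf : IsH2 Ω f G H) :
    IntegrableOn (fun x => ∑ i, ‖G x (e i)‖ ^ 2) Ω :=
  integrable_finsetSum _ fun i _ =>
    (memLp_apply_e hf.memLp_grad i).integrable_norm_pow (p := 2) (by norm_num)

theorem IsH2.integrable_hess_sq (hf : IsH2 Ω f G H) :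
    IntegrableOn (fun x => ∑ i, ∑ l, ‖H x (e i) (e l)‖ ^ 2) Ω :=
  integrable_finsetSum _ fun i _ => integrable_finsetSum _ fun l _ =>
    (memLp_apply_e (memLp_apply_e (X := Mat3) hf.memLp_hess i) l).integrable_norm_pow (p := 2)
      (by norm_num)

theorem IsH2.h2NormSq_eq (hf : IsH2 Ω f G H) : h2NormSq Ω f G H
    = (∫ x in Ω, ‖f x‖ ^ 2) + (∫ x in Ω, ∑ i, ‖G x (e i)‖ ^ 2)
      + ∫ x in Ω, ∑ i, ∑ l, ‖H x (e i) (e l)‖ ^ 2 := by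
  have h : Integrable (fun x => ‖f x‖ ^ 2 + ∑ i, ‖G x (e i)‖ ^ 2) (volume.restrict Ω) :=
    hf.integrable_sq.add hf.integrable_grad_sq
  rw [h2NormSq, integral_add h hf.integrable_hess_sq, integral_add hf.integrable_sq hf.integrable_grad_sq]

theorem IsH2.h2NormSq_nonneg : 0 ≤ h2NormSq Ω f G H :=
  integral_nonneg fun x => by positivity

theorem IsH2.integral_sq_le (hf : IsH2 Ω f G H) : ∫ x in Ω, ‖f x‖ ^ 2 ≤ h2NormSq Ω f G H := by
  rw [hf.h2NormSq_eq]
  have h1 : 0 ≤ ∫ x in Ω, ∑ i, ‖G x (e i)‖ ^ 2 := integral_nonneg fun x => by positivity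
  have h2 : 0 ≤ ∫ x in Ω, ∑ i, ∑ l, ‖H x (e i) (e l)‖ ^ 2 :=
    integral_nonneg fun x => by positivity
  linarith

theorem IsH2.integrable_grad_norm_sq (hf : IsH2 Ω f G H) : IntegrableOn (fun x => ‖G x‖ ^ 2) Ω :=
  hf.memLp_grad.integrable_norm_pow (p := 2) (by norm_num)

theorem integrable_norm_sq_of_memLp {X : Type*} [NormedAddCommGroup X] {μ : Measure E3}
    {g : E3 → X} (hg : MemLp g 2 μ) : Integrable (fun x => ‖g x‖ ^ 2) μ :=
  hg.integrable_norm_pow (p := 2) (by norm_num)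

theorem memLp_of_measure_le {X : Type*} [NormedAddCommGroup X] {μ ν : Measure E3}
    {g : E3 → X} (hg : MemLp g 2 μ) (h : ν ≤ μ) : MemLp g 2 ν := hg.mono_measure h

theorem IsH2.integrable_hess_norm_sq (hf : IsH2 Ω f G H) : IntegrableOn (fun x => ‖H x‖ ^ 2) Ω :=
  integrable_norm_sq_of_memLp (X := E3 →L[ℝ] Mat3) hf.memLp_hess

theorem IsH2.integral_grad_sq_le (hf : IsH2 Ω f G H) :
    ∫ x in Ω, ‖G x‖ ^ 2 ≤ h2NormSq Ω f G H := by
  have h0 : ∫ x in Ω, ‖G x‖ ^ 2 ≤ ∫ x in Ω, ∑ i, ‖G x (e i)‖ ^ 2 :=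
    integral_mono hf.integrable_grad_norm_sq hf.integrable_grad_sq fun x => opNorm_sq_le_sum _
  rw [hf.h2NormSq_eq]
  have h1 : 0 ≤ ∫ x in Ω, ‖f x‖ ^ 2 := integral_nonneg fun x => by positivity
  have h2 : 0 ≤ ∫ x in Ω, ∑ i, ∑ l, ‖H x (e i) (e l)‖ ^ 2 :=
    integral_nonneg fun x => by positivity
  linarith

theorem opNorm_hess_sq_le (A : E3 →L[ℝ] Mat3) : ‖A‖ ^ 2 ≤ ∑ i, ∑ l, ‖A (e i) (e l)‖ ^ 2 := by
  refine (opNorm_sq_le_sum A).trans ?_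
  gcongr with i
  exact opNorm_sq_le_sum _

theorem IsH2.integral_hess_sq_le (hf : IsH2 Ω f G H) :
    ∫ x in Ω, ‖H x‖ ^ 2 ≤ h2NormSq Ω f G H := by
  have h0 : ∫ x in Ω, ‖H x‖ ^ 2 ≤ ∫ x in Ω, ∑ i, ∑ l, ‖H x (e i) (e l)‖ ^ 2 :=
    integral_mono hf.integrable_hess_norm_sq hf.integrable_hess_sq fun x => opNorm_hess_sq_le _
  rw [hf.h2NormSq_eq]
  have h1 : 0 ≤ ∫ x in Ω, ‖f x‖ ^ 2 := integral_nonneg fun x => by positivity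
  have h2 : 0 ≤ ∫ x in Ω, ∑ i, ‖G x (e i)‖ ^ 2 := integral_nonneg fun x => by positivity
  linarith

/-- Cauchy–Schwarz against the constant function one. -/
theorem integral_norm_le_sqrt {X : Type*} [NormedAddCommGroup X] {K : Set E3} {g : E3 → X}
    (hKt : volume K ≠ ⊤) (hg : MemLp g 2 (volume.restrict K)) :
    ∫ x in K, ‖g x‖ ≤ √(volume.real K) * √(∫ x in K, ‖g x‖ ^ 2) := by
  have : IsFiniteMeasure (volume.restrict K) := ⟨by simpa using hKt.lt_top⟩
  have h := integral_mul_le_Lp_mul_Lq_of_nonneg (μ := volume.restrict K)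
    Real.HolderConjugate.two_two (f := fun _ => (1 : ℝ)) (g := fun x => ‖g x‖)
    (Eventually.of_forall fun _ => zero_le_one) (Eventually.of_forall fun x => norm_nonneg _)
    (memLp_const _) (by simpa using hg.norm)
  simpa [Real.sqrt_eq_rpow, measureReal_def] using h

theorem eLpNorm_two_eq_ofReal {X : Type*} [NormedAddCommGroup X] {μ : Measure E3} {g : E3 → X}
    (hg : MemLp g 2 μ) : eLpNorm g 2 μ = ENNReal.ofReal (√(∫ x, ‖g x‖ ^ 2 ∂μ)) := by
  rw [hg.eLpNorm_eq_integral_rpow_norm (by norm_num) (by norm_num), Real.sqrt_eq_rpow]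
  simp

end Norms

/-! ### Affine interpolation errors and embeddings of `H²` -/

section Consequences

variable {Ω : Set E3} {f : E3 → E3} {G : E3 → Mat3} {H : E3 → E3 →L[ℝ] Mat3}

theorem IsH2.taylor_real (hΩo : IsOpen Ω) (hΩc : Convex ℝ Ω)
    (hΩb : Bornology.IsBounded Ω) (hΩn : Ω.Nonempty) (hf : IsH2 Ω f G H)
    (hfc : ContinuousOn f (closure Ω))
    {K : Set E3} (hK : Convex ℝ K) (hKm : MeasurableSet K) (hKΩ : K ⊆ closure Ω) {h : ℝ}
    (hh : ∀ x ∈ K, ∀ y ∈ K, ‖x - y‖ ≤ h) {z : E3} (hz : z ∈ K) :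
    ‖volume.real K • f z - taylorAvg K f G z‖ ≤
      2 * h ^ 2 * (√(volume.real K) * √(∫ x in K, ‖H x‖ ^ 2)) := by
  have h1 := hf.taylor hΩo hΩc hΩb hΩn hfc hK hKm hKΩ hh hz
  have hVt : volume K ≠ ⊤ := (hΩb.closure.subset hKΩ).measure_lt_top.ne
  have e1 : eLpNorm H 2 (volume.restrict K) = ENNReal.ofReal (√(∫ x in K, ‖H x‖ ^ 2)) :=
    eLpNorm_two_eq_ofReal (X := E3 →L[ℝ] Mat3) (memLp_of_measure_le (X := E3 →L[ℝ] Mat3)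
      hf.memLp_hess (restrict_le_of_subset_closure hΩc hKΩ))
  have e2 : volume K ^ (1 / 2 : ℝ) = ENNReal.ofReal (√(volume.real K)) := by
    rw [Real.sqrt_eq_rpow, ← ENNReal.ofReal_rpow_of_nonneg (by positivity) (by norm_num),
      ofReal_measureReal hVt]
  rw [e1, e2, ← ENNReal.ofReal_mul (by positivity), ← ENNReal.ofReal_mul (by positivity),
    ← ofReal_norm] at h1
  exact (ENNReal.ofReal_le_ofReal_iff (by positivity)).1 h1

/-- The averaged Taylor polynomial is affine in its argument, hence reproduced exactly by affine
interpolation. -/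
theorem taylorAvg_sum {K : Set E3} (hKm : MeasurableSet K) (hKb : Bornology.IsBounded K)
    (hf : IntegrableOn f K) (hG : IntegrableOn G K) {ι : Type*} (s : Finset ι) (l : ι → ℝ)
    (z : ι → E3) (hl : ∑ i ∈ s, l i = 1) :
    taylorAvg K f G (∑ i ∈ s, l i • z i) = ∑ i ∈ s, l i • taylorAvg K f G (z i) := by
  unfold taylorAvg
  simp_rw [← integral_smul]
  rw [← integral_finsetSum (f := fun i x => l i • (f x + G x (z i - x))) _ fun i _ =>
    (integrableOn_taylor hKm hKb hf hG (z i)).smul (l i)]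
  congr with x
  simp_rw [smul_add, Finset.sum_add_distrib, ← Finset.sum_smul, hl, one_smul, ← map_smul,
    ← map_sum, smul_sub, Finset.sum_sub_distrib, ← Finset.sum_smul, hl, one_smul]

theorem taylorAvg_sub {K : Set E3} (hKm : MeasurableSet K) (hKb : Bornology.IsBounded K)
    (hf : IntegrableOn f K) (hG : IntegrableOn G K) (z z' : E3) :
    taylorAvg K f G z - taylorAvg K f G z' = ∫ x in K, G x (z - z') := by
  unfold taylorAvg
  rw [← integral_sub (integrableOn_taylor hKm hKb hf hG z) (integrableOn_taylor hKm hKb hf hG z')]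
  congr with x
  simp only [map_sub]
  abel_nf

/-- Pointwise error of affine interpolation on a convex set. -/
theorem IsH2.interp_error (hΩo : IsOpen Ω) (hΩc : Convex ℝ Ω)
    (hΩb : Bornology.IsBounded Ω) (hΩn : Ω.Nonempty) (hf : IsH2 Ω f G H)
    (hfc : ContinuousOn f (closure Ω))
    {K : Set E3} (hK : Convex ℝ K) (hKm : MeasurableSet K) (hKΩ : K ⊆ closure Ω) {h : ℝ}
    (hh : ∀ x ∈ K, ∀ y ∈ K, ‖x - y‖ ≤ h) {ι : Type*} (s : Finset ι) (l : ι → ℝ)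
    (z : ι → E3) (hl : ∑ i ∈ s, l i = 1) (hl0 : ∀ i ∈ s, 0 ≤ l i) (hz : ∀ i ∈ s, z i ∈ K) :
    volume.real K * ‖f (∑ i ∈ s, l i • z i) - ∑ i ∈ s, l i • f (z i)‖ ≤
      4 * h ^ 2 * (√(volume.real K) * √(∫ x in K, ‖H x‖ ^ 2)) := by
  have hKb : Bornology.IsBounded K := hΩb.closure.subset hKΩ
  have hVt : volume K ≠ ⊤ := hKb.measure_lt_top.ne
  have hle := restrict_le_of_subset_closure hΩc hKΩ
  have if0 : IntegrableOn f K := integrableOn_of_memLp_two hle hVt hf.memLp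
  have iG : IntegrableOn G K := integrableOn_of_memLp_two hle hVt hf.memLp_grad
  have hx : ∑ i ∈ s, l i • z i ∈ K := hK.sum_mem hl0 hl hz
  have hT := fun y hy => hf.taylor_real hΩo hΩc hΩb hΩn hfc hK hKm hKΩ hh (z := y) hy
  set V := volume.real K
  set A := √V * √(∫ x in K, ‖H x‖ ^ 2)
  -- The polynomial part cancels, so the interpolation error is the Taylor error at the point minus
  -- the weighted Taylor errors at the vertices: `2 + 2` times `h ^ 2`.
  have key : V • (f (∑ i ∈ s, l i • z i) - ∑ i ∈ s, l i • f (z i))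
      = (V • f (∑ i ∈ s, l i • z i) - taylorAvg K f G (∑ i ∈ s, l i • z i))
        - ∑ i ∈ s, l i • (V • f (z i) - taylorAvg K f G (z i)) := by
    rw [taylorAvg_sum hKm hKb if0 iG s l z hl]
    simp_rw [smul_sub, Finset.sum_sub_distrib, Finset.smul_sum, smul_comm V]
    abel
  have hV0 : 0 ≤ V := measureReal_nonneg
  calc V * ‖f (∑ i ∈ s, l i • z i) - ∑ i ∈ s, l i • f (z i)‖
      = ‖V • (f (∑ i ∈ s, l i • z i) - ∑ i ∈ s, l i • f (z i))‖ := by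
        rw [norm_smul, Real.norm_of_nonneg hV0]
    _ ≤ ‖V • f (∑ i ∈ s, l i • z i) - taylorAvg K f G (∑ i ∈ s, l i • z i)‖
        + ∑ i ∈ s, ‖l i • (V • f (z i) - taylorAvg K f G (z i))‖ := by
        rw [key]
        exact (_root_.norm_sub_le _ _).trans (add_le_add le_rfl (norm_sum_le _ _))
    _ ≤ 2 * h ^ 2 * A + ∑ i ∈ s, l i * (2 * h ^ 2 * A) := by
        refine add_le_add (hT _ hx) (Finset.sum_le_sum fun i hi => ?_)
        rw [norm_smul, Real.norm_of_nonneg (hl0 i hi)]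
        exact mul_le_mul_of_nonneg_left (hT _ (hz i hi)) (hl0 i hi)
    _ = _ := by rw [← Finset.sum_mul, hl]; ring

/-- Two values differ by the difference of the averaged polynomials, which is the averaged gradient
applied to `z - z'`, and by two Taylor errors. On a tetrahedron this bounds the gradient of the
interpolant. -/
theorem IsH2.norm_sub_le (hΩo : IsOpen Ω) (hΩc : Convex ℝ Ω)
    (hΩb : Bornology.IsBounded Ω) (hΩn : Ω.Nonempty) (hf : IsH2 Ω f G H)
    (hfc : ContinuousOn f (closure Ω))
    {K : Set E3} (hK : Convex ℝ K) (hKm : MeasurableSet K) (hKΩ : K ⊆ closure Ω) {h : ℝ}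
    (hh : ∀ x ∈ K, ∀ y ∈ K, ‖x - y‖ ≤ h) {z z' : E3} (hz : z ∈ K) (hz' : z' ∈ K) :
    volume.real K * ‖f z - f z'‖ ≤
      h * (∫ x in K, ‖G x‖) + 4 * h ^ 2 * (√(volume.real K) * √(∫ x in K, ‖H x‖ ^ 2)) := by
  have hKb : Bornology.IsBounded K := hΩb.closure.subset hKΩ
  have hVt : volume K ≠ ⊤ := hKb.measure_lt_top.ne
  have hle := restrict_le_of_subset_closure hΩc hKΩ
  have if0 : IntegrableOn f K := integrableOn_of_memLp_two hle hVt hf.memLp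
  have iG : IntegrableOn G K := integrableOn_of_memLp_two hle hVt hf.memLp_grad
  have hT := fun y hy => hf.taylor_real hΩo hΩc hΩb hΩn hfc hK hKm hKΩ hh (z := y) hy
  set V := volume.real K
  set A := √V * √(∫ x in K, ‖H x‖ ^ 2)
  have hV0 : 0 ≤ V := measureReal_nonneg
  have key : V • (f z - f z') = (V • f z - taylorAvg K f G z) - (V • f z' - taylorAvg K f G z')
      + ∫ x in K, G x (z - z') := by
    rw [← taylorAvg_sub hKm hKb if0 iG]; module
  have hI : ‖∫ x in K, G x (z - z')‖ ≤ h * ∫ x in K, ‖G x‖ := by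
    rw [← integral_const_mul]
    refine norm_integral_le_of_norm_le (iG.norm.const_mul h) (Eventually.of_forall fun x => ?_)
    refine ((G x).le_opNorm _).trans ?_
    rw [mul_comm]
    exact mul_le_mul_of_nonneg_right (hh z hz z' hz') (norm_nonneg _)
  calc V * ‖f z - f z'‖ = ‖V • (f z - f z')‖ := by rw [norm_smul, Real.norm_of_nonneg hV0]
    _ ≤ ‖V • f z - taylorAvg K f G z‖ + ‖V • f z' - taylorAvg K f G z'‖
        + ‖∫ x in K, G x (z - z')‖ := by
        rw [key]; exact (norm_add_le _ _).trans (add_le_add (_root_.norm_sub_le _ _) le_rfl)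
    _ ≤ 2 * h ^ 2 * A + 2 * h ^ 2 * A + h * ∫ x in K, ‖G x‖ :=
        add_le_add (add_le_add (hT _ hz) (hT _ hz')) hI
    _ = _ := by ring

theorem norm_sub_le_diam (hΩb : Bornology.IsBounded Ω) :
    ∀ x ∈ closure Ω, ∀ y ∈ closure Ω, ‖x - y‖ ≤ Metric.diam Ω := fun x hx y hy => by
  rw [← dist_eq_norm, ← Metric.diam_closure]
  exact Metric.dist_le_diam_of_mem hΩb.closure hx hy

/-- The embedding of `H²` in the continuous functions. -/
theorem exists_sup_bound (hΩo : IsOpen Ω) (hΩc : Convex ℝ Ω)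
    (hΩb : Bornology.IsBounded Ω) (hΩn : Ω.Nonempty) :
    ∃ C : ℝ, 0 ≤ C ∧ ∀ f G H, IsH2 Ω f G H → ContinuousOn f (closure Ω) →
      ∀ z ∈ closure Ω, ‖f z‖ ≤ C * √(h2NormSq Ω f G H) := by
  set D := Metric.diam Ω with hD
  set V := volume.real Ω with hV
  have hVt : volume Ω ≠ ⊤ := hΩb.measure_lt_top.ne
  have hV0 : 0 < V := ENNReal.toReal_pos (hΩo.measure_pos volume hΩn).ne' hVt
  have hD0 : 0 ≤ D := Metric.diam_nonneg
  -- The Taylor estimate on the whole closure: `1` and `D` come from the averaged polynomial, `2 * D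
  -- ^ 2` from the remainder.
  refine ⟨V⁻¹ * (√V * (1 + D + 2 * D ^ 2)), by positivity, fun f G H hf hfc z hz => ?_⟩
  have hcl : volume.restrict (closure Ω) = volume.restrict Ω := restrict_closure_eq hΩc
  have hVc : volume.real (closure Ω) = V := by
    rw [hV, measureReal_def, measureReal_def]
    have := congrArg (fun μ => μ Set.univ) hcl
    simp at this
    rw [this]
  have h1 := hf.taylor_real hΩo hΩc hΩb hΩn hfc hΩc.closure isClosed_closure.measurableSet
    subset_rfl (norm_sub_le_diam hΩb) hz
  rw [hVc, hcl] at h1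
  set N := √(h2NormSq Ω f G H)
  have b0 : √(∫ x in Ω, ‖f x‖ ^ 2) ≤ N := Real.sqrt_le_sqrt hf.integral_sq_le
  have b1 : √(∫ x in Ω, ‖G x‖ ^ 2) ≤ N := Real.sqrt_le_sqrt hf.integral_grad_sq_le
  have b2 : √(∫ x in Ω, ‖H x‖ ^ 2) ≤ N := Real.sqrt_le_sqrt hf.integral_hess_sq_le
  have if0 : IntegrableOn f Ω := integrableOn_of_memLp_two le_rfl hVt hf.memLp
  have iG : IntegrableOn G Ω := integrableOn_of_memLp_two le_rfl hVt hf.memLp_grad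
  have h2 : ‖taylorAvg (closure Ω) f G z‖ ≤ √V * N + D * (√V * N) := by
    unfold taylorAvg
    rw [hcl]
    calc _ ≤ ∫ x in Ω, (‖f x‖ + D * ‖G x‖) := by
          refine norm_integral_le_of_norm_le (if0.norm.add (iG.norm.const_mul D)) ?_
          refine (ae_restrict_iff' hΩo.measurableSet).2 (Eventually.of_forall fun x hx => ?_)
          refine (norm_add_le _ _).trans (add_le_add le_rfl (((G x).le_opNorm _).trans ?_))
          rw [mul_comm]
          exact mul_le_mul_of_nonneg_right (norm_sub_le_diam hΩb z hz x (subset_closure hx))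
            (norm_nonneg _)
      _ = (∫ x in Ω, ‖f x‖) + D * ∫ x in Ω, ‖G x‖ := by
          rw [integral_add if0.norm (iG.norm.const_mul D), integral_const_mul]
      _ ≤ √V * √(∫ x in Ω, ‖f x‖ ^ 2) + D * (√V * √(∫ x in Ω, ‖G x‖ ^ 2)) := by
          gcongr
          · exact integral_norm_le_sqrt hVt hf.memLp
          · exact integral_norm_le_sqrt hVt hf.memLp_grad
      _ ≤ _ := by gcongr
  have h3 : V * ‖f z‖ ≤ √V * (1 + D + 2 * D ^ 2) * N := by
    calc V * ‖f z‖ = ‖V • f z‖ := by rw [norm_smul, Real.norm_of_nonneg hV0.le]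
      _ = ‖(V • f z - taylorAvg (closure Ω) f G z) + taylorAvg (closure Ω) f G z‖ := by simp
      _ ≤ 2 * D ^ 2 * (√V * √(∫ x in Ω, ‖H x‖ ^ 2)) + (√V * N + D * (√V * N)) :=
          (norm_add_le _ _).trans (add_le_add h1 h2)
      _ ≤ 2 * D ^ 2 * (√V * N) + (√V * N + D * (√V * N)) := by gcongr
      _ = _ := by ring
  rw [mul_assoc, inv_mul_eq_div, le_div_iff₀ hV0]
  linarith

/-- This extra integrability of the gradient is used twice: to show that boundary values vanish, and
to bound the interpolant in `W^{1,4}`. -/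
theorem exists_grad_L4_bound (hΩo : IsOpen Ω) (hΩc : Convex ℝ Ω)
    (hΩb : Bornology.IsBounded Ω) (hΩn : Ω.Nonempty) :
    ∃ C : ℝ, 0 ≤ C ∧ ∀ f G H, IsH2 Ω f G H →
      ∫⁻ x in Ω, ‖G x‖ₑ ^ 4 ≤ ENNReal.ofReal (C * h2NormSq Ω f G H ^ 2) := by
  set D := Metric.diam Ω with hD
  set V := volume.real Ω with hV
  have hVt : volume Ω ≠ ⊤ := hΩb.measure_lt_top.ne
  have hVp := (hΩo.measure_pos volume hΩn).ne'
  have hV0 : 0 < V := ENNReal.toReal_pos hVp hVt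
  have hD0 : 0 ≤ D := Metric.diam_nonneg
  refine ⟨2 ^ 17 * V⁻¹ * (1 + D ^ 4), by positivity, fun f G H hf => ?_⟩
  have h := hf.lintegral_grad_pow_four_le hΩo hΩc hΩb hΩn
  set N := h2NormSq Ω f G H
  have hN0 : 0 ≤ N := IsH2.h2NormSq_nonneg
  have b1 : ∫⁻ x in Ω, ‖G x‖ₑ ^ 2 ≤ ENNReal.ofReal N := by
    rw [← sq_eLpNorm_two, eLpNorm_two_eq_ofReal hf.memLp_grad,
      ← ENNReal.ofReal_pow (Real.sqrt_nonneg _), Real.sq_sqrt (integral_nonneg fun x => by positivity)]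
    exact ENNReal.ofReal_le_ofReal hf.integral_grad_sq_le
  have b2 : ∫⁻ x in Ω, ‖H x‖ₑ ^ 2 ≤ ENNReal.ofReal N := by
    have e0 : ∫⁻ x in Ω, ‖H x‖ₑ ^ 2 = eLpNorm H 2 (volume.restrict Ω) ^ 2 :=
      (sq_eLpNorm_two (F := E3 →L[ℝ] Mat3) _ _).symm
    have e1 : eLpNorm H 2 (volume.restrict Ω) = ENNReal.ofReal (√(∫ x in Ω, ‖H x‖ ^ 2)) :=
      eLpNorm_two_eq_ofReal (X := E3 →L[ℝ] Mat3) hf.memLp_hess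
    rw [e0, e1, ← ENNReal.ofReal_pow (Real.sqrt_nonneg _),
      Real.sq_sqrt (integral_nonneg fun x => by positivity)]
    exact ENNReal.ofReal_le_ofReal hf.integral_hess_sq_le
  have hVr : volume Ω = ENNReal.ofReal V := (ofReal_measureReal hVt).symm
  have h4 : volume Ω ^ 4 * ∫⁻ x in Ω, ‖G x‖ₑ ^ 4 ≤
      volume Ω ^ 4 * ENNReal.ofReal (2 ^ 17 * V⁻¹ * (1 + D ^ 4) * N ^ 2) := by
    refine h.trans ?_
    calc _ ≤ 2 ^ 17 * volume Ω ^ 3 *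
          (ENNReal.ofReal N ^ 2 + ENNReal.ofReal D ^ 4 * ENNReal.ofReal N ^ 2) := by gcongr
      _ = ENNReal.ofReal (2 ^ 17 * V ^ 3 * (N ^ 2 + D ^ 4 * N ^ 2)) := by
          rw [hVr, ENNReal.ofReal_mul (by positivity), ENNReal.ofReal_mul (by positivity),
            ENNReal.ofReal_add (by positivity) (by positivity), ENNReal.ofReal_mul (by positivity),
            ENNReal.ofReal_pow hN0, ENNReal.ofReal_pow hD0, ENNReal.ofReal_pow hV0.le]
          congr 2
          rw [ENNReal.ofReal_pow (by norm_num)]; norm_num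
      _ = _ := by
          rw [hVr, ← ENNReal.ofReal_pow hV0.le, ← ENNReal.ofReal_mul (by positivity)]
          congr 1
          field_simp
  exact (ENNReal.mul_le_mul_iff_right (pow_ne_zero 4 hVp) (ENNReal.pow_ne_top hVt)).1 h4

end Consequences

end EricksenLeslie

namespace EricksenLeslie
open Filter Topology

/-! ### Zero boundary values of functions in `H²` and in the closure of the solenoidal fields -/

section BoundaryValues

variable {Ω : Set E3}

theorem IsSolenoidalTest.eq_zero_of_notMem {ψ : E3 → E3} (hψ : IsSolenoidalTest Ω ψ) {x : E3}
    (hx : x ∉ Ω) : ψ x = 0 :=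
  image_eq_zero_of_notMem_tsupport fun h => hx (hψ.support h)

theorem IsSolenoidalTest.fderiv_eq_zero_of_notMem {ψ : E3 → E3} (hψ : IsSolenoidalTest Ω ψ)
    {x : E3} (hx : x ∉ Ω) : fderiv ℝ ψ x = 0 := by
  by_contra h
  exact hx (hψ.support (support_fderiv_subset ℝ h))

/-- A unit vector pointing out of an open convex set at a point not in the set. -/
theorem exists_outward_direction (hΩo : IsOpen Ω) (hΩc : Convex ℝ Ω) (hΩn : Ω.Nonempty) {x₀ : E3}
    (hx₀ : x₀ ∉ Ω) : ∃ n : E3, ‖n‖ = 1 ∧ ∀ s : ℝ, ∀ x, ‖x - x₀‖ ≤ s → x + s • n ∉ Ω := by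
  obtain ⟨f, hf⟩ := geometric_hahn_banach_open_point hΩc hΩo hx₀
  set y := (InnerProductSpace.toDual ℝ E3).symm f with hy
  have hfy : ∀ x, f x = inner ℝ y x := fun x => by simp [hy]
  have hy0 : y ≠ 0 := by
    intro h0
    obtain ⟨a, ha⟩ := hΩn
    have := hf a ha
    simp [hfy, h0] at this
  have hyn : 0 < ‖y‖ := norm_pos_iff.2 hy0
  -- A shift by `s` in this direction raises the separating functional by `‖y‖ * s`, which makes up
  -- for the loss of at most `‖y‖ * s` in moving from `x₀` to `x`.
  refine ⟨‖y‖⁻¹ • y, by rw [norm_smul, norm_inv, norm_norm, inv_mul_cancel₀ hyn.ne'], ?_⟩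
  intro s x hx hmem
  have h1 := hf _ hmem
  rw [hfy, hfy, inner_add_right, inner_smul_right, inner_smul_right,
    real_inner_self_eq_norm_sq] at h1
  have h2 : |inner ℝ y (x - x₀)| ≤ ‖y‖ * ‖x - x₀‖ := abs_real_inner_le_norm _ _
  rw [inner_sub_right] at h2
  have h3 : ‖y‖ * ‖x - x₀‖ ≤ ‖y‖ * s := by gcongr
  have h4 : s * (‖y‖⁻¹ * ‖y‖ ^ 2) = ‖y‖ * s := by field_simp
  have h5 := abs_le.1 h2
  linarith [h5.1]

/-- Moving a point of the ball by `s` in the outward direction leaves `Ω`, where `ψ` vanishes. The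
fundamental theorem of calculus on this segment, which stays in the ball of radius `2 * s`, bounds
`ψ` by its gradient. -/
theorem poincare_near_boundary {ψ : E3 → E3} (hψ : IsSolenoidalTest Ω ψ) (hΩo : IsOpen Ω)
    (hΩc : Convex ℝ Ω) (hΩn : Ω.Nonempty) {x₀ : E3} (hx₀ : x₀ ∉ Ω) {s : ℝ} (hs : 0 < s) :
    ∫⁻ x in Metric.closedBall x₀ s ∩ Ω, ‖ψ x‖ₑ ^ 2 ≤
      ENNReal.ofReal s ^ 2 * ∫⁻ x in Metric.closedBall x₀ (2 * s) ∩ Ω, ‖fderiv ℝ ψ x‖ₑ ^ 2 := by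
  obtain ⟨n, hn, hout⟩ := exists_outward_direction hΩo hΩc hΩn hx₀
  have hΩm := hΩo.measurableSet
  have hψ1 : ContDiff ℝ 1 ψ := hψ.contDiff.of_le (by norm_cast)
  have hc : Continuous (fderiv ℝ ψ) := hψ1.continuous_fderiv (by norm_num)
  have hce : Continuous fun x => ‖fderiv ℝ ψ x‖ₑ := continuous_enorm_comp (X := Mat3) hc
  have h1 : ∀ x ∈ Metric.closedBall x₀ s, ‖ψ x‖ₑ ^ 2 ≤ ENNReal.ofReal s ^ 2 *
      ∫⁻ t in Set.Ioo (0 : ℝ) 1, ‖fderiv ℝ ψ (x + t • (s • n))‖ₑ ^ 2 := by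
    intro x hx
    rw [Metric.mem_closedBall, dist_eq_norm] at hx
    have h2 := enorm_line_le hψ1 x (x + s • n)
    rw [hψ.eq_zero_of_notMem (hout s x hx), sub_zero, add_sub_cancel_left] at h2
    have h3 : ‖s • n‖ₑ = ENNReal.ofReal s := by
      rw [← ofReal_norm, norm_smul, hn, mul_one, Real.norm_of_nonneg hs.le]
    rw [h3, lintegral_mul_const' _ _ ENNReal.ofReal_ne_top, mul_comm] at h2
    refine (pow_le_pow_left' h2 2).trans ?_
    rw [mul_pow]
    gcongr
    have := sq_lintegral_le (volume.restrict (Set.Ioo (0 : ℝ) 1))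
      (f := fun t => ‖fderiv ℝ ψ (x + t • (s • n))‖ₑ)
      ((hce.comp (by fun_prop : Continuous fun t : ℝ => x + t • (s • n))).measurable.aemeasurable)
    simpa using this
  calc _ ≤ ∫⁻ x in Metric.closedBall x₀ s, ‖ψ x‖ₑ ^ 2 :=
        lintegral_mono_set Set.inter_subset_left
    _ ≤ ∫⁻ x in Metric.closedBall x₀ s, ENNReal.ofReal s ^ 2 *
      ∫⁻ t in Set.Ioo (0 : ℝ) 1, ‖fderiv ℝ ψ (x + t • (s • n))‖ₑ ^ 2 :=
        setLIntegral_mono' Metric.isClosed_closedBall.measurableSet h1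
    _ = ENNReal.ofReal s ^ 2 * ∫⁻ x in Metric.closedBall x₀ s,
      ∫⁻ t in Set.Ioo (0 : ℝ) 1, ‖fderiv ℝ ψ (x + t • (s • n))‖ₑ ^ 2 := by
        rw [lintegral_const_mul' _ _ (by simp)]
    _ = ENNReal.ofReal s ^ 2 * ∫⁻ t in Set.Ioo (0 : ℝ) 1, ∫⁻ x in Metric.closedBall x₀ s,
        ‖fderiv ℝ ψ (x + t • (s • n))‖ₑ ^ 2 := by
        congr 1
        refine lintegral_lintegral_swap (Measurable.aemeasurable ?_)
        exact (hce.comp (by fun_prop : Continuous fun p : E3 × ℝ =>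
          p.1 + p.2 • (s • n))).measurable.pow_const 2
    _ ≤ ENNReal.ofReal s ^ 2 * ∫⁻ t in Set.Ioo (0 : ℝ) 1,
        ∫⁻ x in Metric.closedBall x₀ (2 * s), ‖fderiv ℝ ψ x‖ₑ ^ 2 := by
        refine mul_le_mul' le_rfl (setLIntegral_mono' measurableSet_Ioo fun t ht => ?_)
        have := setLIntegral_comp_add_smul_le (fun x => ‖fderiv ℝ ψ x‖ₑ ^ 2) (t • (s • n))
          (one_ne_zero) (K := Metric.closedBall x₀ s) (K' := Metric.closedBall x₀ (2 * s))
          Metric.isClosed_closedBall.measurableSet Metric.isClosed_closedBall.measurableSet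
          (fun x hx => ?_)
        · simp only [one_smul, abs_one, one_pow, inv_one, ENNReal.ofReal_one, one_mul] at this
          refine le_trans (le_of_eq (lintegral_congr fun x => ?_)) this
          rw [add_comm]
        · rw [Metric.mem_closedBall, dist_eq_norm] at hx ⊢
          calc _ = ‖t • (s • n) + (x - x₀)‖ := by congr 1; module
            _ ≤ ‖t • (s • n)‖ + ‖x - x₀‖ := norm_add_le _ _
            _ ≤ s + s := by
              refine add_le_add ?_ hx
              rw [norm_smul, norm_smul, hn, Real.norm_of_nonneg ht.1.le, Real.norm_of_nonneg hs.le]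
              nlinarith [ht.2]
            _ = 2 * s := by ring
    _ = ENNReal.ofReal s ^ 2 * ∫⁻ x in Metric.closedBall x₀ (2 * s), ‖fderiv ℝ ψ x‖ₑ ^ 2 := by
        simp
    _ = _ := by
        congr 1
        rw [← lintegral_indicator Metric.isClosed_closedBall.measurableSet,
          ← lintegral_indicator (Metric.isClosed_closedBall.measurableSet.inter hΩm)]
        refine lintegral_congr fun x => ?_
        by_cases hxΩ : x ∈ Ω
        · by_cases hxb : x ∈ Metric.closedBall x₀ (2 * s) <;> simp [Set.indicator, hxΩ]
        · have h0 : ‖fderiv ℝ ψ x‖ₑ ^ 2 = 0 := by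
            have h00 : ‖fderiv ℝ ψ x‖ₑ = 0 := by
              rw [hψ.fderiv_eq_zero_of_notMem hxΩ]; exact enorm_zero (E := Mat3)
            rw [h00]; simp
          simp only [Set.indicator, h0, ite_self]

/-- The estimate for test fields is stable under convergence of the field and its gradient in `L²`.
-/
theorem MemH10Sigma.near_boundary {φ : E3 → E3} {G : E3 → Mat3} (hφ : MemH10Sigma Ω φ G)
    (hΩo : IsOpen Ω) (hΩc : Convex ℝ Ω) (hΩn : Ω.Nonempty) {x₀ : E3} (hx₀ : x₀ ∉ Ω) {s : ℝ}
    (hs : 0 < s) :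
    eLpNorm φ 2 (volume.restrict (Metric.closedBall x₀ s ∩ Ω)) ≤ ENNReal.ofReal s *
      eLpNorm G 2 (volume.restrict (Metric.closedBall x₀ (2 * s) ∩ Ω)) := by
  obtain ⟨h0, h1, h2⟩ := hφ
  set μ := volume.restrict (Metric.closedBall x₀ s ∩ Ω) with hμ
  set ν := volume.restrict (Metric.closedBall x₀ (2 * s) ∩ Ω) with hν
  have hμle : μ ≤ volume.restrict Ω := Measure.restrict_mono Set.inter_subset_right le_rfl
  have hνle : ν ≤ volume.restrict Ω := Measure.restrict_mono Set.inter_subset_right le_rfl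
  have key : ∀ ε : ℝ, 0 < ε → eLpNorm φ 2 μ ≤
      ENNReal.ofReal s * (eLpNorm G 2 ν + ENNReal.ofReal ε) + ENNReal.ofReal ε := by
    intro ε hε
    obtain ⟨ψ, hψ, e1, e2⟩ := h2 ε hε
    have hψ1 : ContDiff ℝ 1 ψ := hψ.contDiff.of_le (by norm_cast)
    have hc : Continuous (fderiv ℝ ψ) := hψ1.continuous_fderiv (by norm_num)
    have p1 : eLpNorm ψ 2 μ ≤ ENNReal.ofReal s * eLpNorm (fderiv ℝ ψ) 2 ν := by
      rw [eLpNorm_two_le_iff]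
      exact poincare_near_boundary hψ hΩo hΩc hΩn hx₀ hs
    have p2 : eLpNorm φ 2 μ ≤ eLpNorm ψ 2 μ + ENNReal.ofReal ε := by
      refine (eLpNorm_le_add_sub (h0.1.mono_measure hμle)
        hψ1.continuous.aestronglyMeasurable).trans (add_le_add le_rfl ?_)
      exact (eLpNorm_mono_measure _ hμle).trans e1.le
    have p3 : eLpNorm (fderiv ℝ ψ) 2 ν ≤ eLpNorm G 2 ν + ENNReal.ofReal ε := by
      refine (eLpNorm_le_add_sub hc.aestronglyMeasurable (h1.1.mono_measure hνle)).trans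
        (add_le_add le_rfl ?_)
      refine le_trans ?_ ((eLpNorm_mono_measure _ hνle).trans e2.le)
      rw [← eLpNorm_neg]
      refine le_of_eq (congrArg (fun q => eLpNorm q 2 ν) ?_)
      funext x; simp
    calc _ ≤ eLpNorm ψ 2 μ + ENNReal.ofReal ε := p2
      _ ≤ ENNReal.ofReal s * eLpNorm (fderiv ℝ ψ) 2 ν + ENNReal.ofReal ε := by gcongr
      _ ≤ _ := by gcongr
  have hlim : Tendsto (fun ε : ℝ => ENNReal.ofReal s * (eLpNorm G 2 ν + ENNReal.ofReal ε)
      + ENNReal.ofReal ε) (𝓝[>] 0) (𝓝 (ENNReal.ofReal s * (eLpNorm G 2 ν + 0) + 0)) := by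
    have hε : Tendsto (fun ε : ℝ => ENNReal.ofReal ε) (𝓝[>] 0) (𝓝 0) := by
      have := (ENNReal.continuous_ofReal.tendsto 0)
      rw [ENNReal.ofReal_zero] at this
      exact this.mono_left nhdsWithin_le_nhds
    exact (ENNReal.Tendsto.const_mul (hε.const_add _) (Or.inr ENNReal.ofReal_ne_top)).add hε
  rw [add_zero, add_zero] at hlim
  exact ge_of_tendsto hlim (by filter_upwards [self_mem_nhdsWithin] with ε hε using key ε hε)

/-- The homothety of ratio `θ` centred at `x₀` maps `Ω` into itself by convexity and into the small
ball, and scales volumes by `θ ^ 3`. -/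
theorem volume_contraction_le (hΩo : IsOpen Ω) (hΩc : Convex ℝ Ω) (hΩb : Bornology.IsBounded Ω)
    {x₀ : E3} (hx₀ : x₀ ∈ closure Ω) {θ : ℝ} (hθ : 0 < θ) (hθ1 : θ ≤ 1) :
    ENNReal.ofReal (θ ^ 3) * volume Ω ≤
      volume (Metric.closedBall x₀ (θ * Metric.diam Ω) ∩ Ω) := by
  set K' := Metric.closedBall x₀ (θ * Metric.diam Ω) ∩ Ω with hK'
  have hKm : MeasurableSet K' := Metric.isClosed_closedBall.measurableSet.inter hΩo.measurableSet
  have h := setLIntegral_comp_add_smul_le (fun _ => 1) (x₀ - θ • x₀) hθ.ne'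
    (K := Ω) (K' := K') hΩo.measurableSet hKm (fun x hx => ?_)
  · simp only [lintegral_const, one_mul, Measure.restrict_apply_univ] at h
    calc _ ≤ ENNReal.ofReal (θ ^ 3) * (ENNReal.ofReal ((|θ| ^ 3)⁻¹) * volume K') := by gcongr
      _ = _ := by
        rw [← mul_assoc, ← ENNReal.ofReal_mul (by positivity), abs_of_pos hθ,
          mul_inv_cancel₀ (by positivity), ENNReal.ofReal_one, one_mul]
  · have e1 : x₀ - θ • x₀ + θ • x = (1 - θ) • x₀ + θ • x := by module
    have e2 : x₀ - θ • x₀ + θ • x - x₀ = θ • (x - x₀) := by module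
    refine ⟨?_, ?_⟩
    · rw [Metric.mem_closedBall, dist_eq_norm, e2, norm_smul, Real.norm_of_nonneg hθ.le]
      have := norm_sub_le_diam hΩb x (subset_closure hx) x₀ hx₀
      gcongr
    · rw [e1]
      have := hΩc.combo_closure_interior_mem_interior hx₀ (by rwa [hΩo.interior_eq] : x ∈ interior Ω)
        (by linarith : (0 : ℝ) ≤ 1 - θ) hθ (by ring)
      rwa [hΩo.interior_eq] at this

/-- The continuous representative of a function in `H² ∩ H¹₀` vanishes on the boundary. -/
theorem MemH10Sigma.eq_zero_on_frontier {φ : E3 → E3} {G : E3 → Mat3} {H : E3 → E3 →L[ℝ] Mat3}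
    (hφ : MemH10Sigma Ω φ G) (hH : IsH2 Ω φ G H) (hφc : ContinuousOn φ (closure Ω))
    (hΩo : IsOpen Ω) (hΩc : Convex ℝ Ω) (hΩb : Bornology.IsBounded Ω) (hΩn : Ω.Nonempty)
    {x₀ : E3} (hx₀ : x₀ ∈ frontier Ω) : φ x₀ = 0 := by
  by_contra hne
  have hx₀c : x₀ ∈ closure Ω := hx₀.1
  have hx₀n : x₀ ∉ Ω := by rw [frontier, hΩo.interior_eq] at hx₀; exact hx₀.2
  set c := ‖φ x₀‖ / 2 with hc
  have hc0 : 0 < c := half_pos (norm_pos_iff.2 hne)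
  obtain ⟨C, hC0, hC⟩ := exists_grad_L4_bound hΩo hΩc hΩb hΩn
  set M : ℝ≥0∞ := ∫⁻ x in Ω, ‖G x‖ₑ ^ 4 with hM
  have hMt : M ≠ ⊤ := ((hC φ G H hH).trans_lt ENNReal.ofReal_lt_top).ne
  set D := Metric.diam Ω with hD
  have hD0 : 0 < D := by
    obtain ⟨a, ha⟩ := hΩn
    have : a ≠ x₀ := fun h => hx₀n (h ▸ ha)
    exact (norm_pos_iff.2 (sub_ne_zero.2 this)).trans_le
      (norm_sub_le_diam hΩb a (subset_closure ha) x₀ hx₀c)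
  have hVp := (hΩo.measure_pos volume hΩn).ne'
  -- a neighbourhood in which `φ` is bounded below
  obtain ⟨r, hr, hball⟩ : ∃ r > 0, ∀ x ∈ Ω, ‖x - x₀‖ < r → c ≤ ‖φ x‖ := by
    have h1 : ∀ᶠ x in 𝓝[closure Ω] x₀, c < ‖φ x‖ :=
      ((hφc x₀ hx₀c).norm).eventually (lt_mem_nhds (by rw [hc]; linarith [norm_pos_iff.2 hne]))
    obtain ⟨r, hr, h2⟩ := Metric.mem_nhdsWithin_iff.1 h1
    exact ⟨r, hr, fun x hx hxr => (h2 ⟨by simpa [dist_eq_norm] using hxr, subset_closure hx⟩).le⟩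
  set κ : ℝ≥0∞ := volume (Metric.ball (0 : E3) 1) with hκ
  have hκt : κ ≠ ⊤ := Metric.isBounded_ball.measure_lt_top.ne
  set A : ℝ≥0∞ := ENNReal.ofReal (c ^ 4) * volume Ω ^ 2 with hA
  have hA0 : A ≠ 0 := by simp [hA, hc0, hVp, pow_pos]
  -- If `φ` is at least `c` in norm near `x₀`, its squared integral near `x₀` is at least of order
  -- `θ ^ 3`. The Poincaré estimate and the `L⁴` integrability of `G` bound it above by order `θ ^ 2
  -- * θ ^ (3/2)`. After squaring one compares `θ ^ 6` with `θ ^ 7`, impossible as `θ` tends to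
  -- zero.
  have key : ∀ θ : ℝ, 0 < θ → θ ≤ 1 → θ * D < r →
      A ≤ ENNReal.ofReal θ * (ENNReal.ofReal (8 * D ^ 7) * κ * M) := by
    intro θ hθ hθ1 hθr
    set s := θ * D with hs
    have hs0 : 0 < s := by positivity
    set S₁ := Metric.closedBall x₀ s ∩ Ω with hS₁
    set S₂ := Metric.closedBall x₀ (2 * s) ∩ Ω with hS₂
    have hS₁m : MeasurableSet S₁ := Metric.isClosed_closedBall.measurableSet.inter hΩo.measurableSet
    have hS₂m : MeasurableSet S₂ := Metric.isClosed_closedBall.measurableSet.inter hΩo.measurableSet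
    have v1 : ENNReal.ofReal (θ ^ 3) * volume Ω ≤ volume S₁ :=
      volume_contraction_le hΩo hΩc hΩb hx₀c hθ hθ1
    have v2 : volume S₂ ≤ ENNReal.ofReal ((2 * s) ^ 3) * κ := by
      refine (measure_mono Set.inter_subset_left).trans (le_of_eq ?_)
      rw [Measure.addHaar_closedBall _ _ (by positivity), finrank_E3]
    have l1 : ENNReal.ofReal (c ^ 2) * volume S₁ ≤ ∫⁻ x in S₁, ‖φ x‖ₑ ^ 2 := by
      rw [← setLIntegral_const]
      refine setLIntegral_mono' hS₁m fun x hx => ?_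
      rw [ENNReal.ofReal_pow hc0.le, ← ofReal_norm]
      gcongr
      refine hball x hx.2 ?_
      have := hx.1
      rw [Metric.mem_closedBall, dist_eq_norm] at this
      exact this.trans_lt hθr
    have l2 : ∫⁻ x in S₁, ‖φ x‖ₑ ^ 2 ≤ ENNReal.ofReal s ^ 2 * ∫⁻ x in S₂, ‖G x‖ₑ ^ 2 :=
      (eLpNorm_two_le_iff _ _ _ _ _).1 (hφ.near_boundary hΩo hΩc hΩn hx₀n hs0)
    have l3 : (∫⁻ x in S₂, ‖G x‖ₑ ^ 2) ^ 2 ≤ volume S₂ * M := by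
      have hGm : AEMeasurable (fun x => ‖G x‖ₑ ^ 2) (volume.restrict S₂) :=
        ((hφ.2.1.1.mono_measure
          (Measure.restrict_mono Set.inter_subset_right le_rfl)).enorm.pow_const 2)
      have := sq_lintegral_le (volume.restrict S₂) hGm
      rw [Measure.restrict_apply_univ] at this
      refine this.trans (mul_le_mul' le_rfl ?_)
      simp_rw [← pow_mul]
      exact lintegral_mono_set Set.inter_subset_right
    have l4 : (ENNReal.ofReal (c ^ 2) * (ENNReal.ofReal (θ ^ 3) * volume Ω)) ^ 2 ≤
        (ENNReal.ofReal s ^ 2) ^ 2 * ((ENNReal.ofReal ((2 * s) ^ 3) * κ) * M) := by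
      calc _ ≤ (ENNReal.ofReal s ^ 2 * ∫⁻ x in S₂, ‖G x‖ₑ ^ 2) ^ 2 := by
            refine pow_le_pow_left' (le_trans ?_ (l1.trans l2)) 2
            gcongr
        _ = (ENNReal.ofReal s ^ 2) ^ 2 * (∫⁻ x in S₂, ‖G x‖ₑ ^ 2) ^ 2 := by rw [mul_pow]
        _ ≤ _ := by
            refine mul_le_mul' le_rfl (l3.trans (mul_le_mul' v2 le_rfl))
    have e1 : (ENNReal.ofReal (c ^ 2) * (ENNReal.ofReal (θ ^ 3) * volume Ω)) ^ 2
        = ENNReal.ofReal (θ ^ 6) * A := by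
      rw [hA, mul_pow, mul_pow, ← ENNReal.ofReal_pow (by positivity),
        ← ENNReal.ofReal_pow (by positivity), ← pow_mul, ← pow_mul]
      ring
    have e2 : (ENNReal.ofReal s ^ 2) ^ 2 * ((ENNReal.ofReal ((2 * s) ^ 3) * κ) * M)
        = ENNReal.ofReal (θ ^ 6) * (ENNReal.ofReal θ * (ENNReal.ofReal (8 * D ^ 7) * κ * M)) := by
      rw [← ENNReal.ofReal_pow hs0.le, ← ENNReal.ofReal_pow (by positivity)]
      simp only [← mul_assoc]
      rw [← ENNReal.ofReal_mul (by positivity), ← ENNReal.ofReal_mul (by positivity),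
        ← ENNReal.ofReal_mul (by positivity)]
      congr 3
      rw [hs]; ring
    rw [e1, e2] at l4
    exact (ENNReal.mul_le_mul_iff_right (by simp; positivity) ENNReal.ofReal_ne_top).1 l4
  have hBt : ENNReal.ofReal (8 * D ^ 7) * κ * M ≠ ⊤ :=
    ENNReal.mul_ne_top (ENNReal.mul_ne_top ENNReal.ofReal_ne_top hκt) hMt
  have hlim : Tendsto (fun θ : ℝ => ENNReal.ofReal θ * (ENNReal.ofReal (8 * D ^ 7) * κ * M))
      (𝓝[>] 0) (𝓝 0) := by
    have h0 : Tendsto (fun ε : ℝ => ENNReal.ofReal ε) (𝓝[>] 0) (𝓝 0) := by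
      have := (ENNReal.continuous_ofReal.tendsto 0)
      rw [ENNReal.ofReal_zero] at this
      exact this.mono_left nhdsWithin_le_nhds
    simpa using ENNReal.Tendsto.mul_const h0 (Or.inr hBt)
  have : A ≤ 0 := by
    refine ge_of_tendsto hlim ?_
    have hm : Set.Ioo (0 : ℝ) (min 1 (r / D)) ∈ 𝓝[>] (0 : ℝ) :=
      Ioo_mem_nhdsGT (lt_min one_pos (by positivity))
    filter_upwards [hm] with θ hθ
    refine key θ hθ.1 (hθ.2.le.trans (min_le_left _ _)) ?_
    have := hθ.2.trans_le (min_le_right _ _)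
    rwa [lt_div_iff₀ hD0] at this
  exact hA0 (le_antisymm this (by simp))

end BoundaryValues

/-! ### Sobolev inequality and exchange of derivatives for Lipschitz functions -/

section LipschitzFunctions

/-- Mollification of a Lipschitz function commutes with differentiation. -/
theorem hasFDerivAt_moll_of_lipschitz {u : E3 → E3} {C : NNReal} (hu : LipschitzWith C u)
    (ρ : ContDiffBump (0 : E3)) (x₀ : E3) :
    HasFDerivAt (moll ρ u) (moll ρ (fderiv ℝ u) x₀) x₀ := by
  have hint : ∀ x, Integrable (fun y => ρ.normed volume y • u (x - y)) volume := fun x =>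
    Continuous.integrable_of_hasCompactSupport
      (ρ.continuous_normed.smul (hu.continuous.comp (by fun_prop)))
      ρ.hasCompactSupport_normed.smul_right
  have h := hasFDerivAt_integral_of_dominated_loc_of_lip (μ := (volume : Measure E3))
    (F := fun x y => ρ.normed volume y • u (x - y))
    (F' := fun y => ρ.normed volume y • fderiv ℝ u (x₀ - y)) (x₀ := x₀)
    (bound := fun y => ρ.normed volume y * C) (s := Set.univ) univ_mem
    (Eventually.of_forall fun x => (hint x).1) (hint x₀) ?_ ?_ ?_ ?_
  · exact h.2
  · refine (ρ.continuous_normed.aestronglyMeasurable).smul ?_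
    exact ((measurable_fderiv ℝ u).stronglyMeasurable.comp_measurable
      (by fun_prop : Measurable fun y : E3 => x₀ - y)).aestronglyMeasurable
  · refine Eventually.of_forall fun y => ?_
    rw [lipschitzOnWith_univ]
    refine LipschitzWith.of_dist_le_mul fun a b => ?_
    rw [dist_eq_norm, ← smul_sub, norm_smul, Real.norm_of_nonneg (ρ.nonneg_normed y)]
    have := hu.dist_le_mul (a - y) (b - y)
    rw [dist_eq_norm] at this
    have e : dist (a - y) (b - y) = dist a b := by simp
    rw [e] at this
    have h0 : 0 ≤ ρ.normed volume y * C := mul_nonneg (ρ.nonneg_normed y) C.2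
    rw [Real.coe_nnabs, abs_of_nonneg h0, mul_assoc]
    exact mul_le_mul_of_nonneg_left this (ρ.nonneg_normed y)
  · exact ρ.integrable_normed.mul_const _
  · have h1 : ∀ᵐ y ∂(volume : Measure E3), DifferentiableAt ℝ u (x₀ - y) :=
      (Measure.measurePreserving_sub_left volume x₀).quasiMeasurePreserving.ae
        hu.ae_differentiableAt
    filter_upwards [h1] with y hy
    have h2 : HasFDerivAt (fun x => u (x - y)) (fderiv ℝ u (x₀ - y)) x₀ := by
      refine (HasFDerivAt.comp x₀ hy.hasFDerivAt
        ((hasFDerivAt_id x₀).sub_const y)).congr_fderiv ?_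
      ext; simp
    exact h2.const_smul (ρ.normed volume y)

/-- The Sobolev inequality for compactly supported Lipschitz functions. -/
theorem exists_sobolev : ∃ C : NNReal, ∀ (u : E3 → E3) (L : NNReal), LipschitzWith L u →
    HasCompactSupport u →
      ∫⁻ x, ‖u x‖ₑ ^ 6 ≤ C * (∫⁻ x, ‖fderiv ℝ u x‖ₑ ^ 2) ^ 3 := by
  set K := SNormLESNormFDerivOfEqConst E3 (volume : Measure E3) (2 : NNReal) with hK
  refine ⟨K ^ 6, fun u L hu hc => ?_⟩
  have hbump : ∀ n : ℕ, ∃ ρ : ContDiffBump (0 : E3), ρ.rOut = 2 / ((n : ℝ) + 1) := fun n =>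
    ⟨⟨1 / ((n : ℝ) + 1), 2 / ((n : ℝ) + 1), by positivity, by gcongr; norm_num⟩, rfl⟩
  choose ρ hρ using hbump
  have hρ0 : Tendsto (fun n => (ρ n).rOut) atTop (𝓝 0) := by
    have := (tendsto_one_div_add_atTop_nhds_zero_nat (𝕜 := ℝ)).const_mul 2
    refine (this.congr fun n => ?_).trans (by simp)
    rw [hρ]; ring
  -- The inequality for `C¹` functions with exponents 2 and 6 applies to the mollification, whose
  -- gradient is the mollified gradient and so no larger in `L²`. Fatou's lemma then removes the
  -- mollification on the left.
  have hstep : ∀ n, ∫⁻ x, ‖moll (ρ n) u x‖ₑ ^ 6 ≤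
      (K ^ 6 : NNReal) * (∫⁻ x, ‖fderiv ℝ u x‖ₑ ^ 2) ^ 3 := by
    intro n
    have hs : ContDiff ℝ 1 (moll (ρ n) u) :=
      (contDiff_moll (ρ n) hu.continuous.locallyIntegrable).of_le (by norm_cast)
    have hcs : HasCompactSupport (moll (ρ n) u) :=
      HasCompactSupport.convolution _ (ρ n).hasCompactSupport_normed hc
    have h1 := eLpNorm_le_eLpNorm_fderiv_of_eq (volume : Measure E3) hs hcs (p := 2) (p' := 6)
      (by norm_num) (by simp) (by rw [finrank_E3]; norm_num)
    have e6 : eLpNorm (moll (ρ n) u) (6 : NNReal) volume ^ 6 = ∫⁻ x, ‖moll (ρ n) u x‖ₑ ^ 6 := by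
      have := eLpNorm_nnreal_pow_eq_lintegral (μ := (volume : Measure E3)) (f := moll (ρ n) u)
        (p := 6) (by norm_num)
      simpa using this
    have e2 : eLpNorm (fderiv ℝ (moll (ρ n) u)) (2 : NNReal) volume ^ 2
        ≤ ∫⁻ x, ‖fderiv ℝ u x‖ₑ ^ 2 := by
      have e : fderiv ℝ (moll (ρ n) u) = moll (ρ n) (fderiv ℝ u) :=
        funext fun x => (hasFDerivAt_moll_of_lipschitz hu (ρ n) x).fderiv
      rw [e]
      have := sq_eLpNorm_two (volume : Measure E3) (moll (ρ n) (fderiv ℝ u))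
      calc _ = ∫⁻ x, ‖moll (ρ n) (fderiv ℝ u) x‖ₑ ^ 2 := by rw [← this]; rfl
        _ ≤ _ := lintegral_moll_sq_le (ρ n) (measurable_fderiv ℝ u).stronglyMeasurable.aestronglyMeasurable
    rw [← e6]
    calc _ ≤ (K * eLpNorm (fderiv ℝ (moll (ρ n) u)) (2 : NNReal) volume) ^ 6 :=
          pow_le_pow_left' h1 6
      _ = (K ^ 6 : NNReal) * (eLpNorm (fderiv ℝ (moll (ρ n) u)) (2 : NNReal) volume ^ 2) ^ 3 := by
          push_cast; ring
      _ ≤ _ := by gcongr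
  have hfatou : ∫⁻ x, ‖u x‖ₑ ^ 6 ≤ liminf (fun n => ∫⁻ x, ‖moll (ρ n) u x‖ₑ ^ 6) atTop := by
    refine le_trans (lintegral_mono fun x => ?_) (lintegral_liminf_le fun n => ?_)
    · have h1 : Tendsto (fun n => moll (ρ n) u x) atTop (𝓝 (u x)) :=
        ContDiffBump.convolution_tendsto_right_of_continuous hρ0 hu.continuous x
      have h2 : Tendsto (fun n => ‖moll (ρ n) u x‖ₑ ^ 6) atTop (𝓝 (‖u x‖ₑ ^ 6)) :=
        ((ENNReal.continuous_pow 6).tendsto _).comp ((continuous_enorm.tendsto _).comp h1)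
      exact h2.liminf_eq.ge
    · exact ((contDiff_moll (ρ n)
        hu.continuous.locallyIntegrable).continuous.enorm.measurable).pow_const 6
  refine hfatou.trans (liminf_le_of_frequently_le' (Frequently.of_forall hstep))

/-- Second derivatives are not available, so `f` is replaced by its difference quotient in the
direction `v`. One integration by parts in the direction `w` and a translation move both operations
onto the other factor, and the limit of the difference quotients gives the identity. It is the
integral identity behind Korn's inequality. -/
theorem integral_lineDeriv_mul_lineDeriv {f g : E3 → ℝ} {C D : NNReal} (hf : LipschitzWith C f)
    (hg : LipschitzWith D g) (hfc : HasCompactSupport f) (hgc : HasCompactSupport g) (v w : E3) :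
    ∫ x, lineDeriv ℝ f x v * lineDeriv ℝ g x w = ∫ x, lineDeriv ℝ f x w * lineDeriv ℝ g x v := by
  have hint : ∀ {q : E3 → ℝ} {A : NNReal} (_ : LipschitzWith A q) (_ : HasCompactSupport q)
      (y : E3), Integrable (fun x => lineDeriv ℝ q x y) volume := by
    intro q A hq hqc y
    have hb : MemLp (fun x => lineDeriv ℝ q x y) ⊤ volume := hq.memLp_lineDeriv y
    have hz : ∀ x ∉ tsupport q, lineDeriv ℝ q x y = 0 := by
      intro x hx
      have h1 : q =ᶠ[𝓝 x] fun _ => 0 := notMem_tsupport_iff_eventuallyEq.1 hx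
      rw [h1.lineDeriv_eq]
      simp [lineDeriv]
    have hI : IntegrableOn (fun x => lineDeriv ℝ q x y) (tsupport q) volume := by
      have : IsFiniteMeasure (volume.restrict (tsupport q)) := ⟨by
        simpa using (show IsCompact (tsupport q) from hqc).measure_lt_top⟩
      exact (hb.restrict _).integrable le_top
    exact (integrableOn_iff_integrable_of_support_subset fun x hx => by
      by_contra h; exact hx (hz x h)).1 hI
  have A := hf.integral_inv_smul_sub_mul_tendsto_integral_lineDeriv_mul (μ := volume)
    (hint hg hgc w) v
  have B := hg.integral_inv_smul_sub_mul_tendsto_integral_lineDeriv_mul (μ := volume)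
    (hint hf hfc w) (-v)
  have hneg : ∫ x, lineDeriv ℝ g x (-v) * lineDeriv ℝ f x w
      = -∫ x, lineDeriv ℝ f x w * lineDeriv ℝ g x v := by
    rw [← integral_neg]
    congr with x
    rw [lineDeriv_neg]; ring
  rw [hneg] at B
  have hB' := B.neg
  rw [neg_neg] at hB'
  refine tendsto_nhds_unique A (hB'.congr' ?_)
  filter_upwards [self_mem_nhdsWithin] with t ht
  -- integrate by parts the difference quotient
  set F : E3 → ℝ := fun x => t⁻¹ • (f (x + t • v) - f x) with hF
  have hft : LipschitzWith C fun x => f (x + t • v) :=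
    LipschitzWith.of_dist_le_mul fun a b => by
      simpa using hf.dist_le_mul (a + t • v) (b + t • v)
  have hFl : ∃ A, LipschitzWith A F := ⟨_, (lipschitzWith_smul (t⁻¹)).comp (hft.sub hf)⟩
  obtain ⟨A', hFl⟩ := hFl
  have h1 := hFl.integral_lineDeriv_mul_eq (μ := volume) hg hgc w
  have hFd : ∀ᵐ x ∂(volume : Measure E3), lineDeriv ℝ F x w
      = t⁻¹ * (lineDeriv ℝ f (x + t • v) w - lineDeriv ℝ f x w) := by
    have d1 := hf.ae_differentiableAt (μ := volume)
    have d2 : ∀ᵐ x ∂(volume : Measure E3), DifferentiableAt ℝ f (x + t • v) :=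
      (measurePreserving_add_right volume (t • v)).quasiMeasurePreserving.ae d1
    filter_upwards [d1, d2] with x hx hx2
    have k1 : HasFDerivAt (fun y => f (y + t • v)) (fderiv ℝ f (x + t • v)) x := by
      refine (HasFDerivAt.comp x hx2.hasFDerivAt
        ((hasFDerivAt_id x).add_const (t • v))).congr_fderiv ?_
      ext; simp
    have k2 : HasFDerivAt F (t⁻¹ • (fderiv ℝ f (x + t • v) - fderiv ℝ f x)) x :=
      (k1.sub hx.hasFDerivAt).const_smul t⁻¹
    rw [k2.differentiableAt.lineDeriv_eq_fderiv, k2.fderiv, hx.lineDeriv_eq_fderiv,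
      hx2.lineDeriv_eq_fderiv]
    simp
  have i1 : Integrable (fun x => lineDeriv ℝ f x w * g x) volume := by
    refine (hint hf hfc w).mul_of_top_left ?_
    exact hg.continuous.memLp_of_hasCompactSupport hgc
  have hgt : Continuous fun x => g (x - t • v) := hg.continuous.comp (by fun_prop)
  have i2 : Integrable (fun x => lineDeriv ℝ f (x + t • v) w * g x) volume := by
    refine Integrable.mul_of_top_left ?_ (hg.continuous.memLp_of_hasCompactSupport hgc)
    exact (hint hf hfc w).comp_add_right (t • v)
  have i3 : Integrable (fun x => lineDeriv ℝ f x w * g (x - t • v)) volume := by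
    have := i2.comp_add_right (-(t • v))
    simpa [sub_eq_add_neg] using this
  have e1 : ∫ x, lineDeriv ℝ F x w * g x
      = t⁻¹ * ((∫ x, lineDeriv ℝ f x w * g (x - t • v)) - ∫ x, lineDeriv ℝ f x w * g x) := by
    have e2 : ∫ x, lineDeriv ℝ f (x + t • v) w * g x
        = ∫ x, lineDeriv ℝ f x w * g (x - t • v) := by
      have := integral_add_right_eq_self (μ := (volume : Measure E3))
        (fun x => lineDeriv ℝ f x w * g (x - t • v)) (t • v)
      simpa using this
    rw [← e2, ← integral_sub i2 i1, ← integral_const_mul]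
    refine integral_congr_ae ?_
    filter_upwards [hFd] with x hx
    rw [hx]; ring
  have e3 : ∫ x, t⁻¹ • (g (x + t • (-v)) - g x) * lineDeriv ℝ f x w
      = t⁻¹ * ((∫ x, lineDeriv ℝ f x w * g (x - t • v)) - ∫ x, lineDeriv ℝ f x w * g x) := by
    rw [← integral_sub i3 i1, ← integral_const_mul]
    congr with x
    rw [smul_neg, ← sub_eq_add_neg, smul_eq_mul]; ring
  rw [e3, ← e1, h1, ← integral_neg]
  congr with x
  rw [lineDeriv_neg]
  ring

end LipschitzFunctions

end EricksenLeslie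

/-! ### Tetrahedra, barycentric coordinates and nodal functions -/

namespace EricksenLeslie
open Filter Topology

theorem IsConvexPolyhedron.isOpen {Ω : Set E3} (h : IsConvexPolyhedron Ω) : IsOpen Ω := by
  obtain ⟨-, S, rfl⟩ := h; exact isOpen_interior

theorem IsConvexPolyhedron.convex {Ω : Set E3} (h : IsConvexPolyhedron Ω) : Convex ℝ Ω := by
  obtain ⟨-, S, rfl⟩ := h; exact (convex_convexHull ℝ _).interior

theorem IsConvexPolyhedron.isBounded {Ω : Set E3} (h : IsConvexPolyhedron Ω) :
    Bornology.IsBounded Ω := by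
  obtain ⟨-, S, rfl⟩ := h
  exact ((S.finite_toSet.isCompact_convexHull ℝ).isBounded).subset interior_subset

theorem affineMap_apply_sum {F : Type*} [AddCommGroup F] [Module ℝ F] (f : E3 →ᵃ[ℝ] F)
    {s : Finset E3} {w : E3 → ℝ} (hw : ∑ y ∈ s, w y = 1) :
    f (∑ y ∈ s, w y • y) = ∑ y ∈ s, w y • f y := by
  have h : ∀ x, f x = f.linear x + f 0 := fun x => congrFun f.decomp x
  rw [h, map_sum]
  have h2 : ∀ y ∈ s, w y • f y = f.linear (w y • y) + w y • f 0 := fun y _ => by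
    rw [map_smul, ← smul_add, ← h]
  rw [Finset.sum_congr rfl h2, Finset.sum_add_distrib, ← Finset.sum_smul, hw, one_smul]

/-- The closed convex hull of the vertices of a tetrahedron. -/
abbrev hull (s : Finset E3) : Set E3 := convexHull ℝ (s : Set E3)

theorem isCompact_hull (s : Finset E3) : IsCompact (hull s) := s.finite_toSet.isCompact_convexHull ℝ

theorem measurableSet_hull (s : Finset E3) : MeasurableSet (hull s) :=
  (isCompact_hull s).isClosed.measurableSet

theorem mem_hull {s : Finset E3} {z : E3} (hz : z ∈ s) : z ∈ hull s :=
  subset_convexHull ℝ _ hz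

theorem convex_hull (s : Finset E3) : Convex ℝ (hull s) := convex_convexHull ℝ _

/-- Statements on derivatives are checked only inside the tetrahedra; the boundary of a convex set
does not count. -/
theorem interior_hull_ae (s : Finset E3) :
    (interior (hull s) : Set E3) =ᵐ[volume] hull s :=
  interior_ae_eq_of_null_frontier ((convex_hull s).addHaar_frontier volume)

theorem restrict_interior_hull (s : Finset E3) :
    volume.restrict (interior (hull s)) = volume.restrict (hull s) :=
  Measure.restrict_congr_set (interior_hull_ae s)

theorem ae_mem_interior_hull (s : Finset E3) :
    ∀ᵐ x ∂volume.restrict (hull s), x ∈ interior (hull s) := by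
  rw [← restrict_interior_hull]
  exact ae_restrict_mem isOpen_interior.measurableSet

namespace TetMesh

variable {Ω : Set E3} (M : TetMesh Ω) {s t : Finset E3}

theorem mem_cells : s ∈ M.cells ↔ s ∈ M.faces ∧ s.card = 4 := by
  simp [cells]

theorem mem_nodes {z : E3} : z ∈ M.nodes ↔ ∃ s ∈ M.cells, z ∈ s := by
  simp [nodes]

/-- The affine basis of space that consists of the vertices of a tetrahedron. -/
noncomputable def cellBasis (hs : s ∈ M.cells) : AffineBasis s ℝ E3 where
  toFun := (↑)
  ind' := M.indep (M.mem_cells.1 hs).1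
  tot' := by
    rw [(M.indep (M.mem_cells.1 hs).1).affineSpan_eq_top_iff_card_eq_finrank_add_one, finrank_E3]
    simp [(M.mem_cells.1 hs).2]

open Classical in
/-- The barycentric coordinate of the tetrahedron `s` that belongs to the vertex `z`. -/
noncomputable def coord (s : Finset E3) (z : E3) : E3 →ᵃ[ℝ] ℝ :=
  if h : s ∈ M.cells ∧ z ∈ s then (M.cellBasis h.1).coord ⟨z, h.2⟩ else 0

theorem coord_of_notMem {z : E3} (hz : z ∉ s) : M.coord s z = 0 := by
  simp [coord, hz]

theorem coord_of_mem (hs : s ∈ M.cells) {z : E3} (hz : z ∈ s) :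
    M.coord s z = (M.cellBasis hs).coord ⟨z, hz⟩ := by
  simp [coord, hz, hs]

theorem sum_coord_eq {F : Type*} [AddCommGroup F] [Module ℝ F] (hs : s ∈ M.cells) (x : E3)
    (g : E3 → F) :
    ∑ z ∈ s, M.coord s z x • g z = ∑ i : s, (M.cellBasis hs).coord i x • g i := by
  rw [← Finset.sum_coe_sort s]
  exact Finset.sum_congr rfl fun i _ => by rw [M.coord_of_mem hs i.2]

theorem sum_coord (hs : s ∈ M.cells) (x : E3) : ∑ z ∈ s, M.coord s z x = 1 := by
  have := M.sum_coord_eq hs x (fun _ => (1 : ℝ))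
  simp only [smul_eq_mul, mul_one] at this
  rw [this]
  exact (M.cellBasis hs).sum_coord_apply_eq_one x

theorem sum_coord_smul (hs : s ∈ M.cells) (x : E3) : ∑ z ∈ s, M.coord s z x • z = x := by
  rw [M.sum_coord_eq hs x (fun z => z)]
  exact (M.cellBasis hs).linear_combination_coord_eq_self x

theorem coord_vertex (hs : s ∈ M.cells) {y : E3} (hy : y ∈ s) (z : E3) :
    M.coord s z y = if z = y then 1 else 0 := by
  by_cases hz : z ∈ s
  · rw [M.coord_of_mem hs hz]
    have : y = M.cellBasis hs ⟨y, hy⟩ := rfl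
    conv_lhs => rw [this]
    rw [AffineBasis.coord_apply]
    simp [Subtype.ext_iff]
  · rw [M.coord_of_notMem hz, if_neg (fun h : z = y => hz (by rwa [h]))]; rfl

theorem mem_hull_iff (hs : s ∈ M.cells) {x : E3} : x ∈ hull s ↔ ∀ z, 0 ≤ M.coord s z x := by
  have h := (M.cellBasis hs).convexHull_eq_nonneg_coord
  have hr : Set.range (M.cellBasis hs) = (s : Set E3) := by
    change Set.range ((↑) : s → E3) = _
    simp
  rw [hr] at h
  rw [hull, h, Set.mem_setOf_eq]
  constructor
  · intro hx z
    by_cases hz : z ∈ s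
    · rw [M.coord_of_mem hs hz]; exact hx _
    · rw [M.coord_of_notMem hz]; exact le_rfl
  · intro hx i
    rw [← M.coord_of_mem hs i.2]; exact hx _

theorem coord_eq_of_sum (hs : s ∈ M.cells) {w : E3 → ℝ} (hw : ∑ y ∈ s, w y = 1) {z : E3}
    (hz : z ∈ s) : M.coord s z (∑ y ∈ s, w y • y) = w z := by
  rw [affineMap_apply_sum _ hw]
  calc _ = ∑ y ∈ s, if z = y then w y else 0 := Finset.sum_congr rfl fun y hy => by
        rw [M.coord_vertex hs hy]; simp
    _ = w z := by simp [hz]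

/-- Conformity: a common point lies in the hull of the common vertices, so it has weights supported
there. Extended by zero, they are its barycentric coordinates in both tetrahedra by uniqueness. -/
theorem coord_eq_coord (hs : s ∈ M.cells) (ht : t ∈ M.cells) {x : E3} (hxs : x ∈ hull s)
    (hxt : x ∈ hull t) (z : E3) : M.coord s z x = M.coord t z x := by
  classical
  have h1 := M.inter_subset_convexHull (M.mem_cells.1 hs).1 (M.mem_cells.1 ht).1 ⟨hxs, hxt⟩
  rw [← Finset.coe_inter, Finset.mem_convexHull'] at h1
  obtain ⟨w, -, hw1, hwx⟩ := h1
  set w' : E3 → ℝ := fun y => if y ∈ s ∩ t then w y else 0 with hw'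
  have key : ∀ u ∈ M.cells, s ∩ t ⊆ u → M.coord u z x = w' z := by
    intro u hu hsub
    have e1 : ∑ y ∈ u, w' y = 1 := by
      rw [← hw1, ← Finset.sum_subset hsub (fun y _ hy => by simp only [hw', if_neg hy, zero_smul])]
      exact Finset.sum_congr rfl fun y hy => by simp only [hw', if_pos hy]
    have e2 : ∑ y ∈ u, w' y • y = x := by
      rw [← hwx, ← Finset.sum_subset hsub (fun y _ hy => by simp only [hw', if_neg hy, zero_smul])]
      exact Finset.sum_congr rfl fun y hy => by simp only [hw', if_pos hy]
    by_cases hz : z ∈ u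
    · rw [← e2, M.coord_eq_of_sum hu e1 hz]
    · rw [M.coord_of_notMem hz, hw']
      simp only
      rw [if_neg fun h => hz (hsub h)]; rfl
  rw [key s hs Finset.inter_subset_left, key t ht Finset.inter_subset_right]

/-- The arbitrary choice in the definition of `hat` is harmless because any two systems of
barycentric coordinates of a point agree. -/
theorem hat_eq_coord (hs : s ∈ M.cells) {x : E3} (hx : x ∈ hull s) (z : E3) :
    M.hat z x = M.coord s z x := by
  have hb : ∃ w, M.IsBary x w := ⟨fun y => M.coord s y x, s, hs,
    fun y _ => (M.mem_hull_iff hs).1 hx y, fun y hy => by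
      simp only [M.coord_of_notMem hy]; rfl,
    M.sum_coord hs x, M.sum_coord_smul hs x⟩
  rw [hat, dif_pos hb]
  obtain ⟨t, ht, h0, hn, h1, h2⟩ := hb.choose_spec
  have hxt : x ∈ hull t := by
    rw [hull, Finset.mem_convexHull']
    exact ⟨_, h0, h1, h2⟩
  rw [M.coord_eq_coord hs ht hx hxt]
  by_cases hz : z ∈ t
  · have := M.coord_eq_of_sum ht h1 hz
    rw [h2] at this
    exact this.symm
  · rw [M.coord_of_notMem hz, hn z hz]; rfl

theorem closure_eq : closure Ω = ⋃ s ∈ M.cells, hull s := by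
  rw [← M.space_eq]
  apply Set.Subset.antisymm
  · intro x hx
    obtain ⟨f, hf, hxf⟩ := Geometry.SimplicialComplex.mem_space_iff.1 hx
    obtain ⟨t, ht, hft, hc⟩ := M.pure f hf
    exact Set.mem_biUnion (M.mem_cells.2 ⟨ht, hc⟩) (convexHull_mono (by exact_mod_cast hft) hxf)
  · intro x hx
    obtain ⟨s, hs, hx⟩ := Set.mem_iUnion₂.1 hx
    exact Geometry.SimplicialComplex.mem_space_iff.2 ⟨s, (M.mem_cells.1 hs).1, hx⟩

theorem hull_subset (hs : s ∈ M.cells) : hull s ⊆ closure Ω := by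
  rw [M.closure_eq]; exact Set.subset_biUnion_of_mem (u := fun s => hull s) hs

theorem exists_cell {x : E3} (hx : x ∈ closure Ω) : ∃ s ∈ M.cells, x ∈ hull s := by
  rw [M.closure_eq] at hx
  simpa using hx

theorem node_mem_closure {z : E3} (hz : z ∈ M.nodes) : z ∈ closure Ω := by
  obtain ⟨s, hs, hzs⟩ := M.mem_nodes.1 hz
  exact M.hull_subset hs (mem_hull hzs)

theorem mem_nodes_of_mem (hs : s ∈ M.cells) {z : E3} (hz : z ∈ s) : z ∈ M.nodes :=
  M.mem_nodes.2 ⟨s, hs, hz⟩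

theorem hat_nonneg (z x : E3) : 0 ≤ M.hat z x := by
  by_cases hb : ∃ w, M.IsBary x w
  · have hb' := hb
    obtain ⟨w, t, ht, h0, -, h1, h2⟩ := hb'
    have hxt : x ∈ hull t := by
      rw [hull, Finset.mem_convexHull']
      exact ⟨_, h0, h1, h2⟩
    rw [M.hat_eq_coord ht hxt]
    exact (M.mem_hull_iff ht).1 hxt z
  · rw [hat, dif_neg hb]

theorem coord_le_one (hs : s ∈ M.cells) {x : E3} (hx : x ∈ hull s) (z : E3) :
    M.coord s z x ≤ 1 := by
  by_cases hz : z ∈ s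
  · rw [← M.sum_coord hs x]
    exact Finset.single_le_sum (f := fun y => M.coord s y x)
      (fun y _ => (M.mem_hull_iff hs).1 hx y) hz
  · rw [M.coord_of_notMem hz]; simp

theorem hat_node {y : E3} (hy : y ∈ M.nodes) (z : E3) : M.hat z y = if z = y then 1 else 0 := by
  obtain ⟨s, hs, hys⟩ := M.mem_nodes.1 hy
  rw [M.hat_eq_coord hs (mem_hull hys), M.coord_vertex hs hys]

theorem interp_eq (hs : s ∈ M.cells) {x : E3} (hx : x ∈ hull s) (f : E3 → E3) :
    M.interp f x = ∑ z ∈ s, M.coord s z x • f z := by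
  rw [interp]
  calc _ = ∑ z ∈ M.nodes, M.coord s z x • f z :=
        Finset.sum_congr rfl fun z _ => by rw [M.hat_eq_coord hs hx]
    _ = _ := (Finset.sum_subset (fun z hz => M.mem_nodes_of_mem hs hz)
        fun z _ hz => by rw [M.coord_of_notMem hz]; simp).symm

theorem interp_node {y : E3} (hy : y ∈ M.nodes) (f : E3 → E3) : M.interp f y = f y := by
  rw [interp]
  calc _ = ∑ z ∈ M.nodes, if z = y then f z else 0 :=
        Finset.sum_congr rfl fun z _ => by rw [M.hat_node hy]; simp
    _ = f y := by simp [hy]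

/-- A supporting functional at the boundary point `x` is at most `f x` on the closure and strictly
smaller at `z`. A positive weight of `z` in the barycentric representation of `x` would give `f x <
f x`. -/
theorem hat_eq_zero_on_frontier (hΩo : IsOpen Ω) (hΩc : Convex ℝ Ω) {z x : E3}
    (hz : z ∉ frontier Ω) (hx : x ∈ frontier Ω) : M.hat z x = 0 := by
  obtain ⟨s, hs, hxs⟩ := M.exists_cell hx.1
  rw [M.hat_eq_coord hs hxs]
  by_contra hne
  have hzs : z ∈ s := by
    by_contra h; exact hne (by rw [M.coord_of_notMem h]; rfl)
  have hpos : 0 < M.coord s z x := lt_of_le_of_ne ((M.mem_hull_iff hs).1 hxs z) (Ne.symm hne)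
  have hzΩ : z ∈ Ω := by
    by_contra h
    exact hz ⟨M.hull_subset hs (mem_hull hzs), by rwa [hΩo.interior_eq]⟩
  have hxΩ : x ∉ Ω := by have := hx.2; rwa [hΩo.interior_eq] at this
  obtain ⟨f, hf⟩ := geometric_hahn_banach_open_point hΩc hΩo hxΩ
  have hfc : ∀ a ∈ closure Ω, f a ≤ f x := fun a ha =>
    closure_minimal (fun b hb => (hf b hb).le) (isClosed_le f.continuous continuous_const) ha
  have h1 : f x = ∑ y ∈ s, M.coord s y x * f y := by
    conv_lhs => rw [← M.sum_coord_smul hs x]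
    simp
  have h2 : ∑ y ∈ s, M.coord s y x * f y < ∑ y ∈ s, M.coord s y x * f x := by
    refine Finset.sum_lt_sum (fun y hy => mul_le_mul_of_nonneg_left
      (hfc y (M.hull_subset hs (mem_hull hy))) ((M.mem_hull_iff hs).1 hxs y)) ⟨z, hzs, ?_⟩
    exact mul_lt_mul_of_pos_left (hf z hzΩ) hpos
  rw [← h1, ← Finset.sum_mul, M.sum_coord hs, one_mul] at h2
  exact lt_irrefl _ h2

/-! ### Decomposition of integrals -/

/-- Both cells have four vertices, so some vertex `z` of `s` is not in `t`. Its coordinate vanishes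
on the intersection, which therefore lies in a plane. -/
theorem aedisjoint_hull (hs : s ∈ M.cells) (ht : t ∈ M.cells) (hst : s ≠ t) :
    AEDisjoint volume (hull s) (hull t) := by
  obtain ⟨z, hzs, hzt⟩ : ∃ z ∈ s, z ∉ t := by
    by_contra! h
    exact hst (Finset.eq_of_subset_of_card_le h
      (by rw [(M.mem_cells.1 hs).2, (M.mem_cells.1 ht).2]))
  let S : AffineSubspace ℝ E3 := (AffineSubspace.mk' (0 : ℝ) ⊥).comap (M.coord s z)
  have hS : ∀ x, x ∈ S ↔ M.coord s z x = 0 := by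
    intro x
    simp [S, AffineSubspace.mem_comap, AffineSubspace.mem_mk']
  refine measure_mono_null (t := (S : Set E3)) (fun x hx => ?_)
    (Measure.addHaar_affineSubspace volume S fun h => ?_)
  · rw [SetLike.mem_coe, hS, M.coord_eq_coord hs ht hx.1 hx.2, M.coord_of_notMem hzt]; rfl
  · have : z ∈ S := h ▸ AffineSubspace.mem_top ℝ E3 z
    rw [hS, M.coord_vertex hs hzs] at this
    simp at this

theorem restrict_eq (hΩc : Convex ℝ Ω) :
    volume.restrict Ω = ∑ s ∈ M.cells, volume.restrict (hull s) := by
  have hU : (⋃ s ∈ M.cells, hull s) = ⋃ s : M.cells, hull s.1 := by ext; simp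
  rw [← restrict_closure_eq hΩc, M.closure_eq, hU,
    Measure.restrict_iUnion_ae (fun s t hst => M.aedisjoint_hull s.2 t.2 fun h =>
      hst (Subtype.ext h)) (fun s => (measurableSet_hull s.1).nullMeasurableSet),
    Measure.sum_fintype]
  exact Finset.sum_coe_sort M.cells fun s => volume.restrict (hull s)

theorem integral_eq {F : Type*} [NormedAddCommGroup F] [NormedSpace ℝ F] (hΩc : Convex ℝ Ω)
    {f : E3 → F} (hf : ∀ s ∈ M.cells, IntegrableOn f (hull s)) :
    ∫ x in Ω, f x = ∑ s ∈ M.cells, ∫ x in hull s, f x := by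
  rw [M.restrict_eq hΩc, integral_finsetSum_measure hf]

theorem integrableOn_iff {F : Type*} [NormedAddCommGroup F] (hΩc : Convex ℝ Ω) {f : E3 → F} :
    IntegrableOn f Ω ↔ ∀ s ∈ M.cells, IntegrableOn f (hull s) := by
  rw [IntegrableOn, M.restrict_eq hΩc, integrable_finsetSum_measure]; rfl

theorem ae_iff (hΩc : Convex ℝ Ω) {p : E3 → Prop} :
    (∀ᵐ x ∂volume.restrict Ω, p x) ↔ ∀ s ∈ M.cells, ∀ᵐ x ∂volume.restrict (hull s), p x := by
  rw [M.restrict_eq hΩc, ae_finsetSum_measure_iff]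

theorem ae_of_interior (hΩc : Convex ℝ Ω) {p : E3 → Prop}
    (h : ∀ s ∈ M.cells, ∀ x ∈ interior (hull s), p x) : ∀ᵐ x ∂volume.restrict Ω, p x :=
  (M.ae_iff hΩc).2 fun s hs => (ae_mem_interior_hull s).mono fun x hx => h s hs x hx

theorem continuousOn_closure {F : Type*} [TopologicalSpace F] {f : E3 → F}
    (h : ∀ s ∈ M.cells, ContinuousOn f (hull s)) : ContinuousOn f (closure Ω) := by
  rw [M.closure_eq]
  have : ∀ T : Finset (Finset E3), T ⊆ M.cells → ContinuousOn f (⋃ s ∈ T, hull s) := by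
    classical
    intro T
    induction T using Finset.induction_on with
    | empty => intro _; simp
    | insert a T ha ih =>
      intro hT
      rw [Finset.set_biUnion_insert]
      refine (h a (hT (Finset.mem_insert_self a T))).union_of_isClosed
        (ih ((Finset.subset_insert a T).trans hT)) (isCompact_hull a).isClosed ?_
      exact T.finite_toSet.isClosed_biUnion fun s _ => (isCompact_hull s).isClosed
  exact this _ subset_rfl

theorem continuous_coord (s : Finset E3) (z : E3) : Continuous (M.coord s z) :=
  (M.coord s z).continuous_of_finiteDimensional

end TetMesh

end EricksenLeslie

namespace EricksenLeslie
open Filter Topology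

/-! ### Affine and quadratic functions in explicit form -/

section Polynomials

variable {F : Type*} [NormedAddCommGroup F] [NormedSpace ℝ F]

/-- Affine functions, in explicit form. -/
def IsAff (p : E3 → F) : Prop := ∃ (c : F) (L : E3 →L[ℝ] F), ∀ x, p x = c + L x

/-- Quadratic functions, in explicit form. -/
def IsQuad (p : E3 → F) : Prop :=
  ∃ (c : F) (L : E3 →L[ℝ] F) (B : E3 →L[ℝ] E3 →L[ℝ] F), ∀ x, p x = c + L x + B x x

theorem isAff_const (c : F) : IsAff fun _ => c := ⟨c, 0, by simp⟩

theorem isAff_apply (i : Fin 3) : IsAff fun x : E3 => x i :=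
  ⟨0, EuclideanSpace.proj i, by simp⟩

theorem isAff_affineMap (f : E3 →ᵃ[ℝ] F) : IsAff f :=
  ⟨f 0, LinearMap.toContinuousLinearMap f.linear, fun x => by
    rw [congrFun f.decomp x]; simp [add_comm]⟩

theorem IsAff.add {p q : E3 → F} (hp : IsAff p) (hq : IsAff q) : IsAff fun x => p x + q x := by
  obtain ⟨c, L, h⟩ := hp
  obtain ⟨c', L', h'⟩ := hq
  exact ⟨c + c', L + L', fun x => by simp only [h, h', ContinuousLinearMap.add_apply]; abel⟩

theorem IsAff.smul_const {p : E3 → ℝ} (hp : IsAff p) (v : F) : IsAff fun x => p x • v := by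
  obtain ⟨c, L, h⟩ := hp
  exact ⟨c • v, L.smulRight v, fun x => by simp [h, add_smul]⟩

theorem IsAff.sum {ι : Type*} {p : ι → E3 → F} {s : Finset ι} (h : ∀ i ∈ s, IsAff (p i)) :
    IsAff fun x => ∑ i ∈ s, p i x := by
  classical
  induction s using Finset.induction_on with
  | empty => simpa using isAff_const (0 : F)
  | insert a s ha ih =>
    simp_rw [Finset.sum_insert ha]
    exact (h a (by simp)).add (ih fun i hi => h i (by simp [hi]))

theorem IsAff.isQuad {p : E3 → F} (hp : IsAff p) : IsQuad p := by
  obtain ⟨c, L, h⟩ := hp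
  exact ⟨c, L, 0, by simp [h]⟩

theorem IsQuad.add {p q : E3 → F} (hp : IsQuad p) (hq : IsQuad q) :
    IsQuad fun x => p x + q x := by
  obtain ⟨c, L, B, h⟩ := hp
  obtain ⟨c', L', B', h'⟩ := hq
  exact ⟨c + c', L + L', B + B', fun x => by
    simp only [h, h', ContinuousLinearMap.add_apply]; abel⟩

theorem IsQuad.const_smul {p : E3 → F} (hp : IsQuad p) (a : ℝ) : IsQuad fun x => a • p x := by
  obtain ⟨c, L, B, h⟩ := hp
  exact ⟨a • c, a • L, a • B, fun x => by simp [h, smul_add]⟩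

theorem IsQuad.smul_const {p : E3 → ℝ} (hp : IsQuad p) (v : F) : IsQuad fun x => p x • v := by
  obtain ⟨c, L, B, h⟩ := hp
  refine ⟨c • v, L.smulRight v,
    (ContinuousLinearMap.smulRightL ℝ E3 F).flip v ∘L B, fun x => ?_⟩
  simp [h, add_smul]

theorem IsQuad.sum {ι : Type*} {p : ι → E3 → F} {s : Finset ι} (h : ∀ i ∈ s, IsQuad (p i)) :
    IsQuad fun x => ∑ i ∈ s, p i x := by
  classical
  induction s using Finset.induction_on with
  | empty => simpa using (isAff_const (0 : F)).isQuad
  | insert a s ha ih =>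
    simp_rw [Finset.sum_insert ha]
    exact (h a (by simp)).add (ih fun i hi => h i (by simp [hi]))

theorem IsAff.mul {p q : E3 → ℝ} (hp : IsAff p) (hq : IsAff q) : IsQuad fun x => p x * q x := by
  obtain ⟨c, L, h⟩ := hp
  obtain ⟨c', L', h'⟩ := hq
  refine ⟨c * c', c • L' + c' • L, L.smulRight L', fun x => ?_⟩
  simp [h, h']; ring

theorem IsQuad.contDiff {p : E3 → F} (hp : IsQuad p) {n : ℕ∞ω} : ContDiff ℝ n p := by
  obtain ⟨c, L, B, h⟩ := hp
  have : p = fun x => c + L x + B x x := funext h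
  rw [this]
  fun_prop

theorem IsQuad.isAff_fderiv {p : E3 → F} (hp : IsQuad p) : IsAff (fderiv ℝ p) := by
  obtain ⟨c, L, B, h⟩ := hp
  have : p = fun x => c + L x + B x x := funext h
  refine ⟨L, B + B.flip, fun x => ?_⟩
  refine HasFDerivAt.fderiv ?_
  rw [this]
  have h1 : HasFDerivAt (fun x => B x x) (B x + B.flip x) x := by
    have := B.hasFDerivAt_of_bilinear (hasFDerivAt_id x) (hasFDerivAt_id x)
    refine this.congr_fderiv ?_
    ext y
    simp
  exact (((hasFDerivAt_const c x).add L.hasFDerivAt).add h1).congr_fderiv (by simp)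

theorem IsAff.midpoint {p : E3 → F} (hp : IsAff p) (z x : E3) :
    p z = (2 : ℝ) • p (z + (1 / 2 : ℝ) • (x - z)) - p x := by
  obtain ⟨c, L, h⟩ := hp
  rw [h, h, h]; simp only [map_add, map_smul, map_sub]; module

/-- Third differences annihilate quadratics. The value at `z` is thus a combination of values at
images of `x` under homotheties centred at `z` with positive ratios, and these can be integrated
over `x`. -/
theorem IsQuad.third_difference {p : E3 → F} (hp : IsQuad p) (z x : E3) :
    p z = (3 : ℝ) • p (z + (1 / 3 : ℝ) • (x - z)) - (3 : ℝ) • p (z + (2 / 3 : ℝ) • (x - z))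
      + p x := by
  obtain ⟨c, L, B, h⟩ := hp
  rw [h, h, h, h]
  simp only [map_add, map_smul, map_sub, ContinuousLinearMap.add_apply, sub_apply,
    ContinuousLinearMap.smul_apply]
  module

/-- Central differences are exact on quadratics, so a bound on values gives a bound on gradients. -/
theorem IsQuad.central_difference {p : E3 → F} (hp : IsQuad p) (x u : E3) :
    p (x + u) - p (x - u) = (2 : ℝ) • fderiv ℝ p x u := by
  obtain ⟨c, L, B, h⟩ := hp
  have : p = fun x => c + L x + B x x := funext h
  have h1 : HasFDerivAt (fun x => B x x) (B x + B.flip x) x := by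
    have := B.hasFDerivAt_of_bilinear (hasFDerivAt_id x) (hasFDerivAt_id x)
    refine this.congr_fderiv ?_
    ext y
    simp
  have h2 : HasFDerivAt p (L + (B x + B.flip x)) x := by
    rw [this]
    exact (((hasFDerivAt_const c x).add L.hasFDerivAt).add h1).congr_fderiv (by simp)
  rw [h2.fderiv, h, h]
  simp only [map_add, map_sub, ContinuousLinearMap.add_apply, sub_apply,
    ContinuousLinearMap.flip_apply]
  module

theorem isQuad_monomial {a b c : ℕ} (h : a + b + c ≤ 2) :
    IsQuad fun x : E3 => x 0 ^ a * x 1 ^ b * x 2 ^ c := by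
  have X := isAff_apply
  have one : IsAff fun _ : E3 => (1 : ℝ) := isAff_const 1
  have ha : a ≤ 2 := by omega
  have hb : b ≤ 2 := by omega
  have hc : c ≤ 2 := by omega
  have key : ∀ p q : E3 → ℝ, IsAff p → IsAff q →
      (∀ x : E3, x 0 ^ a * x 1 ^ b * x 2 ^ c = p x * q x) →
      IsQuad fun x : E3 => x 0 ^ a * x 1 ^ b * x 2 ^ c := by
    intro p q hp hq hpq
    simp_rw [hpq]; exact hp.mul hq
  interval_cases a <;> interval_cases b <;> interval_cases c <;> first
    | omega
    | exact key _ _ one one (fun x => by ring1)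
    | exact key _ _ one (X 0) (fun x => by ring1)
    | exact key _ _ one (X 1) (fun x => by ring1)
    | exact key _ _ one (X 2) (fun x => by ring1)
    | exact key _ _ (X 0) (X 0) (fun x => by ring1)
    | exact key _ _ (X 0) (X 1) (fun x => by ring1)
    | exact key _ _ (X 0) (X 2) (fun x => by ring1)
    | exact key _ _ (X 1) (X 1) (fun x => by ring1)
    | exact key _ _ (X 1) (X 2) (fun x => by ring1)
    | exact key _ _ (X 2) (X 2) (fun x => by ring1)

theorem isAff_monomial {a b c : ℕ} (h : a + b + c ≤ 1) :
    IsAff fun x : E3 => x 0 ^ a * x 1 ^ b * x 2 ^ c := by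
  have X := isAff_apply
  have one : IsAff fun _ : E3 => (1 : ℝ) := isAff_const 1
  have ha : a ≤ 1 := by omega
  have hb : b ≤ 1 := by omega
  have hc : c ≤ 1 := by omega
  interval_cases a <;> interval_cases b <;> interval_cases c <;> first
    | omega
    | simpa using one
    | simpa using X 0
    | simpa using X 1
    | simpa using X 2

theorem eval_eq_monomials (p : MvPolynomial (Fin 3) ℝ) (x : E3) :
    MvPolynomial.eval (fun i => x i) p
      = ∑ d ∈ p.support, (x 0 ^ d 0 * x 1 ^ d 1 * x 2 ^ d 2) • p.coeff d := by
  rw [MvPolynomial.eval_eq']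
  refine Finset.sum_congr rfl fun d _ => ?_
  rw [Fin.prod_univ_three, smul_eq_mul, mul_comm]

theorem degree_le {p : MvPolynomial (Fin 3) ℝ} {n : ℕ} (hp : p.totalDegree ≤ n)
    {d : Fin 3 →₀ ℕ} (hd : d ∈ p.support) : d 0 + d 1 + d 2 ≤ n := by
  have := (MvPolynomial.le_totalDegree hd).trans hp
  rwa [Finsupp.sum_fintype _ _ (fun _ => rfl), Fin.sum_univ_three] at this

theorem isQuad_eval {p : MvPolynomial (Fin 3) ℝ} (hp : p.totalDegree ≤ 2) :
    IsQuad fun x : E3 => MvPolynomial.eval (fun i => x i) p := by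
  simp_rw [eval_eq_monomials]
  exact IsQuad.sum fun d hd => (isQuad_monomial (degree_le hp hd)).smul_const _

theorem isAff_eval {p : MvPolynomial (Fin 3) ℝ} (hp : p.totalDegree ≤ 1) :
    IsAff fun x : E3 => MvPolynomial.eval (fun i => x i) p := by
  simp_rw [eval_eq_monomials]
  exact IsAff.sum fun d hd => (isAff_monomial (degree_le hp hd)).smul_const _

theorem IsAff.exists_mvPolynomial {f : E3 → ℝ} (hf : IsAff f) :
    ∃ p : MvPolynomial (Fin 3) ℝ, p.totalDegree ≤ 1 ∧
      ∀ x : E3, f x = MvPolynomial.eval (fun i => x i) p := by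
  obtain ⟨c, L, h⟩ := hf
  refine ⟨MvPolynomial.C c + ∑ i, MvPolynomial.C (L (e i)) * MvPolynomial.X i, ?_, fun x => ?_⟩
  · refine (MvPolynomial.totalDegree_add _ _).trans (max_le (by simp) ?_)
    refine (MvPolynomial.totalDegree_finset_sum _ _).trans (Finset.sup_le fun i _ => ?_)
    refine (MvPolynomial.totalDegree_mul _ _).trans ?_
    simp
  · rw [h]
    conv_lhs => rw [← sum_smul_e x]
    simp only [map_sum, map_smul, smul_eq_mul, map_add, map_mul, MvPolynomial.eval_C,
      MvPolynomial.eval_X]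
    congr 1
    refine Finset.sum_congr rfl fun i _ => ?_
    ring

end Polynomials

/-! ### Inverse estimates -/

section Inverse

variable {F : Type*} [NormedAddCommGroup F] [NormedSpace ℝ F] {K : Set E3}

theorem homothety_mem (hK : Convex ℝ K) {z x : E3} (hz : z ∈ K) (hx : x ∈ K) {t : ℝ}
    (ht : 0 ≤ t) (ht1 : t ≤ 1) : z + t • (x - z) ∈ K :=
  hK.add_smul_sub_mem hz hx ⟨ht, ht1⟩

theorem setIntegral_homothety_le (hK : Convex ℝ K) (hKc : IsCompact K) {Φ : E3 → ℝ}
    (hΦ : Continuous Φ) (h0 : ∀ x ∈ K, 0 ≤ Φ x) {z : E3} (hz : z ∈ K) {t : ℝ} (ht : 0 < t)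
    (ht1 : t ≤ 1) : ∫ x in K, Φ (z + t • (x - z)) ≤ (t ^ 3)⁻¹ * ∫ x in K, Φ x := by
  have hKm := hKc.isClosed.measurableSet
  have hi0 : 0 ≤ ∫ x in K, Φ x := setIntegral_nonneg hKm h0
  rw [← ENNReal.ofReal_le_ofReal_iff (by positivity), ENNReal.ofReal_mul (by positivity),
    ofReal_integral_eq_lintegral_ofReal, ofReal_integral_eq_lintegral_ofReal]
  · have := setLIntegral_comp_add_smul_le (fun x => ENNReal.ofReal (Φ x)) (z - t • z) ht.ne'
      hKm hKm (K' := K) (fun x hx => by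
        have := homothety_mem hK hz hx ht.le ht1
        rwa [show z + t • (x - z) = z - t • z + t • x by module] at this)
    rw [abs_of_pos ht] at this
    refine le_trans (le_of_eq (lintegral_congr fun x => ?_)) this
    rw [show z + t • (x - z) = z - t • z + t • x by module]
  · exact hΦ.continuousOn.integrableOn_compact hKc
  · exact (ae_restrict_mem hKm).mono fun x hx => h0 x hx
  · exact (hΦ.comp (by fun_prop)).continuousOn.integrableOn_compact hKc
  · exact (ae_restrict_mem hKm).mono fun x hx => h0 _ (homothety_mem hK hz hx ht.le ht1)

theorem pow_sum_three_le {a b c : ℝ} (ha : 0 ≤ a) (hb : 0 ≤ b) (hc : 0 ≤ c) (n : ℕ) :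
    (3 * a + 3 * b + c) ^ n ≤ 7 ^ n * (a ^ n + b ^ n + c ^ n) := by
  have h1 : 3 * a + 3 * b + c ≤ 7 * max a (max b c) := by
    have := le_max_left a (max b c)
    have h2 := (le_max_left b c).trans (le_max_right a (max b c))
    have h3 := (le_max_right b c).trans (le_max_right a (max b c))
    linarith
  have h2 : max a (max b c) ^ n ≤ a ^ n + b ^ n + c ^ n := by
    have ha' := pow_nonneg ha n
    have hb' := pow_nonneg hb n
    have hc' := pow_nonneg hc n
    rcases max_choice a (max b c) with h | h <;> rw [h]
    · linarith
    · rcases max_choice b c with h | h <;> rw [h] <;> linarith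
  calc _ ≤ (7 * max a (max b c)) ^ n := by gcongr
    _ = 7 ^ n * max a (max b c) ^ n := mul_pow _ _ _
    _ ≤ _ := by gcongr

/-- Integrate the third difference identity over `x` in `K`. The homotheties of ratio `1/3` and
`2/3` cost `27` and `27/8`; with the unscaled term the sum stays below 32. The factor `7 ^ n` is the
sum `3 + 3 + 1` of the coefficients, raised to the power. -/
theorem IsQuad.volume_mul_norm_pow_le {p : E3 → F} (hp : IsQuad p) (hK : Convex ℝ K)
    (hKc : IsCompact K) {z : E3} (hz : z ∈ K) (n : ℕ) :
    volume.real K * ‖p z‖ ^ n ≤ 32 * 7 ^ n * ∫ x in K, ‖p x‖ ^ n := by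
  have hc : Continuous fun x => ‖p x‖ ^ n := (hp.contDiff (n := 0)).continuous.norm.pow n
  have hi : ∀ t : ℝ, IntegrableOn (fun x => ‖p (z + t • (x - z))‖ ^ n) K := fun t =>
    (hc.comp (by fun_prop : Continuous fun x => z + t • (x - z))).continuousOn.integrableOn_compact
      hKc
  have hi1 : IntegrableOn (fun x => ‖p x‖ ^ n) K := hc.continuousOn.integrableOn_compact hKc
  have hh := fun t ht ht1 => setIntegral_homothety_le hK hKc hc (fun x _ => by positivity) hz
    (t := t) ht ht1
  have hI : 0 ≤ ∫ x in K, ‖p x‖ ^ n := integral_nonneg fun x => by positivity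
  calc volume.real K * ‖p z‖ ^ n = ∫ x in K, ‖p z‖ ^ n := by
        rw [setIntegral_const, smul_eq_mul]
    _ ≤ ∫ x in K, 7 ^ n * (‖p (z + (1 / 3 : ℝ) • (x - z))‖ ^ n
        + ‖p (z + (2 / 3 : ℝ) • (x - z))‖ ^ n + ‖p x‖ ^ n) := by
        refine integral_mono (integrableOn_const hKc.measure_lt_top.ne)
          ((((hi _).add (hi _)).add hi1).const_mul _) fun x => ?_
        refine le_trans ?_ (pow_sum_three_le (norm_nonneg _) (norm_nonneg _) (norm_nonneg _) n)
        refine pow_le_pow_left₀ (norm_nonneg _) ?_ n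
        rw [hp.third_difference z x]
        refine (norm_add_le _ _).trans (add_le_add ((norm_sub_le _ _).trans ?_) le_rfl)
        rw [norm_smul, norm_smul]; norm_num
    _ = 7 ^ n * ((∫ x in K, ‖p (z + (1 / 3 : ℝ) • (x - z))‖ ^ n)
        + (∫ x in K, ‖p (z + (2 / 3 : ℝ) • (x - z))‖ ^ n) + ∫ x in K, ‖p x‖ ^ n) := by
        rw [integral_const_mul]
        congr 1
        rw [← integral_add (hi _) (hi _)]
        exact integral_add ((hi _).add (hi _)) hi1
    _ ≤ 7 ^ n * (27 * (∫ x in K, ‖p x‖ ^ n) + (27 / 8) * (∫ x in K, ‖p x‖ ^ n)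
        + ∫ x in K, ‖p x‖ ^ n) := by
        have a := hh (1 / 3) (by norm_num) (by norm_num)
        have b := hh (2 / 3) (by norm_num) (by norm_num)
        norm_num at a b ⊢
        gcongr
    _ ≤ _ := by
        have : (0 : ℝ) ≤ 7 ^ n := by positivity
        nlinarith [mul_nonneg this hI]

/-- The case `n = 2`: `32 * 7 ^ 2 = 1568`. -/
theorem IsAff.volume_mul_norm_sq_le {p : E3 → F} (hp : IsAff p) (hK : Convex ℝ K)
    (hKc : IsCompact K) {z : E3} (hz : z ∈ K) :
    volume.real K * ‖p z‖ ^ 2 ≤ 1568 * ∫ x in K, ‖p x‖ ^ 2 := by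
  have := hp.isQuad.volume_mul_norm_pow_le hK hKc hz 2
  norm_num at this
  exact this

/-- A central difference bounds the gradient by `S / q` at any centre of a ball of radius `q` inside
`K`. This applies at `c` with `q = r` and at the midpoint of `x` and `c` with `q = r / 2`. The
gradient is affine, so its value at `x` is twice the midpoint value minus the value at `c`: `4 + 1 =
5`. -/
theorem IsQuad.norm_fderiv_le {p : E3 → F} (hp : IsQuad p) (hK : Convex ℝ K) {c : E3} {r : ℝ}
    (hr : 0 < r) (hc : Metric.closedBall c r ⊆ K) {S : ℝ} (hS : ∀ x ∈ K, ‖p x‖ ≤ S) {x : E3}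
    (hx : x ∈ K) : ‖fderiv ℝ p x‖ ≤ 5 * S / r := by
  have hcK : c ∈ K := hc (Metric.mem_closedBall_self hr.le)
  have hS0 : 0 ≤ S := (norm_nonneg _).trans (hS c hcK)
  have key : ∀ y : E3, ∀ q : ℝ, 0 < q → (∀ u : E3, ‖u‖ ≤ q → y + u ∈ K) →
      ‖fderiv ℝ p y‖ ≤ S / q := by
    intro y q hq hy
    refine ContinuousLinearMap.opNorm_le_bound _ (by positivity) fun u => ?_
    rcases eq_or_ne u 0 with rfl | hu
    · simp
    have hu' : 0 < ‖u‖ := norm_pos_iff.2 hu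
    have hw : ‖(q / ‖u‖) • u‖ ≤ q := by
      rw [norm_smul, Real.norm_of_nonneg (by positivity)]; field_simp; rfl
    have h1 := hp.central_difference y ((q / ‖u‖) • u)
    have h2 : ‖p (y + (q / ‖u‖) • u) - p (y - (q / ‖u‖) • u)‖ ≤ S + S := by
      refine (norm_sub_le _ _).trans (add_le_add (hS _ (hy _ hw)) (hS _ ?_))
      rw [sub_eq_add_neg]
      exact hy _ (by rwa [norm_neg])
    rw [h1, norm_smul, map_smul, norm_smul, Real.norm_of_nonneg (by positivity : 0 ≤ q / ‖u‖)] at h2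
    norm_num at h2
    have h3 : q / ‖u‖ * ‖fderiv ℝ p y u‖ ≤ S := by linarith
    rw [div_mul_eq_mul_div, div_le_iff₀ hu'] at h3
    rw [div_mul_eq_mul_div, le_div_iff₀ hq]
    linarith
  have h1 := key c r hr fun u hu => hc (by simpa [dist_eq_norm] using hu)
  have h2 := key (x + (1 / 2 : ℝ) • (c - x)) (r / 2) (by positivity) fun u hu => by
    have h3 : c + (2 : ℝ) • u ∈ K := hc (by
      simp only [Metric.mem_closedBall, dist_eq_norm, add_sub_cancel_left, norm_smul]
      norm_num; linarith)
    have := homothety_mem hK hx h3 (by norm_num : (0 : ℝ) ≤ 1 / 2) (by norm_num)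
    convert this using 1
    module
  rw [hp.isAff_fderiv.midpoint x c]
  refine (norm_sub_le _ _).trans ?_
  rw [norm_smul]
  calc _ ≤ 2 * (S / (r / 2)) + S / r := by norm_num; linarith
    _ = 5 * S / r := by field_simp; ring

end Inverse

end EricksenLeslie

/-! ### Piecewise smooth functions on a mesh and the lumped quadrature -/

namespace EricksenLeslie
open Filter Topology

namespace TetMesh

variable {Ω : Set E3} (M : TetMesh Ω) {s t : Finset E3}
variable {F X Y : Type*} [NormedAddCommGroup F] [NormedSpace ℝ F] [NormedAddCommGroup X]
  [NormedSpace ℝ X] [NormedAddCommGroup Y] [NormedSpace ℝ Y]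

/-- Functions that are continuous up to the boundary on the interior of every tetrahedron. -/
def PwCont (g : E3 → F) : Prop :=
  ∀ s ∈ M.cells, ∃ p : E3 → F, Continuous p ∧ ∀ x ∈ interior (hull s), g x = p x

/-- Continuous functions that are `C¹` on every tetrahedron. -/
def PwC1 (f : E3 → F) : Prop :=
  ∀ s ∈ M.cells, ∃ p : E3 → F, ContDiff ℝ 1 p ∧ ∀ x ∈ hull s, f x = p x

/-- Continuous functions that are quadratic on every tetrahedron. -/
def PwQuad (f : E3 → F) : Prop :=
  ∀ s ∈ M.cells, ∃ p : E3 → F, IsQuad p ∧ ∀ x ∈ hull s, f x = p x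

/-- Continuous functions that are affine on every tetrahedron. -/
def PwAff (f : E3 → F) : Prop :=
  ∀ s ∈ M.cells, ∃ p : E3 → F, IsAff p ∧ ∀ x ∈ hull s, f x = p x

variable {M}

theorem PwAff.pwQuad {f : E3 → F} (h : M.PwAff f) : M.PwQuad f := fun s hs => by
  obtain ⟨p, hp, h⟩ := h s hs
  exact ⟨p, hp.isQuad, h⟩

theorem PwQuad.pwC1 {f : E3 → F} (h : M.PwQuad f) : M.PwC1 f := fun s hs => by
  obtain ⟨p, hp, h⟩ := h s hs
  exact ⟨p, hp.contDiff, h⟩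

theorem PwC1.pwCont {f : E3 → F} (h : M.PwC1 f) : M.PwCont f := fun s hs => by
  obtain ⟨p, hp, h⟩ := h s hs
  exact ⟨p, hp.continuous, fun x hx => h x (interior_subset hx)⟩

theorem PwC1.continuousOn {f : E3 → F} (h : M.PwC1 f) : ContinuousOn f (closure Ω) :=
  M.continuousOn_closure fun s hs => by
    obtain ⟨p, hp, h⟩ := h s hs
    exact hp.continuous.continuousOn.congr h

theorem fderiv_eq_of_eqOn {f p : E3 → F} (h : ∀ x ∈ hull s, f x = p x) {x : E3}
    (hx : x ∈ interior (hull s)) : fderiv ℝ f x = fderiv ℝ p x :=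
  Filter.EventuallyEq.fderiv_eq (by
    filter_upwards [isOpen_interior.mem_nhds hx] with y hy using h y (interior_subset hy))

theorem PwC1.differentiableAt {f : E3 → F} (h : M.PwC1 f) (hs : s ∈ M.cells) {x : E3}
    (hx : x ∈ interior (hull s)) : DifferentiableAt ℝ f x := by
  obtain ⟨p, hp, h⟩ := h s hs
  refine (hp.differentiable (by norm_num) x).congr_of_eventuallyEq ?_
  filter_upwards [isOpen_interior.mem_nhds hx] with y hy using h y (interior_subset hy)

theorem PwC1.pwCont_fderiv {f : E3 → F} (h : M.PwC1 f) : M.PwCont (fderiv ℝ f) := fun s hs => by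
  obtain ⟨p, hp, h⟩ := h s hs
  exact ⟨fderiv ℝ p, hp.continuous_fderiv (by norm_num), fun x hx => fderiv_eq_of_eqOn h hx⟩

theorem PwCont.prodMk {f : E3 → X} {g : E3 → Y} (hf : M.PwCont f) (hg : M.PwCont g) :
    M.PwCont fun x => (f x, g x) := fun s hs => by
  obtain ⟨p, hp, h⟩ := hf s hs
  obtain ⟨q, hq, h'⟩ := hg s hs
  exact ⟨fun x => (p x, q x), hp.prodMk hq, fun x hx => by simp only [h x hx, h' x hx]⟩

theorem PwCont.comp {f : E3 → X} (hf : M.PwCont f) {φ : X → F} (hφ : Continuous φ) :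
    M.PwCont fun x => φ (f x) := fun s hs => by
  obtain ⟨p, hp, h⟩ := hf s hs
  exact ⟨fun x => φ (p x), hφ.comp hp, fun x hx => by simp only [h x hx]⟩

theorem PwCont.comp₂ {f : E3 → X} {g : E3 → Y} (hf : M.PwCont f) (hg : M.PwCont g)
    (φ : X → Y → F) (hφ : Continuous fun p : X × Y => φ p.1 p.2) :
    M.PwCont fun x => φ (f x) (g x) :=
  (hf.prodMk hg).comp hφ

theorem PwC1.prodMk {f : E3 → X} {g : E3 → Y} (hf : M.PwC1 f) (hg : M.PwC1 g) :
    M.PwC1 fun x => (f x, g x) := fun s hs => by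
  obtain ⟨p, hp, h⟩ := hf s hs
  obtain ⟨q, hq, h'⟩ := hg s hs
  exact ⟨fun x => (p x, q x), hp.prodMk hq, fun x hx => by simp only [h x hx, h' x hx]⟩

theorem PwC1.comp {f : E3 → X} (hf : M.PwC1 f) {φ : X → F} (hφ : ContDiff ℝ 1 φ) :
    M.PwC1 fun x => φ (f x) := fun s hs => by
  obtain ⟨p, hp, h⟩ := hf s hs
  exact ⟨fun x => φ (p x), hφ.comp hp, fun x hx => by simp only [h x hx]⟩

theorem PwC1.comp₂ {f : E3 → X} {g : E3 → Y} (hf : M.PwC1 f) (hg : M.PwC1 g)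
    (φ : X → Y → F) (hφ : ContDiff ℝ 1 fun p : X × Y => φ p.1 p.2) :
    M.PwC1 fun x => φ (f x) (g x) :=
  (hf.prodMk hg).comp hφ

theorem PwCont.integrableOn_hull {g : E3 → F} (hg : M.PwCont g) (hs : s ∈ M.cells) :
    IntegrableOn g (hull s) := by
  obtain ⟨p, hp, h⟩ := hg s hs
  refine (hp.continuousOn.integrableOn_compact (isCompact_hull s)).congr ?_
  exact (ae_mem_interior_hull s).mono fun x hx => (h x hx).symm

theorem PwCont.integrableOn (hΩc : Convex ℝ Ω) {g : E3 → F} (hg : M.PwCont g) :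
    IntegrableOn g Ω :=
  (M.integrableOn_iff hΩc).2 fun _ hs => hg.integrableOn_hull hs

theorem PwCont.integral_eq (hΩc : Convex ℝ Ω) {g : E3 → F} (hg : M.PwCont g) :
    ∫ x in Ω, g x = ∑ s ∈ M.cells, ∫ x in hull s, g x :=
  M.integral_eq hΩc fun _ hs => hg.integrableOn_hull hs

theorem PwC1.ae_differentiableAt (hΩc : Convex ℝ Ω) {f : E3 → F} (h : M.PwC1 f) :
    ∀ᵐ x ∂volume.restrict Ω, DifferentiableAt ℝ f x :=
  M.ae_of_interior hΩc fun _ hs _ hx => h.differentiableAt hs hx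

theorem fderiv_linComb (hΩc : Convex ℝ Ω) {f g : E3 → F} (hf : M.PwC1 f) (hg : M.PwC1 g)
    (a b : ℝ) : ∀ᵐ x ∂volume.restrict Ω,
      fderiv ℝ (fun x => a • f x + b • g x) x = a • fderiv ℝ f x + b • fderiv ℝ g x := by
  filter_upwards [hf.ae_differentiableAt hΩc, hg.ae_differentiableAt hΩc] with x h1 h2
  exact ((h1.hasFDerivAt.const_smul a).add (h2.hasFDerivAt.const_smul b)).fderiv

theorem fderiv_congr_ae (hΩc : Convex ℝ Ω) (M : TetMesh Ω) {f g : E3 → F}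
    (h : ∀ x ∈ closure Ω, f x = g x) :
    ∀ᵐ x ∂volume.restrict Ω, fderiv ℝ f x = fderiv ℝ g x :=
  M.ae_of_interior hΩc fun _ hs _ hx =>
    fderiv_eq_of_eqOn (fun y hy => h y (M.hull_subset hs hy)) hx

variable (M)

theorem interior_hull_nonempty (hs : s ∈ M.cells) : (interior (hull s)).Nonempty := by
  have h := (M.cellBasis hs).centroid_mem_interior_convexHull
  have hr : Set.range (M.cellBasis hs) = (s : Set E3) := by
    change Set.range ((↑) : s → E3) = _
    simp
  rw [hr] at h
  exact ⟨_, h⟩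

theorem volume_hull_pos (hs : s ∈ M.cells) : 0 < volume.real (hull s) := by
  refine ENNReal.toReal_pos ?_ (isCompact_hull s).measure_lt_top.ne
  exact (lt_of_lt_of_le (isOpen_interior.measure_pos volume (M.interior_hull_nonempty hs))
    (measure_mono interior_subset)).ne'

/-- A tetrahedron is convex with nonempty interior, so derivatives within it are unique even at its
vertices. -/
theorem cellGrad_eq (hs : s ∈ M.cells) {f p : E3 → E3} (hp : ContDiff ℝ 1 p)
    (h : ∀ x ∈ hull s, f x = p x) {z : E3} (hz : z ∈ hull s) :
    cellGrad f s z = fderiv ℝ p z := by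
  rw [cellGrad, fderivWithin_congr h (h z hz)]
  exact (hp.differentiable (by norm_num) z).fderivWithin
    (uniqueDiffOn_convex (convex_hull s) (M.interior_hull_nonempty hs) z hz)

/-! ### Piecewise polynomials -/

variable {M}

theorem isPiecewisePoly_of {m : ℕ} {f : E3 → ℝ} (h : ∀ s ∈ M.cells,
    ∃ p : MvPolynomial (Fin 3) ℝ, p.totalDegree ≤ m ∧
      ∀ x ∈ hull s, f x = MvPolynomial.eval (fun i => x i) p) : M.IsPiecewisePoly m f := by
  refine ⟨M.continuousOn_closure fun s hs => ?_, h⟩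
  obtain ⟨p, -, hp⟩ := h s hs
  refine ContinuousOn.congr ?_ hp
  exact ((MvPolynomial.continuous_eval p).comp
    (by fun_prop : Continuous fun x : E3 => fun i => x i)).continuousOn

theorem IsPiecewisePoly.linComb {m : ℕ} {f g : E3 → ℝ} (hf : M.IsPiecewisePoly m f)
    (hg : M.IsPiecewisePoly m g) (a b : ℝ) : M.IsPiecewisePoly m fun x => a * f x + b * g x :=
  isPiecewisePoly_of fun s hs => by
    obtain ⟨p, hp, h⟩ := hf.2 s hs
    obtain ⟨q, hq, h'⟩ := hg.2 s hs
    refine ⟨a • p + b • q, (MvPolynomial.totalDegree_add _ _).trans (max_le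
      ((MvPolynomial.totalDegree_smul_le _ _).trans hp)
      ((MvPolynomial.totalDegree_smul_le _ _).trans hq)), fun x hx => ?_⟩
    rw [h x hx, h' x hx]; simp

theorem isPiecewisePoly_zero (m : ℕ) : M.IsPiecewisePoly m fun _ => 0 :=
  isPiecewisePoly_of fun _ _ => ⟨0, by simp, by simp⟩

theorem IsPiecewisePoly.mul {m n : ℕ} {f g : E3 → ℝ} (hf : M.IsPiecewisePoly m f)
    (hg : M.IsPiecewisePoly n g) : M.IsPiecewisePoly (m + n) fun x => f x * g x :=
  isPiecewisePoly_of fun s hs => by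
    obtain ⟨p, hp, h⟩ := hf.2 s hs
    obtain ⟨q, hq, h'⟩ := hg.2 s hs
    exact ⟨p * q, (MvPolynomial.totalDegree_mul _ _).trans (add_le_add hp hq), fun x hx => by
      rw [h x hx, h' x hx]; simp⟩

theorem IsPiecewisePoly.mono {m n : ℕ} (hmn : m ≤ n) {f : E3 → ℝ} (hf : M.IsPiecewisePoly m f) :
    M.IsPiecewisePoly n f :=
  isPiecewisePoly_of fun s hs => by
    obtain ⟨p, hp, h⟩ := hf.2 s hs
    exact ⟨p, hp.trans hmn, h⟩

theorem IsPiecewisePoly.sum {ι : Type*} {m : ℕ} {S : Finset ι} {f : ι → E3 → ℝ} (c : ι → ℝ)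
    (hf : ∀ i ∈ S, M.IsPiecewisePoly m (f i)) :
    M.IsPiecewisePoly m fun x => ∑ i ∈ S, f i x * c i := by
  classical
  induction S using Finset.induction_on with
  | empty => simpa using isPiecewisePoly_zero m
  | insert a S ha ih =>
    have := (hf a (by simp)).linComb (ih fun i hi => hf i (by simp [hi])) (c a) 1
    simpa [Finset.sum_insert ha, mul_comm] using this

theorem isPiecewisePoly_hat (z : E3) : M.IsPiecewisePoly 1 (M.hat z) :=
  isPiecewisePoly_of fun s hs => by
    obtain ⟨p, hp, h⟩ := (isAff_affineMap (M.coord s z)).exists_mvPolynomial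
    exact ⟨p, hp, fun x hx => by rw [M.hat_eq_coord hs hx, h]⟩

theorem IsPiecewisePoly.pwAff {f : E3 → ℝ} (hf : M.IsPiecewisePoly 1 f) : M.PwAff f :=
  fun s hs => by
    obtain ⟨p, hp, h⟩ := hf.2 s hs
    exact ⟨_, isAff_eval hp, h⟩

theorem pwAff_hat (z : E3) : M.PwAff (M.hat z) := (isPiecewisePoly_hat z).pwAff

theorem MemZ.pwAff {y : E3 → E3} (hy : M.MemZ y) : M.PwAff y := fun s hs => by
  choose p hp h using fun i => (hy i).2 s hs
  refine ⟨fun x => ∑ i, MvPolynomial.eval (fun i => x i) (p i) • e i,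
    IsAff.sum fun i _ => (isAff_eval (hp i)).smul_const _, fun x hx => ?_⟩
  conv_lhs => rw [← sum_smul_e (y x)]
  exact Finset.sum_congr rfl fun i _ => congrArg (· • e i) (h i x hx)

theorem MemV.pwQuad {v : E3 → E3} (hv : M.MemV v) : M.PwQuad v := fun s hs => by
  choose p hp h using fun i => (hv.1 i).2 s hs
  refine ⟨fun x => ∑ i, MvPolynomial.eval (fun i => x i) (p i) • e i,
    IsQuad.sum fun i _ => (isQuad_eval (hp i)).smul_const _, fun x hx => ?_⟩
  conv_lhs => rw [← sum_smul_e (v x)]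
  exact Finset.sum_congr rfl fun i _ => congrArg (· • e i) (h i x hx)

theorem MemV.pwC1 {v : E3 → E3} (hv : M.MemV v) : M.PwC1 v := hv.pwQuad.pwC1

theorem MemZ.pwC1 {v : E3 → E3} (hv : M.MemZ v) : M.PwC1 v := hv.pwAff.pwQuad.pwC1

theorem memZ_interp (f : E3 → E3) : M.MemZ (M.interp f) := fun i => by
  have : (fun x => M.interp f x i) = fun x => ∑ z ∈ M.nodes, M.hat z x * f z i := by
    funext x; simp [interp]
  rw [this]
  exact IsPiecewisePoly.sum _ fun z _ => isPiecewisePoly_hat z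

theorem memY_interp (hΩo : IsOpen Ω) (hΩc : Convex ℝ Ω) {f : E3 → E3}
    (hf : ∀ z ∈ M.nodes, z ∈ frontier Ω → f z = 0) : M.MemY (M.interp f) := by
  refine ⟨memZ_interp f, fun x hx => Finset.sum_eq_zero fun z hz => ?_⟩
  by_cases hzf : z ∈ frontier Ω
  · rw [hf z hz hzf, smul_zero]
  · rw [M.hat_eq_zero_on_frontier hΩo hΩc hzf hx, zero_smul]

theorem MemZ.linComb {y y' : E3 → E3} (hy : M.MemZ y) (hy' : M.MemZ y') (a b : ℝ) :
    M.MemZ fun x => a • y x + b • y' x := fun i => by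
  simpa using (hy i).linComb (hy' i) a b

theorem MemY.linComb {y y' : E3 → E3} (hy : M.MemY y) (hy' : M.MemY y') (a b : ℝ) :
    M.MemY fun x => a • y x + b • y' x :=
  ⟨hy.1.linComb hy'.1 a b, fun x hx => by simp [hy.2 x hx, hy'.2 x hx]⟩

theorem IsPiecewisePoly.congr {m : ℕ} {f g : E3 → ℝ} (hf : M.IsPiecewisePoly m f)
    (h : ∀ x ∈ closure Ω, g x = f x) : M.IsPiecewisePoly m g :=
  isPiecewisePoly_of fun s hs => by
    obtain ⟨p, hp, h'⟩ := hf.2 s hs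
    exact ⟨p, hp, fun x hx => by rw [h x (M.hull_subset hs hx), h' x hx]⟩

theorem MemZ.congr {y y' : E3 → E3} (hy : M.MemZ y) (h : ∀ x ∈ closure Ω, y' x = y x) :
    M.MemZ y' := fun i => (hy i).congr fun x hx => by rw [h x hx]

theorem MemY.congr {y y' : E3 → E3} (hy : M.MemY y) (h : ∀ x ∈ closure Ω, y' x = y x) :
    M.MemY y' := ⟨hy.1.congr h, fun x hx => by rw [h x hx.1, hy.2 x hx]⟩

theorem _root_.EricksenLeslie.IsAff.eq_sum_coord (hs : s ∈ M.cells) {p : E3 → F} (hp : IsAff p)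
    (x : E3) : p x = ∑ z ∈ s, M.coord s z x • p z := by
  obtain ⟨c, L, h⟩ := hp
  have h1 := M.sum_coord hs x
  conv_lhs => rw [h, ← M.sum_coord_smul hs x, map_sum]
  simp_rw [h, smul_add, Finset.sum_add_distrib, ← Finset.sum_smul, h1, one_smul, map_smul]

theorem PwAff.eq_sum_coord (hs : s ∈ M.cells) {f : E3 → F} (hf : M.PwAff f) {x : E3}
    (hx : x ∈ hull s) : f x = ∑ z ∈ s, M.coord s z x • f z := by
  obtain ⟨p, hp, h⟩ := hf s hs
  rw [h x hx, hp.eq_sum_coord hs x]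
  exact Finset.sum_congr rfl fun z hz => by rw [h z (mem_hull hz)]

theorem pwCont_divg {v : E3 → E3} (hv : M.PwC1 v) : M.PwCont (divg v) :=
  hv.pwCont_fderiv.comp (φ := fun A : Mat3 => ∑ i, (A (e i)) i) (by fun_prop)

theorem divg_linComb {v u : E3 → E3} {x : E3} {a b : ℝ}
    (h : fderiv ℝ (fun x => a • v x + b • u x) x = a • fderiv ℝ v x + b • fderiv ℝ u x) :
    divg (fun x => a • v x + b • u x) x = a * divg v x + b * divg u x := by
  simp [divg, h, Finset.sum_add_distrib, Finset.mul_sum]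

theorem MemV.linComb (hΩc : Convex ℝ Ω) {v u : E3 → E3} (hv : M.MemV v) (hu : M.MemV u)
    (a b : ℝ) : M.MemV fun x => a • v x + b • u x := by
  refine ⟨fun i => by simpa using (hv.1 i).linComb (hu.1 i) a b,
    fun x hx => by simp [hv.2.1 x hx, hu.2.1 x hx], fun q hq => ?_⟩
  have hqc : M.PwCont q := hq.1.pwAff.pwQuad.pwC1.pwCont
  have i1 := ((pwCont_divg hv.pwC1).comp₂ hqc (fun a b => a * b) (by fun_prop)).integrableOn hΩc
  have i2 := ((pwCont_divg hu.pwC1).comp₂ hqc (fun a b => a * b) (by fun_prop)).integrableOn hΩc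
  calc _ = ∫ x in Ω, (a * (divg v x * q x) + b * (divg u x * q x)) := by
        refine integral_congr_ae ?_
        filter_upwards [fderiv_linComb hΩc hv.pwC1 hu.pwC1 a b] with x hx
        rw [divg_linComb hx]; ring
    _ = 0 := by
        rw [integral_add (i1.const_mul a) (i2.const_mul b), integral_const_mul,
          integral_const_mul, hv.2.2 q hq, hu.2.2 q hq]
        simp

/-! ### Lumped quadrature -/

variable (M)

/-- The weight of the vertex `z` of the tetrahedron `s` in the lumped quadrature rule. -/
noncomputable def mass (s : Finset E3) (z : E3) : ℝ := ∫ x in hull s, M.hat z x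

theorem mass_eq (hs : s ∈ M.cells) (z : E3) : M.mass s z = ∫ x in hull s, M.coord s z x :=
  setIntegral_congr_fun (measurableSet_hull s) fun _ hx => M.hat_eq_coord hs hx z

theorem mass_nonneg (s : Finset E3) (z : E3) : 0 ≤ M.mass s z :=
  integral_nonneg fun x => M.hat_nonneg z x

theorem lumpedCells_eq (f : Finset E3 → E3 → ℝ) :
    M.lumpedCells f = ∑ p ∈ M.cells.sigma (fun s => s), f p.1 p.2 * M.mass p.1 p.2 := by
  rw [Finset.sum_sigma]; rfl

theorem integrableOn_coord (s : Finset E3) (z : E3) : IntegrableOn (M.coord s z) (hull s) :=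
  (M.continuous_coord s z).continuousOn.integrableOn_compact (isCompact_hull s)

theorem integral_hat (hΩc : Convex ℝ Ω) (z : E3) :
    ∫ x in Ω, M.hat z x = ∑ s ∈ M.cells, M.mass s z :=
  (pwAff_hat z).pwQuad.pwC1.pwCont.integral_eq hΩc

theorem mass_of_notMem (hs : s ∈ M.cells) {z : E3} (hz : z ∉ s) : M.mass s z = 0 := by
  rw [M.mass_eq hs, M.coord_of_notMem hz]; simp

theorem sum_nodes_eq (hΩc : Convex ℝ Ω) (g : E3 → ℝ) :
    ∑ z ∈ M.nodes, g z * ∫ x in Ω, M.hat z x = M.lumpedCells fun _ z => g z := by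
  simp_rw [M.integral_hat hΩc, Finset.mul_sum]
  rw [Finset.sum_comm]
  refine Finset.sum_congr rfl fun s hs => ?_
  exact (Finset.sum_subset (fun z hz => M.mem_nodes_of_mem hs hz)
    fun z _ hz => by rw [M.mass_of_notMem hs hz, mul_zero]).symm

/-- Writing nodal sums as sums over pairs of a cell and a vertex brings all terms of the scheme
under one sum, where they can be compared pair by pair. -/
theorem lumped_eq (hΩc : Convex ℝ Ω) (y₁ y₂ : E3 → E3) :
    M.lumped y₁ y₂ = M.lumpedCells fun _ z => inner ℝ (y₁ z) (y₂ z) :=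
  M.sum_nodes_eq hΩc _

theorem lumpedCells_congr {f g : Finset E3 → E3 → ℝ}
    (h : ∀ s ∈ M.cells, ∀ z ∈ s, f s z = g s z) : M.lumpedCells f = M.lumpedCells g :=
  Finset.sum_congr rfl fun s hs => Finset.sum_congr rfl fun z hz => by rw [h s hs z hz]

theorem lumpedCells_mono {f g : Finset E3 → E3 → ℝ}
    (h : ∀ s ∈ M.cells, ∀ z ∈ s, f s z ≤ g s z) : M.lumpedCells f ≤ M.lumpedCells g :=
  Finset.sum_le_sum fun s hs => Finset.sum_le_sum fun z hz =>
    mul_le_mul_of_nonneg_right (h s hs z hz) (M.mass_nonneg s z)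

theorem lumpedCells_nonneg {f : Finset E3 → E3 → ℝ}
    (h : ∀ s ∈ M.cells, ∀ z ∈ s, 0 ≤ f s z) : 0 ≤ M.lumpedCells f :=
  Finset.sum_nonneg fun s hs => Finset.sum_nonneg fun z hz =>
    mul_nonneg (h s hs z hz) (M.mass_nonneg s z)

theorem lumpedCells_mul (a : ℝ) (f : Finset E3 → E3 → ℝ) :
    M.lumpedCells (fun s z => a * f s z) = a * M.lumpedCells f := by
  simp_rw [lumpedCells_eq, Finset.mul_sum, mul_assoc]

theorem abs_lumpedCells_le (f : Finset E3 → E3 → ℝ) :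
    |M.lumpedCells f| ≤ M.lumpedCells fun s z => |f s z| := by
  simp_rw [lumpedCells_eq]
  refine (Finset.abs_sum_le_sum_abs _ _).trans (le_of_eq (Finset.sum_congr rfl fun p _ => ?_))
  rw [abs_mul, abs_of_nonneg (M.mass_nonneg _ _)]

/-- Cauchy–Schwarz for finite sums, with the nonnegative quadrature weights split into two square
roots. -/
theorem lumpedCells_mul_le (f g : Finset E3 → E3 → ℝ) :
    M.lumpedCells (fun s z => f s z * g s z) ≤
      √(M.lumpedCells fun s z => f s z ^ 2) * √(M.lumpedCells fun s z => g s z ^ 2) := by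
  simp_rw [lumpedCells_eq]
  have := Real.sum_mul_le_sqrt_mul_sqrt (M.cells.sigma (fun s => s))
    (fun p => f p.1 p.2 * √(M.mass p.1 p.2)) (fun p => g p.1 p.2 * √(M.mass p.1 p.2))
  refine le_trans (le_of_eq (Finset.sum_congr rfl fun p _ => ?_)) (this.trans (le_of_eq ?_))
  · rw [mul_mul_mul_comm, Real.mul_self_sqrt (M.mass_nonneg _ _)]
  · simp_rw [mul_pow, Real.sq_sqrt (M.mass_nonneg _ _)]

theorem mass_le (hs : s ∈ M.cells) (z : E3) : M.mass s z ≤ volume.real (hull s) := by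
  have hfin : volume (hull s) ≠ ⊤ := (isCompact_hull s).measure_lt_top.ne
  calc _ = ∫ x in hull s, M.coord s z x := M.mass_eq hs z
    _ ≤ ∫ x in hull s, (1 : ℝ) := setIntegral_mono_on (M.integrableOn_coord s z)
        (integrableOn_const hfin) (measurableSet_hull s) fun x hx => M.coord_le_one hs hx z
    _ = _ := by simp

/-- The barycentre of a tetrahedron. -/
noncomputable def center (s : Finset E3) : E3 := ∑ z ∈ s, (1 / 4 : ℝ) • z

theorem coord_center (hs : s ∈ M.cells) {z : E3} (hz : z ∈ s) :
    M.coord s z (center s) = 1 / 4 :=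
  M.coord_eq_of_sum hs (w := fun _ => 1 / 4)
    (by rw [Finset.sum_const, (M.mem_cells.1 hs).2]; norm_num) hz

theorem center_mem (hs : s ∈ M.cells) : center s ∈ hull s := by
  rw [M.mem_hull_iff hs]
  intro z
  by_cases hz : z ∈ s
  · rw [M.coord_center hs hz]; norm_num
  · rw [M.coord_of_notMem hz]; exact le_rfl

theorem coord_homothety (s : Finset E3) (z a x : E3) (t : ℝ) :
    M.coord s z (a + t • (x - a)) = (1 - t) * M.coord s z a + t * M.coord s z x := by
  have h : ∀ x, M.coord s z x = (M.coord s z).linear x + M.coord s z 0 :=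
    fun x => congrFun (M.coord s z).decomp x
  rw [h, h a, h x]; simp only [map_add, map_smul, map_sub, smul_eq_mul]; ring

theorem coord_half_ge (hs : s ∈ M.cells) {z x : E3} (hz : z ∈ s) (hx : x ∈ hull s) :
    1 / 8 ≤ M.coord s z (center s + (1 / 2 : ℝ) • (x - center s)) := by
  rw [M.coord_homothety, M.coord_center hs hz]
  have := (M.mem_hull_iff hs).1 hx z
  linarith

/-- The homothety of ratio `1/2` centred at the barycentre maps the cell into itself with Jacobian
`1/8`. On its image the barycentric coordinates are at least `1/8`, so products of coordinates have
integrals comparable to the volume. -/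
theorem le_integral_of_half (hs : s ∈ M.cells) {Φ : E3 → ℝ} (hΦ : Continuous Φ)
    (h0 : ∀ x ∈ hull s, 0 ≤ Φ x) {a : ℝ}
    (ha : ∀ x ∈ hull s, a ≤ Φ (center s + (1 / 2 : ℝ) • (x - center s))) :
    a * volume.real (hull s) ≤ 8 * ∫ x in hull s, Φ x := by
  have h1 := setIntegral_homothety_le (convex_hull s) (isCompact_hull s) hΦ h0
    (M.center_mem hs) (t := 1 / 2) (by norm_num) (by norm_num)
  norm_num at h1
  refine le_trans ?_ h1
  have hfin : volume (hull s) ≠ ⊤ := (isCompact_hull s).measure_lt_top.ne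
  calc a * volume.real (hull s) = ∫ x in hull s, a := by
        rw [setIntegral_const, smul_eq_mul, mul_comm]
    _ ≤ _ := by
        refine setIntegral_mono_on (integrableOn_const hfin) ?_ (measurableSet_hull s)
          fun x hx => by simpa using ha x hx
        exact (hΦ.comp (by fun_prop)).continuousOn.integrableOn_compact (isCompact_hull s)

/-- Here `64 = 8 * 8`: the Jacobian times the inverse of the lower bound `1/8` of the coordinate. -/
theorem volume_le_mass (hs : s ∈ M.cells) {z : E3} (hz : z ∈ s) :
    volume.real (hull s) ≤ 64 * M.mass s z := by
  have := M.le_integral_of_half hs (M.continuous_coord s z)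
    (fun x hx => (M.mem_hull_iff hs).1 hx z) (fun x hx => M.coord_half_ge hs hz hx)
  rw [M.mass_eq hs]; linarith

theorem mass_pos (hs : s ∈ M.cells) {z : E3} (hz : z ∈ s) : 0 < M.mass s z := by
  have := M.volume_le_mass hs hz
  have := M.volume_hull_pos hs
  linarith

/-- Two coordinates bounded below by `1/8` give `512 = 8 * 64`. The case `y = z` is included. -/
theorem volume_le_integral_mul (hs : s ∈ M.cells) {z y : E3} (hz : z ∈ s) (hy : y ∈ s) :
    volume.real (hull s) ≤ 512 * ∫ x in hull s, M.hat z x * M.hat y x := by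
  have := M.le_integral_of_half hs (Φ := fun x => M.coord s z x * M.coord s y x)
    ((M.continuous_coord s z).mul (M.continuous_coord s y)) (a := 1 / 64)
    (fun x hx => mul_nonneg ((M.mem_hull_iff hs).1 hx z) ((M.mem_hull_iff hs).1 hx y))
    (fun x hx => by
      have h1 := M.coord_half_ge hs hz hx
      have h2 := M.coord_half_ge hs hy hx
      nlinarith)
  have e : ∫ x in hull s, M.hat z x * M.hat y x = ∫ x in hull s, M.coord s z x * M.coord s y x :=
    setIntegral_congr_fun (measurableSet_hull s) fun x hx => by
      simp only [M.hat_eq_coord hs hx]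
  rw [e]; linarith

/-- Jensen's inequality for the lumped quadrature. -/
theorem integral_pow_le_lumped (hΩc : Convex ℝ Ω) {f : E3 → F} (hf : M.PwAff f) (n : ℕ) :
    ∫ x in Ω, ‖f x‖ ^ n ≤ M.lumpedCells fun _ z => ‖f z‖ ^ n := by
  have hc : M.PwCont fun x => ‖f x‖ ^ n :=
    hf.pwQuad.pwC1.pwCont.comp (φ := fun x => ‖x‖ ^ n) (by fun_prop)
  rw [hc.integral_eq hΩc]
  refine Finset.sum_le_sum fun s hs => ?_
  calc ∫ x in hull s, ‖f x‖ ^ n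
      ≤ ∫ x in hull s, ∑ z ∈ s, ‖f z‖ ^ n * M.coord s z x := by
        refine setIntegral_mono_on (hc.integrableOn_hull hs)
          (integrable_finsetSum _ fun z _ => (M.integrableOn_coord s z).const_mul _)
          (measurableSet_hull s) fun x hx => ?_
        have h0 : ∀ z ∈ s, 0 ≤ M.coord s z x := fun z _ => (M.mem_hull_iff hs).1 hx z
        calc ‖f x‖ ^ n ≤ (∑ z ∈ s, M.coord s z x * ‖f z‖) ^ n := by
              refine pow_le_pow_left₀ (norm_nonneg _) ?_ n
              rw [hf.eq_sum_coord hs hx]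
              refine (norm_sum_le _ _).trans (Finset.sum_le_sum fun z hz => ?_)
              rw [norm_smul, Real.norm_of_nonneg (h0 z hz)]
          _ ≤ ∑ z ∈ s, M.coord s z x * ‖f z‖ ^ n :=
              Real.pow_arith_mean_le_arith_mean_pow s _ _ h0 (M.sum_coord hs x)
                (fun z _ => norm_nonneg _) n
          _ = _ := Finset.sum_congr rfl fun z _ => mul_comm _ _
    _ = ∑ z ∈ s, ‖f z‖ ^ n * M.mass s z := by
        rw [integral_finsetSum _ fun z _ => (M.integrableOn_coord s z).const_mul _]
        exact Finset.sum_congr rfl fun z _ => by rw [integral_const_mul, M.mass_eq hs]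

/-- Quadratic functions are controlled at the nodes by their integral norms. -/
theorem PwQuad.lumped_le {M : TetMesh Ω} (hΩc : Convex ℝ Ω) {f : E3 → F} (hf : M.PwQuad f)
    (n : ℕ) : (M.lumpedCells fun _ z => ‖f z‖ ^ n) ≤ 128 * 7 ^ n * ∫ x in Ω, ‖f x‖ ^ n := by
  have hc : M.PwCont fun x => ‖f x‖ ^ n :=
    hf.pwC1.pwCont.comp (φ := fun x => ‖x‖ ^ n) (by fun_prop)
  rw [hc.integral_eq hΩc, Finset.mul_sum]
  refine Finset.sum_le_sum fun s hs => ?_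
  obtain ⟨p, hp, h⟩ := hf s hs
  have e1 : ∫ x in hull s, ‖f x‖ ^ n = ∫ x in hull s, ‖p x‖ ^ n :=
    setIntegral_congr_fun (measurableSet_hull s) fun x hx => by simp only [h x hx]
  -- Each of the four vertices contributes `32 * 7 ^ n`, hence `128`.
  calc _ ≤ ∑ z ∈ s, 32 * 7 ^ n * ∫ x in hull s, ‖f x‖ ^ n := by
        refine Finset.sum_le_sum fun z hz => ?_
        calc _ ≤ ‖f z‖ ^ n * volume.real (hull s) := by gcongr; exact M.mass_le hs z
          _ = volume.real (hull s) * ‖p z‖ ^ n := by rw [h z (mem_hull hz), mul_comm]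
          _ ≤ _ := by
            rw [e1]
            exact hp.volume_mul_norm_pow_le (convex_hull s) (isCompact_hull s) (mem_hull hz) n
    _ = _ := by rw [Finset.sum_const, (M.mem_cells.1 hs).2]; ring

/-- The gradient of a quadratic function is controlled at the nodes by its integral norm. -/
theorem PwQuad.lumped_cellGrad_le {M : TetMesh Ω} (hΩc : Convex ℝ Ω) {f : E3 → E3}
    (hf : M.PwQuad f) :
    (M.lumpedCells fun s z => ‖cellGrad f s z‖ ^ 2) ≤ 6272 * ∫ x in Ω, ‖fderiv ℝ f x‖ ^ 2 := by
  have hc : M.PwCont fun x => ‖fderiv ℝ f x‖ ^ 2 :=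
    hf.pwC1.pwCont_fderiv.comp (φ := fun x => ‖x‖ ^ 2) (by fun_prop)
  rw [hc.integral_eq hΩc, Finset.mul_sum]
  refine Finset.sum_le_sum fun s hs => ?_
  obtain ⟨p, hp, h⟩ := hf s hs
  have e1 : ∫ x in hull s, ‖fderiv ℝ f x‖ ^ 2 = ∫ x in hull s, ‖fderiv ℝ p x‖ ^ 2 := by
    refine integral_congr_ae ((ae_mem_interior_hull s).mono fun x hx => ?_)
    simp only [fderiv_eq_of_eqOn h hx]
  -- The gradient of a quadratic is affine, so each of the four vertices contributes `1568`, hence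
  -- `6272`.
  calc _ ≤ ∑ z ∈ s, 1568 * ∫ x in hull s, ‖fderiv ℝ f x‖ ^ 2 := by
        refine Finset.sum_le_sum fun z hz => ?_
        calc _ ≤ ‖cellGrad f s z‖ ^ 2 * volume.real (hull s) := by
              gcongr; exact M.mass_le hs z
          _ = volume.real (hull s) * ‖fderiv ℝ p z‖ ^ 2 := by
              rw [M.cellGrad_eq hs hp.contDiff h (mem_hull hz), mul_comm]
          _ ≤ _ := by
            rw [e1]
            exact hp.isAff_fderiv.volume_mul_norm_sq_le (convex_hull s) (isCompact_hull s)
              (mem_hull hz)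
    _ = _ := by rw [Finset.sum_const, (M.mem_cells.1 hs).2]; ring

end TetMesh

end EricksenLeslie

/-! ### Extension by zero, integration by parts, Korn and Sobolev inequalities on meshes -/

namespace EricksenLeslie
open Filter Topology

/-- A continuous curve that is Lipschitz on each set of a finite closed cover is Lipschitz. -/
theorem norm_sub_le_of_closed_cover {F ι : Type*} [NormedAddCommGroup F] {γ : ℝ → F}
    (hγ : Continuous γ) (S : Finset ι) (A : ι → Set ℝ) (hA : ∀ i ∈ S, IsClosed (A i))
    (hcov : ∀ t : ℝ, ∃ i ∈ S, t ∈ A i) {L : ℝ}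
    (hL : ∀ i ∈ S, ∀ s ∈ A i, ∀ t ∈ A i, ‖γ s - γ t‖ ≤ L * |s - t|) : ‖γ 1 - γ 0‖ ≤ L := by
  have h := image_le_of_liminf_slope_right_le_deriv_boundary (f := fun t => ‖γ t - γ 0‖)
    (a := 0) (b := 1) (B := fun t => L * t) (B' := fun _ => L)
    (hγ.sub continuous_const).norm.continuousOn (by simp) (by fun_prop)
    (fun x _ => by
      simpa using ((hasDerivAt_id x).const_mul L).hasDerivWithinAt) ?_
    (Set.right_mem_Icc.2 zero_le_one)
  · simpa using h
  intro x _ r hr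
  -- The cover is finite, so one of its sets is visited arbitrarily close to `x` from the right.
  -- Being closed it contains `x`, and the Lipschitz bound on it controls slopes along these times.
  have h1 : ∃ i ∈ S, ∃ᶠ z in 𝓝[>] x, z ∈ A i := by
    by_contra! hn
    have h2 : ∀ i ∈ S, ∀ᶠ z in 𝓝[>] x, z ∉ A i := fun i hi => by
      simpa [Filter.not_frequently] using hn i hi
    have h3 := (S.eventually_all).2 h2
    obtain ⟨z, hz⟩ := h3.exists
    obtain ⟨i, hi, hzi⟩ := hcov z
    exact hz i hi hzi
  obtain ⟨i, hi, hf⟩ := h1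
  have hxA : x ∈ A i := (hA i hi).mem_of_frequently_of_tendsto hf
    (tendsto_id.mono_left nhdsWithin_le_nhds)
  refine (hf.and_eventually self_mem_nhdsWithin).mono fun z hz => ?_
  have hzx : 0 < z - x := sub_pos.2 hz.2
  rw [slope_def_field, div_lt_iff₀ hzx]
  have h3 := hL i hi z hz.1 x hxA
  rw [abs_of_pos hzx] at h3
  have h4 : ‖γ z - γ 0‖ ≤ ‖γ z - γ x‖ + ‖γ x - γ 0‖ := by
    simpa using norm_add_le (γ z - γ x) (γ x - γ 0)
  have h5 : L * (z - x) < r * (z - x) := mul_lt_mul_of_pos_right hr hzx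
  linarith

namespace TetMesh

variable {Ω : Set E3} {M : TetMesh Ω} {s t : Finset E3}
variable {F : Type*} [NormedAddCommGroup F] [NormedSpace ℝ F]

theorem indicator_eq_of_mem_closure (hΩo : IsOpen Ω) {f : E3 → F}
    (h0 : ∀ x ∈ frontier Ω, f x = 0) {x : E3} (hx : x ∈ closure Ω) : Ω.indicator f x = f x := by
  by_cases h : x ∈ Ω
  · simp [h]
  · rw [Set.indicator_of_notMem h, h0 x ⟨hx, by rwa [hΩo.interior_eq]⟩]

/-- The extension by zero of a finite element function that vanishes on the boundary. -/
theorem PwC1.exists_lipschitzWith (hΩo : IsOpen Ω) {f : E3 → F} (hf : M.PwC1 f)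
    (h0 : ∀ x ∈ frontier Ω, f x = 0) : ∃ L : NNReal, LipschitzWith L (Ω.indicator f) := by
  have hu := fun x hx => indicator_eq_of_mem_closure hΩo h0 (x := x) hx
  have hcont : Continuous (Ω.indicator f) := continuous_indicator h0 hf.continuousOn
  have hcell : ∀ s ∈ M.cells, ∃ C : ℝ, 0 ≤ C ∧ ∀ x ∈ hull s, ∀ y ∈ hull s,
      ‖f x - f y‖ ≤ C * ‖x - y‖ := by
    intro s hs
    obtain ⟨p, hp, h⟩ := hf s hs
    obtain ⟨C, hC⟩ := (isCompact_hull s).exists_bound_of_continuousOn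
      (hp.continuous_fderiv (by norm_num)).continuousOn
    refine ⟨max C 0, le_max_right _ _, fun x hx y hy => ?_⟩
    rw [h x hx, h y hy]
    exact (convex_hull s).norm_image_sub_le_of_norm_fderiv_le
      (fun z _ => hp.differentiable (by norm_num) z) (fun z hz => (hC z hz).trans (le_max_left _ _))
      hy hx
  choose! C hC0 hC using hcell
  set L : ℝ := ∑ s ∈ M.cells, C s with hL
  have hL0 : 0 ≤ L := Finset.sum_nonneg hC0
  refine ⟨⟨L, hL0⟩, LipschitzWith.of_dist_le_mul fun x y => ?_⟩
  rw [dist_eq_norm, dist_eq_norm]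
  set ℓ : ℝ → E3 := fun t => y + t • (x - y) with hℓ
  have hℓc : Continuous ℓ := by fun_prop
  have hd : ∀ a b : ℝ, ‖ℓ a - ℓ b‖ = |a - b| * ‖x - y‖ := fun a b => by
    rw [← Real.norm_eq_abs, ← norm_smul]; congr 1; simp only [hℓ]; module
  -- The times along the segment are covered by those outside `Ω`, where the extension is zero, and
  -- those in each tetrahedron. The sum of the cell constants dominates each of them.
  have := norm_sub_le_of_closed_cover (hcont.comp hℓc) (Finset.insertNone M.cells)
    (fun i => match i with
      | none => {t | ℓ t ∉ Ω}
      | some s => {t | ℓ t ∈ hull s}) ?_ ?_ (L := L * ‖x - y‖) ?_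
  · simp only [hℓ, Function.comp, one_smul, zero_smul, add_zero, add_sub_cancel] at this
    exact this
  · intro i _
    match i with
    | none => exact hΩo.isClosed_compl.preimage hℓc
    | some s => exact (isCompact_hull s).isClosed.preimage hℓc
  · intro t
    by_cases ht : ℓ t ∈ Ω
    · obtain ⟨s, hs, hx⟩ := M.exists_cell (subset_closure ht)
      exact ⟨some s, by simpa using hs, hx⟩
    · exact ⟨none, by simp, ht⟩
  · intro i hi a ha b hb
    match i with
    | none =>
      simp only [Function.comp]
      rw [Set.indicator_of_notMem ha, Set.indicator_of_notMem hb]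
      simp only [sub_zero, norm_zero]
      positivity
    | some s =>
      have hs : s ∈ M.cells := by simpa using hi
      simp only [Function.comp]
      rw [hu _ (M.hull_subset hs ha), hu _ (M.hull_subset hs hb)]
      refine (hC s hs _ ha _ hb).trans ?_
      rw [hd, mul_assoc, mul_comm |a - b|]
      have : C s ≤ L := Finset.single_le_sum (f := C) hC0 hs
      gcongr

theorem fderiv_indicator_of_mem (hΩo : IsOpen Ω) (f : E3 → F) {x : E3} (hx : x ∈ Ω) :
    fderiv ℝ (Ω.indicator f) x = fderiv ℝ f x :=
  Filter.EventuallyEq.fderiv_eq (by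
    filter_upwards [hΩo.mem_nhds hx] with y hy using by simp [hy])

theorem indicator_eventuallyEq_zero (f : E3 → F) {x : E3} (hx : x ∉ closure Ω) :
    Ω.indicator f =ᶠ[𝓝 x] fun _ => 0 := by
  filter_upwards [isClosed_closure.isOpen_compl.mem_nhds hx] with y hy
  exact Set.indicator_of_notMem (fun h => hy (subset_closure h)) f

theorem hasCompactSupport_indicator (hΩb : Bornology.IsBounded Ω) (f : E3 → F) :
    HasCompactSupport (Ω.indicator f) :=
  HasCompactSupport.intro hΩb.isCompact_closure fun _ hx =>
    Set.indicator_of_notMem (fun h => hx (subset_closure h)) f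

theorem integral_eq_of_zero_outside (hΩc : Convex ℝ Ω) {g : E3 → ℝ}
    (h : ∀ x ∉ closure Ω, g x = 0) : ∫ x, g x = ∫ x in Ω, g x := by
  rw [← restrict_closure_eq hΩc, setIntegral_eq_integral_of_forall_compl_eq_zero h]

theorem lineDeriv_indicator_ae (hΩo : IsOpen Ω) (hΩc : Convex ℝ Ω) {f : E3 → F}
    (hf : M.PwC1 f) (w : E3) : ∀ᵐ x ∂volume.restrict Ω,
      lineDeriv ℝ (Ω.indicator f) x w = fderiv ℝ f x w := by
  filter_upwards [hf.ae_differentiableAt hΩc, ae_restrict_mem hΩo.measurableSet] with x hx hxΩ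
  have hd : DifferentiableAt ℝ (Ω.indicator f) x := hx.congr_of_eventuallyEq (by
    filter_upwards [hΩo.mem_nhds hxΩ] with y hy using by simp [hy])
  rw [hd.lineDeriv_eq_fderiv, fderiv_indicator_of_mem hΩo f hxΩ]

theorem lineDeriv_indicator_of_notMem (f : E3 → F) {x : E3} (hx : x ∉ closure Ω) (w : E3) :
    lineDeriv ℝ (Ω.indicator f) x w = 0 := by
  rw [(indicator_eventuallyEq_zero f hx).lineDeriv_eq]
  simp [lineDeriv]

/-- Integrate the zero extension by parts on the whole space against the constant function one. -/
theorem PwC1.integral_fderiv_eq_zero (hΩo : IsOpen Ω) (hΩc : Convex ℝ Ω)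
    (hΩb : Bornology.IsBounded Ω) {f : E3 → ℝ} (hf : M.PwC1 f)
    (h0 : ∀ x ∈ frontier Ω, f x = 0) (w : E3) : ∫ x in Ω, fderiv ℝ f x w = 0 := by
  obtain ⟨L, hL⟩ := hf.exists_lipschitzWith hΩo h0
  have h1 := (LipschitzWith.const (1 : ℝ) : LipschitzWith 0 fun _ : E3 => (1 : ℝ))
    |>.integral_lineDeriv_mul_eq (μ := (volume : Measure E3)) hL
      (hasCompactSupport_indicator hΩb f) (-w)
  have h2 : ∀ x : E3, lineDeriv ℝ (fun _ : E3 => (1 : ℝ)) x (-w) = 0 := fun x => by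
    simp [lineDeriv]
  simp only [h2, zero_mul, integral_zero, neg_neg, mul_one] at h1
  rw [integral_eq_of_zero_outside hΩc
    (fun x hx => lineDeriv_indicator_of_notMem f hx w)] at h1
  rw [h1]
  exact integral_congr_ae ((lineDeriv_indicator_ae hΩo hΩc hf w).mono fun x hx => hx.symm)

theorem PwC1.apply {f : E3 → E3} (hf : M.PwC1 f) (i : Fin 3) : M.PwC1 fun x => f x i :=
  hf.comp (φ := fun x : E3 => x i) (by fun_prop)

theorem fderiv_apply_comp {f : E3 → E3} {x : E3} (hx : DifferentiableAt ℝ f x) (i : Fin 3)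
    (w : E3) : fderiv ℝ (fun y => f y i) x w = (fderiv ℝ f x w) i := by
  have h : HasFDerivAt (fun y => f y i) ((EuclideanSpace.proj i : E3 →L[ℝ] ℝ).comp
    (fderiv ℝ f x)) x := (EuclideanSpace.proj i : E3 →L[ℝ] ℝ).hasFDerivAt.comp x hx.hasFDerivAt
  rw [h.fderiv]; rfl

theorem PwC1.integral_divg_eq_zero (hΩo : IsOpen Ω) (hΩc : Convex ℝ Ω)
    (hΩb : Bornology.IsBounded Ω) {f : E3 → E3} (hf : M.PwC1 f)
    (h0 : ∀ x ∈ frontier Ω, f x = 0) : ∫ x in Ω, divg f x = 0 := by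
  have hi : ∀ i, IntegrableOn (fun x => (fderiv ℝ f x (e i)) i) Ω := fun i =>
    (hf.pwCont_fderiv.comp (φ := fun A : Mat3 => (A (e i)) i) (by fun_prop)).integrableOn hΩc
  simp only [divg]
  rw [integral_finsetSum _ fun i _ => hi i]
  refine Finset.sum_eq_zero fun i _ => ?_
  rw [← (hf.apply i).integral_fderiv_eq_zero hΩo hΩc hΩb (fun x hx => by simp [h0 x hx]) (e i)]
  refine integral_congr_ae ((hf.ae_differentiableAt hΩc).mono fun x hx => ?_)
  exact (fderiv_apply_comp hx i (e i)).symm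

theorem integral_partial_swap (hΩo : IsOpen Ω) (hΩc : Convex ℝ Ω)
    (hΩb : Bornology.IsBounded Ω) {f g : E3 → ℝ} (hf : M.PwC1 f) (hg : M.PwC1 g)
    (hf0 : ∀ x ∈ frontier Ω, f x = 0) (hg0 : ∀ x ∈ frontier Ω, g x = 0) (v w : E3) :
    ∫ x in Ω, fderiv ℝ f x v * fderiv ℝ g x w = ∫ x in Ω, fderiv ℝ f x w * fderiv ℝ g x v := by
  obtain ⟨L, hL⟩ := hf.exists_lipschitzWith hΩo hf0
  obtain ⟨L', hL'⟩ := hg.exists_lipschitzWith hΩo hg0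
  have h := integral_lineDeriv_mul_lineDeriv hL hL' (hasCompactSupport_indicator hΩb f)
    (hasCompactSupport_indicator hΩb g) v w
  rw [integral_eq_of_zero_outside hΩc, integral_eq_of_zero_outside hΩc] at h
  · have e : ∀ v w : E3, ∫ x in Ω, fderiv ℝ f x v * fderiv ℝ g x w = ∫ x in Ω,
        lineDeriv ℝ (Ω.indicator f) x v * lineDeriv ℝ (Ω.indicator g) x w := fun v w => by
      refine integral_congr_ae ?_
      filter_upwards [lineDeriv_indicator_ae hΩo hΩc hf v, lineDeriv_indicator_ae hΩo hΩc hg w]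
        with x h1 h2
      rw [h1, h2]
    rw [e, e, h]
  · intro x hx; rw [lineDeriv_indicator_of_notMem f hx w, zero_mul]
  · intro x hx; rw [lineDeriv_indicator_of_notMem f hx v, zero_mul]

end TetMesh

theorem adjoint_apply_coord (A : Mat3) (i j : Fin 3) :
    (ContinuousLinearMap.adjoint A (e j)) i = (A (e i)) j := by
  have h : ∀ (x : E3) (i : Fin 3), x i = inner ℝ (e i) x := fun x i => by
    rw [e, EuclideanSpace.inner_single_left]; simp
  rw [h, ContinuousLinearMap.adjoint_inner_right, h, real_inner_comm]

theorem frob_eq (A B : Mat3) : frob A B = ∑ j, ∑ i, (A (e j)) i * (B (e j)) i := by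
  simp only [frob, PiLp.inner_apply]
  refine Finset.sum_congr rfl fun j _ => Finset.sum_congr rfl fun i _ => ?_
  simp [mul_comm]

theorem symPart_coord (A : Mat3) (i j : Fin 3) :
    (symPart A (e j)) i = 1 / 2 * ((A (e j)) i + (A (e i)) j) := by
  simp [symPart, adjoint_apply_coord]; ring

/-- Twice the squared symmetric part is the squared norm plus the trace of the square of the matrix.
After integration the trace term becomes a squared divergence. -/
theorem two_mul_frob_symPart (A : Mat3) :
    2 * frob (symPart A) (symPart A) = frob A A + ∑ i, ∑ j, (A (e j)) i * (A (e i)) j := by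
  simp only [frob_eq, symPart_coord, Fin.sum_univ_three]
  ring

theorem continuous_frob_self : Continuous fun A : Mat3 => frob A A := by
  simp only [frob]; fun_prop

theorem continuous_symPart : Continuous symPart := by
  unfold symPart
  exact (continuous_id.add (ContinuousLinearMap.adjoint (𝕜 := ℝ) (E := E3) (F := E3)).continuous).const_smul (1 / 2 : ℝ)

namespace TetMesh

variable {Ω : Set E3} {M : TetMesh Ω}

/-- Korn's inequality. -/
theorem PwC1.korn (hΩo : IsOpen Ω) (hΩc : Convex ℝ Ω) (hΩb : Bornology.IsBounded Ω)
    {v : E3 → E3} (hv : M.PwC1 v) (h0 : ∀ x ∈ frontier Ω, v x = 0) :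
    ∫ x in Ω, frob (fderiv ℝ v x) (fderiv ℝ v x) ≤
      2 * ∫ x in Ω, frob (symPart (fderiv ℝ v x)) (symPart (fderiv ℝ v x)) := by
  have hD := hv.pwCont_fderiv
  have i1 : IntegrableOn (fun x => frob (fderiv ℝ v x) (fderiv ℝ v x)) Ω :=
    (hD.comp continuous_frob_self).integrableOn hΩc
  have i2 : ∀ i j k l : Fin 3, IntegrableOn
      (fun x => (fderiv ℝ v x (e j)) i * (fderiv ℝ v x (e k)) l) Ω := fun i j k l =>
    (hD.comp (φ := fun A : Mat3 => (A (e j)) i * (A (e k)) l) (by fun_prop)).integrableOn hΩc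
  have hcomp : ∀ i j k l : Fin 3, ∫ x in Ω, (fderiv ℝ v x (e j)) i * (fderiv ℝ v x (e k)) l
      = ∫ x in Ω, fderiv ℝ (fun y => v y i) x (e j) * fderiv ℝ (fun y => v y l) x (e k) :=
    fun i j k l => integral_congr_ae ((hv.ae_differentiableAt hΩc).mono fun x hx => by
      simp only [fderiv_apply_comp hx])
  -- Exchanging the two derivatives turns the trace of the squared gradient into the squared
  -- divergence under the integral, which is nonnegative.
  have hswap : ∀ i j : Fin 3, ∫ x in Ω, (fderiv ℝ v x (e j)) i * (fderiv ℝ v x (e i)) j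
      = ∫ x in Ω, (fderiv ℝ v x (e i)) i * (fderiv ℝ v x (e j)) j := fun i j => by
    rw [hcomp, hcomp]
    exact integral_partial_swap hΩo hΩc hΩb (hv.apply i) (hv.apply j)
      (fun x hx => by simp [h0 x hx]) (fun x hx => by simp [h0 x hx]) _ _
  rw [← integral_const_mul]
  simp_rw [two_mul_frob_symPart]
  rw [integral_add i1 (integrable_finsetSum _ fun i _ => integrable_finsetSum _ fun j _ =>
    i2 i j i j)]
  have : 0 ≤ ∫ x in Ω, ∑ i, ∑ j, (fderiv ℝ v x (e j)) i * (fderiv ℝ v x (e i)) j := by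
    have hsum : ∀ g : Fin 3 → Fin 3 → E3 → ℝ, (∀ i j, IntegrableOn (g i j) Ω) →
        ∫ x in Ω, ∑ i, ∑ j, g i j x = ∑ i, ∑ j, ∫ x in Ω, g i j x := fun g hg => by
      rw [integral_finsetSum _ fun i _ => integrable_finsetSum _ fun j _ => hg i j]
      exact Finset.sum_congr rfl fun i _ => integral_finsetSum _ fun j _ => hg i j
    rw [hsum _ fun i j => i2 i j i j, Finset.sum_congr rfl fun i _ =>
      Finset.sum_congr rfl fun j _ => hswap i j, ← hsum _ fun i j => i2 i i j j]
    refine integral_nonneg fun x => ?_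
    simp only [Pi.zero_apply, ← Finset.sum_mul_sum]
    exact mul_self_nonneg _
  linarith

/-- The Sobolev inequality for finite element functions. -/
theorem exists_sobolev_bound (hΩo : IsOpen Ω) (hΩc : Convex ℝ Ω) (hΩb : Bornology.IsBounded Ω) :
    ∃ C : ℝ, 0 ≤ C ∧ ∀ (M : TetMesh Ω) (v : E3 → E3), M.PwC1 v → (∀ x ∈ frontier Ω, v x = 0) →
      ∫ x in Ω, ‖v x‖ ^ 6 ≤ C * (∫ x in Ω, ‖fderiv ℝ v x‖ ^ 2) ^ 3 := by
  obtain ⟨C, hC⟩ := exists_sobolev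
  refine ⟨C, C.2, fun M v hv h0 => ?_⟩
  obtain ⟨L, hL⟩ := hv.exists_lipschitzWith hΩo h0
  have h := hC _ L hL (hasCompactSupport_indicator hΩb v)
  have i6 : IntegrableOn (fun x => ‖v x‖ ^ 6) Ω :=
    (hv.pwCont.comp (φ := fun x => ‖x‖ ^ 6) (by fun_prop)).integrableOn hΩc
  have i2 : IntegrableOn (fun x => ‖fderiv ℝ v x‖ ^ 2) Ω :=
    (hv.pwCont_fderiv.comp (φ := fun x => ‖x‖ ^ 2) (by fun_prop)).integrableOn hΩc
  have n2 : 0 ≤ ∫ x in Ω, ‖fderiv ℝ v x‖ ^ 2 := integral_nonneg fun x => by positivity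
  have e6 : ∫⁻ x, ‖Ω.indicator v x‖ₑ ^ 6 = ENNReal.ofReal (∫ x in Ω, ‖v x‖ ^ 6) := by
    rw [ofReal_integral_eq_lintegral_ofReal i6 (Eventually.of_forall fun x => by positivity),
      ← lintegral_indicator hΩo.measurableSet]
    refine lintegral_congr fun x => ?_
    by_cases hx : x ∈ Ω
    · simp [hx, ← ofReal_norm, ENNReal.ofReal_pow]
    · simp [hx]
  have e2 : ∫⁻ x, ‖fderiv ℝ (Ω.indicator v) x‖ₑ ^ 2
      = ENNReal.ofReal (∫ x in Ω, ‖fderiv ℝ v x‖ ^ 2) := by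
    rw [ofReal_integral_eq_lintegral_ofReal i2 (Eventually.of_forall fun x => by positivity)]
    have h1 : ∫⁻ x, ‖fderiv ℝ (Ω.indicator v) x‖ₑ ^ 2
        = ∫⁻ x in closure Ω, ‖fderiv ℝ (Ω.indicator v) x‖ₑ ^ 2 := by
      rw [← lintegral_indicator isClosed_closure.measurableSet]
      refine lintegral_congr fun x => ?_
      by_cases hx : x ∈ closure Ω
      · simp [hx]
      · have h00 : ‖fderiv ℝ (Ω.indicator v) x‖ₑ = 0 := by
          rw [(indicator_eventuallyEq_zero v hx).fderiv_eq]
          simp only [fderiv_fun_const, Pi.zero_apply]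
          exact enorm_zero (E := Mat3)
        rw [h00, Set.indicator_of_notMem hx]; simp
    rw [h1, restrict_closure_eq hΩc]
    refine setLIntegral_congr_fun hΩo.measurableSet fun x hx => ?_
    simp only [fderiv_indicator_of_mem hΩo v hx]
    rw [ENNReal.ofReal_pow (norm_nonneg _), ofReal_norm]
  rw [e6, e2, ← ENNReal.ofReal_pow n2, ← ENNReal.ofReal_coe_nnreal,
    ← ENNReal.ofReal_mul C.coe_nonneg] at h
  exact (ENNReal.ofReal_le_ofReal_iff (mul_nonneg C.coe_nonneg (pow_nonneg n2 3))).1 h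

end TetMesh

end EricksenLeslie

namespace EricksenLeslie
open Filter Topology

/-! ### Vector algebra -/

theorem cross_apply_zero (x y : E3) : cross x y 0 = x 1 * y 2 - x 2 * y 1 := by
  simp [cross, crossProduct]

theorem cross_apply_one (x y : E3) : cross x y 1 = x 2 * y 0 - x 0 * y 2 := by
  simp [cross, crossProduct]

theorem cross_apply_two (x y : E3) : cross x y 2 = x 0 * y 1 - x 1 * y 0 := by
  simp [cross, crossProduct]

theorem inner_eq (x y : E3) : inner ℝ x y = x 0 * y 0 + x 1 * y 1 + x 2 * y 2 := by
  rw [PiLp.inner_apply, Fin.sum_univ_three]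
  simp [mul_comm]

/-- Crossing with `m` is skew. This identity pairs the elastic force with the transport term of the
director equation. -/
theorem inner_cross_cross (m a b : E3) :
    inner ℝ (cross m a) (cross m b) = -inner ℝ a (cross m (cross m b)) := by
  simp only [inner_eq, cross_apply_zero, cross_apply_one, cross_apply_two]; ring

theorem cross_neg_right (m a : E3) : cross m (-a) = -cross m a := by
  ext i
  fin_cases i <;> simp [cross_apply_zero, cross_apply_one, cross_apply_two] <;> ring

theorem cross_smul_self (m : E3) (t : ℝ) : cross m (t • m) = 0 := by
  ext i
  fin_cases i <;> simp [cross_apply_zero, cross_apply_one, cross_apply_two] <;> ring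

theorem norm_cross_sq (a b : E3) : ‖cross a b‖ ^ 2 = ‖a‖ ^ 2 * ‖b‖ ^ 2 - inner ℝ a b ^ 2 := by
  simp only [← real_inner_self_eq_norm_sq, inner_eq, cross_apply_zero, cross_apply_one,
    cross_apply_two]; ring

theorem norm_cross_le (a b : E3) : ‖cross a b‖ ≤ ‖a‖ * ‖b‖ := by
  refine abs_le_of_sq_le_sq' ?_ (by positivity) |>.2
  rw [norm_cross_sq, mul_pow]; linarith [sq_nonneg (inner ℝ a b)]

theorem inner_skwPart_swap (A : Mat3) (x y : E3) :
    inner ℝ (skwPart A x) y = -inner ℝ (skwPart A y) x := by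
  simp only [skwPart, ContinuousLinearMap.smul_apply, sub_apply, inner_smul_left,
    inner_sub_left, ContinuousLinearMap.adjoint_inner_left]
  rw [real_inner_comm x (A y), real_inner_comm y (A x)]; simp; ring

theorem inner_skwPart_self (A : Mat3) (x : E3) : inner ℝ (skwPart A x) x = 0 := by
  have := inner_skwPart_swap A x x; linarith

theorem norm_symPart_le (A : Mat3) : ‖symPart A‖ ≤ ‖A‖ := by
  rw [symPart, norm_smul]
  have := norm_add_le A (ContinuousLinearMap.adjoint A)
  rw [LinearIsometryEquiv.norm_map] at this
  norm_num; linarith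

theorem norm_skwPart_le (A : Mat3) : ‖skwPart A‖ ≤ ‖A‖ := by
  rw [skwPart, norm_smul]
  have := norm_sub_le A (ContinuousLinearMap.adjoint A)
  rw [LinearIsometryEquiv.norm_map] at this
  norm_num; linarith

theorem apply_coord (A : Mat3) (x : E3) (i : Fin 3) : (A x) i = ∑ j, x j * (A (e j)) i := by
  conv_lhs => rw [← sum_smul_e x]
  simp

theorem abs_coord_le (A : Mat3) (i j : Fin 3) : |(A (e j)) i| ≤ ‖A‖ := by
  refine (PiLp.norm_apply_le (A (e j)) i).trans ?_
  have := A.le_opNorm (e j)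
  rwa [norm_e, mul_one] at this

/-- A skew matrix acts as the cross product with its axial vector, so the pairing of `w` and `m`
sees only `cross m w`. This matters because the energy controls `cross m w` but not `w`. -/
theorem abs_inner_skwPart_le (A : Mat3) (w m : E3) :
    |inner ℝ (skwPart A w) m| ≤ 3 * (‖A‖ * ‖cross m w‖) := by
  have hs : ∀ i j, (skwPart A (e j)) i = 1 / 2 * ((A (e j)) i - (A (e i)) j) := fun i j => by
    simp [skwPart, adjoint_apply_coord]
  have e1 : inner ℝ (skwPart A w) m = (skwPart A (e 2)) 1 * cross m w 0
      + (skwPart A (e 0)) 2 * cross m w 1 + (skwPart A (e 1)) 0 * cross m w 2 := by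
    have hw : ∀ i, (skwPart A w) i = ∑ j, w j * (skwPart A (e j)) i := apply_coord _ w
    simp only [inner_eq, hw, Fin.sum_univ_three, hs, cross_apply_zero, cross_apply_one,
      cross_apply_two]
    ring
  have b : ∀ i j k, |(skwPart A (e j)) i * cross m w k| ≤ ‖A‖ * ‖cross m w‖ := fun i j k => by
    rw [abs_mul]
    exact mul_le_mul ((abs_coord_le _ i j).trans (norm_skwPart_le A))
      (PiLp.norm_apply_le (cross m w) k) (abs_nonneg _) (norm_nonneg _)
  rw [e1]
  have h1 := b 1 2 0
  have h2 := b 2 0 1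
  have h3 := b 0 1 2
  refine (abs_add_three _ _ _).trans (by linarith)

namespace TetMesh

variable {Ω : Set E3} {M : TetMesh Ω}

/-- The divergence of `(v · a) u` integrates to zero, since `u` vanishes on the boundary. With `a =
v` this is the skewness of the convective form. -/
theorem integral_convective (hΩo : IsOpen Ω) (hΩc : Convex ℝ Ω) (hΩb : Bornology.IsBounded Ω)
    {u v a : E3 → E3} (hu : M.PwC1 u) (hv : M.PwC1 v) (ha : M.PwC1 a)
    (h0 : ∀ x ∈ frontier Ω, u x = 0) :
    (∫ x in Ω, inner ℝ (fderiv ℝ v x (u x)) (a x)) + (∫ x in Ω, inner ℝ (divg u x • v x) (a x))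
      + ∫ x in Ω, inner ℝ (v x) (fderiv ℝ a x (u x)) = 0 := by
  have i1 : IntegrableOn (fun x => inner ℝ (fderiv ℝ v x (u x)) (a x)) Ω :=
    ((hv.pwCont_fderiv.comp₂ hu.pwCont (fun (A : Mat3) (y : E3) => A y) (by fun_prop)).comp₂
      ha.pwCont (fun y z => inner ℝ y z) (by fun_prop)).integrableOn hΩc
  have i2 : IntegrableOn (fun x => inner ℝ (divg u x • v x) (a x)) Ω :=
    (((pwCont_divg hu).comp₂ hv.pwCont (fun (t : ℝ) (y : E3) => t • y) (by fun_prop)).comp₂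
      ha.pwCont (fun y z => inner ℝ y z) (by fun_prop)).integrableOn hΩc
  have i3 : IntegrableOn (fun x => inner ℝ (v x) (fderiv ℝ a x (u x))) Ω :=
    (hv.pwCont.comp₂ (ha.pwCont_fderiv.comp₂ hu.pwCont (fun (A : Mat3) (y : E3) => A y)
      (by fun_prop)) (fun y z => inner ℝ y z) (by fun_prop)).integrableOn hΩc
  have hva : M.PwC1 fun x => (inner ℝ (v x) (a x) : ℝ) :=
    hv.comp₂ ha (fun y z => inner ℝ y z) (contDiff_fst.inner ℝ contDiff_snd)
  have hprod : M.PwC1 fun x => (inner ℝ (v x) (a x) : ℝ) • u x :=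
    hva.comp₂ hu (fun (t : ℝ) (y : E3) => t • y) (by fun_prop)
  have h := hprod.integral_divg_eq_zero hΩo hΩc hΩb (fun x hx => by simp [h0 x hx])
  have i12 : IntegrableOn (fun x => (inner ℝ (fderiv ℝ v x (u x)) (a x) : ℝ)
      + inner ℝ (divg u x • v x) (a x)) Ω := i1.add i2
  rw [← integral_add i1 i2, ← integral_add i12 i3, ← h]
  refine integral_congr_ae ?_
  filter_upwards [hu.ae_differentiableAt hΩc, hv.ae_differentiableAt hΩc,
    ha.ae_differentiableAt hΩc] with x h1 h2 h3
  have hd : fderiv ℝ (fun x => (inner ℝ (v x) (a x) : ℝ) • u x) x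
      = (inner ℝ (v x) (a x) : ℝ) • fderiv ℝ u x
        + (fderiv ℝ (fun x => (inner ℝ (v x) (a x) : ℝ)) x).smulRight (u x) :=
    fderiv_fun_smul (h2.inner ℝ h3) h1
  have hi : ∀ y, fderiv ℝ (fun x => (inner ℝ (v x) (a x) : ℝ)) x y
      = inner ℝ (v x) (fderiv ℝ a x y) + inner ℝ (fderiv ℝ v x y) (a x) := fun y =>
    fderiv_inner_apply ℝ h2 h3 y
  have hsum : ∑ i, fderiv ℝ (fun x => (inner ℝ (v x) (a x) : ℝ)) x (e i) * u x i
      = fderiv ℝ (fun x => (inner ℝ (v x) (a x) : ℝ)) x (u x) := by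
    conv_rhs => rw [← sum_smul_e (u x)]
    simp [mul_comm]
  have hdiv : divg (fun x => (inner ℝ (v x) (a x) : ℝ) • u x) x
      = inner ℝ (v x) (a x) * divg u x
        + fderiv ℝ (fun x => (inner ℝ (v x) (a x) : ℝ)) x (u x) := by
    rw [← hsum]
    simp only [divg, hd, ContinuousLinearMap.add_apply, ContinuousLinearMap.smul_apply,
      ContinuousLinearMap.smulRight_apply, PiLp.add_apply, PiLp.smul_apply, smul_eq_mul,
      Finset.sum_add_distrib, Finset.mul_sum]
  rw [hdiv, hi]
  simp only [inner_smul_left]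
  simp; ring

end TetMesh

/-! ### The scheme -/

open TetMesh

namespace IsSchemeSolution

variable {Ω : Set E3} {P : LeslieCoeffs} {M : TetMesh Ω} {k : ℝ} {J : ℕ} {v₀ d₀ : E3 → E3}
  {v d w : ℕ → E3 → E3} {R : ℕ → E3 → Mat3}

theorem memV (hS : IsSchemeSolution P M k J v₀ d₀ v d w R) {j : ℕ} (hj : j ≤ J) :
    M.MemV (v j) := by
  rcases Nat.eq_zero_or_pos j with rfl | h
  · exact hS.v_zero.1
  · exact hS.v_mem j h hj

theorem memY_sub_interp (hS : IsSchemeSolution P M k J v₀ d₀ v d w R) {j : ℕ} (hj : j ≤ J) :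
    M.MemY (fun x => d j x - M.interp d₀ x) := by
  rcases Nat.eq_zero_or_pos j with rfl | h
  · refine ⟨?_, fun x hx => by simp only [hS.d_zero x hx.1, sub_self]⟩
    exact ((memZ_interp d₀).linComb (memZ_interp d₀) 0 0).congr fun x hx => by
      rw [hS.d_zero x hx]; simp
  · exact hS.d_mem j h hj

theorem memZ_d (hS : IsSchemeSolution P M k J v₀ d₀ v d w R) {j : ℕ} (hj : j ≤ J) :
    M.MemZ (d j) := by
  have := (hS.memY_sub_interp hj).1.linComb (memZ_interp d₀) 1 1
  exact this.congr fun x _ => by simp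

theorem memY_dt (hS : IsSchemeSolution P M k J v₀ d₀ v d w R) {j : ℕ} (hj : j ≤ J) :
    M.MemY (dt k d j) := by
  have := (hS.memY_sub_interp hj).linComb
    (hS.memY_sub_interp ((Nat.sub_le j 1).trans hj)) k⁻¹ (-k⁻¹)
  exact this.congr fun x _ => by simp only [dt]; module

theorem memV_dt (hΩc : Convex ℝ Ω) (hS : IsSchemeSolution P M k J v₀ d₀ v d w R) {j : ℕ}
    (hj : j ≤ J) : M.MemV (dt k v j) := by
  have := (hS.memV hj).linComb hΩc (hS.memV ((Nat.sub_le j 1).trans hj)) k⁻¹ (-k⁻¹)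
  have e : dt k v j = fun x => k⁻¹ • v j x + (-k⁻¹) • v (j - 1) x := by
    funext x; simp only [dt]; module
  rwa [e]

/-- The discrete energy identity for one time step. -/
theorem energy_step (hΩo : IsOpen Ω) (hΩc : Convex ℝ Ω) (hΩb : Bornology.IsBounded Ω)
    (hk : 0 < k) (hS : IsSchemeSolution P M k J v₀ d₀ v d w R) {j : ℕ} (hj1 : 1 ≤ j)
    (hj : j ≤ J) :
    1 / 2 * (∫ x in Ω, ‖v j x‖ ^ 2)
      + 1 / 2 * (∫ x in Ω, frob (fderiv ℝ (d j) x) (fderiv ℝ (d j) x))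
      + k ^ 2 / 2 * (∫ x in Ω, ‖dt k v j x‖ ^ 2)
      + k * dissStress P Ω (v j) (d j) (v j)
      + k * (M.lumpedCells fun _ z => ‖cross (mid d j z) (w j z)‖ ^ 2)
    = 1 / 2 * (∫ x in Ω, ‖v (j - 1) x‖ ^ 2)
      + 1 / 2 * (∫ x in Ω, frob (fderiv ℝ (d (j - 1)) x) (fderiv ℝ (d (j - 1)) x)) := by
  have hj' : j - 1 ≤ J := (Nat.sub_le j 1).trans hj
  have hv := hS.memV hj
  have hv' := hS.memV hj'
  have hd := (hS.memZ_d hj).pwC1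
  have hd' := (hS.memZ_d hj').pwC1
  have hw : M.MemY (fun x => -w j x) :=
    ((hS.laplacian j hj1 hj).1.linComb (hS.laplacian j hj1 hj).1 (-1) 0).congr fun x _ => by simp
  -- The three tests are `v j`, minus the discrete Laplacian, and the discrete time derivative of
  -- the director. The last turns the time derivative term of the director equation into a
  -- difference of elastic energies.
  have e1 := hS.momentum j hj1 hj (v j) hv
  have e2 := hS.director j hj1 hj (fun x => -w j x) hw
  have e3 := (hS.laplacian j hj1 hj).2 _ (hS.memY_dt hj)
  have sqc : ∀ {f : E3 → E3}, M.PwC1 f → IntegrableOn (fun x => ‖f x‖ ^ 2) Ω := fun hf =>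
    (hf.pwCont.comp (φ := fun x : E3 => ‖x‖ ^ 2) (by fun_prop)).integrableOn hΩc
  have frc : ∀ {f : E3 → E3}, M.PwC1 f →
      IntegrableOn (fun x => frob (fderiv ℝ f x) (fderiv ℝ f x)) Ω := fun hf =>
    (hf.pwCont_fderiv.comp continuous_frob_self).integrableOn hΩc
  -- time derivative of the velocity
  have t1 : ∫ x in Ω, inner ℝ (dt k v j x) (v j x) = (2 * k)⁻¹ * (∫ x in Ω, ‖v j x‖ ^ 2)
      - (2 * k)⁻¹ * (∫ x in Ω, ‖v (j - 1) x‖ ^ 2) + k / 2 * ∫ x in Ω, ‖dt k v j x‖ ^ 2 := by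
    have i12 : IntegrableOn (fun x => (2 * k)⁻¹ * ‖v j x‖ ^ 2
        - (2 * k)⁻¹ * ‖v (j - 1) x‖ ^ 2) Ω :=
      ((sqc hv.pwC1).const_mul _).sub ((sqc hv'.pwC1).const_mul _)
    rw [← integral_const_mul, ← integral_const_mul, ← integral_const_mul,
      ← integral_sub ((sqc hv.pwC1).const_mul _) ((sqc hv'.pwC1).const_mul _),
      ← integral_add i12 ((sqc (hS.memV_dt hΩc hj).pwC1).const_mul _)]
    refine integral_congr_ae (Eventually.of_forall fun x => ?_)
    simp only [dt, norm_smul, mul_pow, norm_inv, Real.norm_of_nonneg hk.le, inner_smul_left]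
    rw [← real_inner_self_eq_norm_sq (v j x - v (j - 1) x)]
    simp only [inner_sub_left, inner_sub_right, real_inner_self_eq_norm_sq,
      real_inner_comm (v j x) (v (j - 1) x), conj_trivial]
    field_simp
    ring
  -- the convective terms
  have t2 : (∫ x in Ω, inner ℝ (fderiv ℝ (v j) x (v (j - 1) x)) (v j x))
      + 1 / 2 * (∫ x in Ω, inner ℝ (divg (v (j - 1)) x • v j x) (v j x)) = 0 := by
    have h := integral_convective hΩo hΩc hΩb hv'.pwC1 hv.pwC1 hv.pwC1 hv'.2.1
    have h2 : ∫ x in Ω, inner ℝ (v j x) (fderiv ℝ (v j) x (v (j - 1) x))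
        = ∫ x in Ω, inner ℝ (fderiv ℝ (v j) x (v (j - 1) x)) (v j x) :=
      integral_congr_ae (Eventually.of_forall fun x => real_inner_comm _ _)
    rw [h2] at h; linarith
  -- the elastic energy
  have t3 : ∫ x in Ω, frob (fderiv ℝ (mid d j) x) (fderiv ℝ (dt k d j) x)
      = (2 * k)⁻¹ * (∫ x in Ω, frob (fderiv ℝ (d j) x) (fderiv ℝ (d j) x))
        - (2 * k)⁻¹ * ∫ x in Ω, frob (fderiv ℝ (d (j - 1)) x) (fderiv ℝ (d (j - 1)) x) := by
    rw [← integral_const_mul, ← integral_const_mul,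
      ← integral_sub ((frc hd).const_mul _) ((frc hd').const_mul _)]
    refine integral_congr_ae ?_
    have em : mid d j = fun x => (1 / 2 : ℝ) • d j x + (1 / 2 : ℝ) • d (j - 1) x := by
      funext x; simp only [mid]; module
    have et : dt k d j = fun x => k⁻¹ • d j x + (-k⁻¹) • d (j - 1) x := by
      funext x; simp only [dt]; module
    filter_upwards [fderiv_linComb hΩc hd hd' (1 / 2) (1 / 2),
      fderiv_linComb hΩc hd hd' k⁻¹ (-k⁻¹)] with x h1 h2
    rw [em, et, h1, h2]
    simp only [frob, Finset.mul_sum, ← Finset.sum_sub_distrib]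
    refine Finset.sum_congr rfl fun i _ => ?_
    simp only [ContinuousLinearMap.add_apply, ContinuousLinearMap.smul_apply, inner_add_left,
      inner_add_right, inner_smul_left, inner_smul_right, conj_trivial,
      real_inner_comm (fderiv ℝ (d j) x (e i)) (fderiv ℝ (d (j - 1)) x (e i))]
    field_simp
    ring
  rw [t3, M.lumped_eq hΩc] at e3
  unfold MomentumEq leslieStress at e1
  unfold DirectorEq at e2
  rw [t1, M.lumped_eq hΩc] at e1
  simp only [M.lumped_eq hΩc] at e2
  have e4 : (M.lumpedCells fun _ z => inner ℝ (dt k d j z) (-w j z))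
      = M.lumpedCells fun _ z => inner ℝ (-w j z) (dt k d j z) :=
    M.lumpedCells_congr fun _ _ z _ => real_inner_comm _ _
  rw [e4, e3] at e2
  -- the terms evaluated at the nodes
  have key : -(M.lumpedCells fun _ z => inner ℝ (ContinuousLinearMap.adjoint (R j z)
          (cross (mid d j z) (cross (mid d j z) (w j z)))) (v j z))
      + P.lam * (M.lumpedCells fun s z => inner ℝ (cross (mid d j z)
          (symPart (cellGrad (v j) s z) (mid d j z))) (cross (mid d j z) (w j z)))
      + (M.lumpedCells fun s z => inner ℝ (skwPart (cellGrad (v j) s z) (w j z)) (mid d j z))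
      + (M.lumpedCells fun _ z => inner ℝ (cross (mid d j z) (R j z (v j z)))
          (cross (mid d j z) (-w j z)))
      - (M.lumpedCells fun s z => inner ℝ (skwPart (cellGrad (v j) s z) (mid d j z)) (-w j z))
      + P.lam * (M.lumpedCells fun s z => inner ℝ (cross (mid d j z)
          (symPart (cellGrad (v j) s z) (mid d j z))) (cross (mid d j z) (-w j z)))
      - (M.lumpedCells fun _ z => inner ℝ (cross (mid d j z) (w j z))
          (cross (mid d j z) (-w j z)))
      = M.lumpedCells fun _ z => ‖cross (mid d j z) (w j z)‖ ^ 2 := by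
    -- Everything is now one sum over cells and vertices. In each summand the force and transport
    -- terms cancel by the skewness of the cross product, the skew terms by skewness of the matrix,
    -- and the `lam` terms by opposite signs.
    simp only [M.lumpedCells_eq, Finset.mul_sum, ← Finset.sum_add_distrib,
      ← Finset.sum_sub_distrib, ← Finset.sum_neg_distrib]
    refine Finset.sum_congr rfl fun p _ => ?_
    rw [cross_neg_right, inner_neg_right, inner_neg_right, inner_neg_right, inner_neg_right,
      real_inner_self_eq_norm_sq, inner_cross_cross _ (R j p.2 (v j p.2)),
      ContinuousLinearMap.adjoint_inner_left,
      inner_skwPart_swap _ (mid d j p.2) (w j p.2),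
      real_inner_comm (R j p.2 (v j p.2))]
    ring
  have hfin : (2 * k)⁻¹ * (∫ x in Ω, ‖v j x‖ ^ 2)
      - (2 * k)⁻¹ * (∫ x in Ω, ‖v (j - 1) x‖ ^ 2) + k / 2 * (∫ x in Ω, ‖dt k v j x‖ ^ 2)
      + dissStress P Ω (v j) (d j) (v j)
      + ((2 * k)⁻¹ * (∫ x in Ω, frob (fderiv ℝ (d j) x) (fderiv ℝ (d j) x))
        - (2 * k)⁻¹ * ∫ x in Ω, frob (fderiv ℝ (d (j - 1)) x) (fderiv ℝ (d (j - 1)) x))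
      + (M.lumpedCells fun _ z => ‖cross (mid d j z) (w j z)‖ ^ 2) = 0 := by
    rw [← key]; linarith
  have h2k : k * (2 * k)⁻¹ = 1 / 2 := by field_simp
  have := congrArg (k * ·) hfin
  simp only [mul_zero, mul_add, mul_sub, ← mul_assoc, h2k] at this
  have hkk : k * (k / 2) = k ^ 2 / 2 := by ring
  rw [hkk] at this
  linarith

/-- The discrete energy equality. -/
theorem energy_eq (hΩo : IsOpen Ω) (hΩc : Convex ℝ Ω) (hΩb : Bornology.IsBounded Ω)
    (hk : 0 < k) (hS : IsSchemeSolution P M k J v₀ d₀ v d w R) {n : ℕ} (hn : n ≤ J) :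
    1 / 2 * (∫ x in Ω, ‖v n x‖ ^ 2)
      + 1 / 2 * (∫ x in Ω, frob (fderiv ℝ (d n) x) (fderiv ℝ (d n) x))
      + k ^ 2 / 2 * ∑ j ∈ Finset.Icc 1 n, (∫ x in Ω, ‖dt k v j x‖ ^ 2)
      + k * ∑ j ∈ Finset.Icc 1 n, dissStress P Ω (v j) (d j) (v j)
      + k * ∑ j ∈ Finset.Icc 1 n, (M.lumpedCells fun _ z => ‖cross (mid d j z) (w j z)‖ ^ 2)
    = 1 / 2 * (∫ x in Ω, ‖v 0 x‖ ^ 2)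
      + 1 / 2 * (∫ x in Ω, frob (fderiv ℝ (d 0) x) (fderiv ℝ (d 0) x)) := by
  induction n with
  | zero => simp
  | succ n ih =>
    have h1 := ih (by omega)
    have h2 := hS.energy_step hΩo hΩc hΩb hk (j := n + 1) (by omega) hn
    simp only [Finset.sum_Icc_succ_top (by omega : 1 ≤ n + 1), mul_add]
    simp only [Nat.add_sub_cancel] at h2
    linarith

/-- Test with the midpoint value at the single node `z`, admissible because `z` is interior. Terms
containing `cross m c` vanish as `c` is parallel to `m`, and the skew term vanishes by skewness.
What remains is the product of the difference and the sum of the two directors, so their lengths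
agree. -/
theorem norm_d_succ (hΩo : IsOpen Ω) (hΩc : Convex ℝ Ω)
    (hS : IsSchemeSolution P M k J v₀ d₀ v d w R) (hk : 0 < k) {j : ℕ} (hj1 : 1 ≤ j) (hj : j ≤ J)
    {z : E3} (hz : z ∈ M.nodes) (hzf : z ∉ frontier Ω) : ‖d j z‖ = ‖d (j - 1) z‖ := by
  classical
  set g : E3 → E3 := fun y => if y = z then mid d j z else 0 with hg
  have hc : M.MemY (M.interp g) := memY_interp hΩo hΩc fun y _ hyf => by
    rw [hg]; simp only; rw [if_neg]; rintro rfl; exact hzf hyf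
  have hnode : ∀ y ∈ M.nodes, M.interp g y = (if y = z then (1 : ℝ) else 0) • mid d j y := by
    intro y hy
    rw [M.interp_node hy, hg]
    by_cases h : y = z
    · simp [h]
    · simp [h]
  have e := hS.director j hj1 hj _ hc
  unfold DirectorEq at e
  have z1 : ∀ F : Finset E3 → E3 → E3, (M.lumpedCells fun s y => inner ℝ (F s y)
      (cross (mid d j y) (M.interp g y))) = 0 := fun F => by
    refine (M.lumpedCells_congr (g := fun _ _ => 0) fun s hs y hy => ?_).trans
      (by simp [lumpedCells])
    rw [hnode y (M.mem_nodes_of_mem hs hy), cross_smul_self, inner_zero_right]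
  have z2 : (M.lumpedCells fun s y => inner ℝ (skwPart (cellGrad (v j) s y) (mid d j y))
      (M.interp g y)) = 0 := by
    refine (M.lumpedCells_congr (g := fun _ _ => 0) fun s hs y hy => ?_).trans
      (by simp [lumpedCells])
    rw [hnode y (M.mem_nodes_of_mem hs hy), inner_smul_right, inner_skwPart_self, mul_zero]
  rw [M.lumped_eq hΩc (fun z => cross (mid d j z) (R j z (v j z))),
    M.lumped_eq hΩc (fun z => cross (mid d j z) (w j z)), z1, z2, z1, z1] at e
  have hβ : 0 < ∫ x in Ω, M.hat z x := by
    rw [M.integral_hat hΩc]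
    obtain ⟨s, hs, hzs⟩ := M.mem_nodes.1 hz
    exact Finset.sum_pos' (fun s _ => M.mass_nonneg s z) ⟨s, hs, M.mass_pos hs hzs⟩
  have e' : inner ℝ (dt k d j z) (mid d j z) * (∫ x in Ω, M.hat z x) = 0 := by
    have h1 : M.lumped (dt k d j) (M.interp g) = 0 := by linarith
    rw [lumped, Finset.sum_eq_single z] at h1
    · rwa [hnode z hz, if_pos rfl, one_smul] at h1
    · intro y hy hyz
      rw [hnode y hy, if_neg hyz, zero_smul, inner_zero_right, zero_mul]
    · exact fun h => absurd hz h
  have h2 := (mul_eq_zero.1 e').resolve_right hβ.ne'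
  simp only [dt, mid, inner_smul_left, inner_smul_right, conj_trivial, inner_sub_left,
    inner_add_right, real_inner_self_eq_norm_sq,
    real_inner_comm (d j z) (d (j - 1) z)] at h2
  have hk' : k⁻¹ ≠ 0 := (inv_pos.2 hk).ne'
  have h3 : ‖d j z‖ ^ 2 = ‖d (j - 1) z‖ ^ 2 := by
    have h4 : k⁻¹ * (‖d j z‖ ^ 2 - ‖d (j - 1) z‖ ^ 2) = 0 := by linarith
    linarith [(mul_eq_zero.1 h4).resolve_left hk']
  exact (sq_eq_sq₀ (norm_nonneg _) (norm_nonneg _)).1 h3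

/-- The unit-norm restriction at the nodes. -/
theorem norm_d_eq_one (hΩo : IsOpen Ω) (hΩc : Convex ℝ Ω)
    (hS : IsSchemeSolution P M k J v₀ d₀ v d w R) (hk : 0 < k)
    (hd₀ : ContinuousOn d₀ (closure Ω)) (h1 : ∀ x ∈ Ω, ‖d₀ x‖ = 1) {j : ℕ} (hj : j ≤ J)
    {z : E3} (hz : z ∈ M.nodes) : ‖d j z‖ = 1 := by
  -- The unit length extends to the closure by continuity; it is needed at the boundary nodes.
  have hcl : ∀ x ∈ closure Ω, ‖d₀ x‖ = 1 := fun x hx => by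
    have h2 : ∀ᶠ y in 𝓝[Ω] x, ‖d₀ y‖ = 1 := by
      filter_upwards [self_mem_nhdsWithin] with y hy using h1 y hy
    have hne : (𝓝[Ω] x).NeBot := mem_closure_iff_nhdsWithin_neBot.1 hx
    have h3 : Tendsto (fun y => ‖d₀ y‖) (𝓝[Ω] x) (𝓝 ‖d₀ x‖) :=
      ((hd₀ x hx).mono_left (nhdsWithin_mono x subset_closure)).norm
    exact (tendsto_nhds_unique (tendsto_const_nhds.congr' (h2.mono fun y hy => hy.symm)) h3).symm
  have hz' := M.node_mem_closure hz
  have h0 : ‖d 0 z‖ = 1 := by rw [hS.d_zero z hz', M.interp_node hz, hcl z hz']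
  -- Boundary nodes keep the value of the interpolant of `d₀`; interior nodes preserve length from
  -- step to step.
  by_cases hzf : z ∈ frontier Ω
  · have := (hS.memY_sub_interp hj).2 z hzf
    rw [sub_eq_zero.1 this, M.interp_node hz, hcl z hz']
  · induction j with
    | zero => exact h0
    | succ n ih =>
      rw [hS.norm_d_succ hΩo hΩc hk (by omega) hj hz hzf]
      exact ih (by omega)

end IsSchemeSolution

end EricksenLeslie

/-! ### Hölder inequalities and the bound for the time derivative of the director -/

namespace EricksenLeslie
open Filter Topology

/-- The Cauchy–Schwarz inequality for integrals of real functions. -/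
theorem sq_integral_mul_le {μ : Measure E3} {f g : E3 → ℝ} (hf : Integrable (fun x => f x ^ 2) μ)
    (hg : Integrable (fun x => g x ^ 2) μ) (hfg : Integrable (fun x => f x * g x) μ) :
    (∫ x, f x * g x ∂μ) ^ 2 ≤ (∫ x, f x ^ 2 ∂μ) * ∫ x, g x ^ 2 ∂μ := by
  have h : ∀ t : ℝ, 0 ≤ (∫ x, f x ^ 2 ∂μ) * (t * t) + (2 * ∫ x, f x * g x ∂μ) * t
      + ∫ x, g x ^ 2 ∂μ := fun t => by
    have i1 : Integrable (fun x => t * t * f x ^ 2 + 2 * t * (f x * g x)) μ :=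
      (hf.const_mul _).add (hfg.const_mul _)
    have e : ∫ x, (t * f x + g x) ^ 2 ∂μ = (∫ x, f x ^ 2 ∂μ) * (t * t)
        + (2 * ∫ x, f x * g x ∂μ) * t + ∫ x, g x ^ 2 ∂μ := by
      calc _ = ∫ x, (t * t * f x ^ 2 + 2 * t * (f x * g x)) + g x ^ 2 ∂μ :=
            integral_congr_ae (Eventually.of_forall fun x => by ring)
        _ = _ := by
            rw [integral_add i1 hg, integral_add (hf.const_mul _) (hfg.const_mul _),
              integral_const_mul, integral_const_mul]
            ring
    rw [← e]
    exact integral_nonneg fun x => sq_nonneg _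
  have := discrim_le_zero h
  rw [discrim] at this
  linarith

theorem abs_integral_mul_le {μ : Measure E3} {f g : E3 → ℝ}
    (hf : Integrable (fun x => f x ^ 2) μ) (hg : Integrable (fun x => g x ^ 2) μ)
    (hfg : Integrable (fun x => f x * g x) μ) :
    |∫ x, f x * g x ∂μ| ≤ √(∫ x, f x ^ 2 ∂μ) * √(∫ x, g x ^ 2 ∂μ) := by
  rw [← Real.sqrt_mul (integral_nonneg fun x => sq_nonneg _)]
  exact Real.abs_le_sqrt (sq_integral_mul_le hf hg hfg)

/-- Hölder's inequality with exponents `3` and `3/2` for weighted sums. -/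
theorem pow_three_sum_mul_le {ι : Type*} (S : Finset ι) (β u ρ : ι → ℝ) (hβ : ∀ i ∈ S, 0 ≤ β i)
    (hu : ∀ i ∈ S, 0 ≤ u i) (hρ : ∀ i ∈ S, 0 ≤ ρ i) :
    (∑ i ∈ S, β i * (u i * ρ i ^ 2)) ^ 3 ≤
      (∑ i ∈ S, β i * u i ^ 3) * (∑ i ∈ S, β i * ρ i ^ 3) ^ 2 := by
  have hpq : (3 : ℝ).HolderConjugate (3 / 2) := by
    rw [Real.holderConjugate_iff]; norm_num
  have hb : ∀ i ∈ S, (β i ^ (1 / 3 : ℝ)) ^ 3 = β i := fun i hi => by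
    rw [← Real.rpow_natCast, ← Real.rpow_mul (hβ i hi)]; norm_num
  have hb0 : ∀ i ∈ S, 0 ≤ β i ^ (1 / 3 : ℝ) := fun i hi => Real.rpow_nonneg (hβ i hi) _
  have h := Real.inner_le_Lp_mul_Lq_of_nonneg S hpq (f := fun i => β i ^ (1 / 3 : ℝ) * u i)
    (g := fun i => (β i ^ (1 / 3 : ℝ) * ρ i) ^ 2)
    (fun i hi => mul_nonneg (hb0 i hi) (hu i hi)) (fun i _ => sq_nonneg _)
  have e1 : ∑ i ∈ S, β i ^ (1 / 3 : ℝ) * u i * (β i ^ (1 / 3 : ℝ) * ρ i) ^ 2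
      = ∑ i ∈ S, β i * (u i * ρ i ^ 2) := Finset.sum_congr rfl fun i hi => by
    calc _ = (β i ^ (1 / 3 : ℝ)) ^ 3 * (u i * ρ i ^ 2) := by ring
      _ = _ := by rw [hb i hi]
  have e2 : ∑ i ∈ S, (β i ^ (1 / 3 : ℝ) * u i) ^ (3 : ℝ) = ∑ i ∈ S, β i * u i ^ 3 :=
    Finset.sum_congr rfl fun i hi => by
      have : (3 : ℝ) = ((3 : ℕ) : ℝ) := by norm_num
      rw [this, Real.rpow_natCast, mul_pow]
      rw [← this, hb i hi]
  have e3 : ∑ i ∈ S, ((β i ^ (1 / 3 : ℝ) * ρ i) ^ 2) ^ (3 / 2 : ℝ) = ∑ i ∈ S, β i * ρ i ^ 3 :=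
    Finset.sum_congr rfl fun i hi => by
      have h0 := mul_nonneg (hb0 i hi) (hρ i hi)
      rw [← Real.rpow_natCast, ← Real.rpow_mul h0]
      have : ((2 : ℕ) : ℝ) * (3 / 2) = ((3 : ℕ) : ℝ) := by norm_num
      rw [this, Real.rpow_natCast, mul_pow, hb i hi]
  rw [e1, e2, e3] at h
  have n1 : 0 ≤ ∑ i ∈ S, β i * u i ^ 3 :=
    Finset.sum_nonneg fun i hi => mul_nonneg (hβ i hi) (pow_nonneg (hu i hi) 3)
  have n2 : 0 ≤ ∑ i ∈ S, β i * ρ i ^ 3 :=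
    Finset.sum_nonneg fun i hi => mul_nonneg (hβ i hi) (pow_nonneg (hρ i hi) 3)
  have n0 : 0 ≤ ∑ i ∈ S, β i * (u i * ρ i ^ 2) := Finset.sum_nonneg fun i hi =>
    mul_nonneg (hβ i hi) (mul_nonneg (hu i hi) (sq_nonneg _))
  refine (pow_le_pow_left₀ n0 h 3).trans (le_of_eq ?_)
  rw [mul_pow, ← Real.rpow_natCast, ← Real.rpow_mul n1, ← Real.rpow_natCast (_ ^ (1 / (3 / 2 : ℝ))),
    ← Real.rpow_mul n2, ← Real.rpow_natCast (∑ i ∈ S, β i * ρ i ^ 3)]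
  norm_num

namespace TetMesh

variable {Ω : Set E3} (M : TetMesh Ω) {s t : Finset E3}
variable {F : Type*} [NormedAddCommGroup F] [NormedSpace ℝ F]

theorem lumpedCells_pow_three_le (u ρ : Finset E3 → E3 → ℝ)
    (hu : ∀ s ∈ M.cells, ∀ z ∈ s, 0 ≤ u s z) (hρ : ∀ s ∈ M.cells, ∀ z ∈ s, 0 ≤ ρ s z) :
    (M.lumpedCells fun s z => u s z * ρ s z ^ 2) ^ 3 ≤
      (M.lumpedCells fun s z => u s z ^ 3) * (M.lumpedCells fun s z => ρ s z ^ 3) ^ 2 := by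
  have := pow_three_sum_mul_le (M.cells.sigma fun s => s) (fun p => M.mass p.1 p.2)
    (fun p => u p.1 p.2) (fun p => ρ p.1 p.2) (fun p _ => M.mass_nonneg _ _)
    (fun p hp => hu p.1 (Finset.mem_sigma.1 hp).1 p.2 (Finset.mem_sigma.1 hp).2)
    (fun p hp => hρ p.1 (Finset.mem_sigma.1 hp).1 p.2 (Finset.mem_sigma.1 hp).2)
  simp only [M.lumpedCells_eq]
  simpa only [mul_comm] using this

theorem lumpedCells_one (hΩc : Convex ℝ Ω) : (M.lumpedCells fun _ _ => 1) = volume.real Ω := by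
  have h1 : ∫ x in Ω, (1 : ℝ) = ∑ s ∈ M.cells, ∫ x in hull s, (1 : ℝ) :=
    M.integral_eq hΩc fun s _ => integrableOn_const (isCompact_hull s).measure_lt_top.ne
  rw [setIntegral_const, smul_eq_mul, mul_one] at h1
  rw [h1]
  refine Finset.sum_congr rfl fun s hs => ?_
  have h2 : ∀ z ∈ s, 1 * ∫ x in hull s, M.hat z x = ∫ x in hull s, M.coord s z x := fun z _ => by
    rw [one_mul]; exact M.mass_eq hs z
  rw [Finset.sum_congr rfl h2, ← integral_finsetSum _ fun z _ => M.integrableOn_coord s z]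
  exact integral_congr_ae (Eventually.of_forall fun x => M.sum_coord hs x)

/-- Jensen's inequality for the lumped quadrature, with real exponents. -/
theorem integral_rpow_le_lumped (hΩc : Convex ℝ Ω) {f : E3 → F} (hf : M.PwAff f) {p : ℝ}
    (hp : 1 ≤ p) : ∫ x in Ω, ‖f x‖ ^ p ≤ M.lumpedCells fun _ z => ‖f z‖ ^ p := by
  have hc : M.PwCont fun x => ‖f x‖ ^ p :=
    hf.pwQuad.pwC1.pwCont.comp (φ := fun x => ‖x‖ ^ p)
      (continuous_norm.rpow_const fun _ => Or.inr (by linarith))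
  rw [hc.integral_eq hΩc]
  refine Finset.sum_le_sum fun s hs => ?_
  calc ∫ x in hull s, ‖f x‖ ^ p
      ≤ ∫ x in hull s, ∑ z ∈ s, ‖f z‖ ^ p * M.coord s z x := by
        refine setIntegral_mono_on (hc.integrableOn_hull hs)
          (integrable_finsetSum _ fun z _ => (M.integrableOn_coord s z).const_mul _)
          (measurableSet_hull s) fun x hx => ?_
        have h0 : ∀ z ∈ s, 0 ≤ M.coord s z x := fun z _ => (M.mem_hull_iff hs).1 hx z
        calc ‖f x‖ ^ p ≤ (∑ z ∈ s, M.coord s z x * ‖f z‖) ^ p := by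
              refine Real.rpow_le_rpow (norm_nonneg _) ?_ (by linarith)
              rw [hf.eq_sum_coord hs hx]
              refine (norm_sum_le _ _).trans (Finset.sum_le_sum fun z hz => ?_)
              rw [norm_smul, Real.norm_of_nonneg (h0 z hz)]
          _ ≤ ∑ z ∈ s, M.coord s z x * ‖f z‖ ^ p :=
              Real.rpow_arith_mean_le_arith_mean_rpow s _ _ h0 (M.sum_coord hs x)
                (fun z _ => norm_nonneg _) hp
          _ = _ := Finset.sum_congr rfl fun z _ => mul_comm _ _
    _ = ∑ z ∈ s, ‖f z‖ ^ p * M.mass s z := by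
        rw [integral_finsetSum _ fun z _ => (M.integrableOn_coord s z).const_mul _]
        exact Finset.sum_congr rfl fun z _ => by rw [integral_const_mul, M.mass_eq hs]

variable {M}

theorem PwCont.integrableOn_sq (hΩc : Convex ℝ Ω) {f : E3 → F} (hf : M.PwCont f) :
    IntegrableOn (fun x => ‖f x‖ ^ 2) Ω :=
  (hf.comp (φ := fun x : F => ‖x‖ ^ 2) (by fun_prop)).integrableOn hΩc

/-- The lumped projection is bounded. -/
theorem IsLumpedProj.lumped_le (hΩc : Convex ℝ Ω) {A R : E3 → Mat3} (hR : M.IsLumpedProj A R)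
    (hA : M.PwCont A) :
    (M.lumpedCells fun _ z => ‖R z‖ ^ 2) ≤ ∫ x in Ω, frob (A x) (A x) := by
  have hcol : ∀ w : E3, (M.lumpedCells fun _ z => ‖R z w‖ ^ 2) ≤ ∫ x in Ω, ‖A x w‖ ^ 2 := by
    intro w
    obtain ⟨hZ, hb⟩ := hR w
    have hAw : M.PwCont fun x => A x w := hA.comp (φ := fun B : Mat3 => B w) (by fun_prop)
    -- Test the projection with itself and apply Young's inequality. The `L²` norm of the projection
    -- is at most its lumped norm, so half of the latter is absorbed.
    have h1 := hb _ hZ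
    rw [M.lumped_eq hΩc] at h1
    simp only [real_inner_self_eq_norm_sq] at h1
    have h2 := M.integral_pow_le_lumped hΩc hZ.pwAff 2
    have h3 : ∫ x in Ω, inner ℝ (A x w) (R x w) ≤
        1 / 2 * (∫ x in Ω, ‖A x w‖ ^ 2) + 1 / 2 * ∫ x in Ω, ‖R x w‖ ^ 2 := by
      have i1 := hAw.integrableOn_sq hΩc
      have i2 := hZ.pwC1.pwCont.integrableOn_sq hΩc
      rw [← integral_const_mul, ← integral_const_mul,
        ← integral_add (i1.const_mul _) (i2.const_mul _)]
      refine integral_mono ((hAw.comp₂ hZ.pwC1.pwCont (fun y z => inner ℝ y z)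
        (by fun_prop)).integrableOn hΩc) ((i1.const_mul _).add (i2.const_mul _)) fun x => ?_
      have := real_inner_le_norm (A x w) (R x w)
      simp only [Pi.add_apply]
      nlinarith [sq_nonneg (‖A x w‖ - ‖R x w‖)]
    linarith
  calc _ ≤ M.lumpedCells fun _ z => ∑ i, ‖R z (e i)‖ ^ 2 :=
        M.lumpedCells_mono fun s _ z _ => by
          rw [← frob_self]; exact opNorm_sq_le_frob _
    _ = ∑ i, M.lumpedCells fun _ z => ‖R z (e i)‖ ^ 2 := by
        simp only [M.lumpedCells_eq, Finset.sum_mul]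
        exact Finset.sum_comm
    _ ≤ ∑ i, ∫ x in Ω, ‖A x (e i)‖ ^ 2 := Finset.sum_le_sum fun i _ => hcol (e i)
    _ = _ := by
        rw [← integral_finsetSum _ fun i _ => (hA.comp (φ := fun B : Mat3 => B (e i))
          (by fun_prop)).integrableOn_sq hΩc]
        exact integral_congr_ae (Eventually.of_forall fun x => (frob_self _).symm)

end TetMesh

open TetMesh

theorem pow_le_of_pow_three {q A X : ℝ} (hq : 0 ≤ q) (hA : 0 ≤ A) (hX : X ^ 3 ≤ A ^ 3 * (q ^ 3) ^ 2) :
    X ≤ A * q ^ 2 := by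
  have : X ^ 3 ≤ (A * q ^ 2) ^ 3 := hX.trans (le_of_eq (by ring))
  exact le_of_pow_le_pow_left₀ (by norm_num) (by positivity) this

namespace IsSchemeSolution

variable {Ω : Set E3} {P : LeslieCoeffs} {M : TetMesh Ω} {k : ℝ} {J : ℕ} {v₀ d₀ : E3 → E3}
  {v d w : ℕ → E3 → E3} {R : ℕ → E3 → Mat3}

/-- The duality estimate for the discrete time derivative of the director. -/
theorem eLpNorm_dt_le (hΩo : IsOpen Ω) (hΩc : Convex ℝ Ω)
    (hS : IsSchemeSolution P M k J v₀ d₀ v d w R) {j : ℕ} (hj1 : 1 ≤ j) (hj : j ≤ J)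
    (hm : ∀ z ∈ M.nodes, ‖mid d j z‖ ≤ 1) {a b : ℝ} (ha : 0 ≤ a) (hb : 0 ≤ b)
    (hv6 : (M.lumpedCells fun _ z => ‖v j z‖ ^ 6) ≤ a ^ 6) (hΩv : volume.real Ω ≤ b ^ 6) :
    eLpNorm (dt k d j) (3 / 2) (volume.restrict Ω) ≤ ENNReal.ofReal
      (√(M.lumpedCells fun _ z => ‖R j z‖ ^ 2) * a
        + ((1 + |P.lam|) * √(M.lumpedCells fun s z => ‖cellGrad (v j) s z‖ ^ 2)
          + √(M.lumpedCells fun _ z => ‖cross (mid d j z) (w j z)‖ ^ 2)) * b) := by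
  set y := dt k d j with hy
  set ρ : E3 → ℝ := fun z => √‖y z‖ with hρ
  have hρ0 : ∀ z, 0 ≤ ρ z := fun z => Real.sqrt_nonneg _
  have hρ2 : ∀ z, ρ z ^ 2 = ‖y z‖ := fun z => Real.sq_sqrt (norm_nonneg _)
  have hY := hS.memY_dt hj
  -- The nodal dual element: its length is the square root `ρ` of that of `y`, and its product with
  -- `y` is `ρ ^ 3`, the `3/2` power of the length of `y`. Where `y` vanishes the inverse is zero
  -- and so is `g`.
  set g : E3 → E3 := fun z => (ρ z)⁻¹ • y z with hg
  have hc : M.MemY (M.interp g) := memY_interp hΩo hΩc fun z _ hz => by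
    simp only [hg, hy, hY.2 z hz, smul_zero]
  have hgn : ∀ z, ‖g z‖ = ρ z := fun z => by
    rw [hg]; simp only
    rw [norm_smul, norm_inv, Real.norm_of_nonneg (hρ0 z), ← hρ2, pow_two]
    by_cases h : ρ z = 0
    · simp [h]
    · field_simp
  have hgi : ∀ z, inner ℝ (y z) (g z) = ρ z ^ 3 := fun z => by
    rw [hg]; simp only
    rw [inner_smul_right, real_inner_self_eq_norm_sq, ← hρ2]
    by_cases h : ρ z = 0
    · simp [h]
    · field_simp
  have hnode : ∀ s ∈ M.cells, ∀ z ∈ s, M.interp g z = g z := fun s hs z hz =>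
    M.interp_node (M.mem_nodes_of_mem hs hz) g
  have hm' : ∀ s ∈ M.cells, ∀ z ∈ s, ‖mid d j z‖ ≤ 1 := fun s hs z hz =>
    hm z (M.mem_nodes_of_mem hs hz)
  set S := M.lumpedCells fun _ z => ρ z ^ 3 with hSdef
  have hS0 : 0 ≤ S := M.lumpedCells_nonneg fun s _ z _ => pow_nonneg (hρ0 z) 3
  obtain ⟨q, hq0, hq⟩ : ∃ q : ℝ, 0 ≤ q ∧ q ^ 3 = S := ⟨S ^ (1 / 3 : ℝ), Real.rpow_nonneg hS0 _, by
    rw [← Real.rpow_natCast, ← Real.rpow_mul hS0]; norm_num⟩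
  set r := √(M.lumpedCells fun _ z => ‖R j z‖ ^ 2)
  set G := √(M.lumpedCells fun s z => ‖cellGrad (v j) s z‖ ^ 2)
  set W := √(M.lumpedCells fun _ z => ‖cross (mid d j z) (w j z)‖ ^ 2)
  have e := hS.director j hj1 hj _ hc
  unfold DirectorEq at e
  simp only [M.lumped_eq hΩc] at e
  have eS : (M.lumpedCells fun _ z => inner ℝ (dt k d j z) (M.interp g z)) = S :=
    M.lumpedCells_congr fun s hs z hz => by rw [hnode s hs z hz, ← hy, hgi]
  rw [eS] at e
  -- crossing with the midpoint value does not increase norms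
  have hmc : ∀ s ∈ M.cells, ∀ z ∈ s, ∀ x, ‖cross (mid d j z) x‖ ≤ ‖x‖ := fun s hs z hz x =>
    (norm_cross_le _ _).trans (mul_le_of_le_one_left (norm_nonneg _) (hm' s hs z hz))
  have hin : ∀ s ∈ M.cells, ∀ z ∈ s, ∀ x, |inner ℝ x (cross (mid d j z) (M.interp g z))| ≤
      ‖x‖ * ρ z := fun s hs z hz x => by
    refine (abs_real_inner_le_norm _ _).trans ?_
    have := hmc s hs z hz (M.interp g z)
    rw [hnode s hs z hz, hgn] at this
    rw [hnode s hs z hz]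
    gcongr
  have T1 : |M.lumpedCells fun _ z => inner ℝ (cross (mid d j z) (R j z (v j z)))
      (cross (mid d j z) (M.interp g z))| ≤
        M.lumpedCells fun _ z => ‖R j z‖ * (‖v j z‖ * ρ z) := by
    refine (M.abs_lumpedCells_le _).trans (M.lumpedCells_mono fun s hs z hz => ?_)
    refine (hin s hs z hz _).trans ?_
    rw [← mul_assoc]
    exact mul_le_mul_of_nonneg_right ((hmc s hs z hz _).trans ((R j z).le_opNorm _)) (hρ0 z)
  have T2 : |M.lumpedCells fun s z => inner ℝ (skwPart (cellGrad (v j) s z) (mid d j z))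
      (M.interp g z)| ≤ M.lumpedCells fun s z => ‖cellGrad (v j) s z‖ * ρ z := by
    refine (M.abs_lumpedCells_le _).trans (M.lumpedCells_mono fun s hs z hz => ?_)
    refine (abs_real_inner_le_norm _ _).trans ?_
    rw [hnode s hs z hz, hgn]
    refine mul_le_mul_of_nonneg_right ?_ (hρ0 z)
    refine ((skwPart _).le_opNorm _).trans ?_
    exact (mul_le_of_le_one_right (norm_nonneg _) (hm' s hs z hz)).trans (norm_skwPart_le _)
  have T3 : |M.lumpedCells fun s z => inner ℝ (cross (mid d j z)
      (symPart (cellGrad (v j) s z) (mid d j z))) (cross (mid d j z) (M.interp g z))| ≤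
        M.lumpedCells fun s z => ‖cellGrad (v j) s z‖ * ρ z := by
    refine (M.abs_lumpedCells_le _).trans (M.lumpedCells_mono fun s hs z hz => ?_)
    refine (hin s hs z hz _).trans (mul_le_mul_of_nonneg_right ?_ (hρ0 z))
    refine (hmc s hs z hz _).trans (((symPart _).le_opNorm _).trans ?_)
    exact (mul_le_of_le_one_right (norm_nonneg _) (hm' s hs z hz)).trans (norm_symPart_le _)
  have T4 : |M.lumpedCells fun _ z => inner ℝ (cross (mid d j z) (w j z))
      (cross (mid d j z) (M.interp g z))| ≤
        M.lumpedCells fun _ z => ‖cross (mid d j z) (w j z)‖ * ρ z :=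
    (M.abs_lumpedCells_le _).trans (M.lumpedCells_mono fun s hs z hz => hin s hs z hz _)
  -- Hölder's inequality
  have H1 : (M.lumpedCells fun _ z => (‖v j z‖ * ρ z) ^ 2) ≤ (a * q) ^ 2 := by
    have h := M.lumpedCells_pow_three_le (fun _ z => ‖v j z‖ ^ 2) (fun _ z => ρ z)
      (fun s _ z _ => by positivity) (fun s _ z _ => hρ0 z)
    rw [← hSdef, ← hq] at h
    simp only [← pow_mul] at h
    rw [mul_pow]
    simp only [mul_pow]
    refine pow_le_of_pow_three hq0 (by positivity) (h.trans ?_)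
    rw [show (a ^ 2) ^ 3 = a ^ 6 by ring]
    have e6 : q ^ (3 * 2) = (q ^ 3) ^ 2 := by ring
    rw [e6]
    exact mul_le_mul_of_nonneg_right (by simpa using hv6) (by positivity)
  have H2 : (M.lumpedCells fun _ z => ρ z ^ 2) ≤ (b * q) ^ 2 := by
    have h := M.lumpedCells_pow_three_le (fun _ _ => 1) (fun _ z => ρ z)
      (fun s _ z _ => by positivity) (fun s _ z _ => hρ0 z)
    rw [← hSdef, ← hq] at h
    simp only [one_pow, one_mul, M.lumpedCells_one hΩc] at h
    rw [mul_pow]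
    refine pow_le_of_pow_three hq0 (by positivity) (h.trans ?_)
    rw [show (b ^ 2) ^ 3 = b ^ 6 by ring]
    exact mul_le_mul_of_nonneg_right hΩv (by positivity)
  have U1 : (M.lumpedCells fun _ z => ‖R j z‖ * (‖v j z‖ * ρ z)) ≤ r * (a * q) := by
    refine (M.lumpedCells_mul_le _ _).trans (mul_le_mul_of_nonneg_left ?_ (Real.sqrt_nonneg _))
    exact Real.sqrt_le_iff.2 ⟨by positivity, H1⟩
  have U2 : (M.lumpedCells fun s z => ‖cellGrad (v j) s z‖ * ρ z) ≤ G * (b * q) := by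
    refine (M.lumpedCells_mul_le _ _).trans (mul_le_mul_of_nonneg_left ?_ (Real.sqrt_nonneg _))
    exact Real.sqrt_le_iff.2 ⟨by positivity, H2⟩
  have U3 : (M.lumpedCells fun _ z => ‖cross (mid d j z) (w j z)‖ * ρ z) ≤ W * (b * q) := by
    refine (M.lumpedCells_mul_le _ _).trans (mul_le_mul_of_nonneg_left ?_ (Real.sqrt_nonneg _))
    exact Real.sqrt_le_iff.2 ⟨by positivity, H2⟩
  set Q := r * a + ((1 + |P.lam|) * G + W) * b with hQ
  have hQ0 : 0 ≤ Q := by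
    have h1 : 0 ≤ r := Real.sqrt_nonneg _
    have h2 : 0 ≤ G := Real.sqrt_nonneg _
    have h3 : 0 ≤ W := Real.sqrt_nonneg _
    positivity
  -- The tested equation gives `q ^ 3` on one side and terms linear in `q` on the other. Dividing by
  -- `q` bounds `q ^ 2`, the lumped `L^{3/2}` norm of `y`.
  have hmain : q ^ 3 ≤ Q * q := by
    rw [hq]
    have h1 := (abs_le.1 (T1.trans U1)).1
    have h2 := (abs_le.1 (T2.trans U2)).2
    have h3 := (abs_le.1 (T4.trans U3)).2
    have h4 : |P.lam * (M.lumpedCells fun s z => inner ℝ (cross (mid d j z)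
        (symPart (cellGrad (v j) s z) (mid d j z))) (cross (mid d j z) (M.interp g z)))| ≤
          |P.lam| * (G * (b * q)) := by
      rw [abs_mul]; exact mul_le_mul_of_nonneg_left (T3.trans U2) (abs_nonneg _)
    have h5 := (abs_le.1 h4).1
    have h6 : Q * q = r * (a * q) + G * (b * q) + |P.lam| * (G * (b * q)) + W * (b * q) := by
      rw [hQ]; ring
    rw [h6]
    linarith
  have hq2 : q ^ 2 ≤ Q := by
    rcases eq_or_lt_of_le hq0 with h | h
    · rw [← h]; simpa using hQ0
    · exact le_of_mul_le_mul_right (by linarith [hmain, pow_succ q 2]) h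
  -- from the nodes to the Lebesgue norm
  have hJ := M.integral_rpow_le_lumped hΩc hY.1.pwAff (p := 3 / 2) (by norm_num)
  have hJ' : (M.lumpedCells fun _ z => ‖dt k d j z‖ ^ (3 / 2 : ℝ)) = S :=
    M.lumpedCells_congr fun s _ z _ => by
      rw [← hy, ← hρ2, ← Real.rpow_natCast, ← Real.rpow_mul (hρ0 z)]
      norm_num
  rw [hJ', ← hq] at hJ
  have hint : IntegrableOn (fun x => ‖y x‖ ^ (3 / 2 : ℝ)) Ω :=
    (hY.1.pwC1.pwCont.comp (φ := fun x : E3 => ‖x‖ ^ (3 / 2 : ℝ))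
      (continuous_norm.rpow_const fun _ => Or.inr (by norm_num))).integrableOn hΩc
  have hp : ((3 : ℝ≥0∞) / 2).toReal = 3 / 2 := by simp
  rw [eLpNorm_eq_lintegral_rpow_enorm_toReal (by simp) (ENNReal.div_ne_top (by simp) (by simp)), hp]
  have hl : ∫⁻ x in Ω, ‖y x‖ₑ ^ (3 / 2 : ℝ) ≤ ENNReal.ofReal (q ^ 3) := by
    refine le_trans (le_of_eq ?_) (ENNReal.ofReal_le_ofReal hJ)
    rw [ofReal_integral_eq_lintegral_ofReal hint (Eventually.of_forall fun x => by positivity)]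
    refine lintegral_congr fun x => ?_
    rw [← ofReal_norm, ENNReal.ofReal_rpow_of_nonneg (norm_nonneg _) (by norm_num)]
  refine (ENNReal.rpow_le_rpow hl (by norm_num)).trans ?_
  rw [ENNReal.ofReal_rpow_of_nonneg (by positivity) (by norm_num)]
  refine ENNReal.ofReal_le_ofReal (le_trans (le_of_eq ?_) hq2)
  rw [← Real.rpow_natCast, ← Real.rpow_mul hq0, ← Real.rpow_natCast]
  norm_num

end IsSchemeSolution

end EricksenLeslie

/-! ### Shape regularity and stability of nodal interpolation -/

namespace EricksenLeslie
open Filter Topology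

/-- The volume of the unit ball. -/
noncomputable def ballVol : ℝ := volume.real (Metric.ball (0 : E3) 1)

theorem ballVol_pos : 0 < ballVol :=
  ENNReal.toReal_pos (Metric.measure_ball_pos volume 0 one_pos).ne'
    Metric.isBounded_ball.measure_lt_top.ne

theorem volume_real_closedBall (c : E3) {r : ℝ} (hr : 0 ≤ r) :
    volume.real (Metric.closedBall c r) = ballVol * r ^ 3 := by
  rw [Measure.real, Measure.addHaar_closedBall _ _ hr, finrank_E3, ENNReal.toReal_mul,
    ENNReal.toReal_ofReal (by positivity), mul_comm]; rfl

namespace TetMesh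

variable {Ω : Set E3} (M : TetMesh Ω) {s t : Finset E3}

/-- All tetrahedra have diameter at most `δ` and contain a ball of radius `σ δ`. -/
structure IsShape (M : TetMesh Ω) (δ σ : ℝ) : Prop where
  δ_pos : 0 < δ
  σ_pos : 0 < σ
  diam : ∀ s ∈ M.cells, ∀ x ∈ hull s, ∀ y ∈ hull s, ‖x - y‖ ≤ δ
  ball : ∀ s ∈ M.cells, ∃ c : E3, Metric.closedBall c (σ * δ) ⊆ hull s

theorem _root_.EricksenLeslie.diam_pos_of_isOpen (hΩo : IsOpen Ω) (hΩb : Bornology.IsBounded Ω)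
    (hΩn : Ω.Nonempty) : 0 < Metric.diam Ω := by
  obtain ⟨x, hx⟩ := hΩn
  exact Metric.diam_pos (infinite_of_mem_nhds x (hΩo.mem_nhds hx)).nontrivial hΩb

variable {M}

/-- Quasi-uniformity fixes the diameter of the inner ball; the radius is what enters here, hence `ρ
/ 2`. -/
theorem QuasiUniform.isShape (hΩo : IsOpen Ω) (hΩb : Bornology.IsBounded Ω) (hΩn : Ω.Nonempty)
    {ρ h : ℝ} (hρ : 0 < ρ) (hM : M.QuasiUniform ρ h) :
    M.IsShape (h * Metric.diam Ω) (ρ / 2) where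
  δ_pos := mul_pos hM.1 (diam_pos_of_isOpen hΩo hΩb hΩn)
  σ_pos := half_pos hρ
  diam s hs x hx y hy := by
    rw [← dist_eq_norm]
    exact (Metric.dist_le_diam_of_mem (isCompact_hull s).isBounded hx hy).trans (hM.2.2 s hs).1
  ball s hs := by
    obtain ⟨c, hc⟩ := (hM.2.2 s hs).2
    refine ⟨c, ?_⟩
    rwa [show ρ / 2 * (h * Metric.diam Ω) = ρ * h * Metric.diam Ω / 2 by ring]

namespace IsShape

variable {δ σ : ℝ}

theorem radius_pos (h : M.IsShape δ σ) : 0 < σ * δ := mul_pos h.σ_pos h.δ_pos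

theorem le_volume (h : M.IsShape δ σ) (hs : s ∈ M.cells) :
    ballVol * (σ * δ) ^ 3 ≤ volume.real (hull s) := by
  obtain ⟨c, hc⟩ := h.ball s hs
  rw [← volume_real_closedBall c h.radius_pos.le]
  exact measureReal_mono hc (isCompact_hull s).measure_lt_top.ne

/-- The tetrahedra around a vertex have bounded volume. -/
theorem sum_volume_le (h : M.IsShape δ σ) (hΩc : Convex ℝ Ω) (z : E3) [DecidableEq E3] :
    ∑ s ∈ M.cells.filter (fun s => z ∈ s), volume.real (hull s) ≤ ballVol * δ ^ 3 := by
  rw [← volume_real_closedBall z h.δ_pos.le]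
  set Bz := Metric.closedBall z δ with hB
  have hBm : MeasurableSet Bz := Metric.isClosed_closedBall.measurableSet
  have hBt : volume Bz ≠ ⊤ := Metric.isBounded_closedBall.measure_lt_top.ne
  have h1 : ∑ s ∈ M.cells.filter (fun s => z ∈ s), volume (hull s) ≤ volume Bz := by
    calc _ ≤ ∑ s ∈ M.cells.filter (fun s => z ∈ s), volume.restrict (hull s) Bz := by
          refine Finset.sum_le_sum fun s hs => ?_
          obtain ⟨hs, hzs⟩ := Finset.mem_filter.1 hs
          rw [Measure.restrict_apply hBm]
          refine measure_mono fun x hx => ⟨?_, hx⟩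
          rw [hB, Metric.mem_closedBall, dist_eq_norm]
          exact h.diam s hs x hx z (mem_hull hzs)
      _ ≤ ∑ s ∈ M.cells, volume.restrict (hull s) Bz :=
          Finset.sum_le_sum_of_subset (Finset.filter_subset _ _)
      _ = volume.restrict Ω Bz := by
          rw [M.restrict_eq hΩc, Measure.coe_finsetSum, Finset.sum_apply]
      _ ≤ volume Bz := Measure.restrict_apply_le _ _
  have h2 := ENNReal.toReal_mono hBt h1
  rwa [ENNReal.toReal_sum fun s _ => (isCompact_hull s).measure_lt_top.ne] at h2

/-- The cells around `z` have almost disjoint hulls inside the ball of radius `δ`, and each contains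
a ball of radius `σ * δ`. Comparing volumes bounds their number. -/
theorem card_mul_le (h : M.IsShape δ σ) (hΩc : Convex ℝ Ω) (z : E3) [DecidableEq E3] :
    ((M.cells.filter (fun s => z ∈ s)).card : ℝ) * σ ^ 3 ≤ 1 := by
  have h1 := h.sum_volume_le hΩc z
  have h2 : ((M.cells.filter (fun s => z ∈ s)).card : ℝ) * (ballVol * (σ * δ) ^ 3) ≤
      ∑ s ∈ M.cells.filter (fun s => z ∈ s), volume.real (hull s) := by
    rw [← nsmul_eq_mul]
    exact Finset.card_nsmul_le_sum _ _ _ fun s hs => h.le_volume (Finset.mem_filter.1 hs).1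
  have h3 : 0 < ballVol * δ ^ 3 := mul_pos ballVol_pos (pow_pos h.δ_pos 3)
  refine le_of_mul_le_mul_right ?_ h3
  calc _ = ((M.cells.filter (fun s => z ∈ s)).card : ℝ) * (ballVol * (σ * δ) ^ 3) := by ring
    _ ≤ _ := h2.trans (h1.trans (by rw [one_mul]))

theorem integral_hat_le (h : M.IsShape δ σ) (hΩc : Convex ℝ Ω) (z : E3) :
    ∫ x in Ω, M.hat z x ≤ ballVol * δ ^ 3 := by
  classical
  rw [M.integral_hat hΩc]
  refine le_trans ?_ (h.sum_volume_le hΩc z)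
  rw [Finset.sum_filter]
  refine Finset.sum_le_sum fun s hs => ?_
  by_cases hz : z ∈ s
  · rw [if_pos hz]; exact M.mass_le hs z
  · rw [if_neg hz, M.mass_of_notMem hs hz]

end IsShape

/-! ### Gradients of nodal interpolants -/

variable (M)

/-- The gradient of a barycentric coordinate. -/
noncomputable def coordGrad (s : Finset E3) (z : E3) : E3 →L[ℝ] ℝ :=
  LinearMap.toContinuousLinearMap (M.coord s z).linear

theorem hasFDerivAt_coord (s : Finset E3) (z x : E3) :
    HasFDerivAt (M.coord s z) (M.coordGrad s z) x := by
  have h : (M.coord s z : E3 → ℝ) = fun x => M.coordGrad s z x + M.coord s z 0 :=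
    funext fun x => congrFun (M.coord s z).decomp x
  rw [h]
  exact (M.coordGrad s z).hasFDerivAt.add_const _

theorem coordGrad_sub (s : Finset E3) (z x y : E3) :
    M.coordGrad s z (x - y) = M.coord s z x - M.coord s z y := by
  have h : ∀ x, M.coord s z x = M.coordGrad s z x + M.coord s z 0 :=
    fun x => congrFun (M.coord s z).decomp x
  rw [h x, h y, map_sub]; ring

theorem sum_coordGrad (hs : s ∈ M.cells) : ∑ z ∈ s, M.coordGrad s z = 0 := by
  have h1 : HasFDerivAt (fun x => ∑ z ∈ s, M.coord s z x) (∑ z ∈ s, M.coordGrad s z) 0 :=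
    HasFDerivAt.fun_sum fun z _ => M.hasFDerivAt_coord s z 0
  have h2 : (fun x => ∑ z ∈ s, M.coord s z x) = fun _ => (1 : ℝ) :=
    funext fun x => M.sum_coord hs x
  rw [h2] at h1
  exact h1.unique (hasFDerivAt_const _ _)

variable {M}

/-- Barycentric coordinates take values in `[0, 1]` on the cell, so the inverse estimate for
gradients applies with `S = 1`. -/
theorem IsShape.norm_coordGrad_le {δ σ : ℝ} (h : M.IsShape δ σ) (hs : s ∈ M.cells) (z : E3) :
    ‖M.coordGrad s z‖ ≤ 5 / (σ * δ) := by
  obtain ⟨c, hc⟩ := h.ball s hs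
  have hcm : c ∈ hull s := hc (Metric.mem_closedBall_self h.radius_pos.le)
  have := (isAff_affineMap (M.coord s z)).isQuad.norm_fderiv_le (convex_hull s) h.radius_pos hc
    (S := 1) (fun x hx => by
      rw [Real.norm_of_nonneg ((M.mem_hull_iff hs).1 hx z)]
      exact M.coord_le_one hs hx z) hcm
  rwa [(M.hasFDerivAt_coord s z c).fderiv, mul_one] at this

theorem fderiv_interp (hs : s ∈ M.cells) (f : E3 → E3) {x : E3} (hx : x ∈ interior (hull s)) :
    fderiv ℝ (M.interp f) x = ∑ z ∈ s, (M.coordGrad s z).smulRight (f z) := by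
  rw [fderiv_eq_of_eqOn (fun y hy => M.interp_eq hs hy f) hx]
  exact (HasFDerivAt.fun_sum fun z _ => (M.hasFDerivAt_coord s z x).smul_const (f z)).fderiv

/-- The coordinate gradients sum to zero, so one vertex value may be subtracted from all of them.
Only oscillations between vertices enter, and `20 = 4 * 5`. -/
theorem IsShape.norm_fderiv_interp_le {δ σ : ℝ} (h : M.IsShape δ σ) (hs : s ∈ M.cells)
    {f : E3 → E3} {E : ℝ} (hE : ∀ z ∈ s, ∀ z' ∈ s, ‖f z - f z'‖ ≤ E) {x : E3}
    (hx : x ∈ interior (hull s)) : ‖fderiv ℝ (M.interp f) x‖ ≤ 20 / (σ * δ) * E := by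
  obtain ⟨z₀, hz₀⟩ : s.Nonempty := Finset.card_pos.1 (by rw [(M.mem_cells.1 hs).2]; norm_num)
  have h1 : fderiv ℝ (M.interp f) x = ∑ z ∈ s, (M.coordGrad s z).smulRight (f z - f z₀) := by
    rw [fderiv_interp hs f hx]
    have h2 : ∑ z ∈ s, (M.coordGrad s z).smulRight (f z₀) = 0 := by
      ext1 y
      have := congrArg (fun L : E3 →L[ℝ] ℝ => L y) (M.sum_coordGrad hs)
      simp only [ContinuousLinearMap.sum_apply, zero_apply] at this
      simp only [ContinuousLinearMap.sum_apply, ContinuousLinearMap.smulRight_apply,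
        ← Finset.sum_smul, this, zero_smul, zero_apply]
    rw [← sub_zero (∑ z ∈ s, (M.coordGrad s z).smulRight (f z)), ← h2, ← Finset.sum_sub_distrib]
    refine Finset.sum_congr rfl fun z _ => ?_
    ext1 y
    simp only [sub_apply, ContinuousLinearMap.smulRight_apply, smul_sub]
  rw [h1]
  calc _ ≤ ∑ z ∈ s, 5 / (σ * δ) * E := by
        refine (norm_sum_le _ _).trans (Finset.sum_le_sum fun z hz => ?_)
        rw [ContinuousLinearMap.norm_smulRight_apply]
        have := h.radius_pos
        exact mul_le_mul (h.norm_coordGrad_le hs z) (hE z hz z₀ hz₀) (norm_nonneg _)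
          (by positivity)
    _ = _ := by rw [Finset.sum_const, (M.mem_cells.1 hs).2]; ring

section Interpolation

variable {f : E3 → E3} {G : E3 → Mat3} {H : E3 → E3 →L[ℝ] Mat3} {δ σ : ℝ}

theorem hull_subset_restrict_le (hΩc : Convex ℝ Ω) (M : TetMesh Ω) (hs : s ∈ M.cells) :
    volume.restrict (hull s) ≤ volume.restrict Ω :=
  restrict_le_of_subset_closure hΩc (M.hull_subset hs)

/-- The interpolation error in the maximum norm. -/
theorem IsShape.interp_error (h : M.IsShape δ σ) (hΩo : IsOpen Ω) (hΩc : Convex ℝ Ω)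
    (hΩb : Bornology.IsBounded Ω) (hΩn : Ω.Nonempty) (hf : IsH2 Ω f G H)
    (hfc : ContinuousOn f (closure Ω)) (hs : s ∈ M.cells) {x : E3} (hx : x ∈ hull s) :
    volume.real (hull s) * ‖f x - M.interp f x‖ ^ 2 ≤
      16 * δ ^ 4 * ∫ x in hull s, ‖H x‖ ^ 2 := by
  have h1 := hf.interp_error hΩo hΩc hΩb hΩn hfc (convex_hull s) (measurableSet_hull s)
    (M.hull_subset hs) (h.diam s hs) s (fun z => M.coord s z x) id (M.sum_coord hs x)
    (fun z _ => (M.mem_hull_iff hs).1 hx z) (fun z hz => mem_hull hz)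
  simp only [id, M.sum_coord_smul hs x] at h1
  rw [← M.interp_eq hs hx] at h1
  have hV := M.volume_hull_pos hs
  have hB : 0 ≤ ∫ x in hull s, ‖H x‖ ^ 2 := integral_nonneg fun x => by positivity
  have h2 := pow_le_pow_left₀ (by positivity) h1 2
  rw [mul_pow, mul_pow (4 * δ ^ 2), mul_pow √(volume.real (hull s)), Real.sq_sqrt hV.le,
    Real.sq_sqrt hB] at h2
  refine le_of_mul_le_mul_left ?_ hV
  calc _ = volume.real (hull s) ^ 2 * ‖f x - M.interp f x‖ ^ 2 := by ring
    _ ≤ _ := h2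
    _ = _ := by ring

/-- The oscillation between vertices is controlled by the averaged gradient and the Hessian;
dividing it by the inradius bounds the gradient of the interpolant. The constant is `2 * 20 ^ 2`. -/
theorem IsShape.fderiv_interp_bound (h : M.IsShape δ σ) (hΩo : IsOpen Ω) (hΩc : Convex ℝ Ω)
    (hΩb : Bornology.IsBounded Ω) (hΩn : Ω.Nonempty) (hf : IsH2 Ω f G H)
    (hfc : ContinuousOn f (closure Ω)) (hs : s ∈ M.cells) {x : E3}
    (hx : x ∈ interior (hull s)) :
    volume.real (hull s) * ‖fderiv ℝ (M.interp f) x‖ ^ 2 ≤ 800 / σ ^ 2 *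
      ((∫ x in hull s, ‖G x‖ ^ 2) + 16 * δ ^ 2 * ∫ x in hull s, ‖H x‖ ^ 2) := by
  have hV := M.volume_hull_pos hs
  have hδ := h.δ_pos
  have hσ := h.σ_pos
  have hle := hull_subset_restrict_le hΩc M hs
  set V := volume.real (hull s) with hVdef
  have hE := fun z (hz : z ∈ s) z' (hz' : z' ∈ s) =>
    hf.norm_sub_le hΩo hΩc hΩb hΩn hfc (convex_hull s) (measurableSet_hull s)
    (M.hull_subset hs) (h.diam s hs) (mem_hull hz) (mem_hull hz')
  set A := ∫ x in hull s, ‖G x‖ with hA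
  set B := ∫ x in hull s, ‖H x‖ ^ 2 with hB
  have hA0 : 0 ≤ A := integral_nonneg fun x => norm_nonneg _
  have hB0 : 0 ≤ B := integral_nonneg fun x => by positivity
  have hA2 : A ^ 2 ≤ V * ∫ x in hull s, ‖G x‖ ^ 2 := by
    have hm := memLp_of_measure_le hf.memLp_grad hle
    have : IsFiniteMeasure (volume.restrict (hull s)) :=
      ⟨by simpa using (isCompact_hull s).measure_lt_top⟩
    have h1 := sq_integral_mul_le (μ := volume.restrict (hull s)) (f := fun _ => 1)
      (g := fun x => ‖G x‖) (by simpa using integrable_const (1 : ℝ))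
      (integrable_norm_sq_of_memLp hm)
      (by simpa using (hm.integrable (by norm_num)).norm)
    simpa [hA, hVdef] using h1
  have hb := h.norm_fderiv_interp_le hs (f := f) (E := V⁻¹ * (δ * A + 4 * δ ^ 2 * (√V * √B)))
    (fun z hz z' hz' => by
      rw [inv_mul_eq_div, le_div_iff₀ hV, mul_comm]
      exact hE z hz z' hz') hx
  have h3 : V * ‖fderiv ℝ (M.interp f) x‖ ≤ 20 / σ * (A + 4 * δ * (√V * √B)) := by
    calc _ ≤ V * (20 / (σ * δ) * (V⁻¹ * (δ * A + 4 * δ ^ 2 * (√V * √B)))) := by gcongr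
      _ = _ := by field_simp; try ring
  have h4 := pow_le_pow_left₀ (by positivity) h3 2
  have h5 : (A + 4 * δ * (√V * √B)) ^ 2 ≤ 2 * (V * (∫ x in hull s, ‖G x‖ ^ 2)
      + 16 * δ ^ 2 * (V * B)) := by
    have e : (4 * δ * (√V * √B)) ^ 2 = 16 * δ ^ 2 * (V * B) := by
      rw [mul_pow, mul_pow √V, Real.sq_sqrt hV.le, Real.sq_sqrt hB0]; ring
    nlinarith [sq_nonneg (A - 4 * δ * (√V * √B))]
  refine le_of_mul_le_mul_left ?_ hV
  calc _ = (V * ‖fderiv ℝ (M.interp f) x‖) ^ 2 := by ring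
    _ ≤ (20 / σ * (A + 4 * δ * (√V * √B))) ^ 2 := h4
    _ = 400 / σ ^ 2 * (A + 4 * δ * (√V * √B)) ^ 2 := by rw [mul_pow, div_pow]; norm_num
    _ ≤ 400 / σ ^ 2 * (2 * (V * (∫ x in hull s, ‖G x‖ ^ 2) + 16 * δ ^ 2 * (V * B))) := by gcongr
    _ = _ := by ring

theorem pwCont_fderiv_interp (f : E3 → E3) : M.PwCont (fderiv ℝ (M.interp f)) :=
  (memZ_interp f).pwC1.pwCont_fderiv

/-- Integrating a bound that holds on every tetrahedron. -/
theorem PwCont.integral_hull_le {g : E3 → ℝ} (hg : M.PwCont g) (hs : s ∈ M.cells) {E : ℝ}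
    (h : ∀ x ∈ interior (hull s), volume.real (hull s) * g x ≤ E) :
    ∫ x in hull s, g x ≤ E := by
  have hV := M.volume_hull_pos hs
  calc _ ≤ ∫ x in hull s, (volume.real (hull s))⁻¹ * E := by
        refine integral_mono_ae (hg.integrableOn_hull hs)
          (integrableOn_const (isCompact_hull s).measure_lt_top.ne) ?_
        filter_upwards [ae_mem_interior_hull s] with x hx
        rw [inv_mul_eq_div, le_div_iff₀ hV, mul_comm]
        exact h x hx
    _ = E := by rw [setIntegral_const, smul_eq_mul, mul_inv_cancel_left₀ hV.ne']

theorem IsShape.integral_fderiv_interp_sq_le (h : M.IsShape δ σ) (hΩo : IsOpen Ω)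
    (hΩc : Convex ℝ Ω) (hΩb : Bornology.IsBounded Ω) (hΩn : Ω.Nonempty) (hf : IsH2 Ω f G H)
    (hfc : ContinuousOn f (closure Ω)) :
    ∫ x in Ω, ‖fderiv ℝ (M.interp f) x‖ ^ 2 ≤
      800 / σ ^ 2 * (1 + 16 * δ ^ 2) * h2NormSq Ω f G H := by
  have hσ := h.σ_pos
  have hc : M.PwCont fun x => ‖fderiv ℝ (M.interp f) x‖ ^ 2 :=
    (pwCont_fderiv_interp f).comp (φ := fun x => ‖x‖ ^ 2) (by fun_prop)
  rw [hc.integral_eq hΩc]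
  calc _ ≤ ∑ s ∈ M.cells, 800 / σ ^ 2 *
        ((∫ x in hull s, ‖G x‖ ^ 2) + 16 * δ ^ 2 * ∫ x in hull s, ‖H x‖ ^ 2) :=
        Finset.sum_le_sum fun s hs => hc.integral_hull_le hs fun x hx =>
          h.fderiv_interp_bound hΩo hΩc hΩb hΩn hf hfc hs hx
    _ = 800 / σ ^ 2 * ((∫ x in Ω, ‖G x‖ ^ 2) + 16 * δ ^ 2 * ∫ x in Ω, ‖H x‖ ^ 2) := by
        rw [M.integral_eq hΩc ((M.integrableOn_iff hΩc).1 hf.integrable_grad_norm_sq),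
          M.integral_eq hΩc ((M.integrableOn_iff hΩc).1 hf.integrable_hess_norm_sq),
          ← Finset.mul_sum, Finset.sum_add_distrib, Finset.mul_sum (s := M.cells)
            (f := fun s => ∫ x in hull s, ‖H x‖ ^ 2)]
    _ ≤ 800 / σ ^ 2 * (h2NormSq Ω f G H + 16 * δ ^ 2 * h2NormSq Ω f G H) := by
        gcongr
        · exact hf.integral_grad_sq_le
        · exact hf.integral_hess_sq_le
    _ = _ := by ring

/-- Square the cell bound. The gradient part is passed to `L⁴` by Cauchy–Schwarz on the cell. In the
Hessian part, `δ ^ 4` divided by the cell volume is bounded because the volume is at least of order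
`δ ^ 3` and `δ` is at most the diameter of `Ω`. The squares of the cell integrals sum to at most the
square of their sum. -/
theorem IsShape.exists_integral_fderiv_interp_pow_four_le (hΩo : IsOpen Ω)
    (hΩc : Convex ℝ Ω) (hΩb : Bornology.IsBounded Ω) (hΩn : Ω.Nonempty) {σ : ℝ} (hσ : 0 < σ) :
    ∃ C : ℝ, 0 ≤ C ∧ ∀ (M : TetMesh Ω) (δ : ℝ), M.IsShape δ σ → δ ≤ Metric.diam Ω →
      ∀ (f : E3 → E3) (G : E3 → Mat3) (H : E3 → E3 →L[ℝ] Mat3), IsH2 Ω f G H →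
      ContinuousOn f (closure Ω) →
      ∫ x in Ω, ‖fderiv ℝ (M.interp f) x‖ ^ 4 ≤ C * h2NormSq Ω f G H ^ 2 := by
  obtain ⟨C₁, hC₁, h4⟩ := exists_grad_L4_bound hΩo hΩc hΩb hΩn
  set D := Metric.diam Ω with hD
  have hκ := ballVol_pos
  have hD0 : 0 ≤ D := Metric.diam_nonneg
  refine ⟨2 * (800 / σ ^ 2) ^ 2 * (C₁ + 256 * D / (ballVol * σ ^ 3)), by positivity,
    fun M δ h hδD f G H hf hfc => ?_⟩
  have hδ := h.δ_pos
  set N := h2NormSq Ω f G H with hN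
  have hN0 : 0 ≤ N := IsH2.h2NormSq_nonneg
  have hc : M.PwCont fun x => ‖fderiv ℝ (M.interp f) x‖ ^ 4 :=
    (pwCont_fderiv_interp f).comp (φ := fun x => ‖x‖ ^ 4) (by fun_prop)
  have hGm : AEStronglyMeasurable (fun x => ‖G x‖ ^ 4) (volume.restrict Ω) :=
    hf.memLp_grad.1.norm.pow 4
  have e4 : ∫⁻ x in Ω, ‖(‖G x‖ ^ 4 : ℝ)‖ₑ = ∫⁻ x in Ω, ‖G x‖ₑ ^ 4 := lintegral_congr fun x => by
    rw [enorm_pow, enorm_norm]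
  have hGi : IntegrableOn (fun x => ‖G x‖ ^ 4) Ω := ⟨hGm, by
    rw [hasFiniteIntegral_iff_enorm, e4]
    exact (h4 f G H hf).trans_lt ENNReal.ofReal_lt_top⟩
  have hG4 : ∫ x in Ω, ‖G x‖ ^ 4 ≤ C₁ * N ^ 2 := by
    rw [← ENNReal.ofReal_le_ofReal_iff (by positivity), ofReal_integral_eq_lintegral_ofReal hGi
      (Eventually.of_forall fun x => by positivity)]
    refine le_trans (le_of_eq (lintegral_congr fun x => ?_)) (h4 f G H hf)
    rw [ENNReal.ofReal_pow (norm_nonneg _), ofReal_norm]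
  have hGi' := (M.integrableOn_iff hΩc).1 hGi
  have hG2i' := (M.integrableOn_iff hΩc).1 hf.integrable_grad_norm_sq
  have hHi' := (M.integrableOn_iff hΩc).1 hf.integrable_hess_norm_sq
  have hHN : ∫ x in Ω, ‖H x‖ ^ 2 ≤ N := hf.integral_hess_sq_le
  rw [hc.integral_eq hΩc]
  have hcell : ∀ s ∈ M.cells, ∫ x in hull s, ‖fderiv ℝ (M.interp f) x‖ ^ 4 ≤
      2 * (800 / σ ^ 2) ^ 2 * ((∫ x in hull s, ‖G x‖ ^ 4)
        + 256 * D / (ballVol * σ ^ 3) * (∫ x in hull s, ‖H x‖ ^ 2) ^ 2) := by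
    intro s hs
    refine hc.integral_hull_le hs fun x hx => ?_
    have hV := M.volume_hull_pos hs
    have hVl := h.le_volume hs
    have h1 := h.fderiv_interp_bound hΩo hΩc hΩb hΩn hf hfc hs hx
    set V := volume.real (hull s) with hVdef
    set A := ∫ x in hull s, ‖G x‖ ^ 2 with hA
    set B := ∫ x in hull s, ‖H x‖ ^ 2 with hB
    have hA0 : 0 ≤ A := integral_nonneg fun x => by positivity
    have hB0 : 0 ≤ B := integral_nonneg fun x => by positivity
    have hA2 : A ^ 2 ≤ V * ∫ x in hull s, ‖G x‖ ^ 4 := by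
      have : IsFiniteMeasure (volume.restrict (hull s)) :=
        ⟨by simpa using (isCompact_hull s).measure_lt_top⟩
      have h1 := sq_integral_mul_le (μ := volume.restrict (hull s)) (f := fun _ => 1)
        (g := fun x => ‖G x‖ ^ 2) (by simpa using integrable_const (1 : ℝ))
        (by simp only [← pow_mul]; exact hGi' s hs) (by simp only [one_mul]; exact hG2i' s hs)
      simp only [one_mul, one_pow, ← pow_mul] at h1
      simpa [hA, hVdef] using h1
    have h2 := pow_le_pow_left₀ (by positivity) h1 2
    have h3 : 256 * δ ^ 4 * B ^ 2 ≤ V * (256 * D / (ballVol * σ ^ 3) * B ^ 2) := by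
      have h31 : 256 * δ ^ 4 ≤ V * (256 * D / (ballVol * σ ^ 3)) := by
        calc 256 * δ ^ 4 ≤ 256 * (D * δ ^ 3) := by
              have : δ ^ 4 = δ * δ ^ 3 := by ring
              rw [this]; gcongr
          _ = (ballVol * (σ * δ) ^ 3) * (256 * D / (ballVol * σ ^ 3)) := by field_simp
          _ ≤ _ := by gcongr
      calc _ ≤ (V * (256 * D / (ballVol * σ ^ 3))) * B ^ 2 := by gcongr
        _ = _ := by ring
    have h5 : (A + 16 * δ ^ 2 * B) ^ 2 ≤ 2 * (A ^ 2 + 256 * δ ^ 4 * B ^ 2) := by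
      nlinarith [sq_nonneg (A - 16 * δ ^ 2 * B)]
    refine le_of_mul_le_mul_left ?_ hV
    calc _ = (V * ‖fderiv ℝ (M.interp f) x‖ ^ 2) ^ 2 := by ring
      _ ≤ (800 / σ ^ 2 * (A + 16 * δ ^ 2 * B)) ^ 2 := h2
      _ = (800 / σ ^ 2) ^ 2 * (A + 16 * δ ^ 2 * B) ^ 2 := mul_pow _ _ _
      _ ≤ (800 / σ ^ 2) ^ 2 * (2 * (V * (∫ x in hull s, ‖G x‖ ^ 4)
          + V * (256 * D / (ballVol * σ ^ 3) * B ^ 2))) := by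
          refine mul_le_mul_of_nonneg_left (h5.trans ?_) (by positivity)
          linarith
      _ = _ := by ring
  have hsq : ∑ s ∈ M.cells, (∫ x in hull s, ‖H x‖ ^ 2) ^ 2 ≤ N ^ 2 := by
    refine (Finset.sum_sq_le_sq_sum_of_nonneg fun s _ => integral_nonneg fun x => by positivity).trans ?_
    rw [← M.integral_eq hΩc hHi']
    exact pow_le_pow_left₀ (integral_nonneg fun x => by positivity) hHN 2
  calc _ ≤ ∑ s ∈ M.cells, 2 * (800 / σ ^ 2) ^ 2 * ((∫ x in hull s, ‖G x‖ ^ 4)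
        + 256 * D / (ballVol * σ ^ 3) * (∫ x in hull s, ‖H x‖ ^ 2) ^ 2) :=
        Finset.sum_le_sum hcell
    _ = 2 * (800 / σ ^ 2) ^ 2 * ((∫ x in Ω, ‖G x‖ ^ 4) + 256 * D / (ballVol * σ ^ 3) *
        ∑ s ∈ M.cells, (∫ x in hull s, ‖H x‖ ^ 2) ^ 2) := by
        rw [M.integral_eq hΩc hGi', ← Finset.mul_sum, Finset.sum_add_distrib,
          Finset.mul_sum (s := M.cells) (f := fun s => (∫ x in hull s, ‖H x‖ ^ 2) ^ 2)]
    _ ≤ 2 * (800 / σ ^ 2) ^ 2 * (C₁ * N ^ 2 + 256 * D / (ballVol * σ ^ 3) * N ^ 2) := by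
        gcongr
    _ = _ := by ring

end Interpolation

end TetMesh

end EricksenLeslie

namespace EricksenLeslie
open Filter Topology

namespace TetMesh

variable {Ω : Set E3} {M : TetMesh Ω} {s t : Finset E3}

/-! ### Integration by parts against a pressure -/

theorem pwC1_of_contDiff {F : Type*} [NormedAddCommGroup F] [NormedSpace ℝ F] {f : E3 → F}
    (hf : ContDiff ℝ 1 f) : M.PwC1 f := fun _ _ => ⟨f, hf, fun _ _ => rfl⟩

theorem PwC1.integral_divg_mul (hΩo : IsOpen Ω) (hΩc : Convex ℝ Ω)
    (hΩb : Bornology.IsBounded Ω) {u : E3 → E3} {q : E3 → ℝ} (hu : M.PwC1 u)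
    (h0 : ∀ x ∈ frontier Ω, u x = 0) (hq : M.PwC1 q) :
    ∫ x in Ω, divg u x * q x = -∫ x in Ω, fderiv ℝ q x (u x) := by
  have he : inner ℝ (e 0) (e 0) = (1 : ℝ) := by rw [real_inner_self_eq_norm_sq, norm_e]; norm_num
  -- The scalar formula is the vector one with a constant unit vector as first field and `q` times
  -- it as second.
  have h := integral_convective hΩo hΩc hΩb hu (v := fun _ => e 0) (a := fun x => q x • e 0)
    (pwC1_of_contDiff contDiff_const)
    (hq.comp (φ := fun t : ℝ => t • e 0) (by fun_prop)) h0
  have h1 : ∫ x in Ω, inner ℝ (e 0) (fderiv ℝ (fun x => q x • e 0) x (u x))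
      = ∫ x in Ω, fderiv ℝ q x (u x) := by
    refine integral_congr_ae ((hq.ae_differentiableAt hΩc).mono fun x hx => ?_)
    have : fderiv ℝ (fun x => q x • e 0) x = (fderiv ℝ q x).smulRight (e 0) :=
      (hx.hasFDerivAt.smul_const (e 0)).fderiv
    simp only [this, ContinuousLinearMap.smulRight_apply, inner_smul_right, he, mul_one]
  rw [h1] at h
  have h2 : ∫ x in Ω, inner ℝ (divg u x • e 0) (q x • e 0) = ∫ x in Ω, divg u x * q x :=
    integral_congr_ae (Eventually.of_forall fun x => by
      simp only [inner_smul_left, inner_smul_right, he, conj_trivial]; ring)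
  have h3 : ∫ x in Ω, inner ℝ (fderiv ℝ (fun _ : E3 => e 0) x (u x)) (q x • e 0) = 0 := by
    simp
  rw [h2, h3] at h
  linarith

theorem PwC1.memLp_fderiv {F : Type*} [NormedAddCommGroup F] [NormedSpace ℝ F] (hΩc : Convex ℝ Ω)
    {q : E3 → F} (hq : M.PwC1 q) : MemLp (fderiv ℝ q) 2 (volume.restrict Ω) :=
  (memLp_two_iff_integrable_sq_norm
    (hq.pwCont_fderiv.integrableOn hΩc).aestronglyMeasurable).2 (hq.pwCont_fderiv.integrableOn_sq hΩc)

theorem PwCont.memLp {F : Type*} [NormedAddCommGroup F] [NormedSpace ℝ F] (hΩc : Convex ℝ Ω)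
    {q : E3 → F} (hq : M.PwCont q) : MemLp q 2 (volume.restrict Ω) :=
  (memLp_two_iff_integrable_sq_norm (hq.integrableOn hΩc).aestronglyMeasurable).2
    (hq.integrableOn_sq hΩc)

theorem PwC1.integrableOn_fderiv_apply (hΩc : Convex ℝ Ω) {q : E3 → ℝ} (hq : M.PwC1 q)
    {f : E3 → E3} (hf : MemLp f 2 (volume.restrict Ω)) :
    IntegrableOn (fun x => fderiv ℝ q x (f x)) Ω := by
  have hqL := hq.memLp_fderiv hΩc
  have i1 : Integrable (fun x => ‖fderiv ℝ q x‖ * ‖f x‖) (volume.restrict Ω) :=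
    MemLp.integrable_mul hqL.norm hf.norm
  refine i1.mono ?_ (Eventually.of_forall fun x => ?_)
  · exact (ContinuousLinearMap.apply ℝ ℝ : E3 →L[ℝ] (E3 →L[ℝ] ℝ) →L[ℝ] ℝ).flip
      |>.aestronglyMeasurable_comp₂ hqL.1 hf.1
  · rw [Real.norm_of_nonneg (by positivity : 0 ≤ ‖fderiv ℝ q x‖ * ‖f x‖)]
    exact (fderiv ℝ q x).le_opNorm _

theorem PwC1.abs_integral_fderiv_apply_le (hΩc : Convex ℝ Ω) {q : E3 → ℝ} (hq : M.PwC1 q)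
    {f : E3 → E3} (hf : MemLp f 2 (volume.restrict Ω)) :
    |∫ x in Ω, fderiv ℝ q x (f x)| ≤
      √(∫ x in Ω, ‖fderiv ℝ q x‖ ^ 2) * √(∫ x in Ω, ‖f x‖ ^ 2) := by
  have hqL := hq.memLp_fderiv hΩc
  have i1 : Integrable (fun x => ‖fderiv ℝ q x‖ * ‖f x‖) (volume.restrict Ω) :=
    MemLp.integrable_mul hqL.norm hf.norm
  calc |∫ x in Ω, fderiv ℝ q x (f x)| ≤ ∫ x in Ω, |fderiv ℝ q x (f x)| :=
        abs_integral_le_integral_abs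
    _ ≤ ∫ x in Ω, ‖fderiv ℝ q x‖ * ‖f x‖ :=
        integral_mono (hq.integrableOn_fderiv_apply hΩc hf).abs i1
          fun x => (fderiv ℝ q x).le_opNorm _
    _ ≤ _ := (le_abs_self _).trans (abs_integral_mul_le (hq.pwCont_fderiv.integrableOn_sq hΩc)
        (integrable_norm_sq_of_memLp hf) i1)

/-- For solenoidal test fields this is integration by parts. The pairing is continuous in `L²`, so
it passes to the closure. -/
theorem PwC1.integral_fderiv_apply_eq_zero (hΩo : IsOpen Ω) (hΩc : Convex ℝ Ω)
    (hΩb : Bornology.IsBounded Ω) {q : E3 → ℝ} (hq : M.PwC1 q) {φ : E3 → E3} {G : E3 → Mat3}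
    (hφ : MemH10Sigma Ω φ G) : ∫ x in Ω, fderiv ℝ q x (φ x) = 0 := by
  set A := √(∫ x in Ω, ‖fderiv ℝ q x‖ ^ 2) with hA
  have hA0 : 0 ≤ A := Real.sqrt_nonneg _
  rw [← abs_eq_zero]
  refine le_antisymm (le_of_forall_pos_le_add fun ε hε => ?_) (abs_nonneg _)
  obtain ⟨ψ, hψ, h1, -⟩ := hφ.2.2 (ε / (A + 1)) (by positivity)
  have hψ1 : M.PwC1 ψ := pwC1_of_contDiff (hψ.contDiff.of_le (by norm_cast))
  have hψ2 : MemLp ψ 2 (volume.restrict Ω) := hψ1.pwCont.memLp hΩc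
  have hψ0 : ∫ x in Ω, fderiv ℝ q x (ψ x) = 0 := by
    have := hψ1.integral_divg_mul hΩo hΩc hΩb (fun x hx =>
      hψ.eq_zero_of_notMem (hΩo.frontier_eq ▸ hx : x ∈ closure Ω \ Ω).2) hq
    simp only [hψ.div_eq_zero, zero_mul, integral_zero] at this
    linarith
  have hd : MemLp (fun x => φ x - ψ x) 2 (volume.restrict Ω) := hφ.1.sub hψ2
  have h2 : √(∫ x in Ω, ‖φ x - ψ x‖ ^ 2) ≤ ε / (A + 1) := by
    rw [eLpNorm_two_eq_ofReal hd] at h1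
    exact ((ENNReal.ofReal_lt_ofReal_iff (by positivity)).1 h1).le
  have h3 := hq.abs_integral_fderiv_apply_le hΩc hd
  have h4 : ∫ x in Ω, fderiv ℝ q x (φ x - ψ x) = ∫ x in Ω, fderiv ℝ q x (φ x) := by
    simp only [map_sub]
    rw [integral_sub (hq.integrableOn_fderiv_apply hΩc hφ.1) (hq.integrableOn_fderiv_apply hΩc hψ2), hψ0, sub_zero]
  rw [h4] at h3
  refine h3.trans ?_
  rw [zero_add]
  calc A * √(∫ x in Ω, ‖φ x - ψ x‖ ^ 2) ≤ (A + 1) * (ε / (A + 1)) := by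
        gcongr; linarith
    _ = ε := by field_simp

/-! ### The divergence-preserving correction -/

variable (M)

/-- The moments of `ψ` against the gradients of the barycentric coordinates. -/
noncomputable def gradMoment (ψ : E3 → E3) (s : Finset E3) (z : E3) : ℝ :=
  ∫ x in hull s, M.coordGrad s z (ψ x)

/-- The `L²` inner product of two hat functions. -/
noncomputable def hatInner (y z : E3) : ℝ := ∫ x in Ω, M.hat y x * M.hat z x

/-- The vector weight of the correction at the edge between `y` and `z`. -/
noncomputable def corrVec (ψ : E3 → E3) (s : Finset E3) (y z : E3) : E3 :=
  (M.gradMoment ψ s z / M.hatInner y z) • (z - y)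

/-- A combination of edge bubbles with the same moments against gradients of continuous
piecewise affine functions as `ψ`; here `z₀ s` is a vertex of `s` in the interior. -/
noncomputable def corr (z₀ : Finset E3 → E3) (ψ : E3 → E3) (x : E3) : E3 :=
  ∑ p ∈ M.cells.sigma (fun s => s),
    (M.hat (z₀ p.1) x * M.hat p.2 x) • M.corrVec ψ p.1 (z₀ p.1) p.2

variable {M} {z₀ : Finset E3 → E3} {ψ : E3 → E3}

theorem isPiecewisePoly_hat_mul (y z : E3) : M.IsPiecewisePoly 2 fun x => M.hat y x * M.hat z x :=
  (isPiecewisePoly_hat y).mul (isPiecewisePoly_hat z)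

theorem isPiecewisePoly_corr (i : Fin 3) : M.IsPiecewisePoly 2 fun x => M.corr z₀ ψ x i := by
  have := IsPiecewisePoly.sum (M := M) (S := M.cells.sigma (fun s => s))
    (f := fun p x => M.hat (z₀ p.1) x * M.hat p.2 x)
    (fun p => M.corrVec ψ p.1 (z₀ p.1) p.2 i) fun p _ => isPiecewisePoly_hat_mul _ _
  refine this.congr fun x _ => ?_
  simp [corr]

theorem pwCont_hat_mul (y z : E3) : M.PwCont fun x => M.hat y x * M.hat z x :=
  (pwAff_hat y).pwQuad.pwC1.pwCont.comp₂ (pwAff_hat z).pwQuad.pwC1.pwCont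
    (fun a b => a * b) (by fun_prop)

theorem pwCont_corr : M.PwCont (M.corr z₀ ψ) := by
  have h : M.PwC1 fun x => M.corr z₀ ψ x := fun s hs => by
    refine ⟨fun x => ∑ p ∈ M.cells.sigma (fun s => s),
      (M.coord s (z₀ p.1) x * M.coord s p.2 x) • M.corrVec ψ p.1 (z₀ p.1) p.2, ?_, ?_⟩
    · have hc : ∀ z, ContDiff ℝ 1 (M.coord s z) := fun z => (isAff_affineMap _).isQuad.contDiff
      exact ContDiff.sum fun p _ => ((hc _).mul (hc _)).smul_const _
    · intro x hx
      simp only [corr, M.hat_eq_coord hs hx]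
  exact h.pwCont

theorem corr_eq_zero_on_frontier (hΩo : IsOpen Ω) (hΩc : Convex ℝ Ω)
    (hz₀ : ∀ s ∈ M.cells, z₀ s ∈ s ∧ z₀ s ∉ frontier Ω) {x : E3} (hx : x ∈ frontier Ω) :
    M.corr z₀ ψ x = 0 := by
  refine Finset.sum_eq_zero fun p hp => ?_
  rw [M.hat_eq_zero_on_frontier hΩo hΩc (hz₀ p.1 (Finset.mem_sigma.1 hp).1).2 hx, zero_mul,
    zero_smul]

theorem volume_le_hatInner (hΩc : Convex ℝ Ω) (hs : s ∈ M.cells) {y z : E3} (hy : y ∈ s)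
    (hz : z ∈ s) : volume.real (hull s) ≤ 512 * M.hatInner y z := by
  refine (M.volume_le_integral_mul hs hy hz).trans ?_
  rw [hatInner, (pwCont_hat_mul y z).integral_eq hΩc]
  gcongr
  exact Finset.single_le_sum (f := fun s => ∫ x in hull s, M.hat y x * M.hat z x)
    (fun t _ => integral_nonneg fun x => mul_nonneg (M.hat_nonneg _ _) (M.hat_nonneg _ _)) hs

theorem hatInner_pos (hΩc : Convex ℝ Ω) (hs : s ∈ M.cells) {y z : E3} (hy : y ∈ s)
    (hz : z ∈ s) : 0 < M.hatInner y z := by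
  have := volume_le_hatInner hΩc hs hy hz
  have := M.volume_hull_pos hs
  linarith

/-- Gradients of affine functions in terms of nodal values. -/
theorem PwAff.fderiv_eq (hs : s ∈ M.cells) {q : E3 → ℝ} (hq : M.PwAff q) {x : E3}
    (hx : x ∈ interior (hull s)) (v : E3) :
    fderiv ℝ q x v = ∑ z ∈ s, M.coordGrad s z v * q z := by
  rw [fderiv_eq_of_eqOn (fun y hy => hq.eq_sum_coord hs hy) hx]
  have : HasFDerivAt (fun x => ∑ z ∈ s, M.coord s z x • q z)
      (∑ z ∈ s, (M.coordGrad s z).smulRight (q z)) x :=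
    HasFDerivAt.fun_sum fun z _ => (M.hasFDerivAt_coord s z x).smul_const (q z)
  rw [this.fderiv, ContinuousLinearMap.sum_apply]
  simp

theorem PwAff.fderiv_sub (hs : s ∈ M.cells) {q : E3 → ℝ} (hq : M.PwAff q) {x : E3}
    (hx : x ∈ interior (hull s)) {y z : E3} (hy : y ∈ s) (hz : z ∈ s) :
    fderiv ℝ q x (z - y) = q z - q y := by
  rw [hq.fderiv_eq hs hx]
  simp only [coordGrad_sub, sub_mul, Finset.sum_sub_distrib]
  have h := fun w (hw : w ∈ s) => hq.eq_sum_coord hs (mem_hull hw)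
  simp only [smul_eq_mul] at h
  rw [← h z hz, ← h y hy]

/-- The derivative of `q` along an edge is the difference of its end values on every tetrahedron
that contains the edge. On other tetrahedra the product of the two hat functions vanishes. -/
theorem hat_mul_fderiv_sub (hs : s ∈ M.cells) {q : E3 → ℝ} (hq : M.PwAff q) {x : E3}
    (hx : x ∈ interior (hull s)) (y z : E3) :
    M.hat y x * M.hat z x * fderiv ℝ q x (z - y) = M.hat y x * M.hat z x * (q z - q y) := by
  by_cases hy : y ∈ s
  · by_cases hz : z ∈ s
    · rw [hq.fderiv_sub hs hx hy hz]
    · have : M.hat z x = 0 := by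
        rw [M.hat_eq_coord hs (interior_subset hx), M.coord_of_notMem hz]; rfl
      rw [this]; ring
  · have : M.hat y x = 0 := by
      rw [M.hat_eq_coord hs (interior_subset hx), M.coord_of_notMem hy]; rfl
    rw [this]; ring

/-- On a cell the gradient of `q` is the sum of nodal values times coordinate gradients, so the
moment of `ψ` is a combination of nodal values whose coefficients sum to zero. Hence the values may
be replaced by edge differences `q z - q (z₀ s)`. The bubble on that edge, normalized by its
integral over `Ω`, reproduces precisely this difference. -/
theorem integral_fderiv_corr (hΩc : Convex ℝ Ω) (hz₀ : ∀ s ∈ M.cells, z₀ s ∈ s)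
    (hψ : ContinuousOn ψ (closure Ω)) {q : E3 → ℝ} (hq : M.PwAff q) :
    ∫ x in Ω, fderiv ℝ q x (M.corr z₀ ψ x) = ∫ x in Ω, fderiv ℝ q x (ψ x) := by
  have hqc := hq.pwQuad.pwC1.pwCont_fderiv
  have hψi : ∀ s ∈ M.cells, ∀ z, IntegrableOn (fun x => M.coordGrad s z (ψ x)) (hull s) :=
    fun s hs z => ((M.coordGrad s z).continuous.comp_continuousOn
      (hψ.mono (M.hull_subset hs))).integrableOn_compact (isCompact_hull s)
  have hcell : ∀ s ∈ M.cells, (fun x => fderiv ℝ q x (ψ x)) =ᵐ[volume.restrict (hull s)]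
      fun x => ∑ z ∈ s, M.coordGrad s z (ψ x) * q z := fun s hs =>
    (ae_mem_interior_hull s).mono fun x hx => hq.fderiv_eq hs hx _
  have hci : ∀ s ∈ M.cells, IntegrableOn (fun x => fderiv ℝ q x (ψ x)) (hull s) := fun s hs =>
    (integrable_finsetSum s fun z _ => (hψi s hs z).mul_const (q z)).congr (hcell s hs).symm
  have hR : ∫ x in Ω, fderiv ℝ q x (ψ x) = ∑ s ∈ M.cells, ∑ z ∈ s, M.gradMoment ψ s z * q z := by
    rw [M.integral_eq hΩc hci]
    refine Finset.sum_congr rfl fun s hs => ?_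
    rw [integral_congr_ae (hcell s hs), integral_finsetSum _ fun z _ => (hψi s hs z).mul_const _]
    exact Finset.sum_congr rfl fun z _ => integral_mul_const _ _
  have hsum : ∀ s ∈ M.cells, ∑ z ∈ s, M.gradMoment ψ s z = 0 := fun s hs => by
    simp only [gradMoment]
    rw [← integral_finsetSum _ fun z _ => hψi s hs z]
    have h := fun v => congrArg (fun L : E3 →L[ℝ] ℝ => L v) (M.sum_coordGrad hs)
    simp only [ContinuousLinearMap.sum_apply, zero_apply] at h
    simp only [h, integral_zero]
  have hL : ∫ x in Ω, fderiv ℝ q x (M.corr z₀ ψ x) = ∑ p ∈ M.cells.sigma (fun s => s),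
      M.gradMoment ψ p.1 p.2 * (q p.2 - q (z₀ p.1)) := by
    have h1 : (fun x => fderiv ℝ q x (M.corr z₀ ψ x)) =ᵐ[volume.restrict Ω] fun x =>
        ∑ p ∈ M.cells.sigma (fun s => s), (M.hat (z₀ p.1) x * M.hat p.2 x) *
          (M.gradMoment ψ p.1 p.2 / M.hatInner (z₀ p.1) p.2 * (q p.2 - q (z₀ p.1))) := by
      refine M.ae_of_interior hΩc fun s hs x hx => ?_
      simp only [corr, map_sum]
      refine Finset.sum_congr rfl fun p _ => ?_
      have := hat_mul_fderiv_sub hs hq hx (z₀ p.1) p.2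
      simp only [corrVec, map_smul, smul_eq_mul]
      linear_combination (M.gradMoment ψ p.1 p.2 / M.hatInner (z₀ p.1) p.2) * this
    rw [integral_congr_ae h1, integral_finsetSum _ fun p _ =>
      ((pwCont_hat_mul _ _).integrableOn hΩc).mul_const _]
    refine Finset.sum_congr rfl fun p hp => ?_
    obtain ⟨hp1, hp2⟩ := Finset.mem_sigma.1 hp
    rw [integral_mul_const]
    have hne := (hatInner_pos hΩc hp1 (hz₀ _ hp1) hp2).ne'
    change M.hatInner (z₀ p.1) p.2 * _ = _
    field_simp
  rw [hL, hR, Finset.sum_sigma]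
  refine Finset.sum_congr rfl fun s hs => ?_
  simp only [mul_sub, Finset.sum_sub_distrib, ← Finset.sum_mul, hsum s hs, zero_mul, sub_zero]

/-! ### Size of the correction -/

variable {δ σ E : ℝ}

theorem sum_hat (hs : s ∈ M.cells) {x : E3} (hx : x ∈ hull s) : ∑ z ∈ s, M.hat z x = 1 := by
  rw [← M.sum_coord hs x]
  exact Finset.sum_congr rfl fun z _ => M.hat_eq_coord hs hx z

theorem sum_hat_le (hs : s ∈ M.cells) {x : E3} (hx : x ∈ closure Ω) :
    ∑ z ∈ s, M.hat z x ≤ 1 := by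
  classical
  obtain ⟨t, ht, hxt⟩ := M.exists_cell hx
  rw [← sum_hat ht hxt]
  calc _ ≤ ∑ z ∈ s ∪ t, M.hat z x :=
        Finset.sum_le_sum_of_subset_of_nonneg Finset.subset_union_left
          fun z _ _ => M.hat_nonneg z x
    _ = _ := (Finset.sum_subset Finset.subset_union_right fun z _ hz => by
        rw [M.hat_eq_coord ht hxt, M.coord_of_notMem hz]; rfl).symm

/-- The hat functions of one cell sum to at most one. A cell `s` contributes only if `z₀ s` is a
vertex of the tetrahedron containing `x`, and the number of cells around a vertex is bounded. -/
theorem IsShape.sum_hat_hat_le (h : M.IsShape δ σ) (hΩc : Convex ℝ Ω)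
    (hz₀ : ∀ s ∈ M.cells, z₀ s ∈ s) {x : E3} (hx : x ∈ closure Ω) :
    ∑ p ∈ M.cells.sigma (fun s => s), M.hat (z₀ p.1) x * M.hat p.2 x ≤ (σ ^ 3)⁻¹ := by
  classical
  obtain ⟨t, ht, hxt⟩ := M.exists_cell hx
  have hσ := pow_pos h.σ_pos 3
  calc _ = ∑ s ∈ M.cells, M.hat (z₀ s) x * ∑ z ∈ s, M.hat z x := by
        rw [Finset.sum_sigma]
        refine Finset.sum_congr rfl fun s _ => ?_
        rw [Finset.mul_sum]
    _ ≤ ∑ s ∈ M.cells, M.hat (z₀ s) x := Finset.sum_le_sum fun s hs =>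
        mul_le_of_le_one_right (M.hat_nonneg _ _) (sum_hat_le hs hx)
    _ ≤ ∑ s ∈ M.cells, ∑ y ∈ t, if y ∈ s then M.hat y x else 0 := by
        refine Finset.sum_le_sum fun s hs => ?_
        have hn : ∀ y ∈ t, 0 ≤ if y ∈ s then M.hat y x else 0 := fun y _ => by
          split_ifs
          · exact M.hat_nonneg _ _
          · exact le_rfl
        by_cases hy : z₀ s ∈ t
        · refine le_trans ?_ (Finset.single_le_sum hn hy)
          rw [if_pos (hz₀ s hs)]
        · refine le_trans (le_of_eq ?_) (Finset.sum_nonneg hn)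
          rw [M.hat_eq_coord ht hxt, M.coord_of_notMem hy]; rfl
    _ = ∑ y ∈ t, ((M.cells.filter (fun s => y ∈ s)).card : ℝ) * M.hat y x := by
        rw [Finset.sum_comm]
        refine Finset.sum_congr rfl fun y _ => ?_
        rw [← Finset.sum_filter, Finset.sum_const, nsmul_eq_mul]
    _ ≤ ∑ y ∈ t, (σ ^ 3)⁻¹ * M.hat y x := by
        refine Finset.sum_le_sum fun y _ => mul_le_mul_of_nonneg_right ?_ (M.hat_nonneg _ _)
        rw [← one_div, le_div_iff₀ hσ]
        exact h.card_mul_le hΩc y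
    _ = (σ ^ 3)⁻¹ := by rw [← Finset.mul_sum, sum_hat ht hxt, mul_one]

/-- The moment is at most `5 / (σ δ)` times the maximum of `ψ` times the volume, the normalization
is at least the volume over 512, and the edge has length at most `δ`. So `2560 = 5 * 512`, and the
square root of 16 raises it to `10240`. -/
theorem IsShape.norm_corrVec_sq_le (h : M.IsShape δ σ) (hΩc : Convex ℝ Ω) (hs : s ∈ M.cells)
    {y z : E3} (hy : y ∈ s) (hz : z ∈ s) {b : ℝ}
    (hψ : ∀ x ∈ hull s, volume.real (hull s) * ‖ψ x‖ ^ 2 ≤ 16 * δ ^ 4 * b) :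
    ‖M.corrVec ψ s y z‖ ^ 2 * volume.real (hull s) ≤ (10240 * δ ^ 2 / σ) ^ 2 * b := by
  have hδ := h.δ_pos
  have hσ := h.σ_pos
  have hV := M.volume_hull_pos hs
  have hb : 0 ≤ b := by
    have := (by positivity : (0 : ℝ) ≤ volume.real (hull s) * ‖ψ y‖ ^ 2).trans (hψ y (mem_hull hy))
    exact nonneg_of_mul_nonneg_right this (by positivity)
  set V := volume.real (hull s) with hVd
  have h1 : ∀ x ∈ hull s, ‖M.coordGrad s z (ψ x)‖ ≤ 5 / (σ * δ) * √(16 * δ ^ 4 * b / V) :=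
    fun x hx => by
    refine ((M.coordGrad s z).le_opNorm _).trans ?_
    have := h.radius_pos
    refine mul_le_mul (h.norm_coordGrad_le hs z) ?_ (norm_nonneg _) (by positivity)
    refine Real.le_sqrt_of_sq_le ?_
    rw [le_div_iff₀ hV, mul_comm]
    exact hψ x hx
  have h2 : |M.gradMoment ψ s z| ≤ 5 / (σ * δ) * √(16 * δ ^ 4 * b / V) * V :=
    norm_setIntegral_le_of_norm_le_const (isCompact_hull s).measure_lt_top h1
  have hB := volume_le_hatInner hΩc hs hy hz
  have hB0 := hatInner_pos hΩc hs hy hz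
  have h3 : ‖M.corrVec ψ s y z‖ ≤ 2560 / σ * √(16 * δ ^ 4 * b / V) := by
    rw [corrVec, norm_smul, norm_div, Real.norm_of_nonneg hB0.le, Real.norm_eq_abs]
    calc _ ≤ (5 / (σ * δ) * √(16 * δ ^ 4 * b / V) * V) / (V / 512) * δ := by
          gcongr
          · linarith
          · exact h.diam s hs z (mem_hull hz) y (mem_hull hy)
      _ = _ := by field_simp; ring
  calc _ ≤ (2560 / σ * √(16 * δ ^ 4 * b / V)) ^ 2 * V := by gcongr
    _ = (10240 * δ ^ 2 / σ) ^ 2 * b := by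
        rw [mul_pow, Real.sq_sqrt (by positivity)]
        field_simp
        ring

/-- Cauchy–Schwarz with products of two hat functions as weights, whose sum is bounded. The integral
of each weight is at most a multiple of the volume of its cell, and the factor 4 counts vertices. -/
theorem IsShape.integral_corr_sq_le (h : M.IsShape δ σ) (hΩc : Convex ℝ Ω)
    (hz₀ : ∀ s ∈ M.cells, z₀ s ∈ s) {b : Finset E3 → ℝ}
    (hψ : ∀ s ∈ M.cells, ∀ x ∈ hull s,
      volume.real (hull s) * ‖ψ x‖ ^ 2 ≤ 16 * δ ^ 4 * b s) :
    ∫ x in Ω, ‖M.corr z₀ ψ x‖ ^ 2 ≤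
      4 * (10240 / σ) ^ 2 * (σ ^ 3)⁻¹ ^ 2 * δ ^ 4 * ∑ s ∈ M.cells, b s := by
  have hδ := h.δ_pos
  have hσ := h.σ_pos
  have hκ := ballVol_pos
  set T := M.cells.sigma (fun s => s) with hT
  have hpt : ∀ x ∈ closure Ω, ‖M.corr z₀ ψ x‖ ^ 2 ≤ (σ ^ 3)⁻¹ *
      ∑ p ∈ T, M.hat (z₀ p.1) x * M.hat p.2 x * ‖M.corrVec ψ p.1 (z₀ p.1) p.2‖ ^ 2 := by
    intro x hx
    have hn : ∀ p : (_ : Finset E3) × E3, 0 ≤ M.hat (z₀ p.1) x * M.hat p.2 x := fun p =>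
      mul_nonneg (M.hat_nonneg _ _) (M.hat_nonneg _ _)
    have h1 : ‖M.corr z₀ ψ x‖ ≤ ∑ p ∈ T, √(M.hat (z₀ p.1) x * M.hat p.2 x) *
        (√(M.hat (z₀ p.1) x * M.hat p.2 x) * ‖M.corrVec ψ p.1 (z₀ p.1) p.2‖) := by
      refine (norm_sum_le _ _).trans (Finset.sum_le_sum fun p _ => ?_)
      rw [norm_smul, Real.norm_of_nonneg (hn p), ← mul_assoc, Real.mul_self_sqrt (hn p)]
    calc _ ≤ _ := pow_le_pow_left₀ (norm_nonneg _) h1 2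
      _ ≤ _ := Finset.sum_mul_sq_le_sq_mul_sq T _ _
      _ ≤ _ := by
        simp only [mul_pow, Real.sq_sqrt (hn _)]
        refine mul_le_mul_of_nonneg_right (h.sum_hat_hat_le hΩc hz₀ hx)
          (Finset.sum_nonneg fun p _ => mul_nonneg (hn p) (by positivity))
  have hi : ∀ p : (_ : Finset E3) × E3, IntegrableOn (fun x => M.hat (z₀ p.1) x * M.hat p.2 x *
      ‖M.corrVec ψ p.1 (z₀ p.1) p.2‖ ^ 2) Ω := fun p =>
    ((pwCont_hat_mul _ _).integrableOn hΩc).mul_const _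
  calc ∫ x in Ω, ‖M.corr z₀ ψ x‖ ^ 2 ≤ ∫ x in Ω, (σ ^ 3)⁻¹ *
      ∑ p ∈ T, M.hat (z₀ p.1) x * M.hat p.2 x * ‖M.corrVec ψ p.1 (z₀ p.1) p.2‖ ^ 2 := by
        refine integral_mono_ae (pwCont_corr.integrableOn_sq hΩc)
          ((integrable_finsetSum T fun p _ => hi p).const_mul _) ?_
        exact M.ae_of_interior hΩc fun s hs x hx => hpt x (M.hull_subset hs (interior_subset hx))
    _ = (σ ^ 3)⁻¹ * ∑ p ∈ T, M.hatInner (z₀ p.1) p.2 *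
        ‖M.corrVec ψ p.1 (z₀ p.1) p.2‖ ^ 2 := by
        rw [integral_const_mul, integral_finsetSum _ fun p _ => hi p]
        congr 1
        exact Finset.sum_congr rfl fun p _ => integral_mul_const _ _
    _ ≤ (σ ^ 3)⁻¹ * ∑ p ∈ T, (σ ^ 3)⁻¹ * ((10240 * δ ^ 2 / σ) ^ 2 * b p.1) := by
        refine mul_le_mul_of_nonneg_left (Finset.sum_le_sum fun p hp => ?_) (by positivity)
        obtain ⟨hp1, hp2⟩ := Finset.mem_sigma.1 hp
        have h1 := h.norm_corrVec_sq_le hΩc hp1 (hz₀ _ hp1) hp2 (hψ _ hp1)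
        have h2 : M.hatInner (z₀ p.1) p.2 ≤ (σ ^ 3)⁻¹ * volume.real (hull p.1) := by
          have h3 : M.hatInner (z₀ p.1) p.2 ≤ ∫ x in Ω, M.hat (z₀ p.1) x := by
            refine integral_mono_ae ((pwCont_hat_mul _ _).integrableOn hΩc)
              ((pwAff_hat _).pwQuad.pwC1.pwCont.integrableOn hΩc) ?_
            refine M.ae_of_interior hΩc fun s hs x hx => ?_
            refine mul_le_of_le_one_right (M.hat_nonneg _ _) ?_
            rw [M.hat_eq_coord hs (interior_subset hx)]
            exact M.coord_le_one hs (interior_subset hx) _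
          calc _ ≤ ballVol * δ ^ 3 := h3.trans (h.integral_hat_le hΩc _)
            _ = (σ ^ 3)⁻¹ * (ballVol * (σ * δ) ^ 3) := by field_simp
            _ ≤ _ := by gcongr; exact h.le_volume hp1
        calc _ ≤ (σ ^ 3)⁻¹ * volume.real (hull p.1) * ‖M.corrVec ψ p.1 (z₀ p.1) p.2‖ ^ 2 := by
              gcongr
          _ = (σ ^ 3)⁻¹ * (‖M.corrVec ψ p.1 (z₀ p.1) p.2‖ ^ 2 * volume.real (hull p.1)) := by ring
          _ ≤ _ := by gcongr
    _ = _ := by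
        rw [hT, Finset.sum_sigma, Finset.mul_sum, Finset.mul_sum]
        refine Finset.sum_congr rfl fun s hs => ?_
        simp only [Finset.sum_const, (M.mem_cells.1 hs).2, nsmul_eq_mul]
        push_cast
        ring

end TetMesh

end EricksenLeslie

namespace EricksenLeslie
open Filter Topology

theorem integrableOn_inner {Ω : Set E3} {f g : E3 → E3} (hf : MemLp f 2 (volume.restrict Ω))
    (hg : MemLp g 2 (volume.restrict Ω)) : IntegrableOn (fun x => (inner ℝ (f x) (g x) : ℝ)) Ω :=
  Integrable.mono (g := fun x => ‖f x‖ * ‖g x‖) (MemLp.integrable_mul hf.norm hg.norm)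
    (hf.1.inner hg.1) (Eventually.of_forall fun x => by
      rw [Real.norm_of_nonneg (by positivity : 0 ≤ ‖f x‖ * ‖g x‖)]
      exact norm_inner_le_norm _ _)

theorem abs_integral_inner_le {Ω : Set E3} {f g : E3 → E3} (hf : MemLp f 2 (volume.restrict Ω))
    (hg : MemLp g 2 (volume.restrict Ω)) :
    |∫ x in Ω, inner ℝ (f x) (g x)| ≤ √(∫ x in Ω, ‖f x‖ ^ 2) * √(∫ x in Ω, ‖g x‖ ^ 2) := by
  have i1 : Integrable (fun x => ‖f x‖ * ‖g x‖) (volume.restrict Ω) :=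
    MemLp.integrable_mul hf.norm hg.norm
  calc _ ≤ ∫ x in Ω, |inner ℝ (f x) (g x)| := abs_integral_le_integral_abs
    _ ≤ ∫ x in Ω, ‖f x‖ * ‖g x‖ :=
        integral_mono (integrableOn_inner hf hg).abs i1 fun x => abs_real_inner_le_norm _ _
    _ ≤ _ := (le_abs_self _).trans (abs_integral_mul_le (integrable_norm_sq_of_memLp hf)
        (integrable_norm_sq_of_memLp hg) i1)

theorem MemH10Sigma.congr {Ω : Set E3} {φ φ' : E3 → E3} {G : E3 → Mat3} (h : MemH10Sigma Ω φ G)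
    (he : φ' =ᵐ[volume.restrict Ω] φ) : MemH10Sigma Ω φ' G := by
  refine ⟨h.1.ae_eq he.symm, h.2.1, fun ε hε => ?_⟩
  obtain ⟨ψ, h1, h2, h3⟩ := h.2.2 ε hε
  refine ⟨ψ, h1, ?_, h3⟩
  rwa [eLpNorm_congr_ae (g := fun x => φ x - ψ x) (he.mono fun x hx => by simp only [hx])]

namespace TetMesh

variable {Ω : Set E3} {M : TetMesh Ω} {s t : Finset E3} {δ σ : ℝ}
variable {F : Type*} [NormedAddCommGroup F] [NormedSpace ℝ F]

/-! ### Inverse estimates -/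

theorem pwQuad_of_isPiecewisePoly {v : E3 → E3} (hv : ∀ i, M.IsPiecewisePoly 2 fun x => v x i) :
    M.PwQuad v := fun s hs => by
  choose p hp h using fun i => (hv i).2 s hs
  refine ⟨fun x => ∑ i, MvPolynomial.eval (fun i => x i) (p i) • e i,
    IsQuad.sum fun i _ => (isQuad_eval (hp i)).smul_const _, fun x hx => ?_⟩
  conv_lhs => rw [← sum_smul_e (v x)]
  exact Finset.sum_congr rfl fun i _ => congrArg (· • e i) (h i x hx)

theorem PwQuad.volume_mul_sq_le {p : E3 → F} (hp : M.PwQuad p) (hs : s ∈ M.cells) {x : E3}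
    (hx : x ∈ hull s) : volume.real (hull s) * ‖p x‖ ^ 2 ≤ 1568 * ∫ x in hull s, ‖p x‖ ^ 2 := by
  obtain ⟨g, hg, h⟩ := hp s hs
  rw [h x hx, setIntegral_congr_fun (measurableSet_hull s) (g := fun x => ‖g x‖ ^ 2)
    fun y hy => by simp only [h y hy]]
  refine (hg.volume_mul_norm_pow_le (convex_hull s) (isCompact_hull s) hx 2).trans (le_of_eq ?_)
  norm_num

/-- A squared `L²` norm of order `δ ^ 4` on cells of volume of order `δ ^ 3` leaves a positive power
of `δ`: smallness in `L²` of second order survives the inverse estimate. -/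
theorem IsShape.inverse_sup (h : M.IsShape δ σ) (hΩc : Convex ℝ Ω) {p : E3 → F}
    (hp : M.PwQuad p) {C : ℝ} (hC : ∫ x in Ω, ‖p x‖ ^ 2 ≤ C * δ ^ 4) {x : E3}
    (hx : x ∈ closure Ω) : ‖p x‖ ^ 2 ≤ 1568 * C * δ / (ballVol * σ ^ 3) := by
  obtain ⟨s, hs, hxs⟩ := M.exists_cell hx
  have hδ := h.δ_pos
  have hσ := h.σ_pos
  have hκ := ballVol_pos
  have hle : ∫ x in hull s, ‖p x‖ ^ 2 ≤ ∫ x in Ω, ‖p x‖ ^ 2 :=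
    integral_mono_measure (hull_subset_restrict_le hΩc M hs)
      (Eventually.of_forall fun x => by positivity) (hp.pwC1.pwCont.integrableOn_sq hΩc)
  have h1 := hp.volume_mul_sq_le hs hxs
  have h2 : ballVol * (σ * δ) ^ 3 * ‖p x‖ ^ 2 ≤ 1568 * (C * δ ^ 4) :=
    (mul_le_mul_of_nonneg_right (h.le_volume hs) (by positivity)).trans (h1.trans (by linarith))
  rw [le_div_iff₀ (by positivity)]
  refine le_of_mul_le_mul_right ?_ (pow_pos hδ 3)
  linarith

/-- Per cell the fourth power of the gradient costs `δ ^ (-7)` times the squared integral: four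
powers for the gradient and three for the volume. Against `(δ ^ 4) ^ 2` one power of `δ` remains.
The factor `625` is `5 ^ 4`. -/
theorem IsShape.inverse_fderiv (h : M.IsShape δ σ) (hΩc : Convex ℝ Ω) {p : E3 → F}
    (hp : M.PwQuad p) {C : ℝ} (hC : ∫ x in Ω, ‖p x‖ ^ 2 ≤ C * δ ^ 4) :
    ∫ x in Ω, ‖fderiv ℝ p x‖ ^ 4 ≤ 625 * 1568 ^ 2 * C ^ 2 * δ / (ballVol * σ ^ 7) := by
  have hδ := h.δ_pos
  have hσ := h.σ_pos
  have hκ := ballVol_pos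
  have hc : M.PwCont fun x => ‖fderiv ℝ p x‖ ^ 4 :=
    hp.pwC1.pwCont_fderiv.comp (φ := fun x => ‖x‖ ^ 4) (by fun_prop)
  have hI0 : ∀ s : Finset E3, 0 ≤ ∫ x in hull s, ‖p x‖ ^ 2 :=
    fun s => integral_nonneg fun x => by positivity
  have hcell : ∀ s ∈ M.cells, ∫ x in hull s, ‖fderiv ℝ p x‖ ^ 4 ≤
      625 * 1568 ^ 2 / (ballVol * σ ^ 7 * δ ^ 7) * (∫ x in hull s, ‖p x‖ ^ 2) ^ 2 := by
    intro s hs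
    refine hc.integral_hull_le hs fun x hx => ?_
    have hV := M.volume_hull_pos hs
    set V := volume.real (hull s) with hVd
    set I := ∫ x in hull s, ‖p x‖ ^ 2 with hI
    have hI0' : 0 ≤ I := hI0 s
    obtain ⟨c, hcb⟩ := h.ball s hs
    obtain ⟨g, hg, hpg⟩ := hp s hs
    have hS : ∀ y ∈ hull s, ‖g y‖ ≤ √(1568 * I / V) := fun y hy => by
      refine Real.le_sqrt_of_sq_le ?_
      rw [le_div_iff₀ hV, mul_comm, ← hpg y hy]
      exact hp.volume_mul_sq_le hs hy
    have h1 := hg.norm_fderiv_le (convex_hull s) h.radius_pos hcb hS (interior_subset hx)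
    rw [← fderiv_eq_of_eqOn hpg hx] at h1
    have h4 := pow_le_pow_left₀ (norm_nonneg _) h1 4
    calc V * ‖fderiv ℝ p x‖ ^ 4 ≤ V * (5 * √(1568 * I / V) / (σ * δ)) ^ 4 := by gcongr
      _ = V * (625 * (√(1568 * I / V) ^ 2) ^ 2 / (σ * δ) ^ 4) := by ring
      _ = 625 * 1568 ^ 2 * I ^ 2 / (V * (σ * δ) ^ 4) := by
          rw [Real.sq_sqrt (by positivity)]; field_simp
      _ ≤ 625 * 1568 ^ 2 * I ^ 2 / (ballVol * (σ * δ) ^ 3 * (σ * δ) ^ 4) := by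
          gcongr; exact h.le_volume hs
      _ = _ := by field_simp
  rw [hc.integral_eq hΩc]
  calc _ ≤ _ := Finset.sum_le_sum hcell
    _ ≤ 625 * 1568 ^ 2 / (ballVol * σ ^ 7 * δ ^ 7) * (C * δ ^ 4) ^ 2 := by
        rw [← Finset.mul_sum]
        refine mul_le_mul_of_nonneg_left ?_ (by positivity)
        refine (Finset.sum_sq_le_sq_sum_of_nonneg fun s _ => hI0 s).trans ?_
        refine pow_le_pow_left₀ (Finset.sum_nonneg fun s _ => hI0 s) ?_ 2
        rw [← (hp.pwC1.pwCont.comp (φ := fun y : F => ‖y‖ ^ 2) (by fun_prop)).integral_eq hΩc]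
        exact hC
    _ = _ := by field_simp

theorem integral_fderiv_add_pow_four_le (hΩc : Convex ℝ Ω) {f g : E3 → F} (hf : M.PwC1 f)
    (hg : M.PwC1 g) : ∫ x in Ω, ‖fderiv ℝ (fun x => f x + g x) x‖ ^ 4 ≤
      8 * ((∫ x in Ω, ‖fderiv ℝ f x‖ ^ 4) + ∫ x in Ω, ‖fderiv ℝ g x‖ ^ 4) := by
  have hi : ∀ f : E3 → F, M.PwC1 f → IntegrableOn (fun x => ‖fderiv ℝ f x‖ ^ 4) Ω := fun f hf =>
    (hf.pwCont_fderiv.comp (φ := fun x => ‖x‖ ^ 4) (by fun_prop)).integrableOn hΩc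
  have hfg : M.PwC1 fun x => f x + g x :=
    hf.comp₂ hg (fun a b => a + b) (by fun_prop)
  rw [← integral_add (hi f hf) (hi g hg), ← integral_const_mul]
  refine integral_mono_ae (hi _ hfg) (((hi f hf).add (hi g hg)).const_mul 8) ?_
  filter_upwards [hf.ae_differentiableAt hΩc, hg.ae_differentiableAt hΩc] with x h1 h2
  rw [fderiv_fun_add h1 h2]
  refine (pow_le_pow_left₀ (norm_nonneg _) (norm_add_le _ _) 4).trans ?_
  exact add_pow_le (norm_nonneg _) (norm_nonneg _) 4 |>.trans (by norm_num)

/-! ### The approximation of divergence-free fields -/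

/-- Take the interpolant plus the bubble correction of the interpolation error. The interpolant has
zero boundary values because `φ` does, and the bubbles because their vertices `z₀` are interior. The
moments of the sum against pressure gradients equal those of `φ`, which vanish. Interpolation error
and correction are both of order `δ ^ 2` in `L²`, so inverse estimates keep the correction bounded.
-/
theorem exists_memV_approx (hΩo : IsOpen Ω) (hΩc : Convex ℝ Ω) (hΩb : Bornology.IsBounded Ω)
    (hΩn : Ω.Nonempty) {σ : ℝ} (hσ : 0 < σ) :
    ∃ C : ℝ, 0 ≤ C ∧ ∀ (M : TetMesh Ω) (δ : ℝ), M.IsShape δ σ → δ ≤ Metric.diam Ω →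
      M.HasInteriorNodes → ∀ (φ : E3 → E3) (G : E3 → Mat3) (H : E3 → E3 →L[ℝ] Mat3),
      IsH2 Ω φ G H → MemH10Sigma Ω φ G → h2NormSq Ω φ G H ≤ 1 → ContinuousOn φ (closure Ω) →
      ∃ a : E3 → E3, M.MemV a ∧ (∀ x ∈ closure Ω, ‖a x‖ ≤ C) ∧
        ∫ x in Ω, ‖fderiv ℝ a x‖ ^ 4 ≤ C ∧ ∫ x in Ω, ‖φ x - a x‖ ^ 2 ≤ C * δ ^ 4 := by
  obtain ⟨C₁, hC₁, hsup⟩ := exists_sup_bound hΩo hΩc hΩb hΩn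
  obtain ⟨C₂, hC₂, h4⟩ := IsShape.exists_integral_fderiv_interp_pow_four_le hΩo hΩc hΩb hΩn hσ
  set D := Metric.diam Ω with hD
  have hκ := ballVol_pos
  have hD0 : 0 ≤ D := Metric.diam_nonneg
  set C₃ := 4 * (10240 / σ) ^ 2 * (σ ^ 3)⁻¹ ^ 2 with hC₃
  set C₄ := 1568 * C₃ * D / (ballVol * σ ^ 3) with hC₄
  set C₅ := 625 * 1568 ^ 2 * C₃ ^ 2 * D / (ballVol * σ ^ 7) with hC₅
  have hC₃0 : 0 ≤ C₃ := by positivity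
  have hC₄0 : 0 ≤ C₄ := by positivity
  have hC₅0 : 0 ≤ C₅ := by positivity
  -- The three summands serve the maximum norm, the `L⁴` norm of the gradient, and the `L²` error,
  -- in this order.
  refine ⟨(C₁ + √C₄) + 8 * (C₂ + C₅) + 2 * (16 + C₃), by positivity,
    fun M δ h hδD hM φ G H hφ hφσ hN hφc => ?_⟩
  have hδ := h.δ_pos
  have hφ0 : ∀ x ∈ frontier Ω, φ x = 0 := fun x hx =>
    hφσ.eq_zero_on_frontier hφ hφc hΩo hΩc hΩb hΩn hx
  choose! z₀ hz₀ using hM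
  have hz₀' : ∀ s ∈ M.cells, z₀ s ∈ s := fun s hs => (hz₀ s hs).1
  have hY : M.MemY (M.interp φ) := memY_interp hΩo hΩc fun z _ hz => hφ0 z hz
  set ψ := fun x => φ x - M.interp φ x with hψ
  have hψc : ContinuousOn ψ (closure Ω) := hφc.sub hY.1.pwC1.continuousOn
  set c := M.corr z₀ ψ with hc
  have hN0 : 0 ≤ h2NormSq Ω φ G H := IsH2.h2NormSq_nonneg
  have hHi := (M.integrableOn_iff hΩc).1 hφ.integrable_hess_norm_sq
  have hHs : ∑ s ∈ M.cells, ∫ x in hull s, ‖H x‖ ^ 2 ≤ 1 := by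
    rw [← M.integral_eq hΩc hHi]
    exact hφ.integral_hess_sq_le.trans hN
  have herr : ∀ s ∈ M.cells, ∀ x ∈ hull s, volume.real (hull s) * ‖ψ x‖ ^ 2 ≤
      16 * δ ^ 4 * ∫ x in hull s, ‖H x‖ ^ 2 := fun s hs x hx =>
    h.interp_error hΩo hΩc hΩb hΩn hφ hφc hs hx
  have hc2 : ∫ x in Ω, ‖c x‖ ^ 2 ≤ C₃ * δ ^ 4 := by
    refine (h.integral_corr_sq_le hΩc hz₀' herr).trans ?_
    exact mul_le_of_le_one_right (by positivity) hHs
  have hcP : ∀ i, M.IsPiecewisePoly 2 fun x => c x i := fun i => isPiecewisePoly_corr i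
  have haP : ∀ i, M.IsPiecewisePoly 2 fun x => (M.interp φ x + c x) i := fun i =>
    (((hY.1 i).mono one_le_two).linComb (hcP i) 1 1).congr fun x _ => by simp
  have ha0 : ∀ x ∈ frontier Ω, M.interp φ x + c x = 0 := fun x hx => by
    rw [hY.2 x hx, hc, corr_eq_zero_on_frontier hΩo hΩc hz₀ hx, add_zero]
  have hcQ : M.PwQuad c := pwQuad_of_isPiecewisePoly hcP
  have haQ : M.PwQuad fun x => M.interp φ x + c x := pwQuad_of_isPiecewisePoly haP
  have hIc := hY.1.pwC1.pwCont
  have hφL := hφσ.1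
  have hψL : MemLp ψ 2 (volume.restrict Ω) := hφL.sub (hIc.memLp hΩc)
  have hψ2 : ∫ x in Ω, ‖ψ x‖ ^ 2 ≤ 16 * δ ^ 4 := by
    have hi := (M.integrableOn_iff hΩc).1 (integrable_norm_sq_of_memLp hψL)
    rw [M.integral_eq hΩc hi]
    calc _ ≤ ∑ s ∈ M.cells, 16 * δ ^ 4 * ∫ x in hull s, ‖H x‖ ^ 2 := by
          refine Finset.sum_le_sum fun s hs => ?_
          have hV := M.volume_hull_pos hs
          calc _ ≤ ∫ x in hull s, (volume.real (hull s))⁻¹ *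
                (16 * δ ^ 4 * ∫ x in hull s, ‖H x‖ ^ 2) := by
                refine setIntegral_mono_on (hi s hs)
                  (integrableOn_const (isCompact_hull s).measure_lt_top.ne)
                  (measurableSet_hull s) fun x hx => ?_
                rw [inv_mul_eq_div, le_div_iff₀ hV, mul_comm]
                exact herr s hs x hx
            _ = _ := by rw [setIntegral_const, smul_eq_mul, mul_inv_cancel_left₀ hV.ne']
      _ ≤ _ := by
          rw [← Finset.mul_sum]
          exact mul_le_of_le_one_right (by positivity) hHs
  refine ⟨fun x => M.interp φ x + c x, ⟨haP, ha0, fun q hq => ?_⟩, fun x hx => ?_, ?_, ?_⟩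
  · have hqA := hq.1.pwAff
    have hq1 := hqA.pwQuad.pwC1
    rw [haQ.pwC1.integral_divg_mul hΩo hΩc hΩb ha0 hq1, neg_eq_zero]
    have hcL := hcQ.pwC1.pwCont.memLp hΩc
    simp only [map_add]
    rw [integral_add (hq1.integrableOn_fderiv_apply hΩc (hIc.memLp hΩc))
      (hq1.integrableOn_fderiv_apply hΩc hcL), integral_fderiv_corr hΩc hz₀' hψc hqA]
    simp only [hψ, map_sub]
    rw [integral_sub (hq1.integrableOn_fderiv_apply hΩc hφL)
      (hq1.integrableOn_fderiv_apply hΩc (hIc.memLp hΩc)),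
      hq1.integral_fderiv_apply_eq_zero hΩo hΩc hΩb hφσ]
    ring
  · have h1 : ‖M.interp φ x‖ ≤ C₁ := by
      obtain ⟨s, hs, hxs⟩ := M.exists_cell hx
      rw [M.interp_eq hs hxs]
      refine (norm_sum_le _ _).trans ?_
      calc _ ≤ ∑ z ∈ s, M.coord s z x * C₁ := by
            refine Finset.sum_le_sum fun z hz => ?_
            have h0 := (M.mem_hull_iff hs).1 hxs z
            rw [norm_smul, Real.norm_of_nonneg h0]
            refine mul_le_mul_of_nonneg_left ?_ h0
            refine (hsup φ G H hφ hφc z (M.hull_subset hs (mem_hull hz))).trans ?_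
            exact mul_le_of_le_one_right hC₁ (Real.sqrt_le_one.2 hN)
        _ = C₁ := by rw [← Finset.sum_mul, M.sum_coord hs, one_mul]
    have h2 : ‖c x‖ ≤ √C₄ := Real.le_sqrt_of_sq_le <|
      (h.inverse_sup hΩc hcQ hc2 hx).trans (by rw [hC₄]; gcongr)
    have : 0 ≤ 8 * (C₂ + C₅) + 2 * (16 + C₃) := by positivity
    have := norm_add_le (M.interp φ x) (c x)
    linarith
  · refine (integral_fderiv_add_pow_four_le hΩc hY.1.pwC1 hcQ.pwC1).trans ?_
    have h1 : ∫ x in Ω, ‖fderiv ℝ (M.interp φ) x‖ ^ 4 ≤ C₂ :=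
      (h4 M δ h hδD φ G H hφ hφc).trans (mul_le_of_le_one_right hC₂ (pow_le_one₀ hN0 hN))
    have h2 : ∫ x in Ω, ‖fderiv ℝ c x‖ ^ 4 ≤ C₅ :=
      (h.inverse_fderiv hΩc hcQ hc2).trans (by rw [hC₅]; gcongr)
    have : 0 ≤ (C₁ + √C₄) + 2 * (16 + C₃) := by positivity
    linarith
  · have hci := hcQ.pwC1.pwCont.integrableOn_sq hΩc
    have hψi := integrable_norm_sq_of_memLp hψL
    have haL : MemLp (fun x => φ x - (M.interp φ x + c x)) 2 (volume.restrict Ω) :=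
      hφL.sub (haQ.pwC1.pwCont.memLp hΩc)
    calc _ ≤ ∫ x in Ω, 2 * (‖ψ x‖ ^ 2 + ‖c x‖ ^ 2) := by
          refine integral_mono (integrable_norm_sq_of_memLp haL) ((hψi.add hci).const_mul 2)
            fun x => ?_
          have h1 : φ x - (M.interp φ x + c x) = ψ x - c x := by simp only [hψ]; abel
          have h2 := norm_sub_le (ψ x) (c x)
          simp only [h1]
          nlinarith [norm_nonneg (ψ x - c x), sq_nonneg (‖ψ x‖ - ‖c x‖)]
      _ = 2 * ((∫ x in Ω, ‖ψ x‖ ^ 2) + ∫ x in Ω, ‖c x‖ ^ 2) := by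
          rw [integral_const_mul, integral_add hψi hci]
      _ ≤ 2 * (16 + C₃) * δ ^ 4 := by linarith
      _ ≤ _ := by
          refine mul_le_mul_of_nonneg_right ?_ (by positivity)
          have : 0 ≤ (C₁ + √C₄) + 8 * (C₂ + C₅) := by positivity
          linarith

/-- Test functions from the discrete space which act on a given discrete field like a given
divergence-free field. -/
theorem exists_test_function (hΩo : IsOpen Ω) (hΩc : Convex ℝ Ω) (hΩb : Bornology.IsBounded Ω)
    (hΩn : Ω.Nonempty) {σ : ℝ} (hσ : 0 < σ) :
    ∃ C : ℝ, 0 ≤ C ∧ ∀ (M : TetMesh Ω) (δ : ℝ), M.IsShape δ σ → δ ≤ Metric.diam Ω →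
      M.HasInteriorNodes → ∀ y, M.MemV y →
      ∀ (φ : E3 → E3) (G : E3 → Mat3) (H : E3 → E3 →L[ℝ] Mat3),
      IsH2 Ω φ G H → MemH10Sigma Ω φ G → h2NormSq Ω φ G H ≤ 1 →
      ∃ a : E3 → E3, M.MemV a ∧ (∫ x in Ω, inner ℝ (y x) (φ x)) = (∫ x in Ω, inner ℝ (y x) (a x)) ∧
        (∀ x ∈ closure Ω, ‖a x‖ ≤ C) ∧ ∫ x in Ω, ‖fderiv ℝ a x‖ ^ 4 ≤ C := by
  obtain ⟨C, hC, hA⟩ := exists_memV_approx hΩo hΩc hΩb hΩn hσ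
  set D := Metric.diam Ω with hD
  have hκ := ballVol_pos
  have hD0 : 0 ≤ D := Metric.diam_nonneg
  set C₄ := 1568 * C * D / (ballVol * σ ^ 3) with hC₄
  set C₅ := 625 * 1568 ^ 2 * C ^ 2 * D / (ballVol * σ ^ 7) with hC₅
  have hC₄0 : 0 ≤ C₄ := by positivity
  have hC₅0 : 0 ≤ C₅ := by positivity
  refine ⟨(C + √C₄) + 8 * (C + C₅), by positivity,
    fun M δ h hδD hM y hy φ' G H hφ' hφσ' hN' => ?_⟩
  have hδ := h.δ_pos
  obtain ⟨φ, -, -, hφc, he, -⟩ := hφ'.exists_continuous_rep hΩo hΩc hΩb hΩn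
  have hφ := hφ'.congr hΩo he
  have hφσ := hφσ'.congr he
  have hN : h2NormSq Ω φ G H ≤ 1 := by
    refine le_trans (le_of_eq ?_) hN'
    exact integral_congr_ae (he.mono fun x hx => by simp only [hx])
  have hyφ : ∫ x in Ω, inner ℝ (y x) (φ' x) = ∫ x in Ω, inner ℝ (y x) (φ x) :=
    integral_congr_ae (he.mono fun x hx => by simp only [hx])
  obtain ⟨b, hb, hb1, hb2, hb3⟩ := hA M δ h hδD hM φ G H hφ hφσ hN hφc
  have hyL := hy.pwC1.pwCont.memLp hΩc
  have hbL := hb.pwC1.pwCont.memLp hΩc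
  have hdL : MemLp (fun x => φ x - b x) 2 (volume.restrict Ω) := hφσ.1.sub hbL
  set Y := ∫ x in Ω, ‖y x‖ ^ 2 with hYd
  have hY0 : 0 ≤ Y := integral_nonneg fun x => by positivity
  set r := ∫ x in Ω, inner ℝ (y x) (φ x - b x) with hr
  have hr2 : r ^ 2 ≤ Y * ∫ x in Ω, ‖φ x - b x‖ ^ 2 := by
    have h1 := abs_integral_inner_le hyL hdL
    have h2 := pow_le_pow_left₀ (abs_nonneg _) h1 2
    rwa [sq_abs, mul_pow, Real.sq_sqrt hY0,
      Real.sq_sqrt (integral_nonneg fun x => by positivity)] at h2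
  -- If `Y = 0`, Cauchy–Schwarz forces `r = 0`, so division by zero does no harm.
  have hrY : r / Y * Y = r := by
    rcases hY0.eq_or_lt with h0 | h0
    · rw [← h0, zero_mul] at hr2
      have : r = 0 := pow_eq_zero_iff two_ne_zero |>.1 (le_antisymm hr2 (sq_nonneg r))
      rw [this]; simp
    · exact div_mul_cancel₀ _ h0.ne'
  -- The `L²` projection of `φ - b` onto the line spanned by `y`. It lies in the discrete space,
  -- makes the pairing with `y` exact, and is no larger in `L²` than `φ - b`, so the inverse
  -- estimates apply to it.
  set p := fun x => (r / Y) • y x with hp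
  have hpQ : M.PwQuad p := fun s hs => by
    obtain ⟨g, hg, h⟩ := hy.pwQuad s hs
    exact ⟨_, hg.const_smul (r / Y), fun x hx => by simp only [hp, h x hx]⟩
  have hp2 : ∫ x in Ω, ‖p x‖ ^ 2 ≤ C * δ ^ 4 := by
    have e1 : ∫ x in Ω, ‖p x‖ ^ 2 = (r / Y) ^ 2 * Y := by
      rw [hYd, ← integral_const_mul, ← hYd]
      refine integral_congr_ae (Eventually.of_forall fun x => ?_)
      simp only [hp, norm_smul, mul_pow, Real.norm_eq_abs, sq_abs]
    rw [e1]
    refine le_trans ?_ hb3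
    rcases hY0.eq_or_lt with h0 | h0
    · rw [← h0, mul_zero]
      exact integral_nonneg fun x => by positivity
    · refine le_of_mul_le_mul_left ?_ h0
      refine le_trans (le_of_eq ?_) hr2
      field_simp
  have hey : ∫ x in Ω, inner ℝ (y x) (b x + p x) = ∫ x in Ω, inner ℝ (y x) (φ x) := by
    have e1 : ∫ x in Ω, inner ℝ (y x) (p x) = r := by
      refine Eq.trans ?_ hrY
      rw [hYd, ← integral_const_mul, ← hYd]
      refine integral_congr_ae (Eventually.of_forall fun x => ?_)
      simp only [hp, inner_smul_right, real_inner_self_eq_norm_sq]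
    have e2 : r = (∫ x in Ω, inner ℝ (y x) (φ x)) - ∫ x in Ω, inner ℝ (y x) (b x) := by
      rw [hr, ← integral_sub (integrableOn_inner hyL hφσ.1) (integrableOn_inner hyL hbL)]
      simp only [inner_sub_right]
    simp only [inner_add_right]
    rw [integral_add (integrableOn_inner hyL hbL)
      (integrableOn_inner hyL (hpQ.pwC1.pwCont.memLp hΩc)), e1, e2]
    ring
  refine ⟨fun x => b x + p x, ?_, hyφ.trans hey.symm, fun x hx => ?_, ?_⟩
  · have := hb.linComb hΩc hy 1 (r / Y)
    simpa only [one_smul] using this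
  · have h2 : ‖p x‖ ≤ √C₄ := Real.le_sqrt_of_sq_le <|
      (h.inverse_sup hΩc hpQ hp2 hx).trans (by rw [hC₄]; gcongr)
    have := norm_add_le (b x) (p x)
    have := hb1 x hx
    linarith
  · refine (integral_fderiv_add_pow_four_le hΩc hb.pwC1 hpQ.pwC1).trans ?_
    have h2 : ∫ x in Ω, ‖fderiv ℝ p x‖ ^ 4 ≤ C₅ :=
      (h.inverse_fderiv hΩc hpQ hp2).trans (by rw [hC₅]; gcongr)
    have := Real.sqrt_nonneg C₄
    linarith

end TetMesh

end EricksenLeslie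

/-! ### The dual norm of the time derivative of the velocity -/

namespace EricksenLeslie
open Filter Topology

theorem abs_frob_le (A B : Mat3) : |frob A B| ≤ 3 * (‖A‖ * ‖B‖) := by
  have h : ∀ i, |inner ℝ (A (e i)) (B (e i))| ≤ ‖A‖ * ‖B‖ := fun i => by
    refine (abs_real_inner_le_norm _ _).trans (mul_le_mul ?_ ?_ (norm_nonneg _) (norm_nonneg _)) <;>
      exact (ContinuousLinearMap.le_opNorm _ _).trans (by rw [norm_e, mul_one])
  refine (Finset.abs_sum_le_sum_abs _ _).trans ((Finset.sum_le_sum fun i _ => h i).trans ?_)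
  simp

theorem norm_adjoint_apply_le (A : Mat3) (x : E3) :
    ‖ContinuousLinearMap.adjoint A x‖ ≤ ‖A‖ * ‖x‖ :=
  (ContinuousLinearMap.le_opNorm _ _).trans (by rw [LinearIsometryEquiv.norm_map])

namespace TetMesh

variable {Ω : Set E3} {M : TetMesh Ω} {s t : Finset E3} {δ σ : ℝ}
variable {X Y : Type*} [NormedAddCommGroup X] [NormedSpace ℝ X] [NormedAddCommGroup Y]
  [NormedSpace ℝ Y]

theorem PwCont.abs_integral_le (hΩc : Convex ℝ Ω) {g : E3 → ℝ} {f : E3 → X} {h : E3 → Y}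
    (hg : M.PwCont g) (hf : M.PwCont f) (hh : M.PwCont h) {c : ℝ} (hc : 0 ≤ c)
    (hle : ∀ x ∈ closure Ω, |g x| ≤ c * (‖f x‖ * ‖h x‖)) :
    |∫ x in Ω, g x| ≤ c * (√(∫ x in Ω, ‖f x‖ ^ 2) * √(∫ x in Ω, ‖h x‖ ^ 2)) := by
  have i : IntegrableOn (fun x => ‖f x‖ * ‖h x‖) Ω :=
    (hf.comp₂ hh (fun a b => ‖a‖ * ‖b‖) (by fun_prop)).integrableOn hΩc
  calc _ ≤ ∫ x in Ω, |g x| := abs_integral_le_integral_abs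
    _ ≤ ∫ x in Ω, c * (‖f x‖ * ‖h x‖) :=
        integral_mono_ae (hg.integrableOn hΩc).abs (i.const_mul c) <|
          M.ae_of_interior hΩc fun s hs x hx => hle x (M.hull_subset hs (interior_subset hx))
    _ = c * ∫ x in Ω, ‖f x‖ * ‖h x‖ := integral_const_mul _ _
    _ ≤ _ := mul_le_mul_of_nonneg_left ((le_abs_self _).trans
        (abs_integral_mul_le (hf.integrableOn_sq hΩc) (hh.integrableOn_sq hΩc) i)) hc

theorem abs_lumpedCells_le_of_le {F f g : Finset E3 → E3 → ℝ} {c : ℝ} (hc : 0 ≤ c)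
    (h : ∀ s ∈ M.cells, ∀ z ∈ s, |F s z| ≤ c * (f s z * g s z)) :
    |M.lumpedCells F| ≤
      c * (√(M.lumpedCells fun s z => f s z ^ 2) * √(M.lumpedCells fun s z => g s z ^ 2)) := by
  refine (M.abs_lumpedCells_le F).trans ((M.lumpedCells_mono h).trans ?_)
  rw [lumpedCells_mul]
  exact mul_le_mul_of_nonneg_left (M.lumpedCells_mul_le f g) hc

theorem PwCont.sq_integral_sq_le (hΩc : Convex ℝ Ω) (hΩb : Bornology.IsBounded Ω) {f : E3 → X}
    (hf : M.PwCont f) :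
    (∫ x in Ω, ‖f x‖ ^ 2) ^ 2 ≤ volume.real Ω * ∫ x in Ω, ‖f x‖ ^ 4 := by
  have : IsFiniteMeasure (volume.restrict Ω) := ⟨by simpa using hΩb.measure_lt_top⟩
  have h := sq_integral_mul_le (μ := volume.restrict Ω) (f := fun _ => 1)
    (g := fun x => ‖f x‖ ^ 2) (by simpa using integrable_const (1 : ℝ))
    ((hf.comp (φ := fun x => (‖x‖ ^ 2) ^ 2) (by fun_prop)).integrableOn hΩc)
    ((hf.comp (φ := fun x => 1 * ‖x‖ ^ 2) (by fun_prop)).integrableOn hΩc)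
  simp only [one_mul, one_pow, ← pow_mul] at h
  simpa using h

/-- Interpolate `L⁴` between `L²` and `L⁶`, and bound `L²` by `L⁴` on the bounded domain. The fourth
power integral then appears on both sides with different exponents and can be divided out, so no
separate Poincaré inequality is needed. -/
theorem exists_integral_pow_four_le (hΩo : IsOpen Ω) (hΩc : Convex ℝ Ω)
    (hΩb : Bornology.IsBounded Ω) :
    ∃ C : ℝ, 0 ≤ C ∧ ∀ (M : TetMesh Ω) (v : E3 → E3), M.PwC1 v → (∀ x ∈ frontier Ω, v x = 0) →
      ∫ x in Ω, ‖v x‖ ^ 4 ≤ C * (∫ x in Ω, ‖fderiv ℝ v x‖ ^ 2) ^ 2 := by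
  obtain ⟨C, hC, h⟩ := exists_sobolev_bound hΩo hΩc hΩb
  set W := volume.real Ω with hW
  have hW0 : 0 ≤ W := measureReal_nonneg
  refine ⟨1 + W * C ^ 2, by positivity, fun M v hv h0 => ?_⟩
  have h6 := h M v hv h0
  set S := ∫ x in Ω, ‖fderiv ℝ v x‖ ^ 2 with hS
  set Q := ∫ x in Ω, ‖v x‖ ^ 4 with hQ
  set T := ∫ x in Ω, ‖v x‖ ^ 2 with hT
  have hS0 : 0 ≤ S := integral_nonneg fun x => by positivity
  have hQ0 : 0 ≤ Q := integral_nonneg fun x => by positivity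
  have hT0 : 0 ≤ T := integral_nonneg fun x => by positivity
  have h2 : T ^ 2 ≤ W * Q := hv.pwCont.sq_integral_sq_le hΩc hΩb
  have h4 : Q ^ 2 ≤ T * (C * S ^ 3) := by
    have hi := fun n : ℕ =>
      (hv.pwCont.comp (φ := fun x => ‖x‖ ^ n) (by fun_prop)).integrableOn hΩc
    have := sq_integral_mul_le (μ := volume.restrict Ω) (f := fun x => ‖v x‖)
      (g := fun x => ‖v x‖ ^ 3) (hi 2) (by simp only [← pow_mul]; exact hi 6)
      (by simp only [← pow_succ']; exact hi 4)
    simp only [← pow_mul, ← pow_succ'] at this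
    exact this.trans (mul_le_mul_of_nonneg_left h6 hT0)
  have h8 : Q ^ 4 ≤ W * Q * (C * S ^ 3) ^ 2 := by
    calc Q ^ 4 = (Q ^ 2) ^ 2 := by ring
      _ ≤ (T * (C * S ^ 3)) ^ 2 := by gcongr
      _ = T ^ 2 * (C * S ^ 3) ^ 2 := by ring
      _ ≤ _ := by gcongr
  rcases hQ0.eq_or_lt with hq | hq
  · rw [← hq]; positivity
  · have h3 : Q ^ 3 ≤ (W * C ^ 2) * (S ^ 2) ^ 3 := by
      refine le_of_mul_le_mul_left ?_ hq
      linarith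
    -- Allows a cube root of the estimate without introducing radicals.
    have hc : W * C ^ 2 ≤ (1 + W * C ^ 2) ^ 3 := by
      have : 0 ≤ W * C ^ 2 := by positivity
      nlinarith [pow_nonneg this 2, pow_nonneg this 3]
    refine le_of_pow_le_pow_left₀ three_ne_zero (by positivity) (h3.trans ?_)
    rw [mul_pow]
    gcongr

theorem PwAff.norm_le_one {f : E3 → X} (hf : M.PwAff f) (h : ∀ z ∈ M.nodes, ‖f z‖ ≤ 1) {x : E3}
    (hx : x ∈ closure Ω) : ‖f x‖ ≤ 1 := by
  obtain ⟨s, hs, hxs⟩ := M.exists_cell hx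
  rw [hf.eq_sum_coord hs hxs, ← M.sum_coord hs x]
  refine (norm_sum_le _ _).trans (Finset.sum_le_sum fun z hz => ?_)
  have h0 := (M.mem_hull_iff hs).1 hxs z
  rw [norm_smul, Real.norm_of_nonneg h0]
  exact mul_le_of_le_one_right h0 (h z (M.mem_nodes_of_mem hs hz))

end TetMesh

/-- The triangle inequality for the terms of the momentum equation. -/
theorem abs_le_of_sum_eq_zero {I A B Γ L D₁ D₂ D₃ E₁ E₂ c₁ c₂ c₃ c₄ a γ l d e : ℝ}
    (hconv : A + B + Γ = 0)
    (hsum : I + A + 1 / 2 * B - L + (c₁ * D₁ + c₂ * D₂ + c₃ * D₃ + c₄ * E₁ + E₂) = 0)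
    (hA : |A| ≤ a) (hΓ : |Γ| ≤ γ) (hL : |L| ≤ l) (hD₁ : |D₁| ≤ 1 * d) (hD₂ : |D₂| ≤ 3 * d)
    (hD₃ : |D₃| ≤ 1 * d) (hE₁ : |E₁| ≤ 1 * e) (hE₂ : |E₂| ≤ 3 * e) :
    |I| ≤ a + γ + l + (|c₁| + |c₂| * 3 + |c₃|) * d + (|c₄| + 3) * e := by
  have mulb : ∀ {c x b : ℝ}, |x| ≤ b → |c * x| ≤ |c| * b := fun {c x b} h => by
    rw [abs_mul]; exact mul_le_mul_of_nonneg_left h (abs_nonneg c)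
  have h1 := abs_le.1 hA
  have h2 := abs_le.1 hΓ
  have h3 := abs_le.1 hL
  have h4 := abs_le.1 (mulb (c := c₁) hD₁)
  have h5 := abs_le.1 (mulb (c := c₂) hD₂)
  have h6 := abs_le.1 (mulb (c := c₃) hD₃)
  have h7 := abs_le.1 (mulb (c := c₄) hE₁)
  have h8 := abs_le.1 hE₂
  have h9 := (abs_nonneg _).trans hA
  have h10 := (abs_nonneg _).trans hΓ
  -- The convective identity eliminates `B`: the sum `A + B / 2` equals `(A - Γ) / 2`.
  exact abs_le.2 ⟨by linarith, by linarith⟩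

open TetMesh in
-- With the test function bounded in `L^∞` and its gradient in `L⁴`, every term of the momentum
-- equation except the time derivative is at most linear in the dissipated quantities, the velocity
-- gradient and the cross product. The coefficients involve only norms that the energy bounds
-- uniformly: the previous velocity in `L²` and the projected director gradient. The hardest term is
-- the convective one with the derivative on the test function, estimated in `L⁴`, `L⁴` and `L²`.
theorem exists_dualNorm_le {Ω : Set E3} (hΩo : IsOpen Ω) (hΩc : Convex ℝ Ω)
    (hΩb : Bornology.IsBounded Ω) (hΩn : Ω.Nonempty) {σ : ℝ} (hσ : 0 < σ) (P : LeslieCoeffs) :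
    ∃ K : ℝ, 0 ≤ K ∧ ∀ (M : TetMesh Ω) (δ : ℝ), M.IsShape δ σ → δ ≤ Metric.diam Ω →
      M.HasInteriorNodes → ∀ (k : ℝ) (J : ℕ) (v₀ d₀ : E3 → E3) (v d w : ℕ → E3 → E3)
      (R : ℕ → E3 → Mat3), IsSchemeSolution P M k J v₀ d₀ v d w R →
      ∀ j, 1 ≤ j → j ≤ J → (∀ z ∈ M.nodes, ‖d j z‖ ≤ 1) → (∀ z ∈ M.nodes, ‖mid d j z‖ ≤ 1) →
      dualNorm Ω (dt k v j) ≤ ENNReal.ofReal (K *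
        ((1 + √(∫ x in Ω, ‖v (j - 1) x‖ ^ 2) + √(M.lumpedCells fun _ z => ‖R j z‖ ^ 2)) *
          (√(∫ x in Ω, ‖fderiv ℝ (v j) x‖ ^ 2)
            + √(M.lumpedCells fun _ z => ‖cross (mid d j z) (w j z)‖ ^ 2)))) := by
  obtain ⟨C, hC, htest⟩ := exists_test_function hΩo hΩc hΩb hΩn hσ
  obtain ⟨c₄, hc₄, hv4⟩ := exists_integral_pow_four_le hΩo hΩc hΩb
  set W := volume.real Ω with hW
  set κ := √(√c₄ * √C) with hκ
  set N := √(√W * √C) with hN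
  have hκ0 : 0 ≤ κ := Real.sqrt_nonneg _
  have hN0 : 0 ≤ N := Real.sqrt_nonneg _
  set c₁ := P.μ₁ + P.lam ^ 2 with hc₁
  set c₃ := P.μ₅ + P.μ₆ - P.lam ^ 2 with hc₃
  refine ⟨C + κ + C + (|c₁| + |P.μ₄| * 3 + |c₃|) * N + (|P.lam| + 3) * (√6272 * N),
    by positivity, fun M δ h hδD hM k J v₀ d₀ v d w R hS j hj1 hj hd hm => ?_⟩
  refine iSup_le fun φ => iSup_le fun G => iSup_le fun H => iSup_le fun hφ => ?_
  obtain ⟨a, ha, he, ha1, ha4⟩ :=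
    htest M δ h hδD hM _ (hS.memV_dt hΩc hj) φ G H hφ.1 hφ.2.1 hφ.2.2
  rw [he, ← ofReal_norm, Real.norm_eq_abs]
  refine ENNReal.ofReal_le_ofReal ?_
  have hv := hS.memV hj
  have hv' : M.MemV (v (j - 1)) := hS.memV (by omega)
  have hvc := hv.pwC1.pwCont
  have hvc' := hv'.pwC1.pwCont
  have hac := ha.pwC1.pwCont
  have hDv := hv.pwC1.pwCont_fderiv
  have hDa := ha.pwC1.pwCont_fderiv
  have hdc := (hS.memZ_d hj).pwC1.pwCont
  have hd1 : ∀ x ∈ closure Ω, ‖d j x‖ ≤ 1 := fun x hx =>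
    (hS.memZ_d hj).pwAff.norm_le_one hd hx
  set S := ∫ x in Ω, ‖fderiv ℝ (v j) x‖ ^ 2 with hSd
  set U := √(∫ x in Ω, ‖v (j - 1) x‖ ^ 2) with hU
  set r := √(M.lumpedCells fun _ z => ‖R j z‖ ^ 2) with hr
  set l := √(M.lumpedCells fun _ z => ‖cross (mid d j z) (w j z)‖ ^ 2) with hl
  set n := √(∫ x in Ω, ‖fderiv ℝ a x‖ ^ 2) with hn
  have hS0 : 0 ≤ S := integral_nonneg fun x => by positivity
  have hU0 : 0 ≤ U := Real.sqrt_nonneg _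
  have hr0 : 0 ≤ r := Real.sqrt_nonneg _
  have hl0 : 0 ≤ l := Real.sqrt_nonneg _
  have hn0 : 0 ≤ n := Real.sqrt_nonneg _
  have hs0 : 0 ≤ √S := Real.sqrt_nonneg _
  -- Away from convection the gradient of the test function is needed only in `L²`, which follows
  -- from `L⁴` on a bounded domain.
  have hnN : n ≤ N := by
    refine Real.sqrt_le_sqrt ?_
    rw [← Real.sqrt_mul measureReal_nonneg]
    refine Real.le_sqrt_of_sq_le ((hDa.sq_integral_sq_le hΩc hΩb).trans ?_)
    gcongr
  -- the convective terms
  have hconv := integral_convective hΩo hΩc hΩb hv'.pwC1 hv.pwC1 ha.pwC1 hv'.2.1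
  have hA : |∫ x in Ω, inner ℝ (fderiv ℝ (v j) x (v (j - 1) x)) (a x)| ≤ C * (√S * U) := by
    refine PwCont.abs_integral_le hΩc ((hDv.comp₂ hvc' (fun (A : Mat3) (y : E3) => A y)
      (by fun_prop)).comp₂ hac (fun y z => inner ℝ y z) (by fun_prop)) hDv hvc' hC fun x hx => ?_
    refine (abs_real_inner_le_norm _ _).trans ?_
    rw [mul_comm C]
    exact mul_le_mul (ContinuousLinearMap.le_opNorm _ _) (ha1 x hx) (norm_nonneg _)
      (by positivity)
  have hΓ : |∫ x in Ω, inner ℝ (v j x) (fderiv ℝ a x (v (j - 1) x))| ≤ κ * (√S * U) := by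
    have hva : M.PwCont fun x => ‖v j x‖ * ‖fderiv ℝ a x‖ :=
      hvc.comp₂ hDa (fun y A => ‖y‖ * ‖A‖) (by fun_prop)
    have h1 := PwCont.abs_integral_le hΩc (g := fun x => inner ℝ (v j x)
        (fderiv ℝ a x (v (j - 1) x)))
      (hvc.comp₂ (hDa.comp₂ hvc' (fun (A : Mat3) (y : E3) => A y)
      (by fun_prop)) (fun y z => inner ℝ y z) (by fun_prop)) hva hvc' zero_le_one fun x hx => by
        refine (abs_real_inner_le_norm _ _).trans ?_
        rw [one_mul, Real.norm_of_nonneg (by positivity), mul_assoc]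
        exact mul_le_mul_of_nonneg_left (ContinuousLinearMap.le_opNorm _ _) (norm_nonneg _)
    rw [one_mul] at h1
    refine h1.trans ?_
    rw [← mul_assoc]
    refine mul_le_mul_of_nonneg_right ?_ hU0
    rw [hκ, ← Real.sqrt_mul (by positivity)]
    refine Real.sqrt_le_sqrt ?_
    have j1 : IntegrableOn (fun x => (‖v j x‖ ^ 2) ^ 2) Ω :=
      (hvc.comp (φ := fun x => (‖x‖ ^ 2) ^ 2) (by fun_prop)).integrableOn hΩc
    have j2 : IntegrableOn (fun x => (‖fderiv ℝ a x‖ ^ 2) ^ 2) Ω :=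
      (hDa.comp (φ := fun x => (‖x‖ ^ 2) ^ 2) (by fun_prop)).integrableOn hΩc
    have j3 : IntegrableOn (fun x => ‖v j x‖ ^ 2 * ‖fderiv ℝ a x‖ ^ 2) Ω :=
      (hvc.comp₂ hDa (fun (x : E3) (y : Mat3) => ‖x‖ ^ 2 * ‖y‖ ^ 2) (by fun_prop)).integrableOn hΩc
    have h2 := abs_integral_mul_le j1 j2 j3
    simp only [Real.norm_of_nonneg (mul_nonneg (norm_nonneg _) (norm_nonneg _)), mul_pow]
    refine (le_abs_self _).trans (h2.trans ?_)
    simp only [← pow_mul]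
    have h3 : √(∫ x in Ω, ‖v j x‖ ^ 4) ≤ √c₄ * S := by
      refine Real.sqrt_le_iff.2 ⟨by positivity, ?_⟩
      rw [mul_pow, Real.sq_sqrt hc₄]
      exact hv4 M _ hv.pwC1 hv.2.1
    calc _ ≤ √c₄ * S * √C := by
          refine mul_le_mul h3 (Real.sqrt_le_sqrt ha4) (Real.sqrt_nonneg _) (by positivity)
      _ = _ := by ring
  -- the elastic stress
  have hR : |M.lumped (fun z => ContinuousLinearMap.adjoint (R j z)
      (cross (mid d j z) (cross (mid d j z) (w j z)))) a| ≤ C * (r * l) := by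
    rw [M.lumped_eq hΩc]
    refine abs_lumpedCells_le_of_le (f := fun _ z => ‖R j z‖)
      (g := fun _ z => ‖cross (mid d j z) (w j z)‖) hC fun s hs z hz => ?_
    have hzn := M.mem_nodes_of_mem hs hz
    refine (abs_real_inner_le_norm _ _).trans ?_
    rw [mul_comm C]
    refine mul_le_mul ((norm_adjoint_apply_le _ _).trans ?_) (ha1 z (M.node_mem_closure hzn))
      (norm_nonneg _) (by positivity)
    refine mul_le_mul_of_nonneg_left ?_ (norm_nonneg _)
    exact (norm_cross_le _ _).trans (mul_le_of_le_one_left (norm_nonneg _) (hm z hzn))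
  -- the dissipative stress
  have hsym : ∀ {f : E3 → E3}, M.PwC1 f → M.PwCont fun x => symPart (fderiv ℝ f x) := fun hf =>
    hf.pwCont_fderiv.comp continuous_symPart
  have hsd : ∀ {f : E3 → E3}, M.PwC1 f → M.PwCont fun x => symPart (fderiv ℝ f x) (d j x) :=
    fun hf => (hsym hf).comp₂ hdc (fun (A : Mat3) (y : E3) => A y) (by fun_prop)
  have hsb : ∀ (f : E3 → E3) x, x ∈ closure Ω →
      ‖symPart (fderiv ℝ f x) (d j x)‖ ≤ ‖fderiv ℝ f x‖ := fun f x hx =>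
    (ContinuousLinearMap.le_opNorm _ _).trans <|
      (mul_le_of_le_one_right (norm_nonneg _) (hd1 x hx)).trans (norm_symPart_le _)
  have hsb' : ∀ (f : E3 → E3) x, x ∈ closure Ω →
      |inner ℝ (d j x) (symPart (fderiv ℝ f x) (d j x))| ≤ ‖fderiv ℝ f x‖ := fun f x hx =>
    (abs_real_inner_le_norm _ _).trans <|
      (mul_le_of_le_one_left (norm_nonneg _) (hd1 x hx)).trans (hsb f x hx)
  have hD1 : |∫ x in Ω, inner ℝ (d j x) (symPart (fderiv ℝ (v j) x) (d j x)) *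
      inner ℝ (d j x) (symPart (fderiv ℝ a x) (d j x))| ≤ 1 * (√S * n) := by
    refine PwCont.abs_integral_le hΩc
      ((hdc.comp₂ (hsd hv.pwC1) (fun y z => inner ℝ y z) (by fun_prop)).comp₂
        (hdc.comp₂ (hsd ha.pwC1) (fun y z => inner ℝ y z) (by fun_prop))
        (fun p q => p * q) (by fun_prop)) hDv hDa zero_le_one fun x hx => ?_
    rw [abs_mul, one_mul]
    exact mul_le_mul (hsb' _ x hx) (hsb' _ x hx) (abs_nonneg _) (norm_nonneg _)
  have hD2 : |∫ x in Ω, frob (symPart (fderiv ℝ (v j) x)) (symPart (fderiv ℝ a x))|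
      ≤ 3 * (√S * n) := by
    refine PwCont.abs_integral_le hΩc
      ((hsym hv.pwC1).comp₂ (hsym ha.pwC1) (fun A B => frob A B)
        (by unfold frob; fun_prop)) hDv hDa (by norm_num) fun x hx => ?_
    refine (abs_frob_le _ _).trans ?_
    gcongr <;> exact norm_symPart_le _
  have hD3 : |∫ x in Ω, inner ℝ (symPart (fderiv ℝ (v j) x) (d j x))
      (symPart (fderiv ℝ a x) (d j x))| ≤ 1 * (√S * n) := by
    refine PwCont.abs_integral_le hΩc
      ((hsd hv.pwC1).comp₂ (hsd ha.pwC1) (fun y z => inner ℝ y z) (by fun_prop))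
      hDv hDa zero_le_one fun x hx => ?_
    rw [one_mul]
    exact (abs_real_inner_le_norm _ _).trans
      (mul_le_mul (hsb _ x hx) (hsb _ x hx) (norm_nonneg _) (norm_nonneg _))
  -- the remaining Leslie stress
  have hg : √(M.lumpedCells fun s z => ‖cellGrad a s z‖ ^ 2) ≤ √6272 * n := by
    rw [hn, ← Real.sqrt_mul (by norm_num)]
    exact Real.sqrt_le_sqrt (ha.pwQuad.lumped_cellGrad_le hΩc)
  have hE1 : |M.lumpedCells (fun s z => inner ℝ (cross (mid d j z)
      (symPart (cellGrad a s z) (mid d j z))) (cross (mid d j z) (w j z)))| ≤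
      1 * (√6272 * n * l) := by
    refine (abs_lumpedCells_le_of_le (f := fun s z => ‖cellGrad a s z‖)
      (g := fun _ z => ‖cross (mid d j z) (w j z)‖) zero_le_one fun s hs z hz => ?_).trans
      (by gcongr)
    have hzn := hm z (M.mem_nodes_of_mem hs hz)
    rw [one_mul]
    refine (abs_real_inner_le_norm _ _).trans (mul_le_mul_of_nonneg_right ?_ (norm_nonneg _))
    refine (norm_cross_le _ _).trans ((mul_le_of_le_one_left (norm_nonneg _) hzn).trans ?_)
    exact (ContinuousLinearMap.le_opNorm _ _).trans
      ((mul_le_of_le_one_right (norm_nonneg _) hzn).trans (norm_symPart_le _))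
  -- Here `w j` appears without a cross product; skewness supplies it.
  have hE2 : |M.lumpedCells (fun s z => inner ℝ (skwPart (cellGrad a s z) (w j z)) (mid d j z))| ≤
      3 * (√6272 * n * l) := by
    refine (abs_lumpedCells_le_of_le (f := fun s z => ‖cellGrad a s z‖)
      (g := fun _ z => ‖cross (mid d j z) (w j z)‖) (by norm_num) fun s hs z hz =>
      abs_inner_skwPart_le _ _ _).trans (by gcongr)
  have hmom := hS.momentum j hj1 hj a ha
  simp only [MomentumEq, leslieStress, dissStress] at hmom
  have hbound := abs_le_of_sum_eq_zero hconv hmom hA hΓ hR hD1 hD2 hD3 hE1 hE2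
  refine hbound.trans ?_
  have q1 := mul_nonneg hU0 hl0
  have q2 := mul_nonneg hr0 hs0
  have q3 := mul_nonneg hr0 hl0
  have q4 := mul_nonneg hU0 hs0
  have hW0 : (1 + U + r) * (√S + l) = √S + l + U * √S + U * l + r * √S + r * l := by ring
  have hW1 : √S * U ≤ (1 + U + r) * (√S + l) := by rw [hW0]; linarith
  have hW2 : r * l ≤ (1 + U + r) * (√S + l) := by rw [hW0]; linarith
  have hW3 : √S * n ≤ N * ((1 + U + r) * (√S + l)) := by
    rw [mul_comm]
    exact mul_le_mul hnN (by rw [hW0]; linarith) hs0 hN0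
  have hW4 : √6272 * n * l ≤ √6272 * N * ((1 + U + r) * (√S + l)) := by
    refine mul_le_mul (by gcongr) (by rw [hW0]; linarith) hl0 (by positivity)
  calc _ ≤ C * ((1 + U + r) * (√S + l)) + κ * ((1 + U + r) * (√S + l))
        + C * ((1 + U + r) * (√S + l))
        + (|c₁| + |P.μ₄| * 3 + |c₃|) * (N * ((1 + U + r) * (√S + l)))
        + (|P.lam| + 3) * (√6272 * N * ((1 + U + r) * (√S + l))) := by gcongr
    _ = _ := by ring

end EricksenLeslie

/-! ### One-step bounds, a priori estimates and conclusion -/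

namespace EricksenLeslie
open Filter Topology

namespace TetMesh

variable {Ω : Set E3} {M : TetMesh Ω} {δ σ : ℝ}

/-- The velocity projection is a contraction. -/
theorem IsVelocityProj.integral_sq_le (hΩc : Convex ℝ Ω) {v₀ v : E3 → E3}
    (hv : M.IsVelocityProj v₀ v) (hv₀ : MemLp v₀ 2 (volume.restrict Ω)) :
    ∫ x in Ω, ‖v x‖ ^ 2 ≤ ∫ x in Ω, ‖v₀ x‖ ^ 2 := by
  have h := hv.2 v hv.1
  simp only [real_inner_self_eq_norm_sq] at h
  have h1 := (le_abs_self _).trans (abs_integral_inner_le hv₀ (hv.1.pwC1.pwCont.memLp hΩc))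
  rw [← h] at h1
  set a := ∫ x in Ω, ‖v x‖ ^ 2
  set b := ∫ x in Ω, ‖v₀ x‖ ^ 2
  have ha : 0 ≤ a := integral_nonneg fun x => by positivity
  have hb : 0 ≤ b := integral_nonneg fun x => by positivity
  rcases ha.eq_or_lt with h0 | h0
  · rwa [← h0]
  · have h2 : √a ≤ √b := by
      refine le_of_mul_le_mul_right ?_ (Real.sqrt_pos.2 h0)
      rwa [Real.mul_self_sqrt ha]
    exact (Real.sqrt_le_sqrt_iff hb).1 h2

theorem integral_fderiv_sq_le_frob (hΩc : Convex ℝ Ω) {f : E3 → E3} (hf : M.PwC1 f) :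
    ∫ x in Ω, ‖fderiv ℝ f x‖ ^ 2 ≤ ∫ x in Ω, frob (fderiv ℝ f x) (fderiv ℝ f x) :=
  integral_mono (hf.pwCont_fderiv.integrableOn_sq hΩc)
    ((hf.pwCont_fderiv.comp continuous_frob_self).integrableOn hΩc) fun x => opNorm_sq_le_frob _

theorem IsShape.integral_frob_interp_le (h : M.IsShape δ σ) (hΩo : IsOpen Ω) (hΩc : Convex ℝ Ω)
    (hΩb : Bornology.IsBounded Ω) (hΩn : Ω.Nonempty) {f : E3 → E3} {G : E3 → Mat3}
    {H : E3 → E3 →L[ℝ] Mat3} (hf : IsH2 Ω f G H) (hfc : ContinuousOn f (closure Ω)) :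
    ∫ x in Ω, frob (fderiv ℝ (M.interp f) x) (fderiv ℝ (M.interp f) x) ≤
      3 * (800 / σ ^ 2 * (1 + 16 * δ ^ 2) * h2NormSq Ω f G H) := by
  have hc := pwCont_fderiv_interp (M := M) f
  calc _ ≤ ∫ x in Ω, 3 * ‖fderiv ℝ (M.interp f) x‖ ^ 2 :=
        integral_mono ((hc.comp continuous_frob_self).integrableOn hΩc)
          ((hc.integrableOn_sq hΩc).const_mul 3) fun x => frob_self_le _
    _ ≤ _ := by
        rw [integral_const_mul]
        gcongr
        exact h.integral_fderiv_interp_sq_le hΩo hΩc hΩb hΩn hf hfc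

theorem lumped_interp_self (hΩc : Convex ℝ Ω) (f : E3 → E3) :
    M.lumped (M.interp f) (M.interp f) = M.lumpedCells fun _ z => ‖f z‖ ^ 2 := by
  rw [M.lumped_eq hΩc]
  refine M.lumpedCells_congr fun s hs z hz => ?_
  rw [M.interp_node (M.mem_nodes_of_mem hs hz), real_inner_self_eq_norm_sq]

end TetMesh

theorem dissStress_self (P : LeslieCoeffs) (Ω : Set E3) (v d : E3 → E3) :
    dissStress P Ω v d v =
      (P.μ₁ + P.lam ^ 2) * (∫ x in Ω, (inner ℝ (d x) (symPart (fderiv ℝ v x) (d x))) ^ 2)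
      + P.μ₄ * (∫ x in Ω, frob (symPart (fderiv ℝ v x)) (symPart (fderiv ℝ v x)))
      + (P.μ₅ + P.μ₆ - P.lam ^ 2) * (∫ x in Ω, ‖symPart (fderiv ℝ v x) (d x)‖ ^ 2) := by
  simp only [dissStress, ← pow_two, real_inner_self_eq_norm_sq]

theorem sq_add_sq_le_ofReal {a b : ℝ≥0∞} {K₁ K₂ Z c Y : ℝ} (hK₁ : 0 ≤ K₁) (hK₂ : 0 ≤ K₂)
    (hZ : 0 ≤ Z) (hZY : Z ^ 2 ≤ c * Y) (ha : a ≤ ENNReal.ofReal (K₁ * Z))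
    (hb : b ≤ ENNReal.ofReal (K₂ * Z)) :
    a ^ 2 + b ^ 2 ≤ ENNReal.ofReal ((K₁ ^ 2 + K₂ ^ 2) * (c * Y)) := by
  calc _ ≤ ENNReal.ofReal (K₁ * Z) ^ 2 + ENNReal.ofReal (K₂ * Z) ^ 2 := by gcongr
    _ = ENNReal.ofReal ((K₁ ^ 2 + K₂ ^ 2) * Z ^ 2) := by
        rw [← ENNReal.ofReal_pow (by positivity), ← ENNReal.ofReal_pow (by positivity),
          ← ENNReal.ofReal_add (by positivity) (by positivity)]
        congr 1; ring
    _ ≤ _ := by gcongr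

theorem director_bound_aux {r e x l g a b c q : ℝ} (he : 0 ≤ e) (hx : 0 ≤ x)
    (hl : 0 ≤ l) (ha : 0 ≤ a) (hb : 0 ≤ b) (hc : 0 ≤ c) (hq : 0 ≤ q) (hre : r ≤ e)
    (hg : g ≤ q * x) :
    r * (a * x) + (c * g + l) * b ≤ (a + (c * q + 1) * b) * ((1 + e) * (x + l)) := by
  have h1 := mul_nonneg he hl
  have h2 := mul_nonneg he hx
  have e0 : (1 + e) * (x + l) = x + l + e * x + e * l := by ring
  have hXW : e * x ≤ (1 + e) * (x + l) := by rw [e0]; linarith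
  have hX1 : x ≤ (1 + e) * (x + l) := by rw [e0]; linarith
  have hL1 : l ≤ (1 + e) * (x + l) := by rw [e0]; linarith
  calc _ ≤ e * (a * x) + (c * (q * x) + l) * b := by gcongr
    _ = a * (e * x) + (c * q * x + l) * b := by ring
    _ ≤ a * ((1 + e) * (x + l)) + (c * q * ((1 + e) * (x + l)) + (1 + e) * (x + l)) * b := by
        gcongr
    _ = _ := by ring

theorem velocity_bound_aux {K u r s e x l : ℝ} (hK : 0 ≤ K) (he : 0 ≤ e)
    (hl : 0 ≤ l) (hs : 0 ≤ s) (hu : u ≤ e) (hre : r ≤ e) (hsx : s ≤ x) :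
    K * ((1 + u + r) * (s + l)) ≤ 2 * K * ((1 + e) * (x + l)) := by
  have hx : 0 ≤ x := hs.trans hsx
  calc _ ≤ K * ((1 + e + e) * (x + l)) := by gcongr
    _ ≤ K * ((2 * (1 + e)) * (x + l)) := by gcongr; linarith
    _ = _ := by ring

open TetMesh in
-- Once the energy is bounded by `E`, both time derivatives are at most a constant times `1 + √E`
-- times the sum of the square roots of the two dissipated quantities. Squaring makes the bound
-- linear in the dissipation, which is summable in time.
theorem exists_step_bound {Ω : Set E3} (hΩo : IsOpen Ω) (hΩc : Convex ℝ Ω)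
    (hΩb : Bornology.IsBounded Ω) (hΩn : Ω.Nonempty) {σ : ℝ} (hσ : 0 < σ) (P : LeslieCoeffs) :
    ∃ K : ℝ, 0 ≤ K ∧ ∀ (M : TetMesh Ω) (δ : ℝ), M.IsShape δ σ → δ ≤ Metric.diam Ω →
      M.HasInteriorNodes → ∀ (k : ℝ) (J : ℕ) (v₀ d₀ : E3 → E3) (v d w : ℕ → E3 → E3)
      (R : ℕ → E3 → Mat3), IsSchemeSolution P M k J v₀ d₀ v d w R →
      ∀ j, 1 ≤ j → j ≤ J → (∀ z ∈ M.nodes, ‖d j z‖ ≤ 1) → (∀ z ∈ M.nodes, ‖mid d j z‖ ≤ 1) →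
      ∀ E, ∫ x in Ω, ‖v (j - 1) x‖ ^ 2 ≤ E →
        ∫ x in Ω, frob (fderiv ℝ (d (j - 1)) x) (fderiv ℝ (d (j - 1)) x) ≤ E →
      eLpNorm (dt k d j) (3 / 2) (volume.restrict Ω) ^ 2 + dualNorm Ω (dt k v j) ^ 2 ≤
        ENNReal.ofReal (K * (1 + √E) ^ 2 *
          ((∫ x in Ω, frob (fderiv ℝ (v j) x) (fderiv ℝ (v j) x))
            + M.lumpedCells fun _ z => ‖cross (mid d j z) (w j z)‖ ^ 2)) := by
  obtain ⟨K, hK, hdual⟩ := exists_dualNorm_le hΩo hΩc hΩb hΩn hσ P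
  obtain ⟨C₆, hC₆, hsob⟩ := exists_sobolev_bound hΩo hΩc hΩb
  set W := volume.real Ω with hW
  have hW0 : 0 ≤ W := measureReal_nonneg
  -- Constants at least one are below their sixth powers, which avoids sixth roots. The same device
  -- is used for the volume.
  set ca := 1 + 128 * 7 ^ 6 * C₆ with hca
  set cb := 1 + W with hcb
  have hca1 : 1 ≤ ca := by rw [hca]; linarith [(by positivity : 0 ≤ 128 * 7 ^ 6 * C₆)]
  have hcb1 : 1 ≤ cb := by rw [hcb]; linarith
  set K₁ := ca + ((1 + |P.lam|) * √6272 + 1) * cb with hK₁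
  have hK₁0 : 0 ≤ K₁ := by positivity
  refine ⟨2 * K₁ ^ 2 + 2 * (2 * K) ^ 2, by positivity,
    fun M δ h hδD hM k J v₀ d₀ v d w R hS j hj1 hj hd hm E hE hE' => ?_⟩
  have hv := hS.memV hj
  have hd' := hdual M δ h hδD hM k J v₀ d₀ v d w R hS j hj1 hj hd hm
  have hE0 : 0 ≤ E := (integral_nonneg fun x => by positivity).trans hE
  set X := ∫ x in Ω, frob (fderiv ℝ (v j) x) (fderiv ℝ (v j) x) with hX
  set L := M.lumpedCells fun _ z => ‖cross (mid d j z) (w j z)‖ ^ 2 with hL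
  have hX0 : 0 ≤ X := integral_nonneg fun x => frob_self_nonneg _
  have hL0 : 0 ≤ L := M.lumpedCells_nonneg fun s _ z _ => by positivity
  have hS2 : ∫ x in Ω, ‖fderiv ℝ (v j) x‖ ^ 2 ≤ X := integral_fderiv_sq_le_frob hΩc hv.pwC1
  have hR : √(M.lumpedCells fun _ z => ‖R j z‖ ^ 2) ≤ √E :=
    Real.sqrt_le_sqrt (((hS.proj_grad j hj1 hj).lumped_le hΩc
      (hS.memZ_d (by omega : j - 1 ≤ J)).pwC1.pwCont_fderiv).trans hE')
  have hU := Real.sqrt_le_sqrt hE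
  have hSX := Real.sqrt_le_sqrt hS2
  have hsX : 0 ≤ √X := Real.sqrt_nonneg _
  have hsL : 0 ≤ √L := Real.sqrt_nonneg _
  have hsE : 0 ≤ √E := Real.sqrt_nonneg _
  have sq : (√X + √L) ^ 2 ≤ 2 * (X + L) := by
    have h1 := Real.sq_sqrt hX0
    have h2 := Real.sq_sqrt hL0
    nlinarith [sq_nonneg (√X - √L)]
  have h1 : eLpNorm (dt k d j) (3 / 2) (volume.restrict Ω) ≤
      ENNReal.ofReal (K₁ * ((1 + √E) * (√X + √L))) := by
    have h6 : (M.lumpedCells fun _ z => ‖v j z‖ ^ 6) ≤ (ca * √X) ^ 6 := by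
      calc _ ≤ 128 * 7 ^ 6 * ∫ x in Ω, ‖v j x‖ ^ 6 := hv.pwQuad.lumped_le hΩc 6
        _ ≤ 128 * 7 ^ 6 * (C₆ * X ^ 3) := by
            refine mul_le_mul_of_nonneg_left ((hsob M _ hv.pwC1 hv.2.1).trans ?_) (by norm_num)
            gcongr
        _ = (128 * 7 ^ 6 * C₆) * X ^ 3 := by ring
        _ ≤ ca ^ 6 * X ^ 3 := by
            gcongr
            exact (by rw [hca]; linarith : 128 * 7 ^ 6 * C₆ ≤ ca).trans
              (le_self_pow₀ hca1 (by norm_num))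
        _ = _ := by rw [mul_pow, show √X ^ 6 = (√X ^ 2) ^ 3 by ring, Real.sq_sqrt hX0]
    have hb6 : W ≤ cb ^ 6 :=
      (by rw [hcb]; linarith : W ≤ cb).trans (le_self_pow₀ hcb1 (by norm_num))
    refine (hS.eLpNorm_dt_le hΩo hΩc hj1 hj hm (mul_nonneg (zero_le_one.trans hca1) hsX)
      (zero_le_one.trans hcb1) h6 hb6).trans
      (ENNReal.ofReal_le_ofReal ?_)
    have hg : √(M.lumpedCells fun s z => ‖cellGrad (v j) s z‖ ^ 2) ≤ √6272 * √X := by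
      rw [← Real.sqrt_mul (by norm_num)]
      exact Real.sqrt_le_sqrt ((hv.pwQuad.lumped_cellGrad_le hΩc).trans (by gcongr))
    exact director_bound_aux hsE hsX hsL (zero_le_one.trans hca1) (zero_le_one.trans hcb1)
      (by positivity) (Real.sqrt_nonneg _) hR hg
  have h2 : dualNorm Ω (dt k v j) ≤ ENNReal.ofReal (2 * K * ((1 + √E) * (√X + √L))) := by
    refine hd'.trans (ENNReal.ofReal_le_ofReal ?_)
    exact velocity_bound_aux hK hsE hsL (Real.sqrt_nonneg _) hU hR hSX
  have hZY : ((1 + √E) * (√X + √L)) ^ 2 ≤ 2 * (1 + √E) ^ 2 * (X + L) := by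
    rw [mul_pow, mul_comm 2, mul_assoc]
    exact mul_le_mul_of_nonneg_left sq (sq_nonneg _)
  refine (sq_add_sq_le_ofReal hK₁0 (by positivity) (by positivity) hZY h1 h2).trans (le_of_eq ?_)
  congr 1; ring

theorem ofReal_mul_sum_le {k T c : ℝ} (hk : 0 ≤ k) (hc : 0 ≤ c) {S : Finset ℕ} {Y : ℕ → ℝ}
    {t : ℕ → ℝ≥0∞} (hY : ∀ j ∈ S, 0 ≤ Y j) (hT : k * ∑ j ∈ S, Y j ≤ T)
    (ht : ∀ j ∈ S, t j ≤ ENNReal.ofReal (c * Y j)) :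
    ENNReal.ofReal k * ∑ j ∈ S, t j ≤ ENNReal.ofReal (c * T) := by
  calc _ ≤ ENNReal.ofReal k * ∑ j ∈ S, ENNReal.ofReal (c * Y j) := by
        gcongr with j hj; exact ht j hj
    _ = ENNReal.ofReal (c * (k * ∑ j ∈ S, Y j)) := by
        rw [← ENNReal.ofReal_sum_of_nonneg fun j hj => mul_nonneg hc (hY j hj),
          ← ENNReal.ofReal_mul hk, ← Finset.mul_sum]
        congr 1; ring
    _ ≤ _ := by gcongr

namespace IsSchemeSolution

variable {Ω : Set E3} {P : LeslieCoeffs} {M : TetMesh Ω} {k : ℝ} {J : ℕ} {v₀ d₀ : E3 → E3}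
  {v d w : ℕ → E3 → E3} {R : ℕ → E3 → Mat3}

/-- The a priori bounds contained in the energy equality. -/
theorem energy_bounds (hΩo : IsOpen Ω) (hΩc : Convex ℝ Ω) (hΩb : Bornology.IsBounded Ω)
    (hk : 0 < k) (hS : IsSchemeSolution P M k J v₀ d₀ v d w R) (hμ₄ : 0 < P.μ₄)
    (hμ₁ : 0 ≤ P.μ₁ + P.lam ^ 2) (hμ₅₆ : 0 ≤ P.μ₅ + P.μ₆ - P.lam ^ 2) {E : ℝ}
    (hE : (∫ x in Ω, ‖v 0 x‖ ^ 2)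
      + (∫ x in Ω, frob (fderiv ℝ (d 0) x) (fderiv ℝ (d 0) x)) ≤ E) {n : ℕ} (hn : n ≤ J) :
    ∫ x in Ω, ‖v n x‖ ^ 2 ≤ E ∧ ∫ x in Ω, frob (fderiv ℝ (d n) x) (fderiv ℝ (d n) x) ≤ E ∧
      k * ∑ j ∈ Finset.Icc 1 n, ((∫ x in Ω, frob (fderiv ℝ (v j) x) (fderiv ℝ (v j) x))
        + M.lumpedCells fun _ z => ‖cross (mid d j z) (w j z)‖ ^ 2) ≤ (1 / P.μ₄ + 1) * E := by
  have h := hS.energy_eq hΩo hΩc hΩb hk hn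
  set Q := ∑ j ∈ Finset.Icc 1 n, dissStress P Ω (v j) (d j) (v j) with hQ
  set X := ∑ j ∈ Finset.Icc 1 n, ∫ x in Ω, frob (fderiv ℝ (v j) x) (fderiv ℝ (v j) x) with hX
  set L := ∑ j ∈ Finset.Icc 1 n, M.lumpedCells fun _ z => ‖cross (mid d j z) (w j z)‖ ^ 2 with hL
  have hX0 : 0 ≤ X := Finset.sum_nonneg fun j _ => integral_nonneg fun x => frob_self_nonneg _
  have hL0 : 0 ≤ L :=
    Finset.sum_nonneg fun j _ => M.lumpedCells_nonneg fun s _ z _ => by positivity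
  have hT0 : 0 ≤ ∑ j ∈ Finset.Icc 1 n, ∫ x in Ω, ‖dt k v j x‖ ^ 2 :=
    Finset.sum_nonneg fun j _ => integral_nonneg fun x => by positivity
  -- Korn's inequality bounds the full gradient by twice the symmetric part, hence the half. As the
  -- energy is at most `E / 2`, this yields `k * X ≤ E / μ₄`, and the cross product sum is at most
  -- `E / 2`.
  have hXQ : P.μ₄ / 2 * X ≤ Q := by
    rw [hX, hQ, Finset.mul_sum]
    refine Finset.sum_le_sum fun j hj => ?_
    have hv := hS.memV ((Finset.mem_Icc.1 hj).2.trans hn)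
    have hko := hv.pwC1.korn hΩo hΩc hΩb hv.2.1
    rw [dissStress_self]
    have p1 : 0 ≤ (P.μ₁ + P.lam ^ 2) *
        (∫ x in Ω, (inner ℝ (d j x) (symPart (fderiv ℝ (v j) x) (d j x))) ^ 2) :=
      mul_nonneg hμ₁ (integral_nonneg fun x => sq_nonneg _)
    have p3 : 0 ≤ (P.μ₅ + P.μ₆ - P.lam ^ 2) *
        (∫ x in Ω, ‖symPart (fderiv ℝ (v j) x) (d j x)‖ ^ 2) :=
      mul_nonneg hμ₅₆ (integral_nonneg fun x => sq_nonneg _)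
    have p2 := mul_le_mul_of_nonneg_left hko (half_pos hμ₄).le
    linarith
  have hV0 : 0 ≤ ∫ x in Ω, ‖v n x‖ ^ 2 := integral_nonneg fun x => by positivity
  have hD0 : 0 ≤ ∫ x in Ω, frob (fderiv ℝ (d n) x) (fderiv ℝ (d n) x) :=
    integral_nonneg fun x => frob_self_nonneg _
  have hQ0 : 0 ≤ Q := (mul_nonneg (half_pos hμ₄).le hX0).trans hXQ
  have m1 : 0 ≤ k * Q := mul_nonneg hk.le hQ0
  have m2 : 0 ≤ k * L := mul_nonneg hk.le hL0
  have m3 := mul_nonneg (by positivity : 0 ≤ k ^ 2 / 2) hT0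
  have m4 : k * (P.μ₄ / 2 * X) ≤ k * Q := mul_le_mul_of_nonneg_left hXQ hk.le
  refine ⟨by linarith, by linarith, ?_⟩
  rw [Finset.sum_add_distrib, mul_add, ← hX, ← hL]
  have m5 : k * X ≤ 1 / P.μ₄ * E := by
    rw [one_div, inv_mul_eq_div, le_div_iff₀ hμ₄]
    linarith
  linarith

end IsSchemeSolution

end EricksenLeslie

theorem proposition3p2
    (Ω : Set E3) (hΩ : IsConvexPolyhedron Ω)
    (P : LeslieCoeffs) (hμ₄ : 0 < P.μ₄) (hμ₁ : 0 ≤ P.μ₁ + P.lam ^ 2)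
    (hμ₅₆ : 0 ≤ P.μ₅ + P.μ₆ - P.lam ^ 2)
    (ρ : ℝ) (hρ : 0 < ρ) (B : ℝ) :
    ∃ C : ℝ, 0 < C ∧
      ∀ (h : ℝ) (M : TetMesh Ω), M.QuasiUniform ρ h → M.HasInteriorNodes →
      ∀ (v₀ d₀ : E3 → E3) (G₀ : E3 → Mat3) (H₀ : E3 → E3 →L[ℝ] Mat3),
        MemL2Sigma Ω v₀ → IsH2 Ω d₀ G₀ H₀ → ContinuousOn d₀ (closure Ω) →
        (∀ x ∈ Ω, ‖d₀ x‖ = 1) →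
        (∫ x in Ω, ‖v₀ x‖ ^ 2) + h2NormSq Ω d₀ G₀ H₀ ≤ B →
      ∀ (k : ℝ), 0 < k →
      ∀ (J : ℕ) (v d w : ℕ → E3 → E3) (R : ℕ → E3 → Mat3),
        IsSchemeSolution P M k J v₀ d₀ v d w R →
        -- the discrete energy equality
        (∀ n, 1 ≤ n → n ≤ J →
          1 / 2 * (∫ x in Ω, ‖v n x‖ ^ 2)
            + 1 / 2 * (∫ x in Ω, frob (fderiv ℝ (d n) x) (fderiv ℝ (d n) x))
            + k ^ 2 / 2 * ∑ j ∈ Finset.Icc 1 n, (∫ x in Ω, ‖dt k v j x‖ ^ 2)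
            + k * ∑ j ∈ Finset.Icc 1 n, (P.μ₁ + P.lam ^ 2) *
                (∫ x in Ω, (inner ℝ (d j x) (symPart (fderiv ℝ (v j) x) (d j x))) ^ 2)
            + k * ∑ j ∈ Finset.Icc 1 n, P.μ₄ *
                (∫ x in Ω, frob (symPart (fderiv ℝ (v j) x)) (symPart (fderiv ℝ (v j) x)))
            + k * ∑ j ∈ Finset.Icc 1 n, (P.μ₅ + P.μ₆ - P.lam ^ 2) *
                (∫ x in Ω, ‖symPart (fderiv ℝ (v j) x) (d j x)‖ ^ 2)
            + k * ∑ j ∈ Finset.Icc 1 n,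
                M.lumped (M.interp (fun z => cross (mid d j z) (w j z)))
                  (M.interp (fun z => cross (mid d j z) (w j z)))
          = 1 / 2 * (∫ x in Ω, ‖v 0 x‖ ^ 2)
            + 1 / 2 * (∫ x in Ω, frob (fderiv ℝ (d 0) x) (fderiv ℝ (d 0) x))) ∧
        -- the unit-norm restriction at the nodes
        (∀ j, j ≤ J → ∀ z ∈ M.nodes, ‖d j z‖ = 1) ∧
        -- the uniform bounds
        (∀ n, 1 ≤ n → n ≤ J →
          ENNReal.ofReal k * ∑ j ∈ Finset.Icc 1 n,
            (eLpNorm (dt k d j) (3 / 2) (volume.restrict Ω) ^ 2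
              + dualNorm Ω (dt k v j) ^ 2
              + ∫⁻ x in Ω, ENNReal.ofReal (frob (fderiv ℝ (v j) x) (fderiv ℝ (v j) x)))
          ≤ ENNReal.ofReal (C * (totalEnergy Ω v₀ G₀ + 1))) := by
  have hΩo := hΩ.isOpen
  have hΩc := hΩ.convex
  have hΩb := hΩ.isBounded
  have hΩn := hΩ.1
  have hσ : 0 < ρ / 2 := half_pos hρ
  obtain ⟨K, hK, hstep⟩ := exists_step_bound hΩo hΩc hΩb hΩn hσ P
  set D := Metric.diam Ω with hD
  have hD0 : 0 ≤ D := Metric.diam_nonneg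
  -- The stability constant of interpolation from `H²` to the Dirichlet energy, with the mesh size
  -- bounded by the diameter of `Ω`. The factor 3 compares the Frobenius and operator norms.
  set c₀ := 3 * (800 / (ρ / 2) ^ 2 * (1 + 16 * D ^ 2)) with hc₀
  have hc₀0 : 0 ≤ c₀ := by positivity
  -- Bounds twice the initial discrete energy. The absolute value keeps the constants nonnegative
  -- for every `B`.
  set E := (1 + c₀) * |B| with hE
  have hE0 : 0 ≤ E := by positivity
  -- The added one accounts for the velocity gradient itself, the third term of the sum.
  set c := K * (1 + √E) ^ 2 + 1 with hc
  have hc0 : 0 ≤ c := by positivity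
  set T := (1 / P.μ₄ + 1) * E with hT
  have hT0 : 0 ≤ T := by positivity
  refine ⟨c * T + 1, by positivity, fun h M hM hMi v₀ d₀ G₀ H₀ hv₀ hd₀ hd₀c hd₀1 hB k hk J v d w R
    hS => ⟨fun n _ hn => ?_, fun j hj z hz =>
      hS.norm_d_eq_one hΩo hΩc hk hd₀c hd₀1 hj hz, fun n hn1 hn => ?_⟩⟩
  · rw [← hS.energy_eq hΩo hΩc hΩb hk hn]
    simp only [dissStress_self, TetMesh.lumped_interp_self hΩc, Finset.sum_add_distrib]
    ring
  · have hsh := hM.isShape hΩo hΩb hΩn hρ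
    have hδD : h * D ≤ D := mul_le_of_le_one_left hD0 hM.2.1
    have hN0 : 0 ≤ h2NormSq Ω d₀ G₀ H₀ := IsH2.h2NormSq_nonneg
    have hV0 : 0 ≤ ∫ x in Ω, ‖v₀ x‖ ^ 2 := integral_nonneg fun x => sq_nonneg _
    have hdz : ∫ x in Ω, frob (fderiv ℝ (d 0) x) (fderiv ℝ (d 0) x) ≤
        c₀ * h2NormSq Ω d₀ G₀ H₀ := by
      have he : ∫ x in Ω, frob (fderiv ℝ (d 0) x) (fderiv ℝ (d 0) x) =
          ∫ x in Ω, frob (fderiv ℝ (M.interp d₀) x) (fderiv ℝ (M.interp d₀) x) :=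
        integral_congr_ae ((TetMesh.fderiv_congr_ae hΩc M hS.d_zero).mono fun x hx => by
          simp only [hx])
      rw [he, hc₀, mul_assoc 3]
      refine (hsh.integral_frob_interp_le hΩo hΩc hΩb hΩn hd₀ hd₀c).trans ?_
      have := hsh.δ_pos
      gcongr
    have hE1 : (∫ x in Ω, ‖v 0 x‖ ^ 2)
        + (∫ x in Ω, frob (fderiv ℝ (d 0) x) (fderiv ℝ (d 0) x)) ≤ E := by
      have h1 := hS.v_zero.integral_sq_le hΩc hv₀.1
      have h2 := le_abs_self B
      have h3 := mul_nonneg hc₀0 hV0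
      have h4 := mul_le_mul_of_nonneg_left (hB.trans h2) hc₀0
      rw [hE]
      linarith
    have hen : ∀ j, j ≤ J → _ := fun j hj =>
      hS.energy_bounds hΩo hΩc hΩb hk hμ₄ hμ₁ hμ₅₆ hE1 (n := j) hj
    have hd1 : ∀ j, j ≤ J → ∀ z ∈ M.nodes, ‖d j z‖ = 1 := fun j hj z hz =>
      hS.norm_d_eq_one hΩo hΩc hk hd₀c hd₀1 hj hz
    have hX0 : ∀ j, 0 ≤ ∫ x in Ω, frob (fderiv ℝ (v j) x) (fderiv ℝ (v j) x) := fun j =>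
      integral_nonneg fun x => frob_self_nonneg _
    have hL0 : ∀ j, 0 ≤ M.lumpedCells fun _ z => ‖cross (mid d j z) (w j z)‖ ^ 2 := fun j =>
      M.lumpedCells_nonneg fun s _ z _ => sq_nonneg _
    refine (ofReal_mul_sum_le (c := c) hk.le hc0 (fun j _ => add_nonneg (hX0 j) (hL0 j))
      (hen n hn).2.2 fun j hj => ?_).trans (ENNReal.ofReal_le_ofReal ?_)
    · obtain ⟨hj1, hjn⟩ := Finset.mem_Icc.1 hj
      have hjJ := hjn.trans hn
      have hj' : j - 1 ≤ J := by omega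
      have hmid : ∀ z ∈ M.nodes, ‖mid d j z‖ ≤ 1 := fun z hz => by
        have h1 := norm_add_le (d j z) (d (j - 1) z)
        rw [hd1 j hjJ z hz, hd1 (j - 1) hj' z hz] at h1
        rw [mid, norm_smul]
        norm_num
        linarith
      have hst := hstep M (h * D) hsh hδD hMi k J v₀ d₀ v d w R hS j hj1 hjJ
        (fun z hz => (hd1 j hjJ z hz).le) hmid E (hen (j - 1) hj').1 (hen (j - 1) hj').2.1
      have hint : IntegrableOn (fun x => frob (fderiv ℝ (v j) x) (fderiv ℝ (v j) x)) Ω :=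
        ((hS.memV hjJ).pwC1.pwCont_fderiv.comp continuous_frob_self).integrableOn hΩc
      rw [← ofReal_integral_eq_lintegral_ofReal hint
        (Filter.Eventually.of_forall fun x => frob_self_nonneg _)]
      refine (add_le_add_left hst _).trans ?_
      rw [← ENNReal.ofReal_add (mul_nonneg (by positivity) (add_nonneg (hX0 j) (hL0 j))) (hX0 j)]
      refine ENNReal.ofReal_le_ofReal ?_
      rw [hc, add_mul, one_mul]
      linarith [hL0 j]
    -- The bound `c * T` depends on the data only through `B`. It is below the required right side
    -- because the continuous energy is nonnegative and one is added to it.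
    · have hE2 : 0 ≤ totalEnergy Ω v₀ G₀ := by
        have : 0 ≤ ∫ x in Ω, frob (G₀ x) (G₀ x) := integral_nonneg fun x => frob_self_nonneg _
        rw [totalEnergy]
        linarith
      have h1 : 0 ≤ c * T := mul_nonneg hc0 hT0
      have h2 := mul_nonneg h1 hE2
      linarith
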